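/- Let $k$ be a field of characteristic $0$. A dg-operad over $k$ is a symmetric operad with unit in $\mathbb Z$-graded cochain complexes of $k$-vector spaces (differential of degree $+1$). Let $\mathrm{dgOp}$ be the category of dg-operads and let $\Delta\text{-}\mathrm{dgOp}$ be the category of pairs $(Q,\Delta)$, where $Q$ is a dg-operad and $\Delta\in Q(1)$ has degree $-1$ and satisfies $d\Delta=0$, $\Delta\circ\Delta=0$ (equivalently, a morphism $(k[\Delta],0)\to Q$ is given), with the morphisms of dg-operads that preserve $\Delta$. Let $\mathrm{Triv}\colon \mathrm{dgOp}\to\Delta\text{-}\mathrm{dgOp}$ be the functor $P\mapsto (P,0)$. For $(Q,\Delta)$ in $\Delta\text{-}\mathrm{dgOp}$ let $$Q/\Delta=\bigl(Q\star k\langle\phi_1,\phi_2,\dots\rangle,\ d_Q+\Delta\tfrac{\partial}{\partial\phi}\bigr)$$ be the free product of $Q$ with the free operad on unary operations $\phi_i$ of degree $-2i$ ($i\ge 1$); its differential is the derivation that extends $d_Q$ and is determined on the $\phi_i$ by the coefficients of the powers of $z$ in $$\exp(-\phi(z))\,d\,\exp(\phi(z))=d+z\Delta,\qquad \phi(z)=\sum_{i\ge1}\phi_iz^i,$$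 that is, by $[d,\exp(\phi(z))]=\exp(\phi(z))\,z\Delta$. Then: 1. The functor $(Q,\Delta)\mapsto Q/\Delta$ from $\Delta\text{-}\mathrm{dgOp}$ to $\mathrm{dgOp}$ and the functor $\mathrm{Triv}$ send quasi-isomorphisms to isomorphisms in the localization of their target at the quasi-isomorphisms. The functor induced by $Q\mapsto Q/\Delta$ between the homotopy categories (the localizations at the quasi-isomorphisms) is left adjoint to the functor induced by $\mathrm{Triv}$: $$\mathrm{Hom}_{\mathrm{Ho}(\mathrm{dgOp})}(Q/\Delta,P)\simeq\mathrm{Hom}_{\mathrm{Ho}(\Delta\text{-}\mathrm{dgOp})}((Q,\Delta),\mathrm{Triv}(P)),$$ naturally in $(Q,\Delta)$ and $P$. Thus $Q/\Delta$ is a model of the homotopy quotient of $Q$ by $\Delta$. 2. The dg-algebra $\bigl(k[\Delta]\star k\langle\phi_1,\phi_2,\dots\rangle,\Delta\frac{\partial}{\partial\phi}\bigr)$, that is, $Q/\Delta$ for $Q=k[\Delta]$ (concentrated in arity $1$), is acyclic: its cohomology is $k$, spanned by the class of the unit. -/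

import Mathlib

open CategoryTheory

universe u

/-! ### Graded and differential graded symmetric operads (partial compositions, Koszul signs) -/

/-- A labelling of the inputs of a partial composition `x ∘ᵢ y`, where `x` has inputs `Fin m` and
`y` has inputs `Fin n`: the inputs of `x` other than `i`, together with those of `y`, are
identified with `Fin p` (so `p = m - 1 + n`). -/
abbrev Graft (m n p : ℕ) (i : Fin m) : Type := ({j : Fin m // j ≠ i} ⊕ Fin n) ≃ Fin p

/-- The only labelling for the composition of two unary operations. -/
def Graft.unary : Graft 1 1 1 0 where
  toFun _ := 0
  invFun _ := Sum.inr 0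
  left_inv := by
    rintro (⟨j, hj⟩ | j)
    · exact absurd (Subsingleton.elim j 0) hj
    · exact congrArg Sum.inr (Subsingleton.elim _ _)
  right_inv _ := Subsingleton.elim _ _

/-- The sign `(-1)^a` as a scalar. -/
def koszulSign (k : Type u) [Field k] (a : ℤ) : k := ((a.negOnePow : ℤ) : k)

theorem koszulSign_add (k : Type u) [Field k] (a b : ℤ) :
    koszulSign k (a + b) = koszulSign k a * koszulSign k b := by
  simp [koszulSign, Int.negOnePow_add]

theorem koszulSign_one (k : Type u) [Field k] : koszulSign k 1 = -1 := by
  simp [koszulSign]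

theorem koszulSign_mul_self (k : Type u) [Field k] (a : ℤ) :
    koszulSign k a * koszulSign k a = 1 := by
  rw [← koszulSign_add]
  simp [koszulSign, Int.negOnePow_even _ (Even.add_self a)]

theorem koszulSign_even (k : Type u) [Field k] {a : ℤ} (h : Even a) : koszulSign k a = 1 := by
  simp [koszulSign, Int.negOnePow_even _ h]

/-- A symmetric operad with unit in (cohomologically) `ℤ`-graded `k`-vector spaces:
`obj n a` is the space of `n`-ary operations of degree `a`, `act σ x` renames the input `j` of `x`
to `σ j`, and `comp i e _ x y` is the partial composition `x ∘ᵢ y` with inputs labelled by `e`. -/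
structure GradedOperad (k : Type u) [Field k] where
  obj : ℕ → ℤ → Type u
  [addCommGroup : ∀ n a, AddCommGroup (obj n a)]
  [module : ∀ n a, Module k (obj n a)]
  id : obj 1 0
  act {n : ℕ} {a : ℤ} (σ : Equiv.Perm (Fin n)) : obj n a →ₗ[k] obj n a
  comp {m n p : ℕ} {a b c : ℤ} (i : Fin m) (e : Graft m n p i) (h : a + b = c) :
    obj m a →ₗ[k] obj n b →ₗ[k] obj p c
  act_one {n : ℕ} {a : ℤ} (x : obj n a) : act 1 x = x
  act_mul {n : ℕ} {a : ℤ} (σ τ : Equiv.Perm (Fin n)) (x : obj n a) :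
    act (σ * τ) x = act σ (act τ x)
  comp_act {m n p : ℕ} {a b c : ℤ} (i : Fin m) (h : a + b = c)
    (σ : Equiv.Perm (Fin m)) (τ : Equiv.Perm (Fin n)) (ρ : Equiv.Perm (Fin p))
    (e : Graft m n p i) (e' : Graft m n p (σ i))
    (he : ∀ (j : Fin m) (hj : j ≠ i) (hj' : σ j ≠ σ i),
      e' (Sum.inl ⟨σ j, hj'⟩) = ρ (e (Sum.inl ⟨j, hj⟩)))
    (he' : ∀ j : Fin n, e' (Sum.inr (τ j)) = ρ (e (Sum.inr j)))
    (x : obj m a) (y : obj n b) :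
    comp (σ i) e' h (act σ x) (act τ y) = act ρ (comp i e h x y)
  id_comp {n : ℕ} {b : ℤ} (i : Fin 1) (e : Graft 1 n n i) (h : 0 + b = b)
    (he : ∀ j, e (Sum.inr j) = j) (y : obj n b) : comp i e h id y = y
  comp_id {m : ℕ} {a : ℤ} (i : Fin m) (e : Graft m 1 m i) (h : a + 0 = a)
    (he : ∀ (j : Fin m) (hj : j ≠ i), e (Sum.inl ⟨j, hj⟩) = j) (he' : e (Sum.inr 0) = i)
    (x : obj m a) : comp i e h x id = x
  /-- `(x ∘ᵢ y) ∘ⱼ z = x ∘ᵢ (y ∘ⱼ z)` for an input `j` of `y`. -/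
  assoc_seq {m n l p q r : ℕ} {a b c ab bc t : ℤ} (i : Fin m) (j : Fin n)
    (e : Graft m n p i) (f : Graft p l q (e (Sum.inr j)))
    (e' : Graft n l r j) (f' : Graft m r q i)
    (hab : a + b = ab) (habc : ab + c = t) (hbc : b + c = bc) (habc' : a + bc = t)
    (h₁ : ∀ (s : Fin m) (hs : s ≠ i) (hs' : e (Sum.inl ⟨s, hs⟩) ≠ e (Sum.inr j)),
      f (Sum.inl ⟨e (Sum.inl ⟨s, hs⟩), hs'⟩) = f' (Sum.inl ⟨s, hs⟩))
    (h₂ : ∀ (s : Fin n) (hs : s ≠ j) (hs' : e (Sum.inr s) ≠ e (Sum.inr j)),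
      f (Sum.inl ⟨e (Sum.inr s), hs'⟩) = f' (Sum.inr (e' (Sum.inl ⟨s, hs⟩))))
    (h₃ : ∀ s : Fin l, f (Sum.inr s) = f' (Sum.inr (e' (Sum.inr s))))
    (x : obj m a) (y : obj n b) (z : obj l c) :
    comp (e (Sum.inr j)) f habc (comp i e hab x y) z = comp i f' habc' x (comp j e' hbc y z)
  /-- `(x ∘ᵢ y) ∘ⱼ z = (-1)^{|y||z|} (x ∘ⱼ z) ∘ᵢ y` for two different inputs `i`, `j` of `x`. -/
  assoc_par {m n l p q r : ℕ} {a b c ab ac t : ℤ} (i j : Fin m) (hij : i ≠ j) (hji : j ≠ i)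
    (e : Graft m n p i) (f : Graft p l q (e (Sum.inl ⟨j, hji⟩)))
    (e' : Graft m l r j) (f' : Graft r n q (e' (Sum.inl ⟨i, hij⟩)))
    (hab : a + b = ab) (habc : ab + c = t) (hac : a + c = ac) (hacb : ac + b = t)
    (h₁ : ∀ (s : Fin m) (hs : s ≠ i) (hs' : s ≠ j)
      (hs₁ : e (Sum.inl ⟨s, hs⟩) ≠ e (Sum.inl ⟨j, hji⟩))
      (hs₂ : e' (Sum.inl ⟨s, hs'⟩) ≠ e' (Sum.inl ⟨i, hij⟩)),
      f (Sum.inl ⟨e (Sum.inl ⟨s, hs⟩), hs₁⟩) = f' (Sum.inl ⟨e' (Sum.inl ⟨s, hs'⟩), hs₂⟩))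
    (h₂ : ∀ (s : Fin n) (hs : e (Sum.inr s) ≠ e (Sum.inl ⟨j, hji⟩)),
      f (Sum.inl ⟨e (Sum.inr s), hs⟩) = f' (Sum.inr s))
    (h₃ : ∀ (s : Fin l) (hs : e' (Sum.inr s) ≠ e' (Sum.inl ⟨i, hij⟩)),
      f (Sum.inr s) = f' (Sum.inl ⟨e' (Sum.inr s), hs⟩))
    (x : obj m a) (y : obj n b) (z : obj l c) :
    comp (e (Sum.inl ⟨j, hji⟩)) f habc (comp i e hab x y) z =
      koszulSign k (b * c) • comp (e' (Sum.inl ⟨i, hij⟩)) f' hacb (comp j e' hac x z) y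

attribute [instance] GradedOperad.addCommGroup GradedOperad.module

/-- Composition of unary operations. -/
def GradedOperad.mul {k : Type u} [Field k] (P : GradedOperad k) {a b c : ℤ} (h : a + b = c)
    (x : P.obj 1 a) (y : P.obj 1 b) : P.obj 1 c := P.comp 0 Graft.unary h x y

/-- A dg-operad over `k`: a graded operad with a differential of degree `1`, equivariant and
a derivation of the partial compositions. -/
structure DGOperad (k : Type u) [Field k] extends GradedOperad k where
  d {n : ℕ} {a : ℤ} : obj n a →ₗ[k] obj n (a + 1)
  d_d {n : ℕ} {a : ℤ} (x : obj n a) : d (d x) = 0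
  d_act {n : ℕ} {a : ℤ} (σ : Equiv.Perm (Fin n)) (x : obj n a) : d (act σ x) = act σ (d x)
  d_comp {m n p : ℕ} {a b c : ℤ} (i : Fin m) (e : Graft m n p i) (h : a + b = c)
    (h₁ : a + 1 + b = c + 1) (h₂ : a + (b + 1) = c + 1) (x : obj m a) (y : obj n b) :
    d (comp i e h x y) = comp i e h₁ (d x) y + koszulSign k a • comp i e h₂ x (d y)

/-- Morphisms of dg-operads. -/
@[ext]
structure DGOperad.Hom {k : Type u} [Field k] (P Q : DGOperad k) where
  map {n : ℕ} {a : ℤ} : P.obj n a →ₗ[k] Q.obj n a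
  map_id : map P.id = Q.id
  map_act {n : ℕ} {a : ℤ} (σ : Equiv.Perm (Fin n)) (x : P.obj n a) :
    map (P.act σ x) = Q.act σ (map x)
  map_comp {m n p : ℕ} {a b c : ℤ} (i : Fin m) (e : Graft m n p i) (h : a + b = c)
    (x : P.obj m a) (y : P.obj n b) :
    map (P.comp i e h x y) = Q.comp i e h (map x) (map y)
  map_d {n : ℕ} {a : ℤ} (x : P.obj n a) : map (P.d x) = Q.d (map x)

/-- The category of dg-operads. -/
instance (k : Type u) [Field k] : Category (DGOperad k) where
  Hom P Q := DGOperad.Hom P Q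
  id P := ⟨LinearMap.id, rfl, fun _ _ => rfl, fun _ _ _ _ _ => rfl, fun _ => rfl⟩
  comp f g :=
    { map := g.map ∘ₗ f.map
      map_id := by simp [f.map_id, g.map_id]
      map_act := fun σ x => by simp [f.map_act, g.map_act]
      map_comp := fun i e h x y => by simp [f.map_comp, g.map_comp]
      map_d := fun x => by simp [f.map_d, g.map_d] }

/-- The complex of `n`-ary operations. -/
noncomputable def DGOperad.complex {k : Type u} [Field k] (P : DGOperad k) (n : ℕ) :
    CochainComplex (ModuleCat.{u} k) ℤ :=
  CochainComplex.of (fun a => ModuleCat.of k (P.obj n a)) (fun a => ModuleCat.ofHom P.d)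
    (fun a => by ext x; exact P.d_d x)

/-- The map induced by a morphism of dg-operads on the complexes of `n`-ary operations. -/
noncomputable def DGOperad.Hom.complexMap {k : Type u} [Field k] {P Q : DGOperad k}
    (f : DGOperad.Hom P Q) (n : ℕ) : P.complex n ⟶ Q.complex n :=
  CochainComplex.ofHom (fun _ => ModuleCat.ofHom f.map) (fun a => by
    simp only [DGOperad.complex, CochainComplex.of_d]
    ext x
    exact (f.map_d x).symm)

/-- Quasi-isomorphisms of dg-operads. -/
def DGOperad.quasiIso (k : Type u) [Field k] : MorphismProperty (DGOperad k) :=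
  fun _ _ f => ∀ n, QuasiIso (DGOperad.Hom.complexMap f n)

/-! ### dg-operads with a square-zero unary operation `Δ` -/

/-- A dg-operad with a morphism from `(k[Δ], 0)`: a closed unary operation `Δ` of degree `-1` with
`Δ ∘ Δ = 0`. -/
structure DeltaDGOperad (k : Type u) [Field k] extends DGOperad k where
  Δ : obj 1 (-1)
  Δ_Δ : toGradedOperad.mul (c := -2) (by norm_num) Δ Δ = 0
  d_Δ : d Δ = 0

/-- Morphisms of dg-operads that preserve `Δ`. -/
@[ext]
structure DeltaDGOperad.Hom {k : Type u} [Field k] (P Q : DeltaDGOperad k) where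
  hom : P.toDGOperad ⟶ Q.toDGOperad
  map_Δ : DGOperad.Hom.map hom P.Δ = Q.Δ

/-- The category of dg-operads with a chosen `Δ`. -/
instance (k : Type u) [Field k] : Category (DeltaDGOperad k) where
  Hom P Q := DeltaDGOperad.Hom P Q
  id P := ⟨𝟙 P.toDGOperad, rfl⟩
  comp f g := ⟨f.hom ≫ g.hom, by
    change DGOperad.Hom.map g.hom (DGOperad.Hom.map f.hom _) = _
    rw [f.map_Δ, g.map_Δ]⟩

/-- Morphisms whose underlying morphism of dg-operads is a quasi-isomorphism. -/
def DeltaDGOperad.quasiIso (k : Type u) [Field k] : MorphismProperty (DeltaDGOperad k) :=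
  fun _ _ f => DGOperad.quasiIso k (DeltaDGOperad.Hom.hom f)

/-- The trivial action: every dg-operad with `Δ = 0`. -/
def trivDelta (k : Type u) [Field k] : DGOperad k ⥤ DeltaDGOperad k where
  obj P := ⟨P, 0, by simp [GradedOperad.mul], by simp⟩
  map f := ⟨f, map_zero _⟩

/-! ### The free product `Q ⋆ k⟨φ₁, φ₂, …⟩` -/

/-- Formal operadic expressions in the operations of `Q` and unary symbols `φᵢ` (`i ≥ 1`) of
degree `-2i`. -/
inductive PhiTerm {k : Type u} [Field k] (Q : GradedOperad k) : ℕ → ℤ → Type u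
  | of {n : ℕ} {a : ℤ} (q : Q.obj n a) : PhiTerm Q n a
  | phi (i : ℕ+) : PhiTerm Q 1 (-2 * ((i : ℕ) : ℤ))
  | add {n : ℕ} {a : ℤ} (x y : PhiTerm Q n a) : PhiTerm Q n a
  | smul {n : ℕ} {a : ℤ} (c : k) (x : PhiTerm Q n a) : PhiTerm Q n a
  | act {n : ℕ} {a : ℤ} (σ : Equiv.Perm (Fin n)) (x : PhiTerm Q n a) : PhiTerm Q n a
  | comp {m n p : ℕ} {a b c : ℤ} (i : Fin m) (e : Graft m n p i) (h : a + b = c)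
      (x : PhiTerm Q m a) (y : PhiTerm Q n b) : PhiTerm Q p c

/-- The congruence generated by the axioms of graded operads and by the requirement that
`q ↦ of q` is a morphism of graded operads. -/
inductive PhiRel {k : Type u} [Field k] (Q : GradedOperad k) :
    ∀ {n : ℕ} {a : ℤ}, PhiTerm Q n a → PhiTerm Q n a → Prop
  | refl {n : ℕ} {a : ℤ} (x : PhiTerm Q n a) : PhiRel Q x x
  | symm {n : ℕ} {a : ℤ} {x y : PhiTerm Q n a} : PhiRel Q x y → PhiRel Q y x
  | trans {n : ℕ} {a : ℤ} {x y z : PhiTerm Q n a} : PhiRel Q x y → PhiRel Q y z → PhiRel Q x z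
  | add_congr {n : ℕ} {a : ℤ} {x x' y y' : PhiTerm Q n a} :
      PhiRel Q x x' → PhiRel Q y y' → PhiRel Q (.add x y) (.add x' y')
  | smul_congr {n : ℕ} {a : ℤ} (c : k) {x x' : PhiTerm Q n a} :
      PhiRel Q x x' → PhiRel Q (.smul c x) (.smul c x')
  | act_congr {n : ℕ} {a : ℤ} (σ : Equiv.Perm (Fin n)) {x x' : PhiTerm Q n a} :
      PhiRel Q x x' → PhiRel Q (.act σ x) (.act σ x')
  | comp_congr {m n p : ℕ} {a b c : ℤ} (i : Fin m) (e : Graft m n p i) (h : a + b = c)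
      {x x' : PhiTerm Q m a} {y y' : PhiTerm Q n b} :
      PhiRel Q x x' → PhiRel Q y y' → PhiRel Q (.comp i e h x y) (.comp i e h x' y')
  | add_assoc {n : ℕ} {a : ℤ} (x y z : PhiTerm Q n a) :
      PhiRel Q (.add (.add x y) z) (.add x (.add y z))
  | add_comm {n : ℕ} {a : ℤ} (x y : PhiTerm Q n a) : PhiRel Q (.add x y) (.add y x)
  | zero_add {n : ℕ} {a : ℤ} (x : PhiTerm Q n a) : PhiRel Q (.add (.of 0) x) x
  | neg_add {n : ℕ} {a : ℤ} (x : PhiTerm Q n a) : PhiRel Q (.add (.smul (-1) x) x) (.of 0)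
  | smul_add {n : ℕ} {a : ℤ} (c : k) (x y : PhiTerm Q n a) :
      PhiRel Q (.smul c (.add x y)) (.add (.smul c x) (.smul c y))
  | add_smul {n : ℕ} {a : ℤ} (c c' : k) (x : PhiTerm Q n a) :
      PhiRel Q (.smul (c + c') x) (.add (.smul c x) (.smul c' x))
  | mul_smul {n : ℕ} {a : ℤ} (c c' : k) (x : PhiTerm Q n a) :
      PhiRel Q (.smul (c * c') x) (.smul c (.smul c' x))
  | one_smul {n : ℕ} {a : ℤ} (x : PhiTerm Q n a) : PhiRel Q (.smul 1 x) x
  | of_add {n : ℕ} {a : ℤ} (q q' : Q.obj n a) :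
      PhiRel Q (.of (q + q')) (.add (.of q) (.of q'))
  | of_smul {n : ℕ} {a : ℤ} (c : k) (q : Q.obj n a) :
      PhiRel Q (.of (c • q)) (.smul c (.of q))
  | of_act {n : ℕ} {a : ℤ} (σ : Equiv.Perm (Fin n)) (q : Q.obj n a) :
      PhiRel Q (.of (Q.act σ q)) (.act σ (.of q))
  | of_comp {m n p : ℕ} {a b c : ℤ} (i : Fin m) (e : Graft m n p i) (h : a + b = c)
      (q : Q.obj m a) (q' : Q.obj n b) :
      PhiRel Q (.of (Q.comp i e h q q')) (.comp i e h (.of q) (.of q'))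
  | act_add {n : ℕ} {a : ℤ} (σ : Equiv.Perm (Fin n)) (x y : PhiTerm Q n a) :
      PhiRel Q (.act σ (.add x y)) (.add (.act σ x) (.act σ y))
  | act_smul {n : ℕ} {a : ℤ} (σ : Equiv.Perm (Fin n)) (c : k) (x : PhiTerm Q n a) :
      PhiRel Q (.act σ (.smul c x)) (.smul c (.act σ x))
  | comp_add_left {m n p : ℕ} {a b c : ℤ} (i : Fin m) (e : Graft m n p i) (h : a + b = c)
      (x x' : PhiTerm Q m a) (y : PhiTerm Q n b) :
      PhiRel Q (.comp i e h (.add x x') y) (.add (.comp i e h x y) (.comp i e h x' y))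
  | comp_smul_left {m n p : ℕ} {a b c : ℤ} (i : Fin m) (e : Graft m n p i) (h : a + b = c)
      (s : k) (x : PhiTerm Q m a) (y : PhiTerm Q n b) :
      PhiRel Q (.comp i e h (.smul s x) y) (.smul s (.comp i e h x y))
  | comp_add_right {m n p : ℕ} {a b c : ℤ} (i : Fin m) (e : Graft m n p i) (h : a + b = c)
      (x : PhiTerm Q m a) (y y' : PhiTerm Q n b) :
      PhiRel Q (.comp i e h x (.add y y')) (.add (.comp i e h x y) (.comp i e h x y'))
  | comp_smul_right {m n p : ℕ} {a b c : ℤ} (i : Fin m) (e : Graft m n p i) (h : a + b = c)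
      (s : k) (x : PhiTerm Q m a) (y : PhiTerm Q n b) :
      PhiRel Q (.comp i e h x (.smul s y)) (.smul s (.comp i e h x y))
  | act_one {n : ℕ} {a : ℤ} (x : PhiTerm Q n a) : PhiRel Q (.act 1 x) x
  | act_mul {n : ℕ} {a : ℤ} (σ τ : Equiv.Perm (Fin n)) (x : PhiTerm Q n a) :
      PhiRel Q (.act (σ * τ) x) (.act σ (.act τ x))
  | comp_act {m n p : ℕ} {a b c : ℤ} (i : Fin m) (h : a + b = c)
      (σ : Equiv.Perm (Fin m)) (τ : Equiv.Perm (Fin n)) (ρ : Equiv.Perm (Fin p))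
      (e : Graft m n p i) (e' : Graft m n p (σ i))
      (he : ∀ (j : Fin m) (hj : j ≠ i) (hj' : σ j ≠ σ i),
        e' (Sum.inl ⟨σ j, hj'⟩) = ρ (e (Sum.inl ⟨j, hj⟩)))
      (he' : ∀ j : Fin n, e' (Sum.inr (τ j)) = ρ (e (Sum.inr j)))
      (x : PhiTerm Q m a) (y : PhiTerm Q n b) :
      PhiRel Q (.comp (σ i) e' h (.act σ x) (.act τ y)) (.act ρ (.comp i e h x y))
  | id_comp {n : ℕ} {b : ℤ} (i : Fin 1) (e : Graft 1 n n i) (h : 0 + b = b)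
      (he : ∀ j, e (Sum.inr j) = j) (y : PhiTerm Q n b) :
      PhiRel Q (.comp i e h (.of Q.id) y) y
  | comp_id {m : ℕ} {a : ℤ} (i : Fin m) (e : Graft m 1 m i) (h : a + 0 = a)
      (he : ∀ (j : Fin m) (hj : j ≠ i), e (Sum.inl ⟨j, hj⟩) = j) (he' : e (Sum.inr 0) = i)
      (x : PhiTerm Q m a) : PhiRel Q (.comp i e h x (.of Q.id)) x
  | assoc_seq {m n l p q r : ℕ} {a b c ab bc t : ℤ} (i : Fin m) (j : Fin n)
      (e : Graft m n p i) (f : Graft p l q (e (Sum.inr j)))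
      (e' : Graft n l r j) (f' : Graft m r q i)
      (hab : a + b = ab) (habc : ab + c = t) (hbc : b + c = bc) (habc' : a + bc = t)
      (h₁ : ∀ (s : Fin m) (hs : s ≠ i) (hs' : e (Sum.inl ⟨s, hs⟩) ≠ e (Sum.inr j)),
        f (Sum.inl ⟨e (Sum.inl ⟨s, hs⟩), hs'⟩) = f' (Sum.inl ⟨s, hs⟩))
      (h₂ : ∀ (s : Fin n) (hs : s ≠ j) (hs' : e (Sum.inr s) ≠ e (Sum.inr j)),
        f (Sum.inl ⟨e (Sum.inr s), hs'⟩) = f' (Sum.inr (e' (Sum.inl ⟨s, hs⟩))))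
      (h₃ : ∀ s : Fin l, f (Sum.inr s) = f' (Sum.inr (e' (Sum.inr s))))
      (x : PhiTerm Q m a) (y : PhiTerm Q n b) (z : PhiTerm Q l c) :
      PhiRel Q (.comp (e (Sum.inr j)) f habc (.comp i e hab x y) z)
        (.comp i f' habc' x (.comp j e' hbc y z))
  | assoc_par {m n l p q r : ℕ} {a b c ab ac t : ℤ} (i j : Fin m) (hij : i ≠ j) (hji : j ≠ i)
      (e : Graft m n p i) (f : Graft p l q (e (Sum.inl ⟨j, hji⟩)))
      (e' : Graft m l r j) (f' : Graft r n q (e' (Sum.inl ⟨i, hij⟩)))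
      (hab : a + b = ab) (habc : ab + c = t) (hac : a + c = ac) (hacb : ac + b = t)
      (h₁ : ∀ (s : Fin m) (hs : s ≠ i) (hs' : s ≠ j)
        (hs₁ : e (Sum.inl ⟨s, hs⟩) ≠ e (Sum.inl ⟨j, hji⟩))
        (hs₂ : e' (Sum.inl ⟨s, hs'⟩) ≠ e' (Sum.inl ⟨i, hij⟩)),
        f (Sum.inl ⟨e (Sum.inl ⟨s, hs⟩), hs₁⟩) = f' (Sum.inl ⟨e' (Sum.inl ⟨s, hs'⟩), hs₂⟩))
      (h₂ : ∀ (s : Fin n) (hs : e (Sum.inr s) ≠ e (Sum.inl ⟨j, hji⟩)),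
        f (Sum.inl ⟨e (Sum.inr s), hs⟩) = f' (Sum.inr s))
      (h₃ : ∀ (s : Fin l) (hs : e' (Sum.inr s) ≠ e' (Sum.inl ⟨i, hij⟩)),
        f (Sum.inr s) = f' (Sum.inl ⟨e' (Sum.inr s), hs⟩))
      (x : PhiTerm Q m a) (y : PhiTerm Q n b) (z : PhiTerm Q l c) :
      PhiRel Q (.comp (e (Sum.inl ⟨j, hji⟩)) f habc (.comp i e hab x y) z)
        (.smul (koszulSign k (b * c))
          (.comp (e' (Sum.inl ⟨i, hij⟩)) f' hacb (.comp j e' hac x z) y))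

/-- The space of `n`-ary operations of degree `a` of `Q ⋆ k⟨φ₁, φ₂, …⟩`. -/
def PhiObj {k : Type u} [Field k] (Q : GradedOperad k) (n : ℕ) (a : ℤ) : Type u :=
  Quot (PhiRel Q (n := n) (a := a))

namespace PhiObj

variable {k : Type u} [Field k] {Q : GradedOperad k}

/-- The class of an expression. -/
def mk {n : ℕ} {a : ℤ} (x : PhiTerm Q n a) : PhiObj Q n a := Quot.mk _ x

theorem sound {n : ℕ} {a : ℤ} {x y : PhiTerm Q n a} (h : PhiRel Q x y) : mk x = mk y :=
  Quot.sound h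

theorem ind {n : ℕ} {a : ℤ} {p : PhiObj Q n a → Prop} (h : ∀ x, p (mk x)) (x : PhiObj Q n a) :
    p x := Quot.ind h x

/-- Addition of operations. -/
def add {n : ℕ} {a : ℤ} : PhiObj Q n a → PhiObj Q n a → PhiObj Q n a :=
  Quot.map₂ PhiTerm.add (fun _ _ _ h => .add_congr (.refl _) h)
    (fun _ _ _ h => .add_congr h (.refl _))

/-- Scalar multiplication of operations. -/
def smul {n : ℕ} {a : ℤ} (c : k) : PhiObj Q n a → PhiObj Q n a :=
  Quot.map (PhiTerm.smul c) (fun _ _ h => .smul_congr c h)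

instance {n : ℕ} {a : ℤ} : Add (PhiObj Q n a) := ⟨add⟩

instance {n : ℕ} {a : ℤ} : Zero (PhiObj Q n a) := ⟨mk (.of 0)⟩

instance {n : ℕ} {a : ℤ} : SMul k (PhiObj Q n a) := ⟨smul⟩

instance {n : ℕ} {a : ℤ} : Neg (PhiObj Q n a) := ⟨smul (-1)⟩

instance {n : ℕ} {a : ℤ} : AddCommGroup (PhiObj Q n a) where
  nsmul := nsmulRec
  zsmul := zsmulRec
  add_assoc := ind fun x => ind fun y => ind fun z => sound (.add_assoc x y z)
  add_comm := ind fun x => ind fun y => sound (.add_comm x y)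
  zero_add := ind fun x => sound (.zero_add x)
  add_zero := ind fun x => sound (.trans (.add_comm _ _) (.zero_add x))
  neg_add_cancel := ind fun x => sound (.neg_add x)

theorem mk_add {n : ℕ} {a : ℤ} (x y : PhiTerm Q n a) : mk (.add x y) = mk x + mk y := rfl

theorem mk_zero {n : ℕ} {a : ℤ} : (mk (.of 0) : PhiObj Q n a) = 0 := rfl

instance {n : ℕ} {a : ℤ} : Module k (PhiObj Q n a) :=
  Module.ofMinimalAxioms (R := k) (M := PhiObj Q n a)
    (fun c => ind fun x => ind fun y => sound (.smul_add c x y))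
    (fun c c' => ind fun x => sound (.add_smul c c' x))
    (fun c c' => ind fun x => sound (.mul_smul c c' x))
    (ind fun x => sound (.one_smul x))

theorem mk_smul {n : ℕ} {a : ℤ} (c : k) (x : PhiTerm Q n a) : mk (.smul c x) = c • mk x := rfl

/-- The action of permutations on operations. -/
def act {n : ℕ} {a : ℤ} (σ : Equiv.Perm (Fin n)) : PhiObj Q n a →ₗ[k] PhiObj Q n a where
  toFun := Quot.map (PhiTerm.act σ) (fun _ _ h => .act_congr σ h)
  map_add' := ind fun x => ind fun y => sound (.act_add σ x y)
  map_smul' c := ind fun x => sound (.act_smul σ c x)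

/-- Partial composition of operations. -/
def comp {m n p : ℕ} {a b c : ℤ} (i : Fin m) (e : Graft m n p i) (h : a + b = c) :
    PhiObj Q m a →ₗ[k] PhiObj Q n b →ₗ[k] PhiObj Q p c :=
  LinearMap.mk₂ k
    (Quot.map₂ (PhiTerm.comp i e h) (fun _ _ _ h' => .comp_congr i e h (.refl _) h')
      (fun _ _ _ h' => .comp_congr i e h h' (.refl _)))
    (ind fun x => ind fun x' => ind fun y => sound (.comp_add_left i e h x x' y))
    (fun s => ind fun x => ind fun y => sound (.comp_smul_left i e h s x y))
    (ind fun x => ind fun y => ind fun y' => sound (.comp_add_right i e h x y y'))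
    (fun s => ind fun x => ind fun y => sound (.comp_smul_right i e h s x y))

end PhiObj

/-- The graded operad `Q ⋆ k⟨φ₁, φ₂, …⟩`, the free product of `Q` with the free operad on unary
operations `φᵢ`, `i ≥ 1`, of degree `-2i`. -/
def phiOperad {k : Type u} [Field k] (Q : GradedOperad k) : GradedOperad k where
  obj := PhiObj Q
  id := PhiObj.mk (.of Q.id)
  act := PhiObj.act
  comp := PhiObj.comp
  act_one := PhiObj.ind fun x => PhiObj.sound (.act_one x)
  act_mul σ τ := PhiObj.ind fun x => PhiObj.sound (.act_mul σ τ x)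
  comp_act i h σ τ ρ e e' he he' := PhiObj.ind fun x => PhiObj.ind fun y =>
    PhiObj.sound (.comp_act i h σ τ ρ e e' he he' x y)
  id_comp i e h he := PhiObj.ind fun y => PhiObj.sound (.id_comp i e h he y)
  comp_id i e h he he' := PhiObj.ind fun x => PhiObj.sound (.comp_id i e h he he' x)
  assoc_seq i j e f e' f' hab habc hbc habc' h₁ h₂ h₃ :=
    PhiObj.ind fun x => PhiObj.ind fun y => PhiObj.ind fun z =>
      PhiObj.sound (.assoc_seq i j e f e' f' hab habc hbc habc' h₁ h₂ h₃ x y z)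
  assoc_par i j hij hji e f e' f' hab habc hac hacb h₁ h₂ h₃ :=
    PhiObj.ind fun x => PhiObj.ind fun y => PhiObj.ind fun z =>
      PhiObj.sound (.assoc_par i j hij hji e f e' f' hab habc hac hacb h₁ h₂ h₃ x y z)

/-! ### The differential `exp(-φ(z)) d exp(φ(z)) = d + zΔ` -/

section Exponential

variable {k : Type u} [Field k] (P : GradedOperad k)

theorem GradedOperad.mul_id {a : ℤ} (h : a + 0 = a) (x : P.obj 1 a) : P.mul h x P.id = x :=
  P.comp_id 0 Graft.unary h (fun s hs => absurd (Subsingleton.elim s 0) hs) rfl x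

theorem GradedOperad.mul_assoc {a b c ab bc t : ℤ} (hab : a + b = ab) (habc : ab + c = t)
    (hbc : b + c = bc) (habc' : a + bc = t) (x : P.obj 1 a) (y : P.obj 1 b) (z : P.obj 1 c) :
    P.mul habc (P.mul hab x y) z = P.mul habc' x (P.mul hbc y z) :=
  P.assoc_seq 0 0 Graft.unary Graft.unary Graft.unary Graft.unary hab habc hbc habc'
    (fun s hs => absurd (Subsingleton.elim s 0) hs)
    (fun s hs => absurd (Subsingleton.elim s 0) hs) (fun _ => rfl) x y z

/-- The coefficient of `z^n` in `φ(z)^j`, for unary operations `φ(z) = ∑ φₙ zⁿ`. -/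
def phiPow (φ : ∀ n : ℕ, P.obj 1 (-2 * (n : ℤ))) : ℕ → ∀ n : ℕ, P.obj 1 (-2 * (n : ℤ))
  | 0, 0 => P.id
  | 0, _ + 1 => 0
  | j + 1, n => ∑ i : Fin (n + 1), P.mul (by have := i.isLt; lia) (φ i) (phiPow φ j (n - i))

/-- The coefficient of `z^n` in `exp(φ(z))`, when `φ₀ = 0`. -/
noncomputable def phiExp (φ : ∀ n : ℕ, P.obj 1 (-2 * (n : ℤ))) (n : ℕ) : P.obj 1 (-2 * (n : ℤ)) :=
  ∑ j ∈ Finset.range (n + 1), ((j.factorial : k)⁻¹) • phiPow P φ j n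

/-- The coefficient of `z^n` in the derivative of `φ(z)^j`, computed by the Leibniz rule, for a
derivation of degree `1` that sends `φₙ` to `ψₙ`. -/
def phiPowD (φ : ∀ n : ℕ, P.obj 1 (-2 * (n : ℤ))) (ψ : ∀ n : ℕ, P.obj 1 (-2 * (n : ℤ) + 1)) :
    ℕ → ∀ n : ℕ, P.obj 1 (-2 * (n : ℤ) + 1)
  | 0, _ => 0
  | j + 1, n => ∑ i : Fin (n + 1),
      (P.mul (by have := i.isLt; lia) (ψ i) (phiPow P φ j (n - i)) +
        P.mul (by have := i.isLt; lia) (φ i) (phiPowD φ ψ j (n - i)))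

/-- The coefficient of `z^n` in `exp(φ(z)) zΔ`. -/
noncomputable def phiExpDelta (φ : ∀ n : ℕ, P.obj 1 (-2 * (n : ℤ))) (Δ : P.obj 1 (-1)) :
    ∀ n : ℕ, P.obj 1 (-2 * (n : ℤ) + 1)
  | 0 => 0
  | n + 1 => P.mul (by push_cast; ring) (phiExp P φ n) Δ

/-- The values `ψₙ = [d, φₙ]`, determined one after another by the coefficients of `z^n` in
`[d, exp(φ(z))] = exp(φ(z)) zΔ`, which is the equation `exp(-φ(z)) d exp(φ(z)) = d + zΔ`. The
coefficients of `φ(z)^j`, `j ≥ 2`, involve only the `φᵢ` with `i < n`. -/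
noncomputable def phiDiff (φ : ∀ n : ℕ, P.obj 1 (-2 * (n : ℤ))) (Δ : P.obj 1 (-1)) (n : ℕ) :
    P.obj 1 (-2 * (n : ℤ) + 1) :=
  phiExpDelta P φ Δ n - ∑ j ∈ Finset.Icc 2 n, ((j.factorial : k)⁻¹) •
    phiPowD P φ (fun i => if i < n then phiDiff φ Δ i else 0) j n
termination_by n

variable {P}

theorem GradedOperad.mul_zero {a b c : ℤ} (h : a + b = c) (x : P.obj 1 a) :
    P.mul h x (0 : P.obj 1 b) = 0 := by simp [GradedOperad.mul]

theorem GradedOperad.zero_mul {a b c : ℤ} (h : a + b = c) (x : P.obj 1 b) :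
    P.mul h (0 : P.obj 1 a) x = 0 := by simp [GradedOperad.mul]

theorem phiPow_zero_coeff {φ : ∀ n : ℕ, P.obj 1 (-2 * (n : ℤ))} (hφ : φ 0 = 0) (j : ℕ) :
    phiPow P φ (j + 1) 0 = 0 := by
  simp only [phiPow]
  refine Finset.sum_eq_zero fun ⟨i, hi⟩ _ => ?_
  obtain rfl : i = 0 := by lia
  exact (congrArg (fun t => P.mul _ t _) hφ).trans (GradedOperad.zero_mul _ _)

theorem phiPowD_zero_coeff {φ : ∀ n : ℕ, P.obj 1 (-2 * (n : ℤ))} (hφ : φ 0 = 0)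
    {ψ : ∀ n : ℕ, P.obj 1 (-2 * (n : ℤ) + 1)} (hψ : ψ 0 = 0) (j : ℕ) :
    phiPowD P φ ψ j 0 = 0 := by
  cases j with
  | zero => rfl
  | succ j =>
    simp only [phiPowD]
    refine Finset.sum_eq_zero fun ⟨i, hi⟩ _ => ?_
    obtain rfl : i = 0 := by lia
    refine (congrArg₂ (fun s t => P.mul _ s _ + P.mul _ t _) hψ hφ).trans ?_
    rw [GradedOperad.zero_mul, GradedOperad.zero_mul, add_zero]

theorem phiPowD_congr {φ : ∀ n : ℕ, P.obj 1 (-2 * (n : ℤ))}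
    {ψ ψ' : ∀ n : ℕ, P.obj 1 (-2 * (n : ℤ) + 1)} (n : ℕ) (h : ∀ i ≤ n, ψ i = ψ' i) (j : ℕ) :
    phiPowD P φ ψ j n = phiPowD P φ ψ' j n := by
  induction j generalizing n with
  | zero => rfl
  | succ j ih =>
    simp only [phiPowD]
    refine Finset.sum_congr rfl fun i _ => ?_
    rw [h i (by have := i.isLt; lia), ih (n - i) fun s hs => h s (by lia)]

theorem phiPowD_congr' {φ : ∀ n : ℕ, P.obj 1 (-2 * (n : ℤ))} (hφ : φ 0 = 0)
    {ψ ψ' : ∀ n : ℕ, P.obj 1 (-2 * (n : ℤ) + 1)} (n : ℕ) (h : ∀ i < n, ψ i = ψ' i) (j : ℕ) :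
    phiPowD P φ ψ (j + 2) n = phiPowD P φ ψ' (j + 2) n := by
  rw [phiPowD, phiPowD]
  refine Finset.sum_congr rfl fun i _ => ?_
  congr 1
  · rcases Nat.lt_or_ge (i : ℕ) n with hi | hi
    · rw [h i hi]
    · have : phiPow P φ (j + 1) (n - i) = 0 := by
        rw [Nat.sub_eq_zero_of_le hi]; exact phiPow_zero_coeff hφ j
      rw [this, GradedOperad.mul_zero, GradedOperad.mul_zero]
  · rcases Nat.eq_zero_or_pos (i : ℕ) with hi | hi
    · have : φ i = 0 := by rw [hi]; exact hφ
      rw [this, GradedOperad.zero_mul, GradedOperad.zero_mul]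
    · rw [phiPowD_congr (n - i) (fun s hs => h s (by have := i.isLt; lia))]

theorem phiPowD_one (φ : ∀ n : ℕ, P.obj 1 (-2 * (n : ℤ)))
    (ψ : ∀ n : ℕ, P.obj 1 (-2 * (n : ℤ) + 1)) (n : ℕ) : phiPowD P φ ψ 1 n = ψ n := by
  rw [phiPowD, Finset.sum_eq_single (Fin.last n)]
  · have h0 : ∀ (s : ℕ) (hs : s = 0) (h : (-2 * (n : ℤ) + 1) + -2 * (s : ℤ) = -2 * (n : ℤ) + 1),
        P.mul h (ψ n) (phiPow P φ 0 s) = ψ n := by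
      rintro s rfl h
      exact P.mul_id _ _
    have h1 : phiPowD P φ ψ 0 (n - (Fin.last n : ℕ)) = 0 := rfl
    rw [h1, GradedOperad.mul_zero, add_zero]
    exact h0 _ (by simp) _
  · intro i _ hi
    have h0 : phiPow P φ 0 (n - i) = 0 := by
      obtain ⟨s, hs⟩ : ∃ s, n - (i : ℕ) = s + 1 := by
        have := Fin.lt_last_iff_ne_last.mpr hi
        exact ⟨n - i - 1, by have : (i : ℕ) < n := this; lia⟩
      rw [hs]; rfl
    have h1 : phiPowD P φ ψ 0 (n - i) = 0 := rfl
    rw [h0, h1, GradedOperad.mul_zero, GradedOperad.mul_zero, add_zero]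
  · simp

/-- The coefficients of `z^n` in `[d, exp(φ(z))] = exp(φ(z)) zΔ` hold for `ψₙ = [d, φₙ]`. -/
theorem sum_phiPowD_phiDiff {φ : ∀ n : ℕ, P.obj 1 (-2 * (n : ℤ))} (hφ : φ 0 = 0)
    (Δ : P.obj 1 (-1)) (n : ℕ) :
    ∑ j ∈ Finset.range (n + 1), ((j.factorial : k)⁻¹) • phiPowD P φ (phiDiff P φ Δ) j n =
      phiExpDelta P φ Δ n := by
  cases n with
  | zero => simp [phiPowD, phiExpDelta]
  | succ n =>
    have hr : Finset.range (n + 1 + 1) = insert 0 (insert 1 (Finset.Icc 2 (n + 1))) := by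
      ext j; simp only [Finset.mem_range, Finset.mem_insert, Finset.mem_Icc]; lia
    rw [hr, Finset.sum_insert (by simp), Finset.sum_insert (by simp), phiPowD_one]
    have h2 : ∀ j ∈ Finset.Icc 2 (n + 1),
        ((j.factorial : k)⁻¹) • phiPowD P φ (phiDiff P φ Δ) j (n + 1) =
          ((j.factorial : k)⁻¹) • phiPowD P φ
            (fun i => if i < n + 1 then phiDiff P φ Δ i else 0) j (n + 1) := by
      intro j hj
      obtain ⟨s, rfl⟩ : ∃ s, j = s + 2 := ⟨j - 2, by
        have := (Finset.mem_Icc.mp hj).1; lia⟩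
      rw [phiPowD_congr' hφ (n + 1) (ψ' := fun i => if i < n + 1 then phiDiff P φ Δ i else 0)
        (fun i hi => by simp [hi])]
    rw [Finset.sum_congr rfl h2, phiDiff]
    simp [phiPowD]

end Exponential

/-! ### The homotopy quotient `Q/Δ` -/

section Quotient

variable {k : Type u} [Field k] (Q : DeltaDGOperad k)

/-- The operation of `Q ⋆ k⟨φ₁, φ₂, …⟩` represented by an expression. -/
def phiMk {k : Type u} [Field k] {Q : GradedOperad k} {n : ℕ} {a : ℤ} (x : PhiTerm Q n a) :
    (phiOperad Q).obj n a := PhiObj.mk x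

theorem phiMk_sound {k : Type u} [Field k] {Q : GradedOperad k} {n : ℕ} {a : ℤ}
    {x y : PhiTerm Q n a} (h : PhiRel Q x y) : phiMk x = phiMk y := PhiObj.sound h

theorem phiMk_ind {k : Type u} [Field k] {Q : GradedOperad k} {n : ℕ} {a : ℤ}
    {p : (phiOperad Q).obj n a → Prop} (h : ∀ x, p (phiMk x)) (x : (phiOperad Q).obj n a) : p x :=
  PhiObj.ind h x

/-- The operations `φₙ` of `Q ⋆ k⟨φ₁, φ₂, …⟩`, with `φ₀ = 0`. -/
def phiGen {k : Type u} [Field k] (Q : GradedOperad k) (n : ℕ) :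
    (phiOperad Q).obj 1 (-2 * (n : ℤ)) :=
  if h : 0 < n then phiMk (.phi ⟨n, h⟩) else 0

/-- The operation of `Q ⋆ k⟨φ₁, φ₂, …⟩` given by an operation of `Q`. -/
def phiOf {k : Type u} [Field k] (Q : GradedOperad k) {n : ℕ} {a : ℤ} (q : Q.obj n a) :
    (phiOperad Q).obj n a := phiMk (.of q)

/-- The differential on expressions: the derivation that is `d` on `Q` and sends `φₙ` to the
value prescribed by `exp(-φ(z)) d exp(φ(z)) = d + zΔ`. -/
noncomputable def phiTermD : ∀ {n : ℕ} {a : ℤ}, PhiTerm Q.toGradedOperad n a →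
    (phiOperad Q.toGradedOperad).obj n (a + 1)
  | _, _, .of q => phiOf _ (Q.d q)
  | _, _, .phi i => phiDiff (phiOperad Q.toGradedOperad) (phiGen Q.toGradedOperad)
      (phiOf _ Q.Δ) i
  | _, _, .add x y => phiTermD x + phiTermD y
  | _, _, .smul c x => c • phiTermD x
  | _, _, .act σ x => (phiOperad Q.toGradedOperad).act σ (phiTermD x)
  | _, _, .comp (a := a) i e h x y =>
      (phiOperad Q.toGradedOperad).comp i e (by lia) (phiTermD x) (phiMk y) +
        koszulSign k a • (phiOperad Q.toGradedOperad).comp i e (by lia) (phiMk x) (phiTermD y)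

theorem DGOperad.d_id (P : DGOperad k) : P.d P.id = 0 := by
  have h := P.d_comp 0 Graft.unary (add_zero 0) (by norm_num) (by norm_num) P.id P.id
  have h1 : P.comp 0 Graft.unary (add_zero 0) P.id P.id = P.id :=
    P.toGradedOperad.mul_id _ _
  have h2 : P.comp 0 Graft.unary (show (0 : ℤ) + 1 + 0 = 0 + 1 by norm_num) (P.d P.id) P.id =
    P.d P.id := P.toGradedOperad.mul_id (a := 0 + 1) _ _
  have h3 : ∀ (b : ℤ) (h : 0 + b = b) (y : P.obj 1 b),
      P.comp 0 Graft.unary h P.id y = y := fun b h y =>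
    P.id_comp 0 Graft.unary h (fun _ => Subsingleton.elim _ _) y
  rw [h1, h2, h3, koszulSign_even k (by decide), one_smul] at h
  exact left_eq_add.mp h

theorem phiTermD_congr {n : ℕ} {a : ℤ} {x y : PhiTerm Q.toGradedOperad n a}
    (h : PhiRel Q.toGradedOperad x y) : phiTermD Q x = phiTermD Q y := by
  have add_def : ∀ {n : ℕ} {a : ℤ} (x y : PhiTerm Q.toGradedOperad n a),
      (phiMk (.add x y) : (phiOperad Q.toGradedOperad).obj n a) = phiMk x + phiMk y :=
    fun _ _ => rfl
  have smul_def : ∀ {n : ℕ} {a : ℤ} (c : k) (x : PhiTerm Q.toGradedOperad n a),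
      (phiMk (.smul c x) : (phiOperad Q.toGradedOperad).obj n a) = c • phiMk x :=
    fun _ _ => rfl
  have act_def : ∀ {n : ℕ} {a : ℤ} (σ : Equiv.Perm (Fin n)) (x : PhiTerm Q.toGradedOperad n a),
      (phiMk (.act σ x) : (phiOperad Q.toGradedOperad).obj n a) =
        (phiOperad Q.toGradedOperad).act σ (phiMk x) := fun _ _ => rfl
  have comp_def : ∀ {m n p : ℕ} {a b c : ℤ} (i : Fin m) (e : Graft m n p i) (h : a + b = c)
      (x : PhiTerm Q.toGradedOperad m a) (y : PhiTerm Q.toGradedOperad n b),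
      (phiMk (.comp i e h x y) : (phiOperad Q.toGradedOperad).obj p c) =
        (phiOperad Q.toGradedOperad).comp i e h (phiMk x) (phiMk y) :=
    fun _ _ _ _ _ => rfl
  have of_add : ∀ {n : ℕ} {a : ℤ} (q q' : Q.obj n a),
      phiOf Q.toGradedOperad (q + q') = phiOf _ q + phiOf _ q' :=
    fun q q' => phiMk_sound (.of_add q q')
  have of_smul : ∀ {n : ℕ} {a : ℤ} (c : k) (q : Q.obj n a),
      phiOf Q.toGradedOperad (c • q) = c • phiOf _ q :=
    fun c q => phiMk_sound (.of_smul c q)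
  have of_zero : ∀ {n : ℕ} {a : ℤ}, phiOf Q.toGradedOperad (0 : Q.obj n a) = 0 := rfl
  have d_id : Q.d Q.id = 0 := Q.toDGOperad.d_id
  induction h with
  | refl => rfl
  | symm _ ih => exact ih.symm
  | trans _ _ ih ih' => exact ih.trans ih'
  | add_congr _ _ ih ih' => simp only [phiTermD, ih, ih']
  | smul_congr _ _ ih => simp only [phiTermD, ih]
  | act_congr _ _ ih => simp only [phiTermD, ih]
  | comp_congr i e h hx hy ih ih' =>
    simp only [phiTermD, ih, ih', phiMk_sound hx, phiMk_sound hy]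
  | add_assoc x y z => simp only [phiTermD, _root_.add_assoc]
  | add_comm x y => simp only [phiTermD, _root_.add_comm]
  | zero_add x => simp only [phiTermD, map_zero, of_zero, _root_.zero_add]
  | neg_add x => simp only [phiTermD, map_zero, of_zero, neg_smul, _root_.one_smul,
      neg_add_cancel]
  | smul_add c x y => simp only [phiTermD, _root_.smul_add]
  | add_smul c c' x => simp only [phiTermD, _root_.add_smul]
  | mul_smul c c' x => simp only [phiTermD, _root_.SemigroupAction.mul_smul]
  | one_smul x => simp only [phiTermD, _root_.one_smul]
  | of_add q q' => simp only [phiTermD, map_add, of_add]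
  | of_smul c q => simp only [phiTermD, map_smul, of_smul]
  | of_act σ q =>
    simp only [phiTermD, Q.d_act]
    exact phiMk_sound (.of_act σ _)
  | of_comp i e h q q' =>
    simp only [phiTermD]
    rw [Q.d_comp i e h (by lia) (by lia), of_add, of_smul]
    congr 1
    · exact phiMk_sound (.of_comp _ _ _ _ _)
    · congr 1
      exact phiMk_sound (.of_comp _ _ _ _ _)
  | act_add σ x y => simp only [phiTermD, map_add]
  | act_smul σ c x => simp only [phiTermD, map_smul]
  | comp_add_left i e h x x' y =>
    simp only [phiTermD, add_def, map_add, LinearMap.add_apply, _root_.smul_add]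
    abel
  | comp_smul_left i e h s x y =>
    simp only [phiTermD, smul_def, map_smul, LinearMap.smul_apply, _root_.smul_add]
    rw [smul_comm]
  | comp_add_right i e h x y y' =>
    simp only [phiTermD, add_def, map_add, _root_.smul_add]
    abel
  | comp_smul_right i e h s x y =>
    simp only [phiTermD, smul_def, map_smul, _root_.smul_add]
    rw [smul_comm]
  | act_one x =>
    simp only [phiTermD]
    exact (phiOperad Q.toGradedOperad).act_one _
  | act_mul σ τ x =>
    simp only [phiTermD]
    exact (phiOperad Q.toGradedOperad).act_mul _ _ _
  | comp_act i h σ τ ρ e e' he he' x y =>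
    simp only [phiTermD, act_def, map_add, map_smul]
    rw [(phiOperad Q.toGradedOperad).comp_act i _ σ τ ρ e e' he he',
      (phiOperad Q.toGradedOperad).comp_act i _ σ τ ρ e e' he he']
  | id_comp i e h he y =>
    simp only [phiTermD, d_id, of_zero, map_zero, LinearMap.zero_apply, _root_.zero_add]
    rw [koszulSign_even k (by decide), _root_.one_smul]
    exact (phiOperad Q.toGradedOperad).id_comp i e _ he _
  | comp_id i e h he he' x =>
    simp only [phiTermD, d_id, of_zero, map_zero, smul_zero, _root_.add_zero]
    exact (phiOperad Q.toGradedOperad).comp_id i e _ he he' _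
  | @assoc_seq m n l p q r a b c ab bc t i j e f e' f' hab habc hbc habc' h₁ h₂ h₃ x y z =>
    simp only [phiTermD, comp_def, map_add, map_smul, LinearMap.add_apply,
      LinearMap.smul_apply, _root_.smul_add]
    subst hab hbc
    rw [(phiOperad Q.toGradedOperad).assoc_seq (bc := b + c) i j e f e' f' (by lia) (by lia)
        rfl (by lia) h₁ h₂ h₃,
      (phiOperad Q.toGradedOperad).assoc_seq (bc := b + c + 1) i j e f e' f' (by lia) (by lia)
        (by lia) (by lia) h₁ h₂ h₃ (phiMk x) (phiTermD Q y),
      (phiOperad Q.toGradedOperad).assoc_seq (bc := b + c + 1) i j e f e' f' rfl (by lia)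
        (by lia) (by lia) h₁ h₂ h₃ (phiMk x) (phiMk y) (phiTermD Q z),
      koszulSign_add, _root_.SemigroupAction.mul_smul, _root_.add_assoc]
  | @assoc_par m n l p q r a b c ab ac t i j hij hji e f e' f' hab habc hac hacb h₁ h₂ h₃ x y z =>
    simp only [phiTermD, comp_def, map_add, map_smul, LinearMap.add_apply,
      LinearMap.smul_apply, _root_.smul_add]
    subst hab hac
    rw [(phiOperad Q.toGradedOperad).assoc_par (ac := a + c + 1) i j hij hji e f e' f'
        (by lia) (by lia) (by lia) (by lia) h₁ h₂ h₃ (phiTermD Q x),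
      (phiOperad Q.toGradedOperad).assoc_par (ac := a + c) i j hij hji e f e' f'
        (by lia) (by lia) rfl (by lia) h₁ h₂ h₃ (phiMk x) (phiTermD Q y),
      (phiOperad Q.toGradedOperad).assoc_par (ac := a + c + 1) i j hij hji e f e' f'
        rfl (by lia) (by lia) (by lia) h₁ h₂ h₃ (phiMk x) (phiMk y) (phiTermD Q z)]
    have hb := koszulSign_mul_self k b
    simp only [smul_smul, mul_add, add_mul, koszulSign_add, mul_one, one_mul]
    match_scalars
    · ring
    · ring
    · linear_combination (koszulSign k a * koszulSign k (b * c)) * hb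

/-- The differential `d_Q + Δ∂/∂φ` of `Q ⋆ k⟨φ₁, φ₂, …⟩`. -/
noncomputable def phiD {n : ℕ} {a : ℤ} : (phiOperad Q.toGradedOperad).obj n a →ₗ[k]
    (phiOperad Q.toGradedOperad).obj n (a + 1) where
  toFun := Quot.lift (phiTermD Q) (fun _ _ h => phiTermD_congr Q h)
  map_add' := phiMk_ind fun _ => phiMk_ind fun _ => rfl
  map_smul' _ := phiMk_ind fun _ => rfl

theorem phiD_mk {n : ℕ} {a : ℤ} (x : PhiTerm Q.toGradedOperad n a) :
    phiD Q (phiMk x) = phiTermD Q x := rfl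

theorem phiD_act {n : ℕ} {a : ℤ} (σ : Equiv.Perm (Fin n))
    (x : (phiOperad Q.toGradedOperad).obj n a) :
    phiD Q ((phiOperad Q.toGradedOperad).act σ x) =
      (phiOperad Q.toGradedOperad).act σ (phiD Q x) := by
  revert x
  exact phiMk_ind fun x => rfl

theorem phiD_comp {m n p : ℕ} {a b c : ℤ} (i : Fin m) (e : Graft m n p i) (h : a + b = c)
    (h₁ : a + 1 + b = c + 1) (h₂ : a + (b + 1) = c + 1)
    (x : (phiOperad Q.toGradedOperad).obj m a) (y : (phiOperad Q.toGradedOperad).obj n b) :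
    phiD Q ((phiOperad Q.toGradedOperad).comp i e h x y) =
      (phiOperad Q.toGradedOperad).comp i e h₁ (phiD Q x) y +
        koszulSign k a • (phiOperad Q.toGradedOperad).comp i e h₂ x (phiD Q y) := by
  revert x y
  exact phiMk_ind fun x => phiMk_ind fun y => rfl

theorem phiD_mul_even {a b c : ℤ} (ha : Even a) (h : a + b = c)
    (h₁ : a + 1 + b = c + 1) (h₂ : a + (b + 1) = c + 1)
    (x : (phiOperad Q.toGradedOperad).obj 1 a) (y : (phiOperad Q.toGradedOperad).obj 1 b) :
    phiD Q ((phiOperad Q.toGradedOperad).mul h x y) =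
      (phiOperad Q.toGradedOperad).mul h₁ (phiD Q x) y +
        (phiOperad Q.toGradedOperad).mul h₂ x (phiD Q y) := by
  rw [GradedOperad.mul, phiD_comp Q _ _ h h₁ h₂, koszulSign_even k ha, one_smul]
  rfl

theorem phiD_mul_odd {a b c : ℤ} (ha : Even a) (h : a + 1 + b = c)
    (h₁ : a + 1 + 1 + b = c + 1) (h₂ : a + 1 + (b + 1) = c + 1)
    (x : (phiOperad Q.toGradedOperad).obj 1 (a + 1)) (y : (phiOperad Q.toGradedOperad).obj 1 b) :
    phiD Q ((phiOperad Q.toGradedOperad).mul h x y) =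
      (phiOperad Q.toGradedOperad).mul h₁ (phiD Q x) y -
        (phiOperad Q.toGradedOperad).mul h₂ x (phiD Q y) := by
  rw [GradedOperad.mul, phiD_comp Q _ _ h h₁ h₂, koszulSign_add, koszulSign_even k ha,
    koszulSign_one, one_mul, neg_smul, one_smul, sub_eq_add_neg]
  rfl

theorem phiGen_zero (P : GradedOperad k) : phiGen P 0 = 0 := rfl

theorem phiD_gen (n : ℕ) : phiD Q (phiGen Q.toGradedOperad n) =
    phiDiff (phiOperad Q.toGradedOperad) (phiGen Q.toGradedOperad) (phiOf _ Q.Δ) n := by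
  cases n with
  | zero =>
    rw [phiGen_zero, map_zero, phiDiff]
    simp [phiExpDelta]
  | succ n => rfl

theorem phiD_of {n : ℕ} {a : ℤ} (q : Q.obj n a) :
    phiD Q (phiOf Q.toGradedOperad q) = phiOf _ (Q.d q) := rfl

theorem phiOf_zero (P : GradedOperad k) {n : ℕ} {a : ℤ} : phiOf P (0 : P.obj n a) = 0 := rfl

theorem phiD_pow (j n : ℕ) :
    phiD Q (phiPow (phiOperad Q.toGradedOperad) (phiGen Q.toGradedOperad) j n) =
      phiPowD (phiOperad Q.toGradedOperad) (phiGen Q.toGradedOperad)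
        (phiDiff (phiOperad Q.toGradedOperad) (phiGen Q.toGradedOperad) (phiOf _ Q.Δ)) j n := by
  induction j generalizing n with
  | zero =>
    cases n with
    | zero => exact congrArg (phiOf _) Q.toDGOperad.d_id
    | succ n => exact map_zero _
  | succ j ih =>
    rw [phiPow, phiPowD, map_sum]
    refine Finset.sum_congr rfl fun i _ => ?_
    rw [phiD_mul_even Q ⟨-(i : ℕ), by ring⟩ _ (by have := i.isLt; lia) (by have := i.isLt; lia),
      ih, phiD_gen]

/-- The defining identity of the differential: the coefficient of `z^n` in
`[d, exp(φ(z))] = exp(φ(z)) zΔ`. -/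
theorem phiD_exp [CharZero k] (n : ℕ) :
    phiD Q (phiExp (phiOperad Q.toGradedOperad) (phiGen Q.toGradedOperad) n) =
      phiExpDelta (phiOperad Q.toGradedOperad) (phiGen Q.toGradedOperad) (phiOf _ Q.Δ) n := by
  rw [phiExp, map_sum, ← sum_phiPowD_phiDiff (phiGen_zero _)]
  refine Finset.sum_congr rfl fun j _ => ?_
  rw [map_smul, phiD_pow]

theorem phiD_phiD_exp [CharZero k] (n : ℕ) :
    phiD Q (phiD Q (phiExp (phiOperad Q.toGradedOperad) (phiGen Q.toGradedOperad) n)) = 0 := by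
  rw [phiD_exp]
  match n with
  | 0 => exact map_zero _
  | n + 1 =>
    rw [phiExpDelta, phiD_mul_even Q ⟨-n, by ring⟩ _ (by lia) (by lia), phiD_of, Q.d_Δ,
      phiOf_zero, GradedOperad.mul_zero, add_zero, phiD_exp]
    match n with
    | 0 => exact GradedOperad.zero_mul _ _
    | n + 1 =>
      rw [phiExpDelta, GradedOperad.mul_assoc (bc := -2) _ _ _ (by norm_num) (by lia)]
      have h : (phiOperad Q.toGradedOperad).mul (c := -2) (by norm_num) (phiOf _ Q.Δ)
          (phiOf _ Q.Δ) = phiOf Q.toGradedOperad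
            (Q.toGradedOperad.mul (c := -2) (by norm_num) Q.Δ Q.Δ) :=
        (phiMk_sound (.of_comp _ _ _ _ _)).symm
      rw [h, Q.Δ_Δ, phiOf_zero, GradedOperad.mul_zero]

theorem phiD_phiD_pow {n j : ℕ}
    (h : ∀ i < n, phiD Q (phiD Q (phiGen Q.toGradedOperad i)) = 0) :
    (∀ i < n, phiD Q (phiD Q
      (phiPow (phiOperad Q.toGradedOperad) (phiGen Q.toGradedOperad) j i)) = 0) ∧
    (j ≠ 1 → phiD Q (phiD Q
      (phiPow (phiOperad Q.toGradedOperad) (phiGen Q.toGradedOperad) j n)) = 0) := by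
  have key : ∀ (j i : ℕ),
      (∀ s ≤ i, phiPow (phiOperad Q.toGradedOperad) (phiGen Q.toGradedOperad) j (i - s) ≠ 0 →
        phiD Q (phiD Q (phiGen Q.toGradedOperad s)) = 0) →
      (∀ s ≤ i, s ≠ 0 → phiD Q (phiD Q
        (phiPow (phiOperad Q.toGradedOperad) (phiGen Q.toGradedOperad) j (i - s))) = 0) →
      phiD Q (phiD Q
        (phiPow (phiOperad Q.toGradedOperad) (phiGen Q.toGradedOperad) (j + 1) i)) = 0 := by
    intro j i h1 h2
    rw [phiPow, map_sum, map_sum]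
    refine Finset.sum_eq_zero fun s _ => ?_
    have hs := s.isLt
    rw [phiD_mul_even Q ⟨-(s : ℕ), by ring⟩ _ (by lia) (by lia), map_add,
      phiD_mul_odd Q ⟨-(s : ℕ), by ring⟩ _ (by lia) (by lia),
      phiD_mul_even Q ⟨-(s : ℕ), by ring⟩ _ (by lia) (by lia)]
    have e1 : (phiOperad Q.toGradedOperad).mul
        (show -2 * ((s : ℕ) : ℤ) + 1 + 1 + -2 * ((i - s : ℕ) : ℤ) = -2 * (i : ℤ) + 1 + 1 by lia)
        (phiD Q (phiD Q (phiGen Q.toGradedOperad s)))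
        (phiPow (phiOperad Q.toGradedOperad) (phiGen Q.toGradedOperad) j (i - s)) = 0 := by
      by_cases h0 : phiPow (phiOperad Q.toGradedOperad) (phiGen Q.toGradedOperad) j (i - s) = 0
      · rw [h0, GradedOperad.mul_zero]
      · rw [h1 s (by lia) h0, GradedOperad.zero_mul]
    have e2 : (phiOperad Q.toGradedOperad).mul
        (show -2 * ((s : ℕ) : ℤ) + (-2 * ((i - s : ℕ) : ℤ) + 1 + 1) = -2 * (i : ℤ) + 1 + 1 by lia)
        (phiGen Q.toGradedOperad s) (phiD Q (phiD Q
          (phiPow (phiOperad Q.toGradedOperad) (phiGen Q.toGradedOperad) j (i - s)))) = 0 := by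
      by_cases h0 : (s : ℕ) = 0
      · have : phiGen Q.toGradedOperad s = 0 := by rw [h0]; rfl
        rw [this, GradedOperad.zero_mul]
      · rw [h2 s (by lia) h0, GradedOperad.mul_zero]
    rw [e1, e2]
    abel
  have zero : ∀ i, phiD Q (phiD Q
      (phiPow (phiOperad Q.toGradedOperad) (phiGen Q.toGradedOperad) 0 i)) = 0 := by
    intro i
    rw [phiD_pow]
    exact map_zero _
  have lt : ∀ j, ∀ i < n, phiD Q (phiD Q
      (phiPow (phiOperad Q.toGradedOperad) (phiGen Q.toGradedOperad) j i)) = 0 := by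
    intro j
    induction j with
    | zero => exact fun i _ => zero i
    | succ j ih =>
      exact fun i hi => key j i (fun s hs _ => h s (by lia)) (fun s hs _ => ih (i - s) (by lia))
  refine ⟨lt j, fun hj => ?_⟩
  match j with
  | 0 => exact zero n
  | 1 => exact absurd rfl hj
  | j + 2 =>
    refine key (j + 1) n (fun s hs h0 => ?_) (fun s hs h0 => lt _ _ (by lia))
    rcases hs.lt_or_eq with hs | rfl
    · exact h s hs
    · refine absurd ?_ h0
      rw [Nat.sub_self]
      exact phiPow_zero_coeff (phiGen_zero _) j

theorem phiPow_one {P : GradedOperad k} (φ : ∀ n : ℕ, P.obj 1 (-2 * (n : ℤ))) (n : ℕ) :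
    phiPow P φ 1 n = φ n := by
  rw [phiPow, Finset.sum_eq_single (Fin.last n)]
  · have h0 : ∀ (s : ℕ) (hs : s = 0) (h : -2 * (n : ℤ) + -2 * (s : ℤ) = -2 * (n : ℤ)),
        P.mul h (φ n) (phiPow P φ 0 s) = φ n := by
      rintro s rfl h
      exact P.mul_id _ _
    exact h0 _ (by simp) _
  · intro i _ hi
    have h0 : phiPow P φ 0 (n - i) = 0 := by
      obtain ⟨s, hs⟩ : ∃ s, n - (i : ℕ) = s + 1 := by
        have := Fin.lt_last_iff_ne_last.mpr hi
        exact ⟨n - i - 1, by have : (i : ℕ) < n := this; lia⟩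
      rw [hs]; rfl
    rw [h0, GradedOperad.mul_zero]
  · simp

theorem phiD_phiD_gen [CharZero k] (n : ℕ) :
    phiD Q (phiD Q (phiGen Q.toGradedOperad n)) = 0 := by
  induction n using Nat.strong_induction_on with
  | _ n ih =>
    rcases Nat.eq_zero_or_pos n with rfl | hn
    · rw [phiGen_zero, map_zero, map_zero]
    · have h := phiD_phiD_exp Q n
      rw [phiExp, map_sum, map_sum, Finset.sum_eq_single 1] at h
      · simpa [phiPow_one] using h
      · intro j _ hj
        rw [map_smul, map_smul, (phiD_phiD_pow Q ih).2 hj, smul_zero]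
      · simp [hn.ne']

theorem phiD_phiD [CharZero k] {n : ℕ} {a : ℤ} (x : (phiOperad Q.toGradedOperad).obj n a) :
    phiD Q (phiD Q x) = 0 := by
  revert x
  refine phiMk_ind fun x => ?_
  induction x with
  | of q =>
    change phiOf _ (Q.d (Q.d q)) = 0
    rw [Q.d_d, phiOf_zero]
  | phi i =>
    have h := phiD_phiD_gen Q i
    rwa [phiGen, dif_pos i.pos] at h
  | add x y hx hy =>
    have h : phiMk (.add x y) = phiMk x + phiMk y := rfl
    rw [h, map_add, map_add, hx, hy, add_zero]
  | smul c x hx =>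
    have h : phiMk (.smul c x) = c • phiMk x := rfl
    rw [h, map_smul, map_smul, hx, smul_zero]
  | act σ x hx =>
    have h : phiMk (.act σ x) = (phiOperad Q.toGradedOperad).act σ (phiMk x) := rfl
    rw [h, phiD_act, phiD_act, hx, map_zero]
  | @comp m n p a b c i e h x y hx hy =>
    have h' : phiMk (.comp i e h x y) =
      (phiOperad Q.toGradedOperad).comp i e h (phiMk x) (phiMk y) := rfl
    rw [h', phiD_comp Q i e h (by lia) (by lia), map_add, map_smul,
      phiD_comp Q i e _ (by lia) (by lia), phiD_comp Q i e _ (by lia) (by lia), hx, hy,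
      map_zero, map_zero, LinearMap.zero_apply, smul_zero, zero_add, add_zero,
      koszulSign_add, koszulSign_one]
    simp

/-- The dg-operad `(Q ⋆ k⟨φ₁, φ₂, …⟩, d_Q + Δ∂/∂φ)`. -/
noncomputable def homotopyQuotientObj [CharZero k] : DGOperad k where
  toGradedOperad := phiOperad Q.toGradedOperad
  d := phiD Q
  d_d := phiD_phiD Q
  d_act := phiD_act Q
  d_comp i e h h₁ h₂ := phiD_comp Q i e h h₁ h₂

variable {Q}

/-- The map on expressions induced by a morphism, with `φᵢ ↦ φᵢ`. -/
def PhiTerm.map {P R : DGOperad k} (f : DGOperad.Hom P R) : ∀ {n : ℕ} {a : ℤ},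
    PhiTerm P.toGradedOperad n a → PhiTerm R.toGradedOperad n a
  | _, _, .of q => .of (f.map q)
  | _, _, .phi i => .phi i
  | _, _, .add x y => .add (map f x) (map f y)
  | _, _, .smul c x => .smul c (map f x)
  | _, _, .act σ x => .act σ (map f x)
  | _, _, .comp i e h x y => .comp i e h (map f x) (map f y)

theorem PhiRel.map {P R : DGOperad k} (f : DGOperad.Hom P R) {n : ℕ} {a : ℤ}
    {x y : PhiTerm P.toGradedOperad n a} (h : PhiRel P.toGradedOperad x y) :
    PhiRel R.toGradedOperad (x.map f) (y.map f) := by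
  induction h with
  | refl => exact .refl _
  | symm _ ih => exact .symm ih
  | trans _ _ ih ih' => exact .trans ih ih'
  | add_congr _ _ ih ih' => exact .add_congr ih ih'
  | smul_congr c _ ih => exact .smul_congr c ih
  | act_congr σ _ ih => exact .act_congr σ ih
  | comp_congr i e h _ _ ih ih' => exact .comp_congr i e h ih ih'
  | add_assoc => exact .add_assoc _ _ _
  | add_comm => exact .add_comm _ _
  | zero_add =>
    simp only [PhiTerm.map, map_zero]
    exact .zero_add _
  | neg_add =>
    simp only [PhiTerm.map, map_zero]
    exact .neg_add _
  | smul_add => exact .smul_add _ _ _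
  | add_smul => exact .add_smul _ _ _
  | mul_smul => exact .mul_smul _ _ _
  | one_smul => exact .one_smul _
  | of_add =>
    simp only [PhiTerm.map, map_add]
    exact .of_add _ _
  | of_smul =>
    simp only [PhiTerm.map, map_smul]
    exact .of_smul _ _
  | of_act =>
    simp only [PhiTerm.map, f.map_act]
    exact .of_act _ _
  | of_comp =>
    simp only [PhiTerm.map, f.map_comp]
    exact .of_comp _ _ _ _ _
  | act_add => exact .act_add _ _ _
  | act_smul => exact .act_smul _ _ _
  | comp_add_left => exact .comp_add_left _ _ _ _ _ _
  | comp_smul_left => exact .comp_smul_left _ _ _ _ _ _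
  | comp_add_right => exact .comp_add_right _ _ _ _ _ _
  | comp_smul_right => exact .comp_smul_right _ _ _ _ _ _
  | act_one => exact .act_one _
  | act_mul => exact .act_mul _ _ _
  | comp_act i h σ τ ρ e e' he he' => exact .comp_act i h σ τ ρ e e' he he' _ _
  | id_comp i e h he =>
    simp only [PhiTerm.map, f.map_id]
    exact .id_comp i e h he _
  | comp_id i e h he he' =>
    simp only [PhiTerm.map, f.map_id]
    exact .comp_id i e h he he' _
  | assoc_seq i j e f e' f' hab habc hbc habc' h₁ h₂ h₃ =>
    exact .assoc_seq i j e f e' f' hab habc hbc habc' h₁ h₂ h₃ _ _ _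
  | assoc_par i j hij hji e f e' f' hab habc hac hacb h₁ h₂ h₃ =>
    exact .assoc_par i j hij hji e f e' f' hab habc hac hacb h₁ h₂ h₃ _ _ _

/-- The map `Q ⋆ k⟨φ₁, φ₂, …⟩ → R ⋆ k⟨φ₁, φ₂, …⟩` induced by a morphism `Q → R`. -/
def phiMap {P R : DGOperad k} (f : DGOperad.Hom P R) {n : ℕ} {a : ℤ} :
    (phiOperad P.toGradedOperad).obj n a →ₗ[k] (phiOperad R.toGradedOperad).obj n a where
  toFun := Quot.map (PhiTerm.map f) (fun _ _ h => PhiRel.map f h)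
  map_add' := phiMk_ind fun _ => phiMk_ind fun _ => rfl
  map_smul' _ := phiMk_ind fun _ => rfl

theorem phiMap_mk {P R : DGOperad k} (f : DGOperad.Hom P R) {n : ℕ} {a : ℤ}
    (x : PhiTerm P.toGradedOperad n a) : phiMap f (phiMk x) = phiMk (x.map f) := rfl

theorem phiMap_mul {P R : DGOperad k} (f : DGOperad.Hom P R) {a b c : ℤ} (h : a + b = c)
    (x : (phiOperad P.toGradedOperad).obj 1 a) (y : (phiOperad P.toGradedOperad).obj 1 b) :
    phiMap f ((phiOperad P.toGradedOperad).mul h x y) =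
      (phiOperad R.toGradedOperad).mul h (phiMap f x) (phiMap f y) := by
  revert x y
  exact phiMk_ind fun _ => phiMk_ind fun _ => rfl

theorem phiMap_gen {P R : DGOperad k} (f : DGOperad.Hom P R) (n : ℕ) :
    phiMap f (phiGen P.toGradedOperad n) = phiGen R.toGradedOperad n := by
  cases n with
  | zero => exact map_zero _
  | succ n => rfl

theorem phiMap_pow {P R : DGOperad k} (f : DGOperad.Hom P R) (j n : ℕ) :
    phiMap f (phiPow (phiOperad P.toGradedOperad) (phiGen P.toGradedOperad) j n) =
      phiPow (phiOperad R.toGradedOperad) (phiGen R.toGradedOperad) j n := by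
  induction j generalizing n with
  | zero =>
    cases n with
    | zero => exact congrArg (phiOf _) f.map_id
    | succ n => exact map_zero _
  | succ j ih =>
    rw [phiPow, phiPow, map_sum]
    exact Finset.sum_congr rfl fun i _ => by rw [phiMap_mul, phiMap_gen, ih]

theorem phiMap_powD {P R : DGOperad k} (f : DGOperad.Hom P R)
    {ψ : ∀ n : ℕ, (phiOperad P.toGradedOperad).obj 1 (-2 * (n : ℤ) + 1)}
    {ψ' : ∀ n : ℕ, (phiOperad R.toGradedOperad).obj 1 (-2 * (n : ℤ) + 1)}
    (h : ∀ n, phiMap f (ψ n) = ψ' n) (j n : ℕ) :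
    phiMap f (phiPowD (phiOperad P.toGradedOperad) (phiGen P.toGradedOperad) ψ j n) =
      phiPowD (phiOperad R.toGradedOperad) (phiGen R.toGradedOperad) ψ' j n := by
  induction j generalizing n with
  | zero => exact map_zero _
  | succ j ih =>
    rw [phiPowD, phiPowD, map_sum]
    exact Finset.sum_congr rfl fun i _ => by
      rw [map_add, phiMap_mul, phiMap_mul, phiMap_gen, phiMap_pow, h, ih]

theorem phiMap_diff {P R : DGOperad k} (f : DGOperad.Hom P R) (Δ : P.obj 1 (-1)) (n : ℕ) :
    phiMap f (phiDiff (phiOperad P.toGradedOperad) (phiGen P.toGradedOperad) (phiOf _ Δ) n) =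
      phiDiff (phiOperad R.toGradedOperad) (phiGen R.toGradedOperad) (phiOf _ (f.map Δ)) n := by
  induction n using Nat.strong_induction_on with
  | _ n ih =>
    rw [phiDiff, phiDiff, map_sub, map_sum]
    congr 1
    · cases n with
      | zero => exact map_zero _
      | succ n =>
        rw [phiExpDelta, phiExpDelta, phiMap_mul, phiExp, phiExp, map_sum]
        congr 1
        exact Finset.sum_congr rfl fun j _ => by rw [map_smul, phiMap_pow]
    · refine Finset.sum_congr rfl fun j _ => ?_
      rw [map_smul, phiMap_powD]
      intro i
      split_ifs with hi
      · exact ih i hi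
      · exact map_zero _

theorem phiMap_d {P R : DeltaDGOperad k} (f : P ⟶ R) {n : ℕ} {a : ℤ}
    (x : (phiOperad P.toGradedOperad).obj n a) :
    phiMap (DeltaDGOperad.Hom.hom f) (phiD P x) =
      phiD R (phiMap (DeltaDGOperad.Hom.hom f) x) := by
  revert x
  refine phiMk_ind fun x => ?_
  rw [phiD_mk, phiMap_mk, phiD_mk]
  induction x with
  | of q =>
    exact congrArg (phiOf _) (DGOperad.Hom.map_d (DeltaDGOperad.Hom.hom f) q)
  | phi i =>
    simp only [phiTermD, PhiTerm.map]
    rw [phiMap_diff, DeltaDGOperad.Hom.map_Δ]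
  | add x y hx hy => simp only [phiTermD, PhiTerm.map, map_add, hx, hy]
  | smul c x hx => simp only [phiTermD, PhiTerm.map, map_smul, hx]
  | act σ x hx =>
    simp only [phiTermD, PhiTerm.map, ← hx]
    generalize phiTermD P x = y
    revert y
    exact phiMk_ind fun _ => rfl
  | comp i e h x y hx hy =>
    simp only [phiTermD, PhiTerm.map, ← hx, ← hy, map_add, map_smul]
    generalize phiTermD P x = x'
    generalize phiTermD P y = y'
    revert x' y'
    exact phiMk_ind fun _ => phiMk_ind fun _ => rfl

end Quotient

/-- The functor `Q ↦ Q/Δ = (Q ⋆ k⟨φ₁, φ₂, …⟩, d_Q + Δ∂/∂φ)`. -/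
noncomputable def homotopyQuotient (k : Type u) [Field k] [CharZero k] :
    DeltaDGOperad k ⥤ DGOperad k where
  obj Q := homotopyQuotientObj Q
  map f :=
    { map := phiMap (DeltaDGOperad.Hom.hom f)
      map_id := congrArg (phiOf _) (DGOperad.Hom.map_id (DeltaDGOperad.Hom.hom f))
      map_act := fun σ => phiMk_ind fun _ => rfl
      map_comp := fun i e h => phiMk_ind fun _ => phiMk_ind fun _ => rfl
      map_d := phiMap_d f }
  map_id Q := by
    refine DGOperad.Hom.ext ?_
    funext n a
    refine LinearMap.ext (phiMk_ind fun x => congrArg phiMk ?_)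
    induction x with
    | of q => rfl
    | phi i => rfl
    | add x y hx hy => exact congrArg₂ PhiTerm.add hx hy
    | smul c x hx => exact congrArg (PhiTerm.smul c) hx
    | act σ x hx => exact congrArg (PhiTerm.act σ) hx
    | comp i e h x y hx hy => exact congrArg₂ (PhiTerm.comp i e h) hx hy
  map_comp f g := by
    refine DGOperad.Hom.ext ?_
    funext n a
    refine LinearMap.ext (phiMk_ind fun x => congrArg phiMk ?_)
    induction x with
    | of q => rfl
    | phi i => rfl
    | add x y hx hy => exact congrArg₂ PhiTerm.add hx hy
    | smul c x hx => exact congrArg (PhiTerm.smul c) hx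
    | act σ x hx => exact congrArg (PhiTerm.act σ) hx
    | comp i e h x y hx hy => exact congrArg₂ (PhiTerm.comp i e h) hx hy

/-! ### The operad `k[Δ]` -/

section KDelta

variable (k : Type u) [Field k]

/-- The operations of `k[Δ]` of arity `n` and degree `a`, as elements `s + tΔ ↔ (s, t)` of `k[Δ]`:
multiples of `1` for `n = 1`, `a = 0`, multiples of `Δ` for `n = 1`, `a = -1`, and `0` otherwise. -/
def kDeltaObj (n : ℕ) (a : ℤ) : Submodule k (k × k) where
  carrier := {x | (x.1 ≠ 0 → n = 1 ∧ a = 0) ∧ (x.2 ≠ 0 → n = 1 ∧ a = -1)}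
  zero_mem' := by simp
  add_mem' := by
    rintro ⟨s, t⟩ ⟨s', t'⟩ ⟨h1, h2⟩ ⟨h1', h2'⟩
    refine ⟨fun h => ?_, fun h => ?_⟩
    · by_cases hs : s = 0
      · exact h1' (by simpa [hs] using h)
      · exact h1 hs
    · by_cases ht : t = 0
      · exact h2' (by simpa [ht] using h)
      · exact h2 ht
  smul_mem' := by
    rintro c ⟨s, t⟩ ⟨h1, h2⟩
    exact ⟨fun h => h1 (right_ne_zero_of_mul h), fun h => h2 (right_ne_zero_of_mul h)⟩

variable {k}

theorem kDeltaObj_eq_zero {n : ℕ} {a : ℤ} (hn : n ≠ 1) (x : kDeltaObj k n a) : x = 0 := by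
  obtain ⟨⟨s, t⟩, h1, h2⟩ := x
  refine Subtype.ext (Prod.ext ?_ ?_)
  · by_contra h
    exact hn (h1 h).1
  · by_contra h
    exact hn (h2 h).1

theorem Graft.eq_one {p : ℕ} {i : Fin 1} (e : Graft 1 1 p i) : p = 1 := by
  have h := Fintype.card_congr e
  have : IsEmpty {j : Fin 1 // j ≠ i} := ⟨fun j => j.2 (Subsingleton.elim _ _)⟩
  simpa using h.symm

/-- The product of `k[Δ]`: `(s + tΔ)(s' + t'Δ) = ss' + (st' + ts')Δ`. -/
def kDeltaComp {m n p : ℕ} {a b c : ℤ} (i : Fin m) (e : Graft m n p i) (h : a + b = c) :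
    kDeltaObj k m a →ₗ[k] kDeltaObj k n b →ₗ[k] kDeltaObj k p c :=
  LinearMap.mk₂ k
    (fun x y => ⟨(x.1.1 * y.1.1, x.1.1 * y.1.2 + x.1.2 * y.1.1), by
      obtain ⟨⟨s, t⟩, h1, h2⟩ := x
      obtain ⟨⟨s', t'⟩, h1', h2'⟩ := y
      dsimp only at h1 h2 h1' h2' ⊢
      refine ⟨fun h0 => ?_, fun h0 => ?_⟩
      · obtain ⟨rfl, rfl⟩ := h1 (left_ne_zero_of_mul h0)
        obtain ⟨rfl, rfl⟩ := h1' (right_ne_zero_of_mul h0)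
        exact ⟨e.eq_one, by lia⟩
      · by_cases h3 : s * t' = 0
        · have h4 : t * s' ≠ 0 := by simpa [h3] using h0
          obtain ⟨rfl, rfl⟩ := h2 (left_ne_zero_of_mul h4)
          obtain ⟨rfl, rfl⟩ := h1' (right_ne_zero_of_mul h4)
          exact ⟨e.eq_one, by lia⟩
        · obtain ⟨rfl, rfl⟩ := h1 (left_ne_zero_of_mul h3)
          obtain ⟨rfl, rfl⟩ := h2' (right_ne_zero_of_mul h3)
          exact ⟨e.eq_one, by lia⟩⟩)
    (fun x x' y => Subtype.ext (Prod.ext (by simp; ring) (by simp; ring)))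
    (fun r x y => Subtype.ext (Prod.ext (by simp; ring) (by simp; ring)))
    (fun x y y' => Subtype.ext (Prod.ext (by simp; ring) (by simp; ring)))
    (fun r x y => Subtype.ext (Prod.ext (by simp; ring) (by simp; ring)))

theorem kDeltaComp_fst {m n p : ℕ} {a b c : ℤ} (i : Fin m) (e : Graft m n p i) (h : a + b = c)
    (x : kDeltaObj k m a) (y : kDeltaObj k n b) :
    (kDeltaComp i e h x y).1.1 = x.1.1 * y.1.1 := rfl

theorem kDeltaComp_snd {m n p : ℕ} {a b c : ℤ} (i : Fin m) (e : Graft m n p i) (h : a + b = c)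
    (x : kDeltaObj k m a) (y : kDeltaObj k n b) :
    (kDeltaComp i e h x y).1.2 = x.1.1 * y.1.2 + x.1.2 * y.1.1 := rfl

variable (k)

/-- The dg-operad `(k[Δ], 0)`, concentrated in arity `1`, with its operation `Δ`. -/
def kDelta : DeltaDGOperad k where
  obj n a := kDeltaObj k n a
  id := ⟨(1, 0), fun _ => ⟨rfl, rfl⟩, fun h => absurd rfl h⟩
  act _ := LinearMap.id
  comp := kDeltaComp
  act_one _ := rfl
  act_mul _ _ _ := rfl
  comp_act _ _ _ _ _ _ _ _ _ _ _ := rfl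
  id_comp i e h he y := Subtype.ext (Prod.ext (by simp [kDeltaComp_fst])
    (by simp [kDeltaComp_snd]))
  comp_id i e h he he' x := Subtype.ext (Prod.ext (by simp [kDeltaComp_fst])
    (by simp [kDeltaComp_snd]))
  assoc_seq _ _ _ _ _ _ _ _ _ _ _ _ _ x y z := Subtype.ext (Prod.ext
    (by simp only [kDeltaComp_fst]; ring)
    (by simp only [kDeltaComp_snd, kDeltaComp_fst]; ring))
  assoc_par := by
    intro m n l p q r a b c ab ac t i j hij _ _ _ _ _ _ _ _ _ _ _ _ x y z
    have hm : m ≠ 1 := by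
      rintro rfl
      exact hij (Subsingleton.elim _ _)
    rw [kDeltaObj_eq_zero hm x]
    simp
  d := 0
  d_d _ := rfl
  d_act _ _ := rfl
  d_comp _ _ _ _ _ _ _ := by simp
  Δ := ⟨(0, 1), fun h => absurd rfl h, fun _ => ⟨rfl, rfl⟩⟩
  Δ_Δ := Subtype.ext (Prod.ext (by simp [GradedOperad.mul, kDeltaComp_fst])
    (by simp [GradedOperad.mul, kDeltaComp_snd]))
  d_Δ := rfl

end KDelta

/-!
Three facts about the homotopy quotient carry the proof.

*It preserves quasi-isomorphisms* (`homotopyQuotient_map_quasiIso`). Let `f` be a quasi-isomorphism.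
In characteristic `0` it has an equivariant homotopy inverse (`ConeAcyclic.nonempty_homotopyInverse`).
The operad `Q ⋆ k⟨φ₁, φ₂, …⟩` is graded by weight, with `φₙ` of weight `n` (`phiWeight`). Its
universal derivation relative to `Q`, with values in the free infinitesimal bimodule, composed with
`[n] ↦ n φₙ`, multiplies by the weight; so the homotopy inverse extends weight by weight when
`Δ = 0` (`PhiInverse.succ`). In general `Δ` adds to the differential a term that lowers the weight by
one, and the cone is acyclic by induction on the weight (`DeltaDGOperad.Hom.coneAcyclic_of_below`).

*For free `Δ` it is trivial:* `P → (P ⋆ k[Δ])/Δ` is a quasi-isomorphism (`FreeQuot.exists_sub_proj`).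
The derivation `D` relative to `P` with `D Δ = [0] Δ - Δ [0]` and `D uₙ = ∑ uᵢ [n - i]`, where
`∑ uₙ zⁿ = exp(φ(z))`, commutes with the differentials if the free infinitesimal bimodule is given
the twisted differential `[r] ↦ [r - 1] Δ - Δ [r - 1]` (`FreeQuot.D_d`). Up to a locally nilpotent
map, raising `[r]` to `[r + 1]` and applying `∂/∂Δ` is a contracting homotopy of the elements that
matter (`FreeInf.twDer_raise`). Hence `D x` is a boundary for every cycle `x`, and a contraction takes
`D x` to the weight times `x`. So cycles of positive weight are boundaries.

*The adjunction is formal.* By the second fact two retractions of `P → (P ⋆ k[Δ])/Δ` agree in the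
homotopy category (`freeQuot_retraction_unique`). The unit is the roof
`Q → Q/Δ ← (Q/Δ ⋆ k[Δ'])/Δ' → (Q/Δ, 0)`, with `Δ' ↦ Δ` in the middle and `Δ' ↦ 0` on the right; the
counit is `P/0 → P`, `φₙ ↦ 0`. For `P = Q/Δ` the uniqueness gives the triangle identity that is not
immediate (`nonempty_homotopyQuotient_adjunction`).

Finally let `A = k[Δ]/Δ`. Since `k[Δ]` is initial, `(A ⋆ k[Δ'])/Δ' → A` has a section `kDeltaSection`.
By the second fact each cycle of `A` is homologous to its image with `Δ, φₙ ↦ 0`.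
-/
open CategoryTheory

/-! ### Labellings of iterated compositions -/

/-- The labellings `e, f` and `e', f'` describe the same iterated composition
`(x ∘ᵢ y) ∘ⱼ z = x ∘ᵢ (y ∘ⱼ z)`; the input `j` of `y` is the input `j'` of `x ∘ᵢ y`. -/
structure SeqCompat {m n l p q r : ℕ} (i : Fin m) (j : Fin n) (j' : Fin p)
    (e : Graft m n p i) (f : Graft p l q j') (e' : Graft n l r j) (f' : Graft m r q i) : Prop where
  base : e (Sum.inr j) = j'
  inl_inl : ∀ (s : Fin m) (hs : s ≠ i) (hs' : e (Sum.inl ⟨s, hs⟩) ≠ j'),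
    f (Sum.inl ⟨e (Sum.inl ⟨s, hs⟩), hs'⟩) = f' (Sum.inl ⟨s, hs⟩)
  inl_inr : ∀ (s : Fin n) (hs : s ≠ j) (hs' : e (Sum.inr s) ≠ j'),
    f (Sum.inl ⟨e (Sum.inr s), hs'⟩) = f' (Sum.inr (e' (Sum.inl ⟨s, hs⟩)))
  inr : ∀ s : Fin l, f (Sum.inr s) = f' (Sum.inr (e' (Sum.inr s)))

/-- The labellings `e, f` and `e', f'` describe the same iterated composition
`(x ∘ᵢ y) ∘ⱼ z = ± (x ∘ⱼ z) ∘ᵢ y`; the inputs `i`, `j` of `x` are the input `i'` of `x ∘ⱼ z`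
and the input `j'` of `x ∘ᵢ y`. -/
structure ParCompat {m n l p q r : ℕ} (i j : Fin m) (i' : Fin r) (j' : Fin p)
    (e : Graft m n p i) (f : Graft p l q j') (e' : Graft m l r j) (f' : Graft r n q i') :
    Prop where
  ne : i ≠ j
  base : e (Sum.inl ⟨j, ne.symm⟩) = j'
  base' : e' (Sum.inl ⟨i, ne⟩) = i'
  inl_inl : ∀ (s : Fin m) (hs : s ≠ i) (hs' : s ≠ j) (hs₁ : e (Sum.inl ⟨s, hs⟩) ≠ j')
    (hs₂ : e' (Sum.inl ⟨s, hs'⟩) ≠ i'),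
    f (Sum.inl ⟨e (Sum.inl ⟨s, hs⟩), hs₁⟩) = f' (Sum.inl ⟨e' (Sum.inl ⟨s, hs'⟩), hs₂⟩)
  inl_inr : ∀ (s : Fin n) (hs : e (Sum.inr s) ≠ j'),
    f (Sum.inl ⟨e (Sum.inr s), hs⟩) = f' (Sum.inr s)
  inr : ∀ (s : Fin l) (hs : e' (Sum.inr s) ≠ i'),
    f (Sum.inr s) = f' (Sum.inl ⟨e' (Sum.inr s), hs⟩)

/-- The labellings `e`, `e'` are related by renaming the inputs with `σ`, `τ`, `ρ`. -/
structure ActCompat {m n p : ℕ} (i i' : Fin m) (σ : Equiv.Perm (Fin m)) (τ : Equiv.Perm (Fin n))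
    (ρ : Equiv.Perm (Fin p)) (e : Graft m n p i) (e' : Graft m n p i') : Prop where
  base : σ i = i'
  inl : ∀ (j : Fin m) (hj : j ≠ i) (hj' : σ j ≠ i'),
    e' (Sum.inl ⟨σ j, hj'⟩) = ρ (e (Sum.inl ⟨j, hj⟩))
  inr : ∀ j : Fin n, e' (Sum.inr (τ j)) = ρ (e (Sum.inr j))

theorem ParCompat.symm {m n l p q r : ℕ} {i j : Fin m} {i' : Fin r} {j' : Fin p}
    {e : Graft m n p i} {f : Graft p l q j'} {e' : Graft m l r j} {f' : Graft r n q i'}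
    (h : ParCompat i j i' j' e f e' f') : ParCompat j i j' i' e' f' e f where
  ne := h.ne.symm
  base := h.base'
  base' := h.base
  inl_inl s hs hs' hs₁ hs₂ := (h.inl_inl s hs' hs hs₂ hs₁).symm
  inl_inr s hs := (h.inr s hs).symm
  inr s hs := (h.inl_inr s hs).symm

namespace GradedOperad

variable {k : Type u} [Field k] (P : GradedOperad k)

theorem comp_seq {m n l p q r : ℕ} {a b c ab bc t : ℤ} {i : Fin m} {j : Fin n} {j' : Fin p}
    {e : Graft m n p i} {f : Graft p l q j'} {e' : Graft n l r j} {f' : Graft m r q i}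
    (H : SeqCompat i j j' e f e' f') (hab : a + b = ab) (habc : ab + c = t) (hbc : b + c = bc)
    (habc' : a + bc = t) (x : P.obj m a) (y : P.obj n b) (z : P.obj l c) :
    P.comp j' f habc (P.comp i e hab x y) z = P.comp i f' habc' x (P.comp j e' hbc y z) := by
  obtain ⟨rfl, h₁, h₂, h₃⟩ := H
  exact P.assoc_seq i j e f e' f' hab habc hbc habc' h₁ h₂ h₃ x y z

theorem comp_par {m n l p q r : ℕ} {a b c ab ac t : ℤ} {i j : Fin m} {i' : Fin r} {j' : Fin p}
    {e : Graft m n p i} {f : Graft p l q j'} {e' : Graft m l r j} {f' : Graft r n q i'}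
    (H : ParCompat i j i' j' e f e' f') (hab : a + b = ab) (habc : ab + c = t) (hac : a + c = ac)
    (hacb : ac + b = t) (x : P.obj m a) (y : P.obj n b) (z : P.obj l c) :
    P.comp j' f habc (P.comp i e hab x y) z =
      koszulSign k (b * c) • P.comp i' f' hacb (P.comp j e' hac x z) y := by
  obtain ⟨hij, rfl, rfl, h₁, h₂, h₃⟩ := H
  exact P.assoc_par i j hij hij.symm e f e' f' hab habc hac hacb h₁ h₂ h₃ x y z

theorem comp_perm {m n p : ℕ} {a b c : ℤ} {i i' : Fin m} {σ : Equiv.Perm (Fin m)}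
    {τ : Equiv.Perm (Fin n)} {ρ : Equiv.Perm (Fin p)} {e : Graft m n p i} {e' : Graft m n p i'}
    (H : ActCompat i i' σ τ ρ e e') (h : a + b = c) (x : P.obj m a) (y : P.obj n b) :
    P.comp i' e' h (P.act σ x) (P.act τ y) = P.act ρ (P.comp i e h x y) := by
  obtain ⟨rfl, h₁, h₂⟩ := H
  exact P.comp_act i h σ τ ρ e e' h₁ h₂ x y

end GradedOperad

namespace Graft

/-- A labelling of the composition of an `m`-ary and an `n`-ary operation. -/
noncomputable def std {m : ℕ} (n : ℕ) (i : Fin m) :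
    Graft m n (Fintype.card ({j : Fin m // j ≠ i} ⊕ Fin n)) i :=
  Fintype.equivFin _

variable {m n l p q r : ℕ}

theorem inl_ne_inr {i : Fin m} (e : Graft m n p i) (s : {j : Fin m // j ≠ i}) (t : Fin n) :
    e (Sum.inl s) ≠ e (Sum.inr t) := fun h => by simpa using e.injective h

theorem cases {i : Fin m} (e : Graft m n p i) (t : Fin p) :
    (∃ (s : Fin m) (hs : s ≠ i), e (Sum.inl ⟨s, hs⟩) = t) ∨ ∃ s, e (Sum.inr s) = t := by
  rcases h : e.symm t with s | s
  · exact Or.inl ⟨s.1, s.2, by rw [Equiv.symm_apply_eq] at h; exact h.symm⟩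
  · exact Or.inr ⟨s, by rw [Equiv.symm_apply_eq] at h; exact h.symm⟩

/-- The inputs of `x ∘ᵢ y` other than the input `j` of `y`. -/
def neInr {i : Fin m} (e : Graft m n p i) (j : Fin n) :
    {t : Fin p // t ≠ e (Sum.inr j)} ≃ {s : Fin m // s ≠ i} ⊕ {s : Fin n // s ≠ j} where
  toFun t := match h : e.symm t.1 with
    | Sum.inl s => Sum.inl s
    | Sum.inr s => Sum.inr ⟨s, fun hs => t.2 (by rw [Equiv.symm_apply_eq] at h; rw [h, hs])⟩
  invFun := Sum.elim (fun s => ⟨e (Sum.inl s), inl_ne_inr _ _ _⟩)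
    (fun s => ⟨e (Sum.inr s.1), fun h => s.2 (Sum.inr_injective (e.injective h))⟩)
  left_inv t := by
    apply Subtype.ext
    dsimp only
    split
    · next s h => rw [Equiv.symm_apply_eq] at h; exact h.symm
    · next s h => rw [Equiv.symm_apply_eq] at h; exact h.symm
  right_inv s := by
    rcases s with s | s
    · dsimp only [Sum.elim_inl]
      split
      · next s' h =>
        rw [Equiv.symm_apply_apply] at h
        exact congrArg Sum.inl (Sum.inl_injective h).symm
      · next s' h => rw [Equiv.symm_apply_apply] at h; simp at h
    · dsimp only [Sum.elim_inr]
      split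
      · next s' h => rw [Equiv.symm_apply_apply] at h; simp at h
      · next s' h =>
        rw [Equiv.symm_apply_apply] at h
        exact congrArg Sum.inr (Subtype.ext (Sum.inr_injective h).symm)

/-- The inputs of `x ∘ᵢ y` other than the input `j` of `x`. -/
def neInl {i : Fin m} (e : Graft m n p i) (j : {j : Fin m // j ≠ i}) :
    {t : Fin p // t ≠ e (Sum.inl j)} ≃ {s : Fin m // s ≠ i ∧ s ≠ j.1} ⊕ Fin n where
  toFun t := match h : e.symm t.1 with
    | Sum.inl s => Sum.inl ⟨s.1, s.2, fun hs => t.2 (by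
        rw [Equiv.symm_apply_eq] at h; rw [h, Subtype.ext hs])⟩
    | Sum.inr s => Sum.inr s
  invFun := Sum.elim (fun s => ⟨e (Sum.inl ⟨s.1, s.2.1⟩), fun h => s.2.2
    (congrArg Subtype.val (Sum.inl_injective (e.injective h)))⟩)
    (fun s => ⟨e (Sum.inr s), (inl_ne_inr _ _ _).symm⟩)
  left_inv t := by
    apply Subtype.ext
    dsimp only
    split
    · next s h => rw [Equiv.symm_apply_eq] at h; exact h.symm
    · next s h => rw [Equiv.symm_apply_eq] at h; exact h.symm
  right_inv s := by
    rcases s with s | s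
    · dsimp only [Sum.elim_inl]
      split
      · next s' h =>
        rw [Equiv.symm_apply_apply] at h
        exact congrArg Sum.inl (Subtype.ext (congrArg Subtype.val (Sum.inl_injective h)).symm)
      · next s' h => rw [Equiv.symm_apply_apply] at h; simp at h
    · dsimp only [Sum.elim_inr]
      split
      · next s' h => rw [Equiv.symm_apply_apply] at h; simp at h
      · next s' h =>
        rw [Equiv.symm_apply_apply] at h
        exact congrArg Sum.inr (Sum.inr_injective h).symm

/-- Three labellings of a sequential composition determine the fourth. -/
theorem exists_seq_left {i : Fin m} {j : Fin n} (e : Graft m n p i) (e' : Graft n l r j)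
    (f' : Graft m r q i) :
    ∃ f : Graft p l q (e (Sum.inr j)), SeqCompat i j _ e f e' f' := by
  refine ⟨(Equiv.sumCongr (e.neInr j) (Equiv.refl _)).trans ((Equiv.sumAssoc _ _ _).trans
    ((Equiv.sumCongr (Equiv.refl _) e').trans f')), rfl, fun s hs hs' => ?_, fun s hs hs' => ?_,
    fun s => rfl⟩
  · have h1 : e.neInr j ⟨e (Sum.inl ⟨s, hs⟩), hs'⟩ = Sum.inl ⟨s, hs⟩ := by
      rw [← Equiv.eq_symm_apply]; rfl
    simp [h1]
  · have h1 : e.neInr j ⟨e (Sum.inr s), hs'⟩ = Sum.inr ⟨s, hs⟩ := by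
      rw [← Equiv.eq_symm_apply]; rfl
    simp [h1]

theorem exists_seq_right {i : Fin m} {j : Fin n} {j' : Fin p} (e : Graft m n p i)
    (f : Graft p l q j') (e' : Graft n l r j) (hj : e (Sum.inr j) = j') :
    ∃ f' : Graft m r q i, SeqCompat i j j' e f e' f' := by
  subst hj
  refine ⟨(Equiv.sumCongr (Equiv.refl _) e'.symm).trans ((Equiv.sumAssoc _ _ _).symm.trans
    ((Equiv.sumCongr (e.neInr j).symm (Equiv.refl _)).trans f)), rfl, fun s hs hs' => rfl,
    fun s hs hs' => ?_, fun s => ?_⟩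
  · simp [neInr]
  · simp

theorem exists_par {i j : Fin m} {j' : Fin p} (hij : j ≠ i) (e : Graft m n p i)
    (f : Graft p l q j') (e' : Graft m l r j) (hj : e (Sum.inl ⟨j, hij⟩) = j') :
    ∃ f' : Graft r n q (e' (Sum.inl ⟨i, hij.symm⟩)), ParCompat i j _ j' e f e' f' := by
  subst hj
  let E : ({s : Fin m // s ≠ j ∧ s ≠ i} ⊕ Fin l) ⊕ Fin n ≃
      ({s : Fin m // s ≠ i ∧ s ≠ j} ⊕ Fin n) ⊕ Fin l :=
    (Equiv.sumCongr (Equiv.sumCongr (Equiv.subtypeEquivRight fun s => and_comm) (Equiv.refl _))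
      (Equiv.refl _)).trans ((Equiv.sumAssoc _ _ _).trans
      ((Equiv.sumCongr (Equiv.refl _) (Equiv.sumComm _ _)).trans (Equiv.sumAssoc _ _ _).symm))
  have E1 : ∀ s hs hs', E (Sum.inl (Sum.inl ⟨s, hs', hs⟩)) = Sum.inl (Sum.inl ⟨s, hs, hs'⟩) :=
    fun _ _ _ => rfl
  have E2 : ∀ s, E (Sum.inr s) = Sum.inl (Sum.inr s) := fun _ => rfl
  have E3 : ∀ s, E (Sum.inl (Sum.inr s)) = Sum.inr s := fun _ => rfl
  clear_value E
  refine ⟨(Equiv.sumCongr (e'.neInl ⟨i, hij.symm⟩) (Equiv.refl _)).trans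
    (E.trans ((Equiv.sumCongr (e.neInl ⟨j, hij⟩).symm (Equiv.refl _)).trans f)), hij.symm, rfl,
    rfl, fun s hs hs' hs₁ hs₂ => ?_, fun s hs => ?_, fun s hs => ?_⟩
  · have h1 : e'.neInl ⟨i, hij.symm⟩ ⟨e' (Sum.inl ⟨s, hs'⟩), hs₂⟩ = Sum.inl ⟨s, hs', hs⟩ := by
      rw [← Equiv.eq_symm_apply]; rfl
    simp only [Equiv.trans_apply, Equiv.sumCongr_apply, Sum.map_inl, h1]
    exact (congrArg (fun t => f (Sum.map (e.neInl ⟨j, hij⟩).symm (Equiv.refl _) t))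
      (E1 s hs hs')).symm
  · simp only [Equiv.trans_apply, Equiv.sumCongr_apply, Sum.map_inr, Equiv.refl_apply, E2,
      Sum.map_inl]
    rfl
  · have h1 : e'.neInl ⟨i, hij.symm⟩ ⟨e' (Sum.inr s), hs⟩ = Sum.inr s := by
      rw [← Equiv.eq_symm_apply]; rfl
    simp only [Equiv.trans_apply, Equiv.sumCongr_apply, Sum.map_inl, h1, E3, Sum.map_inr,
      Equiv.refl_apply]

end Graft

/-! ### Infinitesimal bimodules, square-zero extensions and derivations -/

/-- An infinitesimal bimodule over a graded operad `T`: a graded symmetric sequence `M` with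
compositions `x ∘ᵢ μ` (`lcomp`) and `μ ∘ᵢ x` (`rcomp`) for `x` in `T` and `μ` in `M`, such that
`T ⊕ M` satisfies the axioms of an operad up to terms that are quadratic in `M`. -/
structure InfBimodule {k : Type u} [Field k] (T : GradedOperad k) where
  obj : ℕ → ℤ → Type u
  [addCommGroup : ∀ n a, AddCommGroup (obj n a)]
  [module : ∀ n a, Module k (obj n a)]
  act {n : ℕ} {a : ℤ} (σ : Equiv.Perm (Fin n)) : obj n a →ₗ[k] obj n a
  lcomp {m n p : ℕ} {a b c : ℤ} (i : Fin m) (e : Graft m n p i) (h : a + b = c) :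
    T.obj m a →ₗ[k] obj n b →ₗ[k] obj p c
  rcomp {m n p : ℕ} {a b c : ℤ} (i : Fin m) (e : Graft m n p i) (h : a + b = c) :
    obj m a →ₗ[k] T.obj n b →ₗ[k] obj p c
  act_one {n : ℕ} {a : ℤ} (x : obj n a) : act 1 x = x
  act_mul {n : ℕ} {a : ℤ} (σ τ : Equiv.Perm (Fin n)) (x : obj n a) :
    act (σ * τ) x = act σ (act τ x)
  lcomp_perm {m n p : ℕ} {a b c : ℤ} {i i' : Fin m} {σ : Equiv.Perm (Fin m)}
    {τ : Equiv.Perm (Fin n)} {ρ : Equiv.Perm (Fin p)} {e : Graft m n p i} {e' : Graft m n p i'}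
    (H : ActCompat i i' σ τ ρ e e') (h : a + b = c) (x : T.obj m a) (μ : obj n b) :
    lcomp i' e' h (T.act σ x) (act τ μ) = act ρ (lcomp i e h x μ)
  rcomp_perm {m n p : ℕ} {a b c : ℤ} {i i' : Fin m} {σ : Equiv.Perm (Fin m)}
    {τ : Equiv.Perm (Fin n)} {ρ : Equiv.Perm (Fin p)} {e : Graft m n p i} {e' : Graft m n p i'}
    (H : ActCompat i i' σ τ ρ e e') (h : a + b = c) (μ : obj m a) (y : T.obj n b) :
    rcomp i' e' h (act σ μ) (T.act τ y) = act ρ (rcomp i e h μ y)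
  id_lcomp {n : ℕ} {b : ℤ} (i : Fin 1) (e : Graft 1 n n i) (h : 0 + b = b)
    (he : ∀ j, e (Sum.inr j) = j) (μ : obj n b) : lcomp i e h T.id μ = μ
  rcomp_id {m : ℕ} {a : ℤ} (i : Fin m) (e : Graft m 1 m i) (h : a + 0 = a)
    (he : ∀ (j : Fin m) (hj : j ≠ i), e (Sum.inl ⟨j, hj⟩) = j) (he' : e (Sum.inr 0) = i)
    (μ : obj m a) : rcomp i e h μ T.id = μ
  seq_llr {m n l p q r : ℕ} {a b c ab bc t : ℤ} {i : Fin m} {j : Fin n} {j' : Fin p}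
    {e : Graft m n p i} {f : Graft p l q j'} {e' : Graft n l r j} {f' : Graft m r q i}
    (H : SeqCompat i j j' e f e' f') (hab : a + b = ab) (habc : ab + c = t) (hbc : b + c = bc)
    (habc' : a + bc = t) (x : T.obj m a) (y : T.obj n b) (μ : obj l c) :
    lcomp j' f habc (T.comp i e hab x y) μ = lcomp i f' habc' x (lcomp j e' hbc y μ)
  seq_lr {m n l p q r : ℕ} {a b c ab bc t : ℤ} {i : Fin m} {j : Fin n} {j' : Fin p}
    {e : Graft m n p i} {f : Graft p l q j'} {e' : Graft n l r j} {f' : Graft m r q i}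
    (H : SeqCompat i j j' e f e' f') (hab : a + b = ab) (habc : ab + c = t) (hbc : b + c = bc)
    (habc' : a + bc = t) (x : T.obj m a) (μ : obj n b) (z : T.obj l c) :
    rcomp j' f habc (lcomp i e hab x μ) z = lcomp i f' habc' x (rcomp j e' hbc μ z)
  seq_rr {m n l p q r : ℕ} {a b c ab bc t : ℤ} {i : Fin m} {j : Fin n} {j' : Fin p}
    {e : Graft m n p i} {f : Graft p l q j'} {e' : Graft n l r j} {f' : Graft m r q i}
    (H : SeqCompat i j j' e f e' f') (hab : a + b = ab) (habc : ab + c = t) (hbc : b + c = bc)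
    (habc' : a + bc = t) (μ : obj m a) (y : T.obj n b) (z : T.obj l c) :
    rcomp j' f habc (rcomp i e hab μ y) z = rcomp i f' habc' μ (T.comp j e' hbc y z)
  par_rr {m n l p q r : ℕ} {a b c ab ac t : ℤ} {i j : Fin m} {i' : Fin r} {j' : Fin p}
    {e : Graft m n p i} {f : Graft p l q j'} {e' : Graft m l r j} {f' : Graft r n q i'}
    (H : ParCompat i j i' j' e f e' f') (hab : a + b = ab) (habc : ab + c = t) (hac : a + c = ac)
    (hacb : ac + b = t) (μ : obj m a) (y : T.obj n b) (z : T.obj l c) :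
    rcomp j' f habc (rcomp i e hab μ y) z =
      koszulSign k (b * c) • rcomp i' f' hacb (rcomp j e' hac μ z) y
  par_lr {m n l p q r : ℕ} {a b c ab ac t : ℤ} {i j : Fin m} {i' : Fin r} {j' : Fin p}
    {e : Graft m n p i} {f : Graft p l q j'} {e' : Graft m l r j} {f' : Graft r n q i'}
    (H : ParCompat i j i' j' e f e' f') (hab : a + b = ab) (habc : ab + c = t) (hac : a + c = ac)
    (hacb : ac + b = t) (x : T.obj m a) (μ : obj n b) (z : T.obj l c) :
    rcomp j' f habc (lcomp i e hab x μ) z =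
      koszulSign k (b * c) • lcomp i' f' hacb (T.comp j e' hac x z) μ

attribute [instance] InfBimodule.addCommGroup InfBimodule.module

/-- Morphisms of graded operads. -/
structure GradedOperad.Hom {k : Type u} [Field k] (P S : GradedOperad k) where
  map {n : ℕ} {a : ℤ} : P.obj n a →ₗ[k] S.obj n a
  map_id : map P.id = S.id
  map_act {n : ℕ} {a : ℤ} (σ : Equiv.Perm (Fin n)) (x : P.obj n a) :
    map (P.act σ x) = S.act σ (map x)
  map_comp {m n p : ℕ} {a b c : ℤ} (i : Fin m) (e : Graft m n p i) (h : a + b = c)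
    (x : P.obj m a) (y : P.obj n b) :
    map (P.comp i e h x y) = S.comp i e h (map x) (map y)

theorem GradedOperad.Hom.map_mul {k : Type u} [Field k] {P S : GradedOperad k}
    (f : GradedOperad.Hom P S) {a b c : ℤ} (h : a + b = c) (x : P.obj 1 a) (y : P.obj 1 b) :
    f.map (P.mul h x y) = S.mul h (f.map x) (f.map y) := f.map_comp _ _ _ _ _

/-- The underlying morphism of graded operads of a morphism of dg-operads. -/
def DGOperad.Hom.toGraded {k : Type u} [Field k] {P S : DGOperad k} (f : DGOperad.Hom P S) :
    GradedOperad.Hom P.toGradedOperad S.toGradedOperad :=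
  ⟨f.map, f.map_id, f.map_act, f.map_comp⟩

/-- A derivation of a graded operad with values in an infinitesimal bimodule. -/
structure OperadDerivation {k : Type u} [Field k] {T : GradedOperad k} (M : InfBimodule T) where
  map {n : ℕ} {a : ℤ} : T.obj n a →ₗ[k] M.obj n a
  map_act {n : ℕ} {a : ℤ} (σ : Equiv.Perm (Fin n)) (x : T.obj n a) :
    map (T.act σ x) = M.act σ (map x)
  map_comp {m n p : ℕ} {a b c : ℤ} (i : Fin m) (e : Graft m n p i) (h : a + b = c)
    (x : T.obj m a) (y : T.obj n b) :
    map (T.comp i e h x y) = M.rcomp i e h (map x) y + M.lcomp i e h x (map y)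

namespace InfBimodule

variable {k : Type u} [Field k] {T : GradedOperad k} (M : InfBimodule T)

/-- The square-zero extension `T ⊕ M`. -/
def sqZero : GradedOperad k where
  obj n a := T.obj n a × M.obj n a
  id := (T.id, 0)
  act σ := (T.act σ).prodMap (M.act σ)
  comp i e h := LinearMap.mk₂ k
    (fun x y => (T.comp i e h x.1 y.1, M.rcomp i e h x.2 y.1 + M.lcomp i e h x.1 y.2))
    (fun x x' y => Prod.ext (by simp) (by simp; abel))
    (fun s x y => Prod.ext (by simp) (by simp))
    (fun x y y' => Prod.ext (by simp) (by simp; abel))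
    (fun s x y => Prod.ext (by simp) (by simp))
  act_one x := Prod.ext (T.act_one _) (M.act_one _)
  act_mul σ τ x := Prod.ext (T.act_mul _ _ _) (M.act_mul _ _ _)
  comp_act i h σ τ ρ e e' he he' x y := by
    have H : ActCompat i _ σ τ ρ e e' := ⟨rfl, he, he'⟩
    refine Prod.ext (T.comp_perm H h _ _) ?_
    simp [LinearMap.mk₂_apply, M.rcomp_perm H, M.lcomp_perm H]
  id_comp i e h he y := Prod.ext (T.id_comp i e h he _) (by
    simp [LinearMap.mk₂_apply, M.id_lcomp i e h he])
  comp_id i e h he he' x := Prod.ext (T.comp_id i e h he he' _) (by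
    simp [LinearMap.mk₂_apply, M.rcomp_id i e h he he'])
  assoc_seq i j e f e' f' hab habc hbc habc' h₁ h₂ h₃ x y z := by
    have H : SeqCompat i j _ e f e' f' := ⟨rfl, h₁, h₂, h₃⟩
    refine Prod.ext (T.comp_seq H hab habc hbc habc' _ _ _) ?_
    simp only [LinearMap.mk₂_apply, map_add, LinearMap.add_apply,
      M.seq_rr H hab habc hbc habc', M.seq_lr H hab habc hbc habc',
      M.seq_llr H hab habc hbc habc']
    abel
  assoc_par i j hij hji e f e' f' hab habc hac hacb h₁ h₂ h₃ x y z := by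
    have H : ParCompat i j _ _ e f e' f' := ⟨hij, rfl, rfl, h₁, h₂, h₃⟩
    refine Prod.ext (T.comp_par H hab habc hac hacb _ _ _) ?_
    simp only [LinearMap.mk₂_apply, map_add, LinearMap.add_apply, Prod.smul_snd, smul_add,
      M.par_rr H hab habc hac hacb, M.par_lr H hab habc hac hacb,
      M.par_lr H.symm hac hacb hab habc]
    rw [smul_smul, mul_comm _ (koszulSign k (_ * _)), mul_comm (_ : ℤ) (_ : ℤ),
      koszulSign_mul_self, one_smul]
    abel

theorem sqZero_comp_snd {m n p : ℕ} {a b c : ℤ} (i : Fin m) (e : Graft m n p i) (h : a + b = c)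
    (x : M.sqZero.obj m a) (y : M.sqZero.obj n b) :
    (M.sqZero.comp i e h x y).2 = M.rcomp i e h x.2 y.1 + M.lcomp i e h x.1 y.2 := rfl

/-- A section of the square-zero extension is a derivation. -/
def derivationOfHom (f : GradedOperad.Hom T M.sqZero)
    (hf : ∀ {n : ℕ} {a : ℤ} (x : T.obj n a), (f.map x).1 = x) : OperadDerivation M where
  map := LinearMap.snd k _ _ ∘ₗ f.map
  map_act σ x := congrArg Prod.snd (f.map_act σ x)
  map_comp i e h x y := by
    have h1 := congrArg Prod.snd (f.map_comp i e h x y)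
    rw [sqZero_comp_snd, hf, hf] at h1
    exact h1

end InfBimodule

section Shift

variable {k : Type u} [Field k] (T : GradedOperad k)

/-- The bimodule `T` with degrees lowered by `1`, and with the sign `(-1)^|x|` in the left action
of `x`; its derivations are the derivations of `T` of degree `1`. -/
def GradedOperad.shift : InfBimodule T where
  obj n a := T.obj n (a + 1)
  act σ := T.act σ
  lcomp {_ _ _ a _ _} i e h := koszulSign k a • T.comp i e (by lia)
  rcomp i e h := T.comp i e (by lia)
  act_one x := T.act_one x
  act_mul σ τ x := T.act_mul σ τ x
  lcomp_perm H h x μ := by simp [T.comp_perm H]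
  rcomp_perm H h μ y := T.comp_perm H _ _ _
  id_lcomp i e h he μ := by
    simp only [koszulSign_even k (show Even (0 : ℤ) by decide), one_smul]
    exact T.id_comp i e _ he μ
  rcomp_id {_ a} i e h he he' μ := by
    have := T.comp_id i e (add_zero (a + 1)) he he' μ
    exact this
  seq_llr {_ _ _ _ _ _ a b c ab bc t _ _ _ _ _ _ _} H hab habc hbc habc' x y μ := by
    simp only [LinearMap.smul_apply, map_smul]
    rw [T.comp_seq H hab (by lia) (show b + (c + 1) = bc + 1 by lia) (by lia), smul_smul,
      ← koszulSign_add, add_comm b a, hab]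
  seq_lr {_ _ _ _ _ _ a b c ab bc t _ _ _ _ _ _ _} H hab habc hbc habc' x μ z := by
    simp only [LinearMap.smul_apply, map_smul]
    rw [T.comp_seq H _ _ (show (b + 1) + c = bc + 1 by lia) (by lia)]
  seq_rr H hab habc hbc habc' μ y z := T.comp_seq H _ _ hbc _ _ _ _
  par_rr H hab habc hac hacb μ y z := T.comp_par H _ _ _ _ _ _ _
  par_lr {_ _ _ _ _ _ a b c ab ac t _ _ _ _ _ _ _ _} H hab habc hac hacb x μ z := by
    simp only [LinearMap.smul_apply, map_smul]
    rw [T.comp_par H _ _ hac (by lia), smul_smul, smul_smul]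
    congr 1
    rw [← koszulSign_add, ← koszulSign_add, ← hac]
    congr 1
    ring

end Shift

/-! ### The free infinitesimal bimodule on unary generators -/

namespace Graft

variable {m n p q : ℕ}

/-- The labelling of `x ∘ᵢ u`, for a unary operation `u`, by the inputs of `x`. -/
def unit (i : Fin m) : Graft m 1 m i where
  toFun := Sum.elim (fun s => s.1) (fun _ => i)
  invFun t := if h : t ≠ i then Sum.inl ⟨t, h⟩ else Sum.inr 0
  left_inv := by
    rintro (⟨s, hs⟩ | s)
    · simp [hs]
    · simpa using Subsingleton.elim _ _
  right_inv t := by by_cases h : t = i <;> simp [h]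

/-- The labelling of `u ∘ y`, for a unary operation `u`, by the inputs of `y`. -/
def unit' (n : ℕ) : Graft 1 n n 0 where
  toFun := Sum.elim (fun s => absurd (Subsingleton.elim s.1 0) s.2) id
  invFun := Sum.inr
  left_inv := by
    rintro (⟨s, hs⟩ | s)
    · exact absurd (Subsingleton.elim s 0) hs
    · rfl
  right_inv _ := rfl

theorem card_unique {i : Fin m} (e : Graft m n p i) (e' : Graft m n q i) : p = q := by
  simpa using Fintype.card_congr (e.symm.trans e')

theorem exists_perm {i i' : Fin m} (σ : Equiv.Perm (Fin m)) (τ : Equiv.Perm (Fin n))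
    (hσ : σ i = i') (e : Graft m n p i) (e' : Graft m n p i') :
    ∃ ρ, ActCompat i i' σ τ ρ e e' := by
  subst hσ
  refine ⟨e.symm.trans ((Equiv.sumCongr (σ.subtypeEquiv fun s => by simp) τ).trans e'), rfl,
    fun j hj hj' => ?_, fun j => ?_⟩ <;> simp

end Graft

variable {k : Type u} [Field k]

/-- The expressions `x ∘ᵢ [r] ∘ y`, for a unary generator `[r]` of degree `-2r`. -/
structure FreeInfGen (T : GradedOperad k) (n : ℕ) (a : ℤ) : Type u where
  {m l : ℕ}
  {b c : ℤ}
  r : ℕ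
  i : Fin m
  e : Graft m l n i
  h : b + c = a + 2 * (r : ℤ)
  x : T.obj m b
  y : T.obj l c

/-- The relations between the expressions `x ∘ᵢ [r] ∘ y`: bilinearity, and independence of the
numbering of the inputs of `x` and `y`. -/
inductive FreeInfRel (T : GradedOperad k) {n : ℕ} {a : ℤ} : (FreeInfGen T n a →₀ k) → Prop
  | add_left {m l : ℕ} {b c : ℤ} (r : ℕ) (i : Fin m) (e : Graft m l n i)
      (h : b + c = a + 2 * (r : ℤ)) (x x' : T.obj m b) (y : T.obj l c) :
      FreeInfRel T (Finsupp.single ⟨r, i, e, h, x + x', y⟩ 1 -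
        (Finsupp.single ⟨r, i, e, h, x, y⟩ 1 + Finsupp.single ⟨r, i, e, h, x', y⟩ 1))
  | smul_left {m l : ℕ} {b c : ℤ} (r : ℕ) (i : Fin m) (e : Graft m l n i)
      (h : b + c = a + 2 * (r : ℤ)) (s : k) (x : T.obj m b) (y : T.obj l c) :
      FreeInfRel T (Finsupp.single ⟨r, i, e, h, s • x, y⟩ 1 -
        s • Finsupp.single ⟨r, i, e, h, x, y⟩ 1)
  | add_right {m l : ℕ} {b c : ℤ} (r : ℕ) (i : Fin m) (e : Graft m l n i)
      (h : b + c = a + 2 * (r : ℤ)) (x : T.obj m b) (y y' : T.obj l c) :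
      FreeInfRel T (Finsupp.single ⟨r, i, e, h, x, y + y'⟩ 1 -
        (Finsupp.single ⟨r, i, e, h, x, y⟩ 1 + Finsupp.single ⟨r, i, e, h, x, y'⟩ 1))
  | smul_right {m l : ℕ} {b c : ℤ} (r : ℕ) (i : Fin m) (e : Graft m l n i)
      (h : b + c = a + 2 * (r : ℤ)) (s : k) (x : T.obj m b) (y : T.obj l c) :
      FreeInfRel T (Finsupp.single ⟨r, i, e, h, x, s • y⟩ 1 -
        s • Finsupp.single ⟨r, i, e, h, x, y⟩ 1)
  | perm {m l : ℕ} {b c : ℤ} (r : ℕ) {i i' : Fin m} {e : Graft m l n i} {e' : Graft m l n i'}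
      {σ : Equiv.Perm (Fin m)} {τ : Equiv.Perm (Fin l)} (H : ActCompat i i' σ τ 1 e e')
      (h : b + c = a + 2 * (r : ℤ)) (x : T.obj m b) (y : T.obj l c) :
      FreeInfRel T (Finsupp.single ⟨r, i', e', h, T.act σ x, T.act τ y⟩ 1 -
        Finsupp.single ⟨r, i, e, h, x, y⟩ 1)

/-- The underlying symmetric sequence of the free infinitesimal bimodule over `T` on unary
generators `[r]`, `r ≥ 0`, of degree `-2r`: it is spanned by the operations `x ∘ᵢ [r] ∘ y`. -/
def FreeInf (T : GradedOperad k) (n : ℕ) (a : ℤ) : Type u :=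
  (FreeInfGen T n a →₀ k) ⧸ Submodule.span k {w | FreeInfRel T w}

namespace FreeInf

variable {T S : GradedOperad k} {m l n p : ℕ} {a b c : ℤ}

noncomputable instance : AddCommGroup (FreeInf T n a) := Submodule.Quotient.addCommGroup _

noncomputable instance : Module k (FreeInf T n a) := Submodule.Quotient.module _

theorem rel {w w' : FreeInfGen T n a →₀ k} (h : FreeInfRel T (w - w')) :
    (Submodule.Quotient.mk w : FreeInf T n a) = Submodule.Quotient.mk w' :=
  (Submodule.Quotient.eq _).mpr (Submodule.subset_span h)

/-- The operation `x ∘ᵢ [r] ∘ y`, with inputs labelled by `e`. -/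
noncomputable def mk (r : ℕ) (i : Fin m) (e : Graft m l n i) (h : b + c = a + 2 * (r : ℤ)) :
    T.obj m b →ₗ[k] T.obj l c →ₗ[k] FreeInf T n a :=
  LinearMap.mk₂ k (fun x y => Submodule.Quotient.mk (Finsupp.single ⟨r, i, e, h, x, y⟩ 1))
    (fun x x' y => rel (.add_left r i e h x x' y)) (fun s x y => rel (.smul_left r i e h s x y))
    (fun x y y' => rel (.add_right r i e h x y y')) (fun s x y => rel (.smul_right r i e h s x y))

theorem mk_perm_one (r : ℕ) {i i' : Fin m} {e : Graft m l n i} {e' : Graft m l n i'}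
    {σ : Equiv.Perm (Fin m)} {τ : Equiv.Perm (Fin l)} (H : ActCompat i i' σ τ 1 e e')
    (h : b + c = a + 2 * (r : ℤ)) (x : T.obj m b) (y : T.obj l c) :
    mk r i' e' h (T.act σ x) (T.act τ y) = mk r i e h x y := rel (.perm r H h x y)

theorem induction {P : FreeInf T n a → Prop} (zero : P 0) (add : ∀ w w', P w → P w' → P (w + w'))
    (mk : ∀ {m l : ℕ} {b c : ℤ} (r : ℕ) (i : Fin m) (e : Graft m l n i)
      (h : b + c = a + 2 * (r : ℤ)) (x : T.obj m b) (y : T.obj l c), P (mk r i e h x y))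
    (w : FreeInf T n a) : P w := by
  obtain ⟨w, rfl⟩ := Submodule.Quotient.mk_surjective _ w
  induction w using Finsupp.induction_linear with
  | zero => exact zero
  | add w w' h h' => exact add _ _ h h'
  | single g s =>
    obtain ⟨r, i, e, h, x, y⟩ := g
    have h1 := mk r i e h (s • x) y
    rw [map_smul, LinearMap.smul_apply] at h1
    have h2 : (Submodule.Quotient.mk (Finsupp.single ⟨r, i, e, h, x, y⟩ s) : FreeInf T n a) =
        s • FreeInf.mk r i e h x y := by
      change _ = Submodule.Quotient.mk (s • Finsupp.single _ 1)
      rw [Finsupp.smul_single, smul_eq_mul, mul_one]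
    exact h2 ▸ h1

theorem hom_ext {V : Type*} [AddCommGroup V] [Module k V] {f g : FreeInf T n a →ₗ[k] V}
    (H : ∀ {m l : ℕ} {b c : ℤ} (r : ℕ) (i : Fin m) (e : Graft m l n i)
      (h : b + c = a + 2 * (r : ℤ)) (x : T.obj m b) (y : T.obj l c),
      f (mk r i e h x y) = g (mk r i e h x y)) (w : FreeInf T n a) : f w = g w :=
  induction (P := fun w => f w = g w) (by simp) (fun w w' h h' => by simp [h, h'])
    (fun r i e h x y => H r i e h x y) w

/-- The linear map defined by a bilinear family that is independent of the numbering of the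
inputs. -/
noncomputable def lift {V : Type*} [AddCommGroup V] [Module k V]
    (F : ∀ {m l : ℕ} {b c : ℤ} (r : ℕ) (i : Fin m) (_ : Graft m l n i)
      (_ : b + c = a + 2 * (r : ℤ)), T.obj m b →ₗ[k] T.obj l c →ₗ[k] V)
    (hF : ∀ {m l : ℕ} {b c : ℤ} (r : ℕ) {i i' : Fin m} {e : Graft m l n i} {e' : Graft m l n i'}
      {σ : Equiv.Perm (Fin m)} {τ : Equiv.Perm (Fin l)} (_ : ActCompat i i' σ τ 1 e e')
      (h : b + c = a + 2 * (r : ℤ)) (x : T.obj m b) (y : T.obj l c),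
      F r i' e' h (T.act σ x) (T.act τ y) = F r i e h x y) : FreeInf T n a →ₗ[k] V :=
  Submodule.liftQ _ (Finsupp.lift V k (FreeInfGen T n a) fun g => F g.r g.i g.e g.h g.x g.y) (by
    rw [Submodule.span_le]
    intro w hw
    have hw : FreeInfRel T w := hw
    rw [SetLike.mem_coe, LinearMap.mem_ker]
    have key : ∀ g : FreeInfGen T n a, Finsupp.lift V k (FreeInfGen T n a)
        (fun g => F g.r g.i g.e g.h g.x g.y) (Finsupp.single g 1) = F g.r g.i g.e g.h g.x g.y :=
      fun g => by simp
    cases hw with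
    | add_left r i e h x x' y => rw [map_sub, map_add, key, key, key]; simp
    | smul_left r i e h s x y => rw [map_sub, map_smul, key, key]; simp
    | add_right r i e h x y y' => rw [map_sub, map_add, key, key, key]; simp
    | smul_right r i e h s x y => rw [map_sub, map_smul, key, key]; simp
    | perm r H h x y => rw [map_sub, key, key, hF r H h x y, sub_self])

theorem lift_mk {V : Type*} [AddCommGroup V] [Module k V]
    (F : ∀ {m l : ℕ} {b c : ℤ} (r : ℕ) (i : Fin m) (_ : Graft m l n i)
      (_ : b + c = a + 2 * (r : ℤ)), T.obj m b →ₗ[k] T.obj l c →ₗ[k] V) (hF)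
    (r : ℕ) (i : Fin m) (e : Graft m l n i) (h : b + c = a + 2 * (r : ℤ)) (x : T.obj m b)
    (y : T.obj l c) : lift F hF (mk r i e h x y) = F r i e h x y := by
  change Finsupp.lift V k (FreeInfGen T n a) _ (Finsupp.single _ 1) = _
  simp

/-- Renaming of inputs. -/
noncomputable def act (ρ : Equiv.Perm (Fin n)) : FreeInf T n a →ₗ[k] FreeInf T n a :=
  lift (fun r i e h => mk r i (e.trans ρ) h) (by
    intro m l b c r i i' e e' σ τ H h x y
    refine mk_perm_one r ⟨H.base, fun j hj hj' => ?_, fun j => ?_⟩ h x y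
    · simp [H.inl j hj hj']
    · simp [H.inr j])

theorem act_mk (ρ : Equiv.Perm (Fin n)) (r : ℕ) (i : Fin m) (e : Graft m l n i)
    (h : b + c = a + 2 * (r : ℤ)) (x : T.obj m b) (y : T.obj l c) :
    act ρ (mk r i e h x y) = mk r i (e.trans ρ) h x y := lift_mk _ _ _ _ _ _ _ _

theorem mk_perm (r : ℕ) {i i' : Fin m} {e : Graft m l n i} {e' : Graft m l n i'}
    {σ : Equiv.Perm (Fin m)} {τ : Equiv.Perm (Fin l)} {ρ : Equiv.Perm (Fin n)}
    (H : ActCompat i i' σ τ ρ e e')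
    (h : b + c = a + 2 * (r : ℤ)) (x : T.obj m b) (y : T.obj l c) :
    mk r i' e' h (T.act σ x) (T.act τ y) = act ρ (mk r i e h x y) := by
  rw [act_mk]
  exact mk_perm_one r ⟨H.base, fun j hj hj' => by simp [H.inl j hj hj'],
    fun j => by simp [H.inr j]⟩ h x y

end FreeInf

/-- An equivariant family of linear maps of degree `p` between the spaces of operations. The
degree of the target is a variable, constrained by an equation. -/
structure EquivFam (T S : GradedOperad k) (p : ℤ) where
  map {n : ℕ} {a a' : ℤ} (h : a + p = a') : T.obj n a →ₗ[k] S.obj n a'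
  map_act {n : ℕ} {a a' : ℤ} (h : a + p = a') (σ : Equiv.Perm (Fin n)) (x : T.obj n a) :
    map h (T.act σ x) = S.act σ (map h x)

namespace FreeInf

variable {T S : GradedOperad k} {m l n : ℕ} {a b c : ℤ}

/-- The map `x ∘ᵢ [r] ∘ y ↦ (-1)^(q|x|) f x ∘ᵢ [r + j] ∘ g y`, for families `f`, `g` of degrees
`p`, `q`. -/
noncomputable def map₂ {p q : ℤ} (j : ℕ) (f : EquivFam T S p) (g : EquivFam T S q) {a' : ℤ}
    (ha : a + p + q = a' + 2 * (j : ℤ)) : FreeInf T n a →ₗ[k] FreeInf S n a' :=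
  lift (fun {_ _ b _} r i e h => koszulSign k (q * b) •
      (mk (r + j) i e (by push_cast; linear_combination h + ha)).compl₁₂ (f.map rfl)
        (g.map rfl)) (by
    intro m l b c r i i' e e' σ τ H h x y
    simp only [LinearMap.smul_apply, LinearMap.compl₁₂_apply, f.map_act, g.map_act]
    rw [mk_perm_one _ H])

theorem map₂_mk {p q : ℤ} (j : ℕ) (f : EquivFam T S p) (g : EquivFam T S q) {a' : ℤ}
    (ha : a + p + q = a' + 2 * (j : ℤ)) (r : ℕ) (i : Fin m) (e : Graft m l n i)
    (h : b + c = a + 2 * (r : ℤ)) (x : T.obj m b) (y : T.obj l c) {b' c' : ℤ} (hb : b + p = b')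
    (hc : c + q = c') (h' : b' + c' = a' + 2 * ((r + j : ℕ) : ℤ)) :
    map₂ j f g ha (mk r i e h x y) =
      koszulSign k (q * b) • mk (r + j) i e h' (f.map hb x) (g.map hc y) := by
  subst hb hc
  exact lift_mk _ _ _ _ _ _ _ _

theorem map₂_act {p q : ℤ} (j : ℕ) (f : EquivFam T S p) (g : EquivFam T S q) {a' : ℤ}
    (ha : a + p + q = a' + 2 * (j : ℤ)) (ρ : Equiv.Perm (Fin n)) (w : FreeInf T n a) :
    map₂ j f g ha (act ρ w) = act ρ (map₂ j f g ha w) := by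
  refine hom_ext (f := map₂ j f g ha ∘ₗ act ρ) (g := act ρ ∘ₗ map₂ j f g ha) ?_ w
  intro m l b c r i e h x y
  simp only [LinearMap.comp_apply, act_mk]
  rw [map₂_mk j f g ha r i _ h x y rfl rfl (by push_cast; linear_combination h + ha),
    map₂_mk j f g ha r i _ h x y rfl rfl (by push_cast; linear_combination h + ha), map_smul,
    act_mk]

end FreeInf

namespace Graft
variable {m n l p q r : ℕ} {i : Fin m}

/-- The numbering `e` on the inputs of `x`, as a function of natural numbers. -/
def L (e : Graft m n p i) (s : ℕ) : ℕ :=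
  if h : ∃ hs : s < m, (⟨s, hs⟩ : Fin m) ≠ i then e (Sum.inl ⟨⟨s, h.1⟩, h.2⟩) else 0

/-- The numbering `e` on the inputs of `y`, as a function of natural numbers. -/
def R (e : Graft m n p i) (s : ℕ) : ℕ :=
  if h : s < n then e (Sum.inr ⟨s, h⟩) else 0

/-- The inverse of the numbering `e`, as a function of natural numbers. -/
def inv (e : Graft m n p i) (t : ℕ) : ℕ ⊕ ℕ :=
  if h : t < p then (e.symm ⟨t, h⟩).map (fun s => s.1.1) (fun s => s.1) else Sum.inl 0

theorem L_eq (e : Graft m n p i) (s : Fin m) (hs : s ≠ i) :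
    e.L s = e (Sum.inl ⟨s, hs⟩) := by
  have h : ∃ hs : (s : ℕ) < m, (⟨s, hs⟩ : Fin m) ≠ i := ⟨s.2, hs⟩
  rw [L, dif_pos h]

theorem R_eq (e : Graft m n p i) (s : Fin n) : e.R s = e (Sum.inr s) := by simp [R]

theorem inv_L (e : Graft m n p i) (s : ℕ) (h : s < m) (hs : s ≠ i) : e.inv (e.L s) = Sum.inl s := by
  have := e.L_eq ⟨s, h⟩ (fun h => hs (congrArg Fin.val h))
  simp [this, inv]

theorem inv_R (e : Graft m n p i) (s : ℕ) (h : s < n) : e.inv (e.R s) = Sum.inr s := by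
  have := e.R_eq ⟨s, h⟩
  simp [this, inv]

theorem L_lt (e : Graft m n p i) (s : ℕ) (h : s < m) (hs : s ≠ i) : e.L s < p := by
  have := e.L_eq ⟨s, h⟩ (fun h => hs (congrArg Fin.val h))
  simp [this]

theorem R_lt (e : Graft m n p i) (s : ℕ) (h : s < n) : e.R s < p := by
  have := e.R_eq ⟨s, h⟩
  simp [this]

theorem cases_nat (e : Graft m n p i) (t : ℕ) (ht : t < p) :
    (∃ s, s < m ∧ s ≠ i ∧ e.L s = t) ∨ ∃ s, s < n ∧ e.R s = t := by
  rcases e.cases ⟨t, ht⟩ with ⟨s, hs, h⟩ | ⟨s, h⟩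
  · exact Or.inl ⟨s, s.2, fun h => hs (Fin.ext h), by rw [L_eq e s hs, h]⟩
  · exact Or.inr ⟨s, s.2, by rw [R_eq, h]⟩

end Graft

/-- The compatibility on natural numbers: identities between iterated labellings become congruence
problems. -/
theorem seqCompat_iff {m n l p q r : ℕ} {i : Fin m} {j : Fin n} {j' : Fin p}
    {e : Graft m n p i} {f : Graft p l q j'} {e' : Graft n l r j} {f' : Graft m r q i} :
    SeqCompat i j j' e f e' f' ↔ e.R j = j' ∧ (∀ s < m, s ≠ i → f.L (e.L s) = f'.L s) ∧
      (∀ s < n, s ≠ j → f.L (e.R s) = f'.R (e'.L s)) ∧ ∀ s < l, f.R s = f'.R (e'.R s) := by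
  constructor
  · rintro ⟨rfl, h1, h2, h3⟩
    refine ⟨e.R_eq j, fun s hs h => ?_, fun s hs h => ?_, fun s hs => ?_⟩
    · have h' : (⟨s, hs⟩ : Fin m) ≠ i := fun h' => h (congrArg Fin.val h')
      have h4 := h1 ⟨s, hs⟩ h' (Graft.inl_ne_inr _ _ _)
      have h5 := e.L_eq ⟨s, hs⟩ h'
      have h6 := f'.L_eq ⟨s, hs⟩ h'
      simp only at h5 h6
      rw [h5, h6, Graft.L_eq _ _ (Graft.inl_ne_inr _ _ _), h4]
    · have h' : (⟨s, hs⟩ : Fin n) ≠ j := fun h' => h (congrArg Fin.val h')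
      have h'' : e (Sum.inr ⟨s, hs⟩) ≠ e (Sum.inr j) := by simpa using h'
      have h4 := h2 ⟨s, hs⟩ h' h''
      have h5 := e.R_eq ⟨s, hs⟩
      have h6 := e'.L_eq ⟨s, hs⟩ h'
      simp only at h5 h6
      rw [h5, h6, Graft.L_eq _ _ h'', h4, Graft.R_eq]
    · have h5 := f.R_eq ⟨s, hs⟩
      have h6 := e'.R_eq ⟨s, hs⟩
      simp only at h5 h6
      rw [h5, h6, Graft.R_eq, h3]
  · rintro ⟨h0, h1, h2, h3⟩
    obtain rfl : e (Sum.inr j) = j' := Fin.ext (by rw [← h0, Graft.R_eq])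
    refine ⟨rfl, fun s hs hs' => Fin.ext ?_, fun s hs hs' => Fin.ext ?_, fun s => Fin.ext ?_⟩
    · have := h1 s s.2 (fun h => hs (Fin.ext h))
      rwa [e.L_eq s hs, f'.L_eq s hs, f.L_eq _ hs'] at this
    · have := h2 s s.2 (fun h => hs (Fin.ext h))
      rwa [e.R_eq s, e'.L_eq s hs, f.L_eq _ hs', f'.R_eq] at this
    · have := h3 s s.2
      rwa [e'.R_eq s, f.R_eq, f'.R_eq] at this

theorem parCompat_iff {m n l p q r : ℕ} {i j : Fin m} {i' : Fin r} {j' : Fin p}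
    {e : Graft m n p i} {f : Graft p l q j'} {e' : Graft m l r j} {f' : Graft r n q i'} :
    ParCompat i j i' j' e f e' f' ↔ (i : ℕ) ≠ j ∧ e.L j = j' ∧ e'.L i = i' ∧
      (∀ s < m, s ≠ i → s ≠ j → f.L (e.L s) = f'.L (e'.L s)) ∧
      (∀ s < n, f.L (e.R s) = f'.R s) ∧ ∀ s < l, f.R s = f'.L (e'.R s) := by
  have hv : ∀ {m : ℕ} {a b : Fin m}, a ≠ b → (a : ℕ) ≠ b := fun h h' => h (Fin.ext h')
  constructor
  · rintro ⟨hij, rfl, rfl, h1, h2, h3⟩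
    refine ⟨hv hij, e.L_eq j hij.symm, e'.L_eq i hij, fun s hs h h' => ?_, fun s hs => ?_,
      fun s hs => ?_⟩
    · have a1 : (⟨s, hs⟩ : Fin m) ≠ i := fun h' => h (congrArg Fin.val h')
      have a2 : (⟨s, hs⟩ : Fin m) ≠ j := fun h => h' (congrArg Fin.val h)
      have a3 : e (Sum.inl ⟨⟨s, hs⟩, a1⟩) ≠ e (Sum.inl ⟨j, hij.symm⟩) := by simpa using a2
      have a4 : e' (Sum.inl ⟨⟨s, hs⟩, a2⟩) ≠ e' (Sum.inl ⟨i, hij⟩) := by simpa using a1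
      have h4 := h1 ⟨s, hs⟩ a1 a2 a3 a4
      have h5 := e.L_eq ⟨s, hs⟩ a1
      have h6 := e'.L_eq ⟨s, hs⟩ a2
      simp only at h5 h6
      rw [h5, h6, Graft.L_eq _ _ a3, Graft.L_eq _ _ a4, h4]
    · have h4 := h2 ⟨s, hs⟩ (Graft.inl_ne_inr _ _ _).symm
      have h5 := e.R_eq ⟨s, hs⟩
      have h6 := f'.R_eq ⟨s, hs⟩
      simp only at h5 h6
      rw [h5, h6, Graft.L_eq _ _ (Graft.inl_ne_inr _ _ _).symm, h4]
    · have h4 := h3 ⟨s, hs⟩ (Graft.inl_ne_inr _ _ _).symm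
      have h5 := f.R_eq ⟨s, hs⟩
      have h6 := e'.R_eq ⟨s, hs⟩
      simp only at h5 h6
      rw [h5, h6, Graft.L_eq _ _ (Graft.inl_ne_inr _ _ _).symm, h4]
  · rintro ⟨hij, h0, h0', h1, h2, h3⟩
    have hij : i ≠ j := fun h => hij (congrArg Fin.val h)
    obtain rfl : e (Sum.inl ⟨j, hij.symm⟩) = j' := Fin.ext (by rw [← h0, Graft.L_eq])
    obtain rfl : e' (Sum.inl ⟨i, hij⟩) = i' := Fin.ext (by rw [← h0', Graft.L_eq])
    refine ⟨hij, rfl, rfl, fun s hs hs' hs₁ hs₂ => Fin.ext ?_, fun s hs => Fin.ext ?_,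
      fun s hs => Fin.ext ?_⟩
    · have := h1 s s.2 (hv hs) (hv hs')
      rwa [e.L_eq s hs, e'.L_eq s hs', f.L_eq _ hs₁, f'.L_eq _ hs₂] at this
    · have := h2 s s.2
      rwa [e.R_eq s, f.L_eq _ hs, f'.R_eq] at this
    · have := h3 s s.2
      rwa [e'.R_eq s, f.R_eq, f'.L_eq _ hs] at this

theorem SeqCompat.pentagon_llr {m₀ m₁ m l n p₀ p₁ q q₁ q₃ : ℕ}
    {j₀ : Fin m₀} {j₁ : Fin m₁} {j₂ : Fin p₀} {i : Fin m} {i₁ : Fin q₁} {i₃ : Fin q₃}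
    {e₀ : Graft m₀ m₁ p₀ j₀} {f₀ : Graft p₀ n q j₂} {e₀' : Graft m₁ n p₁ j₁}
    {f₀' : Graft m₀ p₁ q j₀} {e : Graft m l n i}
    {E₁ : Graft m₁ m q₁ j₁} {E₂ : Graft q₁ l p₁ i₁} {E₃ : Graft m₀ q₁ q₃ j₀}
    {E₄ : Graft q₃ l q i₃} {E₅ : Graft p₀ m q₃ j₂}
    (H : SeqCompat j₀ j₁ j₂ e₀ f₀ e₀' f₀') (K₁ : SeqCompat j₁ i i₁ E₁ E₂ e e₀')
    (K₂ : SeqCompat j₀ i₁ i₃ E₃ E₄ E₂ f₀') (K₃ : SeqCompat j₀ j₁ j₂ e₀ E₅ E₁ E₃) :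
    SeqCompat j₂ i i₃ E₅ E₄ e f₀ := by
  simp only [seqCompat_iff] at H K₁ K₂ K₃ ⊢
  refine ⟨by grind [Graft.inv_L, Graft.inv_R, Graft.L_lt, Graft.R_lt], fun s hs h => ?_, fun s hs h => ?_, fun s hs => ?_⟩
  · rcases Graft.cases_nat e₀ s hs with ⟨s, hs, h, rfl⟩ | ⟨s, hs, rfl⟩ <;> grind [Graft.inv_L, Graft.inv_R, Graft.L_lt, Graft.R_lt]
  · grind [Graft.inv_L, Graft.inv_R, Graft.L_lt, Graft.R_lt]
  · grind [Graft.inv_L, Graft.inv_R, Graft.L_lt, Graft.R_lt]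

theorem SeqCompat.pentagon_lr {m₀ n m l l' p₀ p₁ q q₁ q₃ : ℕ}
    {j₀ : Fin m₀} {j₁ : Fin n} {j₂ : Fin p₀} {i : Fin m} {i₁ : Fin q₁} {s : Fin l}
    {e₀ : Graft m₀ n p₀ j₀} {f₀ : Graft p₀ l' q j₂} {e₀' : Graft n l' p₁ j₁}
    {f₀' : Graft m₀ p₁ q j₀} {e : Graft m l n i}
    {E₁ : Graft m₀ m q₁ j₀} {E₂ : Graft q₁ l p₀ i₁} {E₃ : Graft l l' q₃ s}
    {E₄ : Graft q₁ q₃ q i₁} {E₅ : Graft m q₃ p₁ i}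
    (H : SeqCompat j₀ j₁ j₂ e₀ f₀ e₀' f₀') (K₁ : SeqCompat j₀ i i₁ E₁ E₂ e e₀)
    (K₂ : SeqCompat i₁ s j₂ E₂ f₀ E₃ E₄) (K₃ : SeqCompat i s j₁ e e₀' E₃ E₅) :
    SeqCompat j₀ i i₁ E₁ E₄ E₅ f₀' := by
  simp only [seqCompat_iff] at H K₁ K₂ K₃ ⊢
  refine ⟨by grind [Graft.inv_L, Graft.inv_R, Graft.L_lt, Graft.R_lt], fun s hs h => ?_, fun s hs h => ?_, fun s hs => ?_⟩
  · grind [Graft.inv_L, Graft.inv_R, Graft.L_lt, Graft.R_lt]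
  · grind [Graft.inv_L, Graft.inv_R, Graft.L_lt, Graft.R_lt]
  · rcases Graft.cases_nat E₃ s hs with ⟨s, hs, h, rfl⟩ | ⟨s, hs, rfl⟩ <;> grind [Graft.inv_L, Graft.inv_R, Graft.L_lt, Graft.R_lt]

theorem SeqCompat.pentagon_lr' {m₀ n m l l' p₀ p₁ q q₁ q₃ q₄ : ℕ}
    {j₀ : Fin m₀} {j₁ : Fin n} {j₂ : Fin p₀} {i s : Fin m} {i₁ s₁ : Fin q₁} {i₃ : Fin q₃}
    {i₄ : Fin q₄}
    {e₀ : Graft m₀ n p₀ j₀} {f₀ : Graft p₀ l' q j₂} {e₀' : Graft n l' p₁ j₁}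
    {f₀' : Graft m₀ p₁ q j₀} {e : Graft m l n i}
    {E₁ : Graft m₀ m q₁ j₀} {E₂ : Graft q₁ l p₀ i₁} {E₃ : Graft m l' q₃ s}
    {E₅ : Graft q₃ l p₁ i₃} {E₆ : Graft q₁ l' q₄ s₁} {E₇ : Graft q₄ l q i₄}
    {E₈ : Graft m₀ q₃ q₄ j₀}
    (H : SeqCompat j₀ j₁ j₂ e₀ f₀ e₀' f₀') (K₁ : SeqCompat j₀ i i₁ E₁ E₂ e e₀)
    (K₂ : ParCompat i₁ s₁ i₄ j₂ E₂ f₀ E₆ E₇) (K₃ : ParCompat i s i₃ j₁ e e₀' E₃ E₅)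
    (K₅ : SeqCompat j₀ s s₁ E₁ E₆ E₃ E₈) :
    SeqCompat j₀ i₃ i₄ E₈ E₇ E₅ f₀' := by
  simp only [seqCompat_iff, parCompat_iff] at H K₁ K₂ K₃ K₅ ⊢
  refine ⟨by grind [Graft.inv_L, Graft.inv_R, Graft.L_lt, Graft.R_lt], fun s hs h => ?_, fun s hs h => ?_, fun s hs => ?_⟩
  · grind [Graft.inv_L, Graft.inv_R, Graft.L_lt, Graft.R_lt]
  · rcases Graft.cases_nat E₃ s hs with ⟨s, hs, h, rfl⟩ | ⟨s, hs, rfl⟩ <;> grind [Graft.inv_L, Graft.inv_R, Graft.L_lt, Graft.R_lt]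
  · grind [Graft.inv_L, Graft.inv_R, Graft.L_lt, Graft.R_lt]

theorem SeqCompat.pentagon_rr {n m l m' l' p₀ p₁ q q₁ q₃ : ℕ}
    {j₀ : Fin n} {j₁ : Fin m'} {j₂ : Fin p₀} {i : Fin m} {s : Fin l} {s₂ : Fin q₁}
    {e₀ : Graft n m' p₀ j₀} {f₀ : Graft p₀ l' q j₂} {e₀' : Graft m' l' p₁ j₁}
    {f₀' : Graft n p₁ q j₀} {e : Graft m l n i}
    {E₁ : Graft l m' q₁ s} {E₂ : Graft m q₁ p₀ i} {E₃ : Graft q₁ l' q₃ s₂}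
    {E₄ : Graft m q₃ q i} {E₅ : Graft l p₁ q₃ s}
    (H : SeqCompat j₀ j₁ j₂ e₀ f₀ e₀' f₀') (K₁ : SeqCompat i s j₀ e e₀ E₁ E₂)
    (K₂ : SeqCompat i s₂ j₂ E₂ f₀ E₃ E₄) (K₃ : SeqCompat s j₁ s₂ E₁ E₃ e₀' E₅) :
    SeqCompat i s j₀ e f₀' E₅ E₄ := by
  simp only [seqCompat_iff] at H K₁ K₂ K₃ ⊢
  refine ⟨by grind [Graft.inv_L, Graft.inv_R, Graft.L_lt, Graft.R_lt], fun s hs h => ?_, fun s hs h => ?_, fun s hs => ?_⟩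
  · grind [Graft.inv_L, Graft.inv_R, Graft.L_lt, Graft.R_lt]
  · grind [Graft.inv_L, Graft.inv_R, Graft.L_lt, Graft.R_lt]
  · rcases Graft.cases_nat e₀' s hs with ⟨s, hs, h, rfl⟩ | ⟨s, hs, rfl⟩ <;> grind [Graft.inv_L, Graft.inv_R, Graft.L_lt, Graft.R_lt]

theorem ParCompat.pentagon_rr {n m l m' l' p₀ p₁ q q₁ q₃ : ℕ}
    {j₀ : Fin n} {j₁ : Fin m'} {j₂ : Fin p₀} {i s : Fin m} {i₁ s₂ : Fin q₁} {i₂ : Fin q₃}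
    {e₀ : Graft n m' p₀ j₀} {f₀ : Graft p₀ l' q j₂} {e₀' : Graft m' l' p₁ j₁}
    {f₀' : Graft n p₁ q j₀} {e : Graft m l n i}
    {E₁ : Graft m m' q₁ s} {E₂ : Graft q₁ l p₀ i₁} {E₃ : Graft q₁ l' q₃ s₂}
    {E₄ : Graft q₃ l q i₂} {E₅ : Graft m p₁ q₃ s}
    (H : SeqCompat j₀ j₁ j₂ e₀ f₀ e₀' f₀') (K₁ : ParCompat i s i₁ j₀ e e₀ E₁ E₂)
    (K₂ : ParCompat i₁ s₂ i₂ j₂ E₂ f₀ E₃ E₄) (K₃ : SeqCompat s j₁ s₂ E₁ E₃ e₀' E₅) :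
    ParCompat i s i₂ j₀ e f₀' E₅ E₄ := by
  simp only [seqCompat_iff, parCompat_iff] at H K₁ K₂ K₃ ⊢
  refine ⟨by grind [Graft.inv_L, Graft.inv_R, Graft.L_lt, Graft.R_lt], by grind [Graft.inv_L, Graft.inv_R, Graft.L_lt, Graft.R_lt], by grind [Graft.inv_L, Graft.inv_R, Graft.L_lt, Graft.R_lt],
    fun s hs h h' => ?_, fun s hs => ?_, fun s hs => ?_⟩
  · grind [Graft.inv_L, Graft.inv_R, Graft.L_lt, Graft.R_lt]
  · grind [Graft.inv_L, Graft.inv_R, Graft.L_lt, Graft.R_lt]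
  · rcases Graft.cases_nat e₀' s hs with ⟨s, hs, h, rfl⟩ | ⟨s, hs, rfl⟩ <;> grind [Graft.inv_L, Graft.inv_R, Graft.L_lt, Graft.R_lt]

theorem SeqCompat.hexagon_rr {n m l l₁ l₂ p₀ p₁ q q₁ q₂ q₃ : ℕ}
    {j₁ j₂ : Fin n} {j₁' : Fin p₁} {j₂' : Fin p₀} {i : Fin m} {s₁ s₂ : Fin l} {s₁' : Fin q₂}
    {s₂' : Fin q₁}
    {e₀ : Graft n l₁ p₀ j₁} {f₀ : Graft p₀ l₂ q j₂'} {e₀' : Graft n l₂ p₁ j₂}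
    {f₀' : Graft p₁ l₁ q j₁'} {e : Graft m l n i}
    {E₁ : Graft l l₁ q₁ s₁} {E₂ : Graft m q₁ p₀ i} {E₁' : Graft l l₂ q₂ s₂}
    {E₂' : Graft m q₂ p₁ i} {E₃ : Graft q₁ l₂ q₃ s₂'} {E₄ : Graft m q₃ q i}
    {E₃' : Graft q₂ l₁ q₃ s₁'}
    (H : ParCompat j₁ j₂ j₁' j₂' e₀ f₀ e₀' f₀') (K₁ : SeqCompat i s₁ j₁ e e₀ E₁ E₂)
    (K₁' : SeqCompat i s₂ j₂ e e₀' E₁' E₂') (K₂ : SeqCompat i s₂' j₂' E₂ f₀ E₃ E₄)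
    (K₃ : ParCompat s₁ s₂ s₁' s₂' E₁ E₃ E₁' E₃') :
    SeqCompat i s₁' j₁' E₂' f₀' E₃' E₄ := by
  simp only [seqCompat_iff, parCompat_iff] at H K₁ K₁' K₂ K₃ ⊢
  refine ⟨by grind [Graft.inv_L, Graft.inv_R, Graft.L_lt, Graft.R_lt], fun s hs h => ?_, fun s hs h => ?_, fun s hs => ?_⟩
  · grind [Graft.inv_L, Graft.inv_R, Graft.L_lt, Graft.R_lt]
  · rcases Graft.cases_nat E₁' s hs with ⟨s, hs, h, rfl⟩ | ⟨s, hs, rfl⟩ <;> grind [Graft.inv_L, Graft.inv_R, Graft.L_lt, Graft.R_lt]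
  · grind [Graft.inv_L, Graft.inv_R, Graft.L_lt, Graft.R_lt]

theorem ParCompat.hexagon_rr {n m l l₁ l₂ p₀ p₁ q q₁ q₂ q₃ : ℕ}
    {j₁ j₂ : Fin n} {j₁' : Fin p₁} {j₂' : Fin p₀} {i s₁ s₂ : Fin m} {i₁ s₂' : Fin q₁}
    {i₂ s₁' : Fin q₂} {i₃ : Fin q₃}
    {e₀ : Graft n l₁ p₀ j₁} {f₀ : Graft p₀ l₂ q j₂'} {e₀' : Graft n l₂ p₁ j₂}
    {f₀' : Graft p₁ l₁ q j₁'} {e : Graft m l n i}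
    {E₁ : Graft m l₁ q₁ s₁} {E₂ : Graft q₁ l p₀ i₁} {E₁' : Graft m l₂ q₂ s₂}
    {E₂' : Graft q₂ l p₁ i₂} {E₃ : Graft q₁ l₂ q₃ s₂'} {E₄ : Graft q₃ l q i₃}
    {E₃' : Graft q₂ l₁ q₃ s₁'}
    (H : ParCompat j₁ j₂ j₁' j₂' e₀ f₀ e₀' f₀') (K₁ : ParCompat i s₁ i₁ j₁ e e₀ E₁ E₂)
    (K₁' : ParCompat i s₂ i₂ j₂ e e₀' E₁' E₂') (K₂ : ParCompat i₁ s₂' i₃ j₂' E₂ f₀ E₃ E₄)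
    (K₃ : ParCompat s₁ s₂ s₁' s₂' E₁ E₃ E₁' E₃') :
    ParCompat i₂ s₁' i₃ j₁' E₂' f₀' E₃' E₄ := by
  simp only [parCompat_iff] at H K₁ K₁' K₂ K₃ ⊢
  refine ⟨by grind [Graft.inv_L, Graft.inv_R, Graft.L_lt, Graft.R_lt], by grind [Graft.inv_L, Graft.inv_R, Graft.L_lt, Graft.R_lt], by grind [Graft.inv_L, Graft.inv_R, Graft.L_lt, Graft.R_lt],
    fun s hs h h' => ?_, fun s hs => ?_, fun s hs => ?_⟩
  · rcases Graft.cases_nat E₁' s hs with ⟨s, hs, h, rfl⟩ | ⟨s, hs, rfl⟩ <;> grind [Graft.inv_L, Graft.inv_R, Graft.L_lt, Graft.R_lt]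
  · grind [Graft.inv_L, Graft.inv_R, Graft.L_lt, Graft.R_lt]
  · grind [Graft.inv_L, Graft.inv_R, Graft.L_lt, Graft.R_lt]

theorem SeqCompat.hexagon_rr' {n m l l₁ l₂ p₀ p₁ q q₁ q₂ : ℕ}
    {j₁ j₂ : Fin n} {j₁' : Fin p₁} {j₂' : Fin p₀} {i s₂ : Fin m} {s₁ : Fin l} {i₃ : Fin q₂}
    {e₀ : Graft n l₁ p₀ j₁} {f₀ : Graft p₀ l₂ q j₂'} {e₀' : Graft n l₂ p₁ j₂}
    {f₀' : Graft p₁ l₁ q j₁'} {e : Graft m l n i}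
    {E₁ : Graft l l₁ q₁ s₁} {E₂ : Graft m q₁ p₀ i} {E₁' : Graft m l₂ q₂ s₂}
    {E₂' : Graft q₂ l p₁ i₃} {E₄ : Graft q₂ q₁ q i₃}
    (H : ParCompat j₁ j₂ j₁' j₂' e₀ f₀ e₀' f₀') (K₁ : SeqCompat i s₁ j₁ e e₀ E₁ E₂)
    (K₁' : ParCompat i s₂ i₃ j₂ e e₀' E₁' E₂') (K₂ : ParCompat i s₂ i₃ j₂' E₂ f₀ E₁' E₄) :
    SeqCompat i₃ s₁ j₁' E₂' f₀' E₁ E₄ := by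
  simp only [seqCompat_iff, parCompat_iff] at H K₁ K₁' K₂ ⊢
  refine ⟨by grind [Graft.inv_L, Graft.inv_R, Graft.L_lt, Graft.R_lt], fun s hs h => ?_, fun s hs h => ?_, fun s hs => ?_⟩
  · rcases Graft.cases_nat E₁' s hs with ⟨s, hs, h, rfl⟩ | ⟨s, hs, rfl⟩ <;> grind [Graft.inv_L, Graft.inv_R, Graft.L_lt, Graft.R_lt]
  · grind [Graft.inv_L, Graft.inv_R, Graft.L_lt, Graft.R_lt]
  · grind [Graft.inv_L, Graft.inv_R, Graft.L_lt, Graft.R_lt]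

theorem SeqCompat.hexagon_lr {m₀ n m l l' p₀ p₁ q q₁ q₃ : ℕ}
    {j₁ j₂ : Fin m₀} {j₁' : Fin p₁} {j₂' : Fin p₀} {i : Fin m} {i₁ s₂ : Fin q₁} {i₃ : Fin q₃}
    {e₀ : Graft m₀ n p₀ j₁} {f₀ : Graft p₀ l' q j₂'} {e₀' : Graft m₀ l' p₁ j₂}
    {f₀' : Graft p₁ n q j₁'} {e : Graft m l n i}
    {E₁ : Graft m₀ m q₁ j₁} {E₂ : Graft q₁ l p₀ i₁} {E₃ : Graft q₁ l' q₃ s₂}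
    {E₄ : Graft q₃ l q i₃} {E₅ : Graft p₁ m q₃ j₁'}
    (H : ParCompat j₁ j₂ j₁' j₂' e₀ f₀ e₀' f₀') (K₁ : SeqCompat j₁ i i₁ E₁ E₂ e e₀)
    (K₂ : ParCompat i₁ s₂ i₃ j₂' E₂ f₀ E₃ E₄) (K₃ : ParCompat j₁ j₂ j₁' s₂ E₁ E₃ e₀' E₅) :
    SeqCompat j₁' i i₃ E₅ E₄ e f₀' := by
  simp only [seqCompat_iff, parCompat_iff] at H K₁ K₂ K₃ ⊢
  refine ⟨by grind [Graft.inv_L, Graft.inv_R, Graft.L_lt, Graft.R_lt], fun s hs h => ?_, fun s hs h => ?_, fun s hs => ?_⟩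
  · rcases Graft.cases_nat e₀' s hs with ⟨s, hs, h, rfl⟩ | ⟨s, hs, rfl⟩ <;> grind [Graft.inv_L, Graft.inv_R, Graft.L_lt, Graft.R_lt]
  · grind [Graft.inv_L, Graft.inv_R, Graft.L_lt, Graft.R_lt]
  · grind [Graft.inv_L, Graft.inv_R, Graft.L_lt, Graft.R_lt]

section
variable {m n l p q r : ℕ} {i i₂ : Fin m} {j j₂ : Fin n} {t t₂ : Fin p}
    {e : Graft m n p i} {f : Graft p l q t} {e' : Graft n l r j} {f' : Graft m r q i}
    {e₂ : Graft m n p i₂} {f₂ : Graft p l q t₂} {e₂' : Graft n l r j₂} {f₂' : Graft m r q i₂}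
    {σ : Equiv.Perm (Fin m)} {τ : Equiv.Perm (Fin n)} {θ : Equiv.Perm (Fin l)}
    {ρ : Equiv.Perm (Fin p)} {ρ' : Equiv.Perm (Fin r)} {κ : Equiv.Perm (Fin q)}

theorem SeqCompat.perm_left
    (K : SeqCompat i j t e f e' f') (K₂ : SeqCompat i₂ j₂ t₂ e₂ f₂ e₂' f₂')
    (He : ActCompat i i₂ σ τ ρ e e₂) (He' : ActCompat j j₂ τ θ ρ' e' e₂')
    (Hf' : ActCompat i i₂ σ ρ' κ f' f₂') : ActCompat t t₂ ρ θ κ f f₂ := by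
  have b1 := K.base
  have b2 := K₂.base
  have b3 := He.base
  have b4 := He'.base
  subst b1 b2 b3 b4
  refine ⟨by rw [He.inr], fun s hs hs' => ?_, fun s => ?_⟩
  · rcases e.cases s with ⟨s, h, rfl⟩ | ⟨s, rfl⟩
    · have := He.inl s h (by simpa using h)
      grind [SeqCompat, ActCompat]
    · grind [SeqCompat, ActCompat]
  · grind [SeqCompat, ActCompat]

theorem SeqCompat.perm_right
    (K : SeqCompat i j t e f e' f') (K₂ : SeqCompat i₂ j₂ t₂ e₂ f₂ e₂' f₂')
    (He : ActCompat i i₂ σ τ ρ e e₂) (Hf : ActCompat t t₂ ρ θ κ f f₂)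
    (He' : ActCompat j j₂ τ θ ρ' e' e₂') : ActCompat i i₂ σ ρ' κ f' f₂' := by
  have b1 := K.base
  have b2 := K₂.base
  have b3 := He.base
  have b4 := He'.base
  subst b1 b2 b3 b4
  refine ⟨rfl, fun s hs hs' => ?_, fun s => ?_⟩
  · have h1 := He.inl s hs hs'
    have h2 := Graft.inl_ne_inr e ⟨s, hs⟩ j
    have h3 := Graft.inl_ne_inr e₂ ⟨σ s, hs'⟩ (τ j)
    have h4 := K₂.inl_inl (σ s) hs' h3
    grind [SeqCompat, ActCompat]
  · rcases e'.cases s with ⟨s, h, rfl⟩ | ⟨s, rfl⟩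
    · have h1 : e (Sum.inr s) ≠ e (Sum.inr j) := by simpa using h
      have h2 : e₂ (Sum.inr (τ s)) ≠ e₂ (Sum.inr (τ j)) := by simpa using h
      have h3 := K₂.inl_inr (τ s) (by simpa using h) h2
      grind [SeqCompat, ActCompat]
    · grind [SeqCompat, ActCompat]

end

theorem ParCompat.perm {m n l p q r : ℕ} {i i₂ j j₂ : Fin m} {i' i₂' : Fin r} {j' j₂' : Fin p}
    {e : Graft m n p i} {f : Graft p l q j'} {e' : Graft m l r j} {f' : Graft r n q i'}
    {e₂ : Graft m n p i₂} {f₂ : Graft p l q j₂'} {e₂' : Graft m l r j₂} {f₂' : Graft r n q i₂'}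
    (K : ParCompat i j i' j' e f e' f') (K₂ : ParCompat i₂ j₂ i₂' j₂' e₂ f₂ e₂' f₂')
    {σ : Equiv.Perm (Fin m)} {τ : Equiv.Perm (Fin n)} {θ : Equiv.Perm (Fin l)}
    {ρ : Equiv.Perm (Fin p)} {ρ' : Equiv.Perm (Fin r)} {κ : Equiv.Perm (Fin q)}
    (He : ActCompat i i₂ σ τ ρ e e₂) (Hf : ActCompat j' j₂' ρ θ κ f f₂)
    (He' : ActCompat j j₂ σ θ ρ' e' e₂') : ActCompat i' i₂' ρ' τ κ f' f₂' := by
  have hne := K.ne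
  have hne₂ := K₂.ne
  have b1 : e (Sum.inl ⟨j, hne.symm⟩) = j' := K.base
  have b2 : e₂ (Sum.inl ⟨j₂, hne₂.symm⟩) = j₂' := K₂.base
  have b1' : e' (Sum.inl ⟨i, hne⟩) = i' := K.base'
  have b2' : e₂' (Sum.inl ⟨i₂, hne₂⟩) = i₂' := K₂.base'
  have b3 := He.base
  have b4 := He'.base
  subst b1 b2 b3 b4 b1' b2'
  refine ⟨by rw [He'.inl], fun s hs hs' => ?_, fun s => ?_⟩
  · rcases e'.cases s with ⟨s, h, rfl⟩ | ⟨s, rfl⟩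
    · have a0 : s ≠ i := by rintro rfl; exact hs rfl
      have a1 : e (Sum.inl ⟨s, a0⟩) ≠ e (Sum.inl ⟨j, hne.symm⟩) := by simpa using h
      have a2 : σ s ≠ σ i := by simpa using a0
      have a3 : σ s ≠ σ j := by simpa using h
      have a4 : e₂ (Sum.inl ⟨σ s, a2⟩) ≠ e₂ (Sum.inl ⟨σ j, hne₂.symm⟩) := by simpa using h
      have a5 : e₂' (Sum.inl ⟨σ s, a3⟩) ≠ e₂' (Sum.inl ⟨σ i, hne₂⟩) := by simpa using a0
      have h1 := K.inl_inl s a0 h a1 hs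
      have h2 := K₂.inl_inl (σ s) a2 a3 a4 a5
      have h3 := He.inl s a0 a2
      have h4 := He'.inl s h a3
      have h5 := Hf.inl _ a1 (h3 ▸ a4)
      simp only [h3] at h2
      simp only [h4] at h2
      rw [← h2, h5, h1]
    · have a1 : e₂' (Sum.inr (θ s)) ≠ e₂' (Sum.inl ⟨σ i, hne₂⟩) := (Graft.inl_ne_inr _ _ _).symm
      have h1 := K.inr s hs
      have h2 := K₂.inr (θ s) a1
      have h3 := He'.inr s
      simp only [h3] at h2
      rw [← h2, Hf.inr, h1]
  · have a1 : e (Sum.inr s) ≠ e (Sum.inl ⟨j, hne.symm⟩) := (Graft.inl_ne_inr _ _ _).symm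
    have a2 : e₂ (Sum.inr (τ s)) ≠ e₂ (Sum.inl ⟨σ j, hne₂.symm⟩) :=
      (Graft.inl_ne_inr _ _ _).symm
    have h1 := K.inl_inr s a1
    have h2 := K₂.inl_inr (τ s) a2
    have h3 := He.inr s
    have h5 := Hf.inl _ a1 (h3 ▸ a2)
    simp only [h3] at h2
    rw [← h2, h5, h1]

namespace Graft

variable {m n l p q r : ℕ}

theorem exists_move {i : Fin m} (e : Graft m n p i) (i' : Fin m) : ∃ _ : Graft m n p i', True :=
  ⟨(Equiv.sumCongr ((Equiv.swap i' i).subtypeEquiv fun s => by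
    rw [Ne, Ne, ← Equiv.eq_symm_apply]; simp) (Equiv.refl _)).trans e, trivial⟩

theorem exists_seq_left' {i : Fin m} {j : Fin n} {j' : Fin p} (e : Graft m n p i)
    (hj : e (Sum.inr j) = j') (e' : Graft n l r j) (f' : Graft m r q i) :
    ∃ f : Graft p l q j', SeqCompat i j j' e f e' f' := by
  subst hj
  exact exists_seq_left e e' f'

theorem exists_par' {i j : Fin m} {i' : Fin r} {j' : Fin p} (hij : j ≠ i) (e : Graft m n p i)
    (f : Graft p l q j') (e' : Graft m l r j) (hj : e (Sum.inl ⟨j, hij⟩) = j')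
    (hi : e' (Sum.inl ⟨i, hij.symm⟩) = i') :
    ∃ f' : Graft r n q i', ParCompat i j i' j' e f e' f' := by
  subst hi
  exact exists_par hij e f e' hj

theorem exists_left {m₀ : ℕ} {i : Fin m} {j : Fin m₀} (e : Graft m l n i) (g : Graft m₀ n p j) :
    ∃ (q : ℕ) (i₁ : Fin q) (e₁ : Graft m₀ m q j) (e₂ : Graft q l p i₁),
      SeqCompat j i i₁ e₁ e₂ e g :=
  ⟨_, _, std m j, exists_seq_left _ _ _⟩

theorem exists_right {m₀ : ℕ} {i : Fin m} {j : Fin n} {s : Fin l} (e : Graft m l n i)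
    (f : Graft n m₀ p j) (hs : e (Sum.inr s) = j) :
    ∃ (q : ℕ) (e' : Graft l m₀ q s) (f' : Graft m q p i), SeqCompat i s j e f e' f' :=
  ⟨_, std m₀ s, exists_seq_right _ _ _ hs⟩

theorem exists_right_par {m₀ : ℕ} {i s : Fin m} {j : Fin n} (hs : s ≠ i) (e : Graft m l n i)
    (f : Graft n m₀ p j) (hj : e (Sum.inl ⟨s, hs⟩) = j) :
    ∃ (q : ℕ) (i₁ : Fin q) (e' : Graft m m₀ q s) (f' : Graft q l p i₁),
      ParCompat i s i₁ j e f e' f' :=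
  ⟨_, _, std m₀ s, exists_par hs _ _ _ hj⟩

end Graft

namespace FreeInf

variable {k : Type u} [Field k] {T : GradedOperad k}

/-- A labelling of `(w ∘ⱼ x) ∘ᵢ y` corresponding to the labelling `e`, `g` of `w ∘ⱼ (x ∘ᵢ y)`. -/
noncomputable def leftGraft {m₀ m l n p : ℕ} {j : Fin m₀} {i : Fin m} (e : Graft m l n i)
    (g : Graft m₀ n p j) : Graft _ l p (Graft.std m j (Sum.inr i)) :=
  Classical.choose (Graft.exists_seq_left (Graft.std m j) e g)

theorem leftGraft_spec {m₀ m l n p : ℕ} {j : Fin m₀} {i : Fin m} (e : Graft m l n i)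
    (g : Graft m₀ n p j) : SeqCompat j i _ (Graft.std m j) (leftGraft e g) e g :=
  Classical.choose_spec (Graft.exists_seq_left (Graft.std m j) e g)

theorem _root_.ActCompat.of_trans {m l n : ℕ} {i : Fin m} (e : Graft m l n i)
    (ρ : Equiv.Perm (Fin n)) : ActCompat i i 1 1 ρ e (e.trans ρ) :=
  ⟨rfl, fun _ _ _ => rfl, fun _ => rfl⟩

theorem _root_.ActCompat.refl {m l n : ℕ} {i : Fin m} (e : Graft m l n i) : ActCompat i i 1 1 1 e e :=
  ⟨rfl, fun _ _ _ => rfl, fun _ => rfl⟩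

/-- The left composition `w ∘ⱼ (x ∘ᵢ [r] ∘ y) = (w ∘ⱼ x) ∘ [r] ∘ y`. -/
noncomputable def lcomp {m₀ n p : ℕ} {a₀ a t : ℤ} (j : Fin m₀) (g : Graft m₀ n p j)
    (h : a₀ + a = t) : T.obj m₀ a₀ →ₗ[k] FreeInf T n a →ₗ[k] FreeInf T p t :=
  LinearMap.flip (lift (V := T.obj m₀ a₀ →ₗ[k] FreeInf T p t)
    (fun {m _ b c} r i e hh => LinearMap.mk₂ k
      (fun x y => (mk r _ (leftGraft e g)
        (show (a₀ + b) + c = t + 2 * (r : ℤ) by linear_combination h + hh)).flip y ∘ₗ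
          (T.comp j (Graft.std m j) rfl).flip x)
      (fun x x' y => by ext w; simp) (fun s x y => by ext w; simp)
      (fun x y y' => by ext w; simp) (fun s x y => by ext w; simp)) (by
    intro m l b c r i i' e e' σ τ H h x y
    ext w
    simp only [LinearMap.mk₂_apply, LinearMap.comp_apply, LinearMap.flip_apply]
    obtain ⟨ρ, H₁⟩ := Graft.exists_perm (i := j) (i' := j) 1 σ rfl (Graft.std m j) (Graft.std m j)
    have H₂ := (leftGraft_spec e g).perm_left (leftGraft_spec e' g) H₁ H (ActCompat.refl g)
    have h1 := T.comp_perm H₁ rfl w x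
    rw [T.act_one] at h1
    rw [h1, mk_perm_one r H₂]))

theorem lcomp_mk {m₀ m l n p q : ℕ} {a₀ a b c t b' : ℤ} {j : Fin m₀} {g : Graft m₀ n p j}
    {i : Fin m} {e : Graft m l n i} {i₁ : Fin q} {e₁ : Graft m₀ m q j} {e₂ : Graft q l p i₁}
    (K : SeqCompat j i i₁ e₁ e₂ e g) (h : a₀ + a = t) (r : ℕ) (hr : b + c = a + 2 * (r : ℤ))
    (hb : a₀ + b = b') (hr' : b' + c = t + 2 * (r : ℤ)) (w : T.obj m₀ a₀) (x : T.obj m b)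
    (y : T.obj l c) :
    lcomp j g h w (mk r i e hr x y) = mk r i₁ e₂ hr' (T.comp j e₁ hb w x) y := by
  subst hb
  rw [lcomp, LinearMap.flip_apply, lift_mk]
  simp only [LinearMap.mk₂_apply, LinearMap.comp_apply, LinearMap.flip_apply]
  obtain rfl := (Graft.std m j).card_unique e₁
  obtain ⟨ρ, H₁⟩ := Graft.exists_perm (i := j) (i' := j) 1 1 rfl (Graft.std m j) e₁
  have H₂ := (leftGraft_spec e g).perm_left K H₁ (ActCompat.refl e) (ActCompat.refl g)
  have h1 := T.comp_perm H₁ rfl w x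
  rw [T.act_one, T.act_one] at h1
  have h2 := mk_perm_one r H₂ hr' (T.comp j (Graft.std m j) rfl w x) y
  rw [T.act_one, ← h1] at h2
  exact h2.symm

/-- A labelling of `x ∘ᵢ (y ∘ z)` corresponding to the labelling `e`, `f` of `(x ∘ᵢ y) ∘ z`. -/
noncomputable def seqGraft {m l n m₀ p : ℕ} {i : Fin m} {j : Fin n} {s : Fin l} (e : Graft m l n i)
    (f : Graft n m₀ p j) (hs : e (Sum.inr s) = j) :
    Graft m (Fintype.card ({t : Fin l // t ≠ s} ⊕ Fin m₀)) p i :=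
  Classical.choose (Graft.exists_seq_right e f (Graft.std m₀ s) hs)

theorem seqGraft_spec {m l n m₀ p : ℕ} {i : Fin m} {j : Fin n} {s : Fin l} (e : Graft m l n i)
    (f : Graft n m₀ p j) (hs : e (Sum.inr s) = j) :
    SeqCompat i s j e f (Graft.std m₀ s) (seqGraft e f hs) :=
  Classical.choose_spec (Graft.exists_seq_right e f (Graft.std m₀ s) hs)

/-- A labelling of `(x ∘ z) ∘ᵢ y` corresponding to the labelling `e`, `f` of `(x ∘ᵢ y) ∘ z`. -/
noncomputable def parGraft {m l n m₀ p : ℕ} {i s : Fin m} {j : Fin n} (hs : s ≠ i)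
    (e : Graft m l n i) (f : Graft n m₀ p j) (hj : e (Sum.inl ⟨s, hs⟩) = j) :
    Graft _ l p (Graft.std m₀ s (Sum.inl ⟨i, hs.symm⟩)) :=
  Classical.choose (Graft.exists_par hs e f (Graft.std m₀ s) hj)

theorem parGraft_spec {m l n m₀ p : ℕ} {i s : Fin m} {j : Fin n} (hs : s ≠ i)
    (e : Graft m l n i) (f : Graft n m₀ p j) (hj : e (Sum.inl ⟨s, hs⟩) = j) :
    ParCompat i s _ j e f (Graft.std m₀ s) (parGraft hs e f hj) :=
  Classical.choose_spec (Graft.exists_par hs e f (Graft.std m₀ s) hj)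

/-- The operations `x ∘ᵢ [r] ∘ (y ∘ z)`. -/
noncomputable def rcompSeq {m l n m₀ p : ℕ} {a₀ a b c t : ℤ} {i : Fin m} {j : Fin n} {s : Fin l}
    (e : Graft m l n i) (f : Graft n m₀ p j) (hs : e (Sum.inr s) = j) (h : a + a₀ = t) (r : ℕ)
    (hr : b + c = a + 2 * (r : ℤ)) :
    T.obj m b →ₗ[k] T.obj l c →ₗ[k] T.obj m₀ a₀ →ₗ[k] FreeInf T p t :=
  LinearMap.mk₂ k (fun x y => mk r i (seqGraft e f hs)
      (show b + (c + a₀) = t + 2 * (r : ℤ) by linear_combination h + hr) x ∘ₗ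
        (T.comp s (Graft.std m₀ s) rfl y))
    (fun x x' y => by ext w; simp) (fun s x y => by ext w; simp)
    (fun x y y' => by ext w; simp) (fun s x y => by ext w; simp)

/-- The right composition does not depend on how the operations are labelled. -/
theorem rcompSeq_eq {m l n m₀ p q : ℕ} {a₀ a b c t c' : ℤ} {j : Fin n} {f : Graft n m₀ p j}
    {i i₂ : Fin m} {s s₂ : Fin l} {e : Graft m l n i} {e₂ : Graft m l n i₂} {e' : Graft l m₀ q s₂}
    {f' : Graft m q p i₂} {σ : Equiv.Perm (Fin m)} {τ : Equiv.Perm (Fin l)}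
    (K : SeqCompat i₂ s₂ j e₂ f e' f') (H : ActCompat i i₂ σ τ 1 e e₂)
    (hs : e (Sum.inr s) = j) (h : a + a₀ = t) (r : ℕ) (hr : b + c = a + 2 * (r : ℤ))
    (hc : c + a₀ = c') (hr' : b + c' = t + 2 * (r : ℤ)) (x : T.obj m b) (y : T.obj l c)
    (z : T.obj m₀ a₀) :
    rcompSeq e f hs h r hr x y z =
      mk r i₂ f' hr' (T.act σ x) (T.comp s₂ e' hc (T.act τ y) z) := by
  subst hc
  have hs' : τ s = s₂ :=
    Sum.inr_injective (e₂.injective (by rw [H.inr, hs, K.base]; rfl))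
  have hq : Fintype.card ({t : Fin l // t ≠ s} ⊕ Fin m₀) = q := by
    have h1 := Fintype.card_congr e'
    simpa using h1
  subst hq
  obtain ⟨ρ, H₁⟩ := Graft.exists_perm τ 1 hs' (Graft.std m₀ s) e'
  have H₂ := (seqGraft_spec e f hs).perm_right K H (ActCompat.refl f) H₁
  have h1 := T.comp_perm H₁ (rfl : c + a₀ = _) y z
  rw [T.act_one] at h1
  rw [h1, mk_perm_one r H₂]
  rfl

/-- The operations `(x ∘ z) ∘ᵢ [r] ∘ y`. -/
noncomputable def rcompPar {m l n m₀ p : ℕ} {a₀ a b c t : ℤ} {i s : Fin m} {j : Fin n}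
    (hs : s ≠ i) (e : Graft m l n i) (f : Graft n m₀ p j) (hj : e (Sum.inl ⟨s, hs⟩) = j)
    (h : a + a₀ = t) (r : ℕ) (hr : b + c = a + 2 * (r : ℤ)) :
    T.obj m b →ₗ[k] T.obj l c →ₗ[k] T.obj m₀ a₀ →ₗ[k] FreeInf T p t :=
  LinearMap.mk₂ k (fun x y => (mk r _ (parGraft hs e f hj)
      (show (b + a₀) + c = t + 2 * (r : ℤ) by linear_combination h + hr)).flip y ∘ₗ
        (T.comp s (Graft.std m₀ s) rfl x))
    (fun x x' y => by ext w; simp) (fun s x y => by ext w; simp)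
    (fun x y y' => by ext w; simp) (fun s x y => by ext w; simp)

theorem rcompPar_eq {m l n m₀ p q : ℕ} {a₀ a b c t b' : ℤ} {j : Fin n} {f : Graft n m₀ p j}
    {i i₂ s s₂ : Fin m} {i₁ : Fin q} {e : Graft m l n i} {e₂ : Graft m l n i₂}
    {e' : Graft m m₀ q s₂} {f' : Graft q l p i₁} {σ : Equiv.Perm (Fin m)}
    {τ : Equiv.Perm (Fin l)} (K : ParCompat i₂ s₂ i₁ j e₂ f e' f')
    (H : ActCompat i i₂ σ τ 1 e e₂) (hs : s ≠ i) (hj : e (Sum.inl ⟨s, hs⟩) = j) (h : a + a₀ = t)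
    (r : ℕ) (hr : b + c = a + 2 * (r : ℤ)) (hb : b + a₀ = b')
    (hr' : b' + c = t + 2 * (r : ℤ)) (x : T.obj m b) (y : T.obj l c) (z : T.obj m₀ a₀) :
    rcompPar hs e f hj h r hr x y z =
      mk r i₁ f' hr' (T.comp s₂ e' hb (T.act σ x) z) (T.act τ y) := by
  subst hb
  have hs' : σ s = s₂ := by
    have h0 := H.base
    have h1 : σ s ≠ i₂ := by
      rw [← h0]
      simpa using hs
    have h2 := H.inl s hs h1
    rw [hj] at h2
    exact congrArg Subtype.val (Sum.inl_injective (e₂.injective (h2.trans K.base.symm)))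
  have hq : Fintype.card ({t : Fin m // t ≠ s} ⊕ Fin m₀) = q := by
    have h1 := Fintype.card_congr e'
    simpa using h1
  subst hq
  obtain ⟨ρ, H₁⟩ := Graft.exists_perm σ 1 hs' (Graft.std m₀ s) e'
  have H₂ := (parGraft_spec hs e f hj).perm K H (ActCompat.refl f) H₁
  have h1 := T.comp_perm H₁ (rfl : b + a₀ = _) x z
  rw [T.act_one] at h1
  rw [h1, mk_perm_one r H₂]
  rfl

open Classical in
/-- The right composition `(x ∘ᵢ [r] ∘ y) ∘ₜ z`: if `t` is an input of `y`, it is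
`x ∘ᵢ [r] ∘ (y ∘ z)`, and if it is an input of `x`, it is `± (x ∘ z) ∘ [r] ∘ y`. -/
noncomputable def rcomp {n m₀ p : ℕ} {a a₀ t : ℤ} (j : Fin n) (f : Graft n m₀ p j)
    (h : a + a₀ = t) : FreeInf T n a →ₗ[k] T.obj m₀ a₀ →ₗ[k] FreeInf T p t :=
  lift (V := T.obj m₀ a₀ →ₗ[k] FreeInf T p t)
    (fun {_ _ _ c} r _ e hh =>
      if H : ∃ s, e (Sum.inr s) = j then rcompSeq e f H.choose_spec h r hh
      else koszulSign k (c * a₀) • rcompPar ((e.cases j).resolve_right H).choose_spec.choose e f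
        ((e.cases j).resolve_right H).choose_spec.choose_spec h r hh) (by
    intro m l b c r i i' e e' σ τ K hh x y
    by_cases H : ∃ s, e (Sum.inr s) = j
    · have H' : ∃ s, e' (Sum.inr s) = j := by
        obtain ⟨s, hs⟩ := H
        exact ⟨τ s, by rw [K.inr, hs]; rfl⟩
      rw [dif_pos H, dif_pos H']
      ext z
      rw [rcompSeq_eq (seqGraft_spec e' f H'.choose_spec) K _ h r hh rfl
          (by linear_combination h + hh),
        rcompSeq_eq (seqGraft_spec e' f H'.choose_spec) (ActCompat.refl e') _ h r hh rfl
          (by linear_combination h + hh), T.act_one, T.act_one]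
    · have H' : ¬ ∃ s, e' (Sum.inr s) = j := by
        rintro ⟨s, hs⟩
        exact H ⟨τ.symm s, by rw [← hs, ← Equiv.apply_symm_apply τ s, K.inr]; simp⟩
      rw [dif_neg H, dif_neg H']
      ext z
      simp only [LinearMap.smul_apply]
      rw [rcompPar_eq (parGraft_spec ((e'.cases j).resolve_right H').choose_spec.choose e' f
            ((e'.cases j).resolve_right H').choose_spec.choose_spec) K _ _ h r hh rfl
          (by linear_combination h + hh),
        rcompPar_eq (parGraft_spec ((e'.cases j).resolve_right H').choose_spec.choose e' f
            ((e'.cases j).resolve_right H').choose_spec.choose_spec) (ActCompat.refl e') _ _ h r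
          hh rfl (by linear_combination h + hh), T.act_one, T.act_one])

theorem rcomp_mk_seq {m l n m₀ p q : ℕ} {a₀ a b c t c' : ℤ} {j : Fin n} {f : Graft n m₀ p j}
    {i : Fin m} {s : Fin l} {e : Graft m l n i} {e' : Graft l m₀ q s} {f' : Graft m q p i}
    (K : SeqCompat i s j e f e' f') (h : a + a₀ = t) (r : ℕ) (hr : b + c = a + 2 * (r : ℤ))
    (hc : c + a₀ = c') (hr' : b + c' = t + 2 * (r : ℤ)) (x : T.obj m b) (y : T.obj l c)
    (z : T.obj m₀ a₀) :
    rcomp j f h (mk r i e hr x y) z = mk r i f' hr' x (T.comp s e' hc y z) := by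
  have H : ∃ s, e (Sum.inr s) = j := ⟨s, K.base⟩
  rw [rcomp, lift_mk, dif_pos H, rcompSeq_eq K (ActCompat.refl e) _ h r hr hc hr', T.act_one,
    T.act_one]

theorem rcomp_mk_par {m l n m₀ p q : ℕ} {a₀ a b c t b' : ℤ} {j : Fin n} {f : Graft n m₀ p j}
    {i s : Fin m} {i₁ : Fin q} {e : Graft m l n i} {e' : Graft m m₀ q s} {f' : Graft q l p i₁}
    (K : ParCompat i s i₁ j e f e' f') (h : a + a₀ = t) (r : ℕ) (hr : b + c = a + 2 * (r : ℤ))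
    (hb : b + a₀ = b') (hr' : b' + c = t + 2 * (r : ℤ)) (x : T.obj m b) (y : T.obj l c)
    (z : T.obj m₀ a₀) :
    rcomp j f h (mk r i e hr x y) z =
      koszulSign k (c * a₀) • mk r i₁ f' hr' (T.comp s e' hb x z) y := by
  have H : ¬ ∃ s, e (Sum.inr s) = j := by
    rintro ⟨s', hs'⟩
    exact Graft.inl_ne_inr e _ _ (K.base.trans hs'.symm)
  rw [rcomp, lift_mk, dif_neg H]
  simp only [LinearMap.smul_apply]
  rw [rcompPar_eq K (ActCompat.refl e) _ _ h r hr hb hr', T.act_one, T.act_one]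

end FreeInf

namespace FreeInf

variable {k : Type u} [Field k] {T : GradedOperad k}

theorem act_one (w : FreeInf T n a) : act 1 w = w :=
  hom_ext (f := act 1) (g := LinearMap.id) (fun r i e h x y => by rw [act_mk]; rfl) w

theorem act_mul (σ τ : Equiv.Perm (Fin n)) (w : FreeInf T n a) :
    act (σ * τ) w = act σ (act τ w) :=
  hom_ext (f := act (σ * τ)) (g := act σ ∘ₗ act τ) (fun r i e h x y => by
    rw [LinearMap.comp_apply, act_mk, act_mk, act_mk]; rfl) w

theorem lcomp_perm {m n p : ℕ} {a b c : ℤ} {i i' : Fin m} {σ : Equiv.Perm (Fin m)}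
    {τ : Equiv.Perm (Fin n)} {ρ : Equiv.Perm (Fin p)} {e : Graft m n p i} {e' : Graft m n p i'}
    (H : ActCompat i i' σ τ ρ e e') (h : a + b = c) (x : T.obj m a) (μ : FreeInf T n b) :
    lcomp i' e' h (T.act σ x) (act τ μ) = act ρ (lcomp i e h x μ) := by
  induction μ using induction with
  | zero => simp
  | add w w' hw hw' => simp only [map_add, hw, hw']
  | @mk m₁ l b₁ c₁ r j g hr y z =>
    obtain ⟨q, j₁, E₁, E₂, K⟩ := Graft.exists_left g e
    obtain ⟨E₁', -⟩ := E₁.exists_move i'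
    obtain ⟨ρ₁, H₁⟩ := Graft.exists_perm σ 1 H.base E₁ E₁'
    obtain ⟨E₂', K'⟩ := Graft.exists_seq_left E₁' (g.trans τ) e'
    have H₂ := K.perm_left K' H₁ (ActCompat.of_trans g τ) H
    have hr' : (a + b₁) + c₁ = c + 2 * (r : ℤ) := by linear_combination h + hr
    rw [act_mk, lcomp_mk K h r hr rfl hr', lcomp_mk K' h r hr rfl hr', ← mk_perm r H₂,
      ← T.comp_perm H₁, T.act_one, T.act_one]

theorem rcomp_perm {m n p : ℕ} {a b c : ℤ} {i i' : Fin m} {σ : Equiv.Perm (Fin m)}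
    {τ : Equiv.Perm (Fin n)} {ρ : Equiv.Perm (Fin p)} {e : Graft m n p i} {e' : Graft m n p i'}
    (H : ActCompat i i' σ τ ρ e e') (h : a + b = c) (μ : FreeInf T m a) (y : T.obj n b) :
    rcomp i' e' h (act σ μ) (T.act τ y) = act ρ (rcomp i e h μ y) := by
  induction μ using induction with
  | zero => simp
  | add w w' hw hw' => simp only [map_add, LinearMap.add_apply, hw, hw']
  | @mk m₁ l b₁ c₁ r j g hr x z =>
    rw [act_mk]
    have H₀ := ActCompat.of_trans g σ
    rcases g.cases i with ⟨s, hs, h0⟩ | ⟨s, h0⟩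
    · obtain ⟨E₂, K⟩ := Graft.exists_par hs g e (Graft.std n s) h0
      have h0' : (g.trans σ) (Sum.inl ⟨s, hs⟩) = i' := by rw [← H.base, ← h0]; rfl
      obtain ⟨E₂', K'⟩ := Graft.exists_par hs (g.trans σ) e' (Graft.std n s) h0'
      obtain ⟨ρ₁, H₁⟩ := Graft.exists_perm 1 τ rfl (Graft.std n s) (Graft.std n s)
      have H₂ := K.perm K' H₀ H H₁
      have hr' : (b₁ + b) + c₁ = c + 2 * (r : ℤ) := by linear_combination h + hr
      have h1 := T.comp_perm H₁ (rfl : b₁ + b = _) x y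
      rw [T.act_one] at h1
      have h2 := mk_perm r H₂ hr' (T.comp s (Graft.std n s) rfl x y) z
      rw [T.act_one] at h2
      rw [rcomp_mk_par K h r hr rfl hr', rcomp_mk_par K' h r hr rfl hr', map_smul, ← h2]
      exact congrArg (fun w => koszulSign k (c₁ * b) • mk r _ E₂' hr' w z) h1
    · obtain ⟨E₂, K⟩ := Graft.exists_seq_right g e (Graft.std n s) h0
      have h0' : (g.trans σ) (Sum.inr s) = i' := by rw [← H.base, ← h0]; rfl
      obtain ⟨E₂', K'⟩ := Graft.exists_seq_right (g.trans σ) e' (Graft.std n s) h0'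
      obtain ⟨ρ₁, H₁⟩ := Graft.exists_perm 1 τ rfl (Graft.std n s) (Graft.std n s)
      have H₂ := K.perm_right K' H₀ H H₁
      have hr' : b₁ + (c₁ + b) = c + 2 * (r : ℤ) := by linear_combination h + hr
      have h1 := T.comp_perm H₁ (rfl : c₁ + b = _) z y
      rw [T.act_one] at h1
      have h2 := mk_perm r H₂ hr' x (T.comp s (Graft.std n s) rfl z y)
      rw [T.act_one] at h2
      rw [rcomp_mk_seq K h r hr rfl hr', rcomp_mk_seq K' h r hr rfl hr', ← h2]
      exact congrArg (mk r j E₂' hr' x) h1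

theorem id_lcomp {n : ℕ} {b : ℤ} (i : Fin 1) (e : Graft 1 n n i) (h : 0 + b = b)
    (he : ∀ j, e (Sum.inr j) = j) (μ : FreeInf T n b) : lcomp i e h T.id μ = μ := by
  obtain rfl : i = 0 := Subsingleton.elim _ _
  induction μ using induction with
  | zero => simp
  | add w w' hw hw' => simp only [map_add, hw, hw']
  | @mk m₁ l b₁ c₁ r j g hr y z =>
    have K : SeqCompat 0 j j (Graft.unit' m₁) g g e :=
      ⟨rfl, fun s hs => absurd (Subsingleton.elim s 0) hs, fun s hs hs' => (he _).symm,
        fun s => (he _).symm⟩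
    rw [lcomp_mk K h r hr (zero_add _) hr, T.id_comp 0 _ _ (fun _ => rfl)]

theorem rcomp_id {m : ℕ} {a : ℤ} (i : Fin m) (e : Graft m 1 m i) (h : a + 0 = a)
    (he : ∀ (j : Fin m) (hj : j ≠ i), e (Sum.inl ⟨j, hj⟩) = j) (he' : e (Sum.inr 0) = i)
    (μ : FreeInf T m a) : rcomp i e h μ T.id = μ := by
  induction μ using induction with
  | zero => simp
  | add w w' hw hw' => simp only [map_add, LinearMap.add_apply, hw, hw']
  | @mk m₁ l b₁ c₁ r j g hr y z =>
    rcases g.cases i with ⟨s, hs, h0⟩ | ⟨s, h0⟩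
    · have K : ParCompat j s j i g e (Graft.unit s) g :=
        ⟨hs.symm, h0, rfl, fun t ht ht' _ _ => he _ _, fun t ht => he _ _,
          fun t _ => by rw [Subsingleton.elim t 0, he', ← h0]; rfl⟩
      rw [rcomp_mk_par K h r hr (add_zero _) hr, T.comp_id s _ _ (fun _ _ => rfl) rfl,
        koszulSign_even k (by simp), one_smul]
    · have K : SeqCompat j s i g e (Graft.unit s) g :=
        ⟨h0, fun t ht _ => he _ _, fun t ht _ => he _ _,
          fun t => by rw [Subsingleton.elim t 0, he', ← h0]; rfl⟩
      rw [rcomp_mk_seq K h r hr (add_zero _) hr, T.comp_id s _ _ (fun _ _ => rfl) rfl]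

variable {m n l p q r : ℕ} {a b c ab bc ac t : ℤ}

theorem seq_llr {i : Fin m} {j : Fin n} {j' : Fin p}
    {e : Graft m n p i} {f : Graft p l q j'} {e' : Graft n l r j} {f' : Graft m r q i}
    (H : SeqCompat i j j' e f e' f') (hab : a + b = ab) (habc : ab + c = t) (hbc : b + c = bc)
    (habc' : a + bc = t) (x : T.obj m a) (y : T.obj n b) (μ : FreeInf T l c) :
    lcomp j' f habc (T.comp i e hab x y) μ = lcomp i f' habc' x (lcomp j e' hbc y μ) := by
  induction μ using induction with
  | zero => simp
  | add w w' hw hw' => simp only [map_add, hw, hw']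
  | @mk m₁ l₁ b₁ c₁ s u g hr v w =>
    obtain ⟨q₁, i₁, E₁, E₂, K₁⟩ := Graft.exists_left g e'
    obtain ⟨q₃, i₃, E₃, E₄, K₂⟩ := Graft.exists_left E₂ f'
    obtain ⟨E₅, K₃⟩ := Graft.exists_seq_left' e H.base E₁ E₃
    have K₄ := SeqCompat.pentagon_llr H K₁ K₂ K₃
    have h1 : (b + b₁) + c₁ = bc + 2 * (s : ℤ) := by linear_combination hbc + hr
    have h2 : (a + (b + b₁)) + c₁ = t + 2 * (s : ℤ) := by linear_combination habc' + h1
    rw [lcomp_mk K₁ hbc s hr rfl h1, lcomp_mk K₂ habc' s h1 rfl h2,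
      lcomp_mk K₄ habc s hr (by lia) h2, T.comp_seq K₃ hab (by lia) rfl rfl]

theorem seq_lr {i : Fin m} {j : Fin n} {j' : Fin p}
    {e : Graft m n p i} {f : Graft p l q j'} {e' : Graft n l r j} {f' : Graft m r q i}
    (H : SeqCompat i j j' e f e' f') (hab : a + b = ab) (habc : ab + c = t) (hbc : b + c = bc)
    (habc' : a + bc = t) (x : T.obj m a) (μ : FreeInf T n b) (z : T.obj l c) :
    rcomp j' f habc (lcomp i e hab x μ) z = lcomp i f' habc' x (rcomp j e' hbc μ z) := by
  induction μ using induction with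
  | zero => simp
  | add w w' hw hw' => simp only [map_add, LinearMap.add_apply, hw, hw']
  | @mk m₁ l₁ b₁ c₁ s u g hr v w =>
    obtain ⟨q₁, i₁, E₁, E₂, K₁⟩ := Graft.exists_left g e
    have h1 : (a + b₁) + c₁ = ab + 2 * (s : ℤ) := by linear_combination hab + hr
    rw [lcomp_mk K₁ hab s hr rfl h1]
    rcases g.cases j with ⟨v₀, hv, h0⟩ | ⟨v₀, h0⟩
    · obtain ⟨q₃, i₃, E₃, E₅, K₃⟩ := Graft.exists_right_par hv g e' h0
      obtain ⟨q₄, i₄, E₈, E₉, K₄⟩ := Graft.exists_left E₅ f'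
      obtain ⟨E₆, K₅⟩ := Graft.exists_seq_left E₁ E₃ E₈
      have hne : E₁ (Sum.inr v₀) ≠ i₁ := by rw [← K₁.base]; simpa using hv
      have hj' : E₂ (Sum.inl ⟨E₁ (Sum.inr v₀), hne⟩) = j' := by
        rw [K₁.inl_inr v₀ hv, h0, H.base]
      have hi4 : E₆ (Sum.inl ⟨i₁, hne.symm⟩) = i₄ := by
        have h2 : E₁ (Sum.inr u) ≠ E₁ (Sum.inr v₀) := by simpa using hv.symm
        have h3 := K₅.inl_inr u hv.symm h2
        rw [K₃.base', K₄.base] at h3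
        rw [← h3]
        simp only [K₁.base]
      obtain ⟨E₇, K₂⟩ := Graft.exists_par' hne E₂ f E₆ hj' hi4
      have K₄' := SeqCompat.pentagon_lr' H K₁ K₂ K₃ K₅
      have h2 : (b₁ + c) + c₁ = bc + 2 * (s : ℤ) := by linear_combination hbc + hr
      have h3 : (a + (b₁ + c)) + c₁ = t + 2 * (s : ℤ) := by linear_combination habc' + h2
      rw [rcomp_mk_par K₂ habc s h1 (by lia) h3, rcomp_mk_par K₃ hbc s hr rfl h2, map_smul,
        lcomp_mk K₄' habc' s h2 rfl h3, T.comp_seq K₅ rfl (by lia) rfl rfl]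
    · obtain ⟨q₃, E₃, E₅, K₃⟩ := Graft.exists_right g e' h0
      have hj' : E₂ (Sum.inr v₀) = j' := by rw [K₁.inr, h0, H.base]
      obtain ⟨E₄, K₂⟩ := Graft.exists_seq_right E₂ f E₃ hj'
      have K₄ := SeqCompat.pentagon_lr H K₁ K₂ K₃
      have h2 : b₁ + (c₁ + c) = bc + 2 * (s : ℤ) := by linear_combination hbc + hr
      have h3 : (a + b₁) + (c₁ + c) = t + 2 * (s : ℤ) := by linear_combination habc' + h2
      rw [rcomp_mk_seq K₂ habc s h1 rfl h3, rcomp_mk_seq K₃ hbc s hr rfl h2,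
        lcomp_mk K₄ habc' s h2 rfl h3]

theorem seq_rr {i : Fin m} {j : Fin n} {j' : Fin p}
    {e : Graft m n p i} {f : Graft p l q j'} {e' : Graft n l r j} {f' : Graft m r q i}
    (H : SeqCompat i j j' e f e' f') (hab : a + b = ab) (habc : ab + c = t) (hbc : b + c = bc)
    (habc' : a + bc = t) (μ : FreeInf T m a) (y : T.obj n b) (z : T.obj l c) :
    rcomp j' f habc (rcomp i e hab μ y) z = rcomp i f' habc' μ (T.comp j e' hbc y z) := by
  induction μ using induction with
  | zero => simp
  | add w w' hw hw' => simp only [map_add, LinearMap.add_apply, hw, hw']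
  | @mk m₁ l₁ b₁ c₁ s u g hr v w =>
    rcases g.cases i with ⟨v₀, hv, h0⟩ | ⟨v₀, h0⟩
    · obtain ⟨q₁, i₁, E₁, E₂, K₁⟩ := Graft.exists_right_par hv g e h0
      have h1 : (b₁ + b) + c₁ = ab + 2 * (s : ℤ) := by linear_combination hab + hr
      have hne : E₁ (Sum.inr j) ≠ i₁ := by
        rw [← K₁.base']; exact (Graft.inl_ne_inr _ _ _).symm
      have hj' : E₂ (Sum.inl ⟨E₁ (Sum.inr j), hne⟩) = j' := by
        rw [← K₁.inr, H.base]
      obtain ⟨E₅, -⟩ : ∃ _ : Graft m₁ r (Fintype.card ({t // t ≠ v₀} ⊕ Fin r)) v₀, True :=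
        ⟨Graft.std r v₀, trivial⟩
      obtain ⟨E₃, K₃⟩ := Graft.exists_seq_left E₁ e' E₅
      obtain ⟨E₄, K₂⟩ := Graft.exists_par hne E₂ f E₃ hj'
      have K₄ := ParCompat.pentagon_rr H K₁ K₂ K₃
      have h2 : (b₁ + bc) + c₁ = t + 2 * (s : ℤ) := by linear_combination habc' + hr
      rw [rcomp_mk_par K₁ hab s hr rfl h1, map_smul, LinearMap.smul_apply,
        rcomp_mk_par K₂ habc s h1 (by lia) h2, rcomp_mk_par K₄ habc' s hr rfl h2,
        T.comp_seq K₃ rfl (by lia) hbc rfl, smul_smul, ← koszulSign_add]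
      congr 2
      rw [← hbc]; ring
    · obtain ⟨q₁, E₁, E₂, K₁⟩ := Graft.exists_right g e h0
      have h1 : b₁ + (c₁ + b) = ab + 2 * (s : ℤ) := by linear_combination hab + hr
      have hj' : E₂ (Sum.inr (E₁ (Sum.inr j))) = j' := by
        rw [← K₁.inr, H.base]
      obtain ⟨E₅, -⟩ : ∃ _ : Graft l₁ r (Fintype.card ({t // t ≠ v₀} ⊕ Fin r)) v₀, True :=
        ⟨Graft.std r v₀, trivial⟩
      obtain ⟨E₃, K₃⟩ := Graft.exists_seq_left E₁ e' E₅
      obtain ⟨E₄, K₂⟩ := Graft.exists_seq_right E₂ f E₃ hj'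
      have K₄ := SeqCompat.pentagon_rr H K₁ K₂ K₃
      have h2 : b₁ + (c₁ + bc) = t + 2 * (s : ℤ) := by linear_combination habc' + hr
      rw [rcomp_mk_seq K₁ hab s hr rfl h1, rcomp_mk_seq K₂ habc s h1 (by lia) h2,
        rcomp_mk_seq K₄ habc' s hr rfl h2, T.comp_seq K₃ rfl (by lia) hbc rfl]

theorem par_lr {i j : Fin m} {i' : Fin r} {j' : Fin p}
    {e : Graft m n p i} {f : Graft p l q j'} {e' : Graft m l r j} {f' : Graft r n q i'}
    (H : ParCompat i j i' j' e f e' f') (hab : a + b = ab) (habc : ab + c = t) (hac : a + c = ac)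
    (hacb : ac + b = t) (x : T.obj m a) (μ : FreeInf T n b) (z : T.obj l c) :
    rcomp j' f habc (lcomp i e hab x μ) z =
      koszulSign k (b * c) • lcomp i' f' hacb (T.comp j e' hac x z) μ := by
  induction μ using induction with
  | zero => simp
  | add w w' hw hw' => simp only [map_add, LinearMap.add_apply, smul_add, hw, hw']
  | @mk m₁ l₁ b₁ c₁ s u g hr v w =>
    obtain ⟨q₁, i₁, E₁, E₂, K₁⟩ := Graft.exists_left g e
    have h1 : (a + b₁) + c₁ = ab + 2 * (s : ℤ) := by linear_combination hab + hr
    have hne : E₁ (Sum.inl ⟨j, H.ne.symm⟩) ≠ i₁ := by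
      rw [← K₁.base]; exact Graft.inl_ne_inr _ _ _
    have hj' : E₂ (Sum.inl ⟨E₁ (Sum.inl ⟨j, H.ne.symm⟩), hne⟩) = j' := by
      rw [K₁.inl_inl, H.base]
    obtain ⟨q₃, i₃, E₃, E₄, K₂⟩ := Graft.exists_right_par hne E₂ f hj'
    obtain ⟨E₅, K₃⟩ := Graft.exists_par' H.ne.symm E₁ E₃ e' rfl H.base'
    have K₄ := SeqCompat.hexagon_lr H K₁ K₂ K₃
    have h2 : (a + b₁ + c) + c₁ = t + 2 * (s : ℤ) := by linear_combination hab + habc + hr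
    rw [lcomp_mk K₁ hab s hr rfl h1, rcomp_mk_par K₂ habc s h1 rfl h2,
      lcomp_mk K₄ hacb s hr (by lia) h2, T.comp_par K₃ rfl rfl hac (by lia), map_smul,
      LinearMap.smul_apply, smul_smul, ← koszulSign_add]
    congr 1
    rw [show c₁ * c + b₁ * c = b * c + 2 * (s : ℤ) * c by linear_combination c * hr,
      koszulSign_add, koszulSign_even k (a := 2 * (s : ℤ) * c) ⟨s * c, by ring⟩, mul_one]

/-- The two compositions `(μ ∘ y) ∘ z` and `(μ ∘ z) ∘ y`, when `y` is grafted above `[r]` and `z`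
beside it. -/
theorem par_rr_mixed {i j : Fin m} {i' : Fin r} {j' : Fin p}
    {e : Graft m n p i} {f : Graft p l q j'} {e' : Graft m l r j} {f' : Graft r n q i'}
    (H : ParCompat i j i' j' e f e' f') (hab : a + b = ab) (habc : ab + c = t) (hac : a + c = ac)
    (hacb : ac + b = t) {m₁ l₁ : ℕ} {b₁ c₁ : ℤ} (s : ℕ) {u v₁ : Fin m₁} {v₀ : Fin l₁}
    (g : Graft m₁ l₁ m u) (hr : b₁ + c₁ = a + 2 * (s : ℤ)) (hv : v₁ ≠ u)
    (h0 : g (Sum.inr v₀) = i) (h0' : g (Sum.inl ⟨v₁, hv⟩) = j) (v : T.obj m₁ b₁)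
    (w : T.obj l₁ c₁) (y : T.obj n b) (z : T.obj l c) :
    rcomp j' f habc (rcomp i e hab (mk s u g hr v w) y) z =
      koszulSign k (b * c) • rcomp i' f' hacb (rcomp j e' hac (mk s u g hr v w) z) y := by
  obtain ⟨q₁, E₁, E₂, K₁⟩ := Graft.exists_right g e h0
  obtain ⟨q₂, i₃, E₁', E₂', K₁'⟩ := Graft.exists_right_par hv g e' h0'
  have hj' : E₂ (Sum.inl ⟨v₁, hv⟩) = j' := by
    have h1 := K₁.inl_inl v₁ hv (by rw [h0']; exact H.ne.symm)
    refine h1.symm.trans (Eq.trans ?_ H.base)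
    simp only [h0']
  obtain ⟨E₄, K₂⟩ := Graft.exists_par' hv E₂ f E₁' hj' K₁'.base'
  have K₄ := SeqCompat.hexagon_rr' H K₁ K₁' K₂
  have h1 : b₁ + (c₁ + b) = ab + 2 * (s : ℤ) := by linear_combination hab + hr
  have h2 : (b₁ + c) + c₁ = ac + 2 * (s : ℤ) := by linear_combination hac + hr
  have h3 : (b₁ + c) + (c₁ + b) = t + 2 * (s : ℤ) := by linear_combination hacb + h2
  rw [rcomp_mk_seq K₁ hab s hr rfl h1, rcomp_mk_par K₂ habc s h1 rfl h3,
    rcomp_mk_par K₁' hac s hr rfl h2, map_smul, LinearMap.smul_apply,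
    rcomp_mk_seq K₄ hacb s h2 rfl h3, smul_smul, ← koszulSign_add]
  congr 2
  ring

theorem par_rr {i j : Fin m} {i' : Fin r} {j' : Fin p}
    {e : Graft m n p i} {f : Graft p l q j'} {e' : Graft m l r j} {f' : Graft r n q i'}
    (H : ParCompat i j i' j' e f e' f') (hab : a + b = ab) (habc : ab + c = t) (hac : a + c = ac)
    (hacb : ac + b = t) (μ : FreeInf T m a) (y : T.obj n b) (z : T.obj l c) :
    rcomp j' f habc (rcomp i e hab μ y) z =
      koszulSign k (b * c) • rcomp i' f' hacb (rcomp j e' hac μ z) y := by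
  induction μ using induction with
  | zero => simp
  | add w w' hw hw' => simp only [map_add, LinearMap.add_apply, smul_add, hw, hw']
  | @mk m₁ l₁ b₁ c₁ s u g hr v w =>
    have hne := H.ne
    rcases g.cases i with ⟨v₀, hv, h0⟩ | ⟨v₀, h0⟩ <;>
      rcases g.cases j with ⟨v₁, hv', h0'⟩ | ⟨v₁, h0'⟩
    · have hvv : v₀ ≠ v₁ := by rintro rfl; exact hne (h0.symm.trans h0')
      obtain ⟨q₁, i₁, E₁, E₂, K₁⟩ := Graft.exists_right_par hv g e h0
      obtain ⟨q₂, i₂, E₁', E₂', K₁'⟩ := Graft.exists_right_par hv' g e' h0'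
      have hne' : E₁ (Sum.inl ⟨v₁, hvv.symm⟩) ≠ i₁ := by rw [← K₁.base']; simpa using hv'
      have hj' : E₂ (Sum.inl ⟨E₁ (Sum.inl ⟨v₁, hvv.symm⟩), hne'⟩) = j' := by
        refine (K₁.inl_inl v₁ hv' hvv.symm (by rw [h0']; exact hne.symm) hne').symm.trans
          (Eq.trans ?_ H.base)
        simp only [h0']
      obtain ⟨q₃, i₃, E₃, E₄, K₂⟩ := Graft.exists_right_par hne' E₂ f hj'
      obtain ⟨E₃', K₃⟩ := Graft.exists_par hvv.symm E₁ E₃ E₁' rfl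
      have K₄ := ParCompat.hexagon_rr H K₁ K₁' K₂ K₃
      have h1 : (b₁ + b) + c₁ = ab + 2 * (s : ℤ) := by linear_combination hab + hr
      have h2 : (b₁ + c) + c₁ = ac + 2 * (s : ℤ) := by linear_combination hac + hr
      have h3 : (b₁ + b + c) + c₁ = t + 2 * (s : ℤ) := by linear_combination habc + h1
      rw [rcomp_mk_par K₁ hab s hr rfl h1, map_smul, LinearMap.smul_apply,
        rcomp_mk_par K₂ habc s h1 rfl h3, rcomp_mk_par K₁' hac s hr rfl h2, map_smul,
        LinearMap.smul_apply, rcomp_mk_par K₄ hacb s h2 (by lia) h3,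
        T.comp_par K₃ rfl rfl rfl (by lia), map_smul, LinearMap.smul_apply, smul_smul, smul_smul,
        smul_smul, smul_smul]
      congr 1
      ring
    · have h1 := par_rr_mixed H.symm hac hacb hab habc s g hr hv h0' h0 v w z y
      rw [h1, smul_smul, mul_comm c b, koszulSign_mul_self, one_smul]
    · exact par_rr_mixed H hab habc hac hacb s g hr hv' h0 h0' v w y z
    · have hvv : v₀ ≠ v₁ := by rintro rfl; exact hne (h0.symm.trans h0')
      obtain ⟨q₁, E₁, E₂, K₁⟩ := Graft.exists_right g e h0
      obtain ⟨q₂, E₁', E₂', K₁'⟩ := Graft.exists_right g e' h0'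
      have hj' : E₂ (Sum.inr (E₁ (Sum.inl ⟨v₁, hvv.symm⟩))) = j' := by
        refine (K₁.inl_inr v₁ hvv.symm (by rw [h0']; exact hne.symm)).symm.trans
          (Eq.trans ?_ H.base)
        simp only [h0']
      obtain ⟨q₃, E₃, E₄, K₂⟩ := Graft.exists_right E₂ f hj'
      obtain ⟨E₃', K₃⟩ := Graft.exists_par hvv.symm E₁ E₃ E₁' rfl
      have K₄ := SeqCompat.hexagon_rr H K₁ K₁' K₂ K₃
      have h1 : b₁ + (c₁ + b) = ab + 2 * (s : ℤ) := by linear_combination hab + hr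
      have h2 : b₁ + (c₁ + c) = ac + 2 * (s : ℤ) := by linear_combination hac + hr
      have h3 : b₁ + (c₁ + b + c) = t + 2 * (s : ℤ) := by linear_combination habc + h1
      rw [rcomp_mk_seq K₁ hab s hr rfl h1, rcomp_mk_seq K₂ habc s h1 rfl h3,
        rcomp_mk_seq K₁' hac s hr rfl h2, rcomp_mk_seq K₄ hacb s h2 (by lia) h3,
        T.comp_par K₃ rfl rfl rfl (by lia), map_smul]

end FreeInf

/-- The free infinitesimal bimodule over `T` on unary generators `[r]`, `r ≥ 0`, of degree
`-2r`. -/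
noncomputable abbrev freeInf {k : Type u} [Field k] (T : GradedOperad k) : InfBimodule T where
  obj := FreeInf T
  act := FreeInf.act
  lcomp := FreeInf.lcomp
  rcomp := FreeInf.rcomp
  act_one := FreeInf.act_one
  act_mul := FreeInf.act_mul
  lcomp_perm := FreeInf.lcomp_perm
  rcomp_perm := FreeInf.rcomp_perm
  id_lcomp := FreeInf.id_lcomp
  rcomp_id := FreeInf.rcomp_id
  seq_llr := FreeInf.seq_llr
  seq_lr := FreeInf.seq_lr
  seq_rr := FreeInf.seq_rr
  par_rr := FreeInf.par_rr
  par_lr := FreeInf.par_lr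

/-! ### Quasi-isomorphisms and equivariant homotopy inverses -/

namespace EquivFam

variable {k : Type u} [Field k] {T S R : GradedOperad k} {p q s : ℤ}

/-- The identity family. -/
def refl (T : GradedOperad k) : EquivFam T T 0 where
  map {_ a a'} h := (show a = a' by lia) ▸ LinearMap.id
  map_act {_ a a'} h σ x := by obtain rfl : a = a' := by lia
                               rfl

/-- The composition of two families. -/
def comp (g : EquivFam S R q) (f : EquivFam T S p) (h : p + q = s) : EquivFam T R s where
  map {_ a a'} h' := g.map (show a + p + q = a' by lia) ∘ₗ f.map rfl
  map_act h σ x := by simp [f.map_act, g.map_act]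

theorem comp_map (g : EquivFam S R q) (f : EquivFam T S p) (h : p + q = s) {n : ℕ} {a b c : ℤ}
    (h₁ : a + p = b) (h₂ : b + q = c) (h₃ : a + s = c) (x : T.obj n a) :
    (g.comp f h).map h₃ x = g.map h₂ (f.map h₁ x) := by
  subst h₁; rfl

/-- The sum of two families. -/
def add (f g : EquivFam T S p) : EquivFam T S p where
  map h := f.map h + g.map h
  map_act h σ x := by simp [f.map_act, g.map_act]

/-- A scalar multiple of a family. -/
def smul (c : k) (f : EquivFam T S p) : EquivFam T S p where
  map h := c • f.map h
  map_act h σ x := by simp [f.map_act]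

theorem add_map (f g : EquivFam T S p) {n : ℕ} {a b : ℤ} (h : a + p = b) (x : T.obj n a) :
    (f.add g).map h x = f.map h x + g.map h x := rfl

theorem smul_map (c : k) (f : EquivFam T S p) {n : ℕ} {a b : ℤ} (h : a + p = b) (x : T.obj n a) :
    (smul c f).map h x = c • f.map h x := rfl

/-- The family of maps of degree `0` given by maps that are compatible with the action. -/
def ofMap (f : ∀ {n : ℕ} {a : ℤ}, T.obj n a →ₗ[k] S.obj n a)
    (hf : ∀ {n : ℕ} {a : ℤ} (σ : Equiv.Perm (Fin n)) (x : T.obj n a),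
      f (T.act σ x) = S.act σ (f x)) : EquivFam T S 0 where
  map {_ a a'} h := (show a = a' by lia) ▸ f
  map_act {_ a a'} h σ x := by obtain rfl : a = a' := by lia
                               exact hf σ x

/-- The family of maps of degree `1` given by maps that are compatible with the action. -/
def ofMap₁ (f : ∀ {n : ℕ} {a : ℤ}, T.obj n a →ₗ[k] S.obj n (a + 1))
    (hf : ∀ {n : ℕ} {a : ℤ} (σ : Equiv.Perm (Fin n)) (x : T.obj n a),
      f (T.act σ x) = S.act σ (f x)) : EquivFam T S 1 where
  map {_ a a'} h := h ▸ f
  map_act {_ a a'} h σ x := by subst h; exact hf σ x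

end EquivFam

section

variable {k : Type u} [Field k]

/-- The differential of a dg-operad, as an equivariant family of degree `1`. -/
def DGOperad.dFam (P : DGOperad k) : EquivFam P.toGradedOperad P.toGradedOperad 1 :=
  EquivFam.ofMap₁ P.d P.d_act

theorem DGOperad.dFam_dFam (P : DGOperad k) {n : ℕ} {a b c : ℤ} (h : a + 1 = b) (h' : b + 1 = c)
    (x : P.obj n a) : P.dFam.map h' (P.dFam.map h x) = 0 := by
  subst h h'
  exact P.d_d x

theorem DGOperad.Hom.map_dFam {P Q : DGOperad k} (f : DGOperad.Hom P Q) {n : ℕ} {a b : ℤ}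
    (h : a + 1 = b) (x : P.obj n a) : f.map (P.dFam.map h x) = Q.dFam.map h (f.map x) := by
  subst h
  exact f.map_d x

/-- The mapping cone of `f` is acyclic, expressed by elements. -/
def DGOperad.Hom.ConeAcyclic {P Q : DGOperad k} (f : DGOperad.Hom P Q) : Prop :=
  ∀ (n : ℕ) (a₁ a a₂ : ℤ) (h : a₁ + 1 = a) (h' : a + 1 = a₂) (x : P.obj n a₂) (y : Q.obj n a),
    P.d x = 0 → Q.dFam.map h' y = f.map x → ∃ (x' : P.obj n a) (y' : Q.obj n a₁),
      P.dFam.map h' x' = x ∧ f.map x' = y + Q.dFam.map h y'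

theorem DGOperad.complex_d (P : DGOperad k) {n : ℕ} {a b : ℤ} (h : a + 1 = b) :
    (P.complex n).d a b = ModuleCat.ofHom (P.dFam.map h) := by
  subst h
  simp only [DGOperad.complex, CochainComplex.of_d]
  rfl

theorem DGOperad.Hom.complexMap_f {P Q : DGOperad k} (f : DGOperad.Hom P Q) (n : ℕ) (a : ℤ) :
    (f.complexMap n).f a = ModuleCat.ofHom f.map := rfl

theorem ModuleCat.exists_lift {A X Y : ModuleCat.{u} k} (f : A ⟶ Y) (g : X ⟶ Y)
    (h : ∀ a, ∃ x, g x = f a) : ∃ l : A ⟶ X, l ≫ g = f := by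
  have : Module.Free k A := Module.Free.of_divisionRing k A
  have : Module.Projective k A := Module.Projective.of_free
  obtain ⟨l, hl⟩ := Module.projective_lifting_property (P := A) g.hom.rangeRestrict
    (f.hom.codRestrict (LinearMap.range g.hom) fun a => LinearMap.mem_range.mpr (h a))
    (LinearMap.surjective_rangeRestrict _)
  refine ⟨ModuleCat.ofHom l, ?_⟩
  ext a
  exact congrArg Subtype.val (LinearMap.congr_fun hl a)

/-- Injectivity and surjectivity on cohomology in all degrees amount to acyclicity of the cone. -/
theorem DGOperad.Hom.quasiIso_iff_coneAcyclic {P Q : DGOperad k} (f : DGOperad.Hom P Q) :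
    DGOperad.quasiIso k f ↔ f.ConeAcyclic := by
  have key : ∀ (n : ℕ) (i j l : ℤ) (hi : i + 1 = j) (hl : j + 1 = l),
      ((Mono (HomologicalComplex.homologyMap (f.complexMap n) j) ↔
        ∀ (x : P.obj n j) (y : Q.obj n i), P.dFam.map hl x = 0 → Q.dFam.map hi y = f.map x →
          ∃ x' : P.obj n i, P.dFam.map hi x' = x)) ∧
      ((Epi (HomologicalComplex.homologyMap (f.complexMap n) j) ↔
        ∀ (y : Q.obj n j), Q.dFam.map hl y = 0 →
          ∃ (x' : P.obj n j) (y' : Q.obj n i), P.dFam.map hl x' = 0 ∧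
            y = f.map x' + Q.dFam.map hi y')) := by
    intro n i j l hi hl
    have hi' : (ComplexShape.up ℤ).prev j = i := by simp [← hi]
    have hl' : (ComplexShape.up ℤ).next j = l := by simp [hl]
    constructor
    · rw [HomologicalComplex.mono_homologyMap_iff_up_to_refinements _ i j l hi' hl',
        P.complex_d hi, P.complex_d hl, Q.complex_d hi, f.complexMap_f]
      constructor
      · intro H x y hx hy
        -- Elements are morphisms from `k`, and an epimorphism onto `k` hits `1`.
        obtain ⟨A', π, hπ, x₁, h1⟩ := H (A := ModuleCat.of k k)
          (ModuleCat.ofHom (LinearMap.toSpanSingleton k (P.obj n j) x)) (by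
            ext; change P.dFam.map hl ((1 : k) • x) = _; rw [one_smul, hx]; rfl)
          (ModuleCat.ofHom (LinearMap.toSpanSingleton k (Q.obj n i) y)) (by
            ext
            change f.map ((1 : k) • x) = Q.dFam.map hi ((1 : k) • y)
            rw [one_smul, one_smul, hy])
        obtain ⟨a', h2⟩ := (ModuleCat.epi_iff_surjective π).mp hπ (1 : k)
        refine ⟨x₁ a', ?_⟩
        have h3 : π.hom a' • x = P.dFam.map hi (x₁.hom a') := congrArg (fun f => f.hom a') h1
        have h2 : π.hom a' = (1 : k) := h2
        rw [h2, one_smul] at h3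
        exact h3.symm
      · intro H A x₂ hx y₁ hy
        obtain ⟨t, ht⟩ := ModuleCat.exists_lift x₂ (ModuleCat.ofHom (P.dFam.map hi)) (fun a => by
          obtain ⟨x', h⟩ := H (x₂ a) (y₁ a) (congrArg (fun f => f.hom a) hx)
            (congrArg (fun f => f.hom a) hy).symm
          exact ⟨x', h⟩)
        exact ⟨A, 𝟙 A, inferInstance, t, by rw [Category.id_comp]; exact ht.symm⟩
    · rw [HomologicalComplex.epi_homologyMap_iff_up_to_refinements _ i j l hi' hl',
        P.complex_d hl, Q.complex_d hi, Q.complex_d hl, f.complexMap_f]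
      constructor
      · intro H y hy
        obtain ⟨A', π, hπ, x₂, h1, y₁, h2⟩ := H (A := ModuleCat.of k k)
          (ModuleCat.ofHom (LinearMap.toSpanSingleton k (Q.obj n j) y)) (by
            ext; change Q.dFam.map hl ((1 : k) • y) = _; rw [one_smul, hy]; rfl)
        obtain ⟨a', h3⟩ := (ModuleCat.epi_iff_surjective π).mp hπ (1 : k)
        refine ⟨x₂ a', y₁ a', congrArg (fun f => f.hom a') h1, ?_⟩
        have h4 : π.hom a' • y = f.map (x₂.hom a') + Q.dFam.map hi (y₁.hom a') :=
          congrArg (fun f => f.hom a') h2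
        have h3 : π.hom a' = (1 : k) := h3
        rw [h3, one_smul] at h4
        exact h4
      · intro H A y₂ hy
        let G : ModuleCat.of k (LinearMap.ker (P.dFam.map (n := n) hl) × Q.obj n i) ⟶
            ModuleCat.of k (Q.obj n j) :=
          ModuleCat.ofHom ((f.map ∘ₗ Submodule.subtype _).coprod (Q.dFam.map hi))
        obtain ⟨t, ht⟩ := ModuleCat.exists_lift y₂ G (fun a => by
          obtain ⟨x', y', h, h'⟩ := H (y₂ a) (congrArg (fun f => f.hom a) hy)
          exact ⟨(⟨x', h⟩, y'), by rw [h']; rfl⟩)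
        refine ⟨A, 𝟙 A, inferInstance, ModuleCat.ofHom (Submodule.subtype _ ∘ₗ LinearMap.fst k _ _
          ∘ₗ t.hom), ?_, ModuleCat.ofHom (LinearMap.snd k _ _ ∘ₗ t.hom), ?_⟩
        · ext a
          exact (t.hom a).1.2
        · rw [← ht]
          ext a
          rfl
  constructor
  · intro H n a₁ a a₂ h h' x y hx hy
    have Hq := H n
    have h1 : IsIso (HomologicalComplex.homologyMap (f.complexMap n) a₂) := by
      rw [← quasiIsoAt_iff_isIso_homologyMap]; exact Hq.quasiIsoAt _
    have h2 : IsIso (HomologicalComplex.homologyMap (f.complexMap n) a) := by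
      rw [← quasiIsoAt_iff_isIso_homologyMap]; exact Hq.quasiIsoAt _
    obtain ⟨x₀, hx₀⟩ := (key n a a₂ _ h' rfl).1.mp inferInstance x y hx hy
    obtain ⟨x₁, y₁, hx₁, hy₁⟩ := (key n a₁ a a₂ h h').2.mp inferInstance (y - f.map x₀) (by
      rw [map_sub, hy, ← f.map_dFam, hx₀, sub_self])
    refine ⟨x₀ + x₁, -y₁, by rw [map_add, hx₀, hx₁, add_zero], ?_⟩
    rw [map_add, map_neg, ← sub_eq_add_neg, eq_sub_iff_add_eq, add_assoc, ← hy₁]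
    abel
  · intro H n
    rw [quasiIso_iff]
    intro j
    rw [quasiIsoAt_iff_isIso_homologyMap]
    obtain ⟨i, rfl⟩ : ∃ i, j = i + 1 := ⟨j - 1, by lia⟩
    have h1 := (key n i (i + 1) _ rfl rfl).1.mpr (fun x y hx hy => by
      obtain ⟨x', -, h, -⟩ := H n (i - 1) i _ (by lia) rfl x y hx hy
      exact ⟨x', h⟩)
    have h2 := (key n i (i + 1) _ rfl rfl).2.mpr (fun y hy => by
      obtain ⟨x', y', h, h'⟩ := H n i (i + 1) _ rfl rfl 0 y (map_zero _) (by rw [hy, map_zero])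
      exact ⟨x', -y', h, by rw [h', map_neg]; abel⟩)
    exact isIso_of_mono_of_epi _

end

section

variable {k : Type u} [Field k]

/-- A linear map of representations of a finite group has an equivariant generalized inverse:
average any linear one. -/
theorem exists_equivariant_generalizedInverse [CharZero k] {G V W : Type*} [Group G] [Fintype G]
    [AddCommGroup V] [Module k V] [AddCommGroup W] [Module k W] (ρ : Representation k G V)
    (τ : Representation k G W) (δ : V →ₗ[k] W) (hδ : ∀ σ v, δ (ρ σ v) = τ σ (δ v)) :
    ∃ s : W →ₗ[k] V, (∀ v, δ (s (δ v)) = δ v) ∧ ∀ σ w, s (τ σ w) = ρ σ (s w) := by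
  obtain ⟨r, hr⟩ := LinearMap.exists_rightInverse_of_surjective δ.rangeRestrict
    (LinearMap.range_rangeRestrict δ)
  obtain ⟨s, hs⟩ := LinearMap.exists_extend r
  have hs' : ∀ v, δ (s (δ v)) = δ v := fun v => by
    have h1 := LinearMap.congr_fun hs (δ.rangeRestrict v)
    have h2 := congrArg Subtype.val (LinearMap.congr_fun hr (δ.rangeRestrict v))
    exact (congrArg δ h1).trans h2
  refine ⟨((Fintype.card G : k)⁻¹) • ∑ g : G, ρ g ∘ₗ s ∘ₗ τ g⁻¹, fun v => ?_, fun σ w => ?_⟩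
  · simp only [LinearMap.smul_apply, LinearMap.sum_apply, LinearMap.comp_apply, map_smul, map_sum,
      hδ]
    have h1 : ∀ g : G, τ g (δ (s (τ g⁻¹ (δ v)))) = δ v := fun g => by
      rw [← hδ g⁻¹, hs', hδ, ← Module.End.mul_apply, ← map_mul, mul_inv_cancel, map_one]
      rfl
    rw [Finset.sum_congr rfl fun g _ => h1 g, Finset.sum_const, Finset.card_univ,
      ← Nat.cast_smul_eq_nsmul k, smul_smul, inv_mul_cancel₀, one_smul]
    exact_mod_cast Fintype.card_ne_zero
  · simp only [LinearMap.smul_apply, LinearMap.sum_apply, LinearMap.comp_apply, map_smul, map_sum]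
    congr 1
    refine Fintype.sum_equiv (Equiv.mulLeft σ⁻¹) _ _ fun g => ?_
    simp only [Equiv.coe_mulLeft, ← Module.End.mul_apply, ← map_mul]
    simp

/-- The action of the symmetric group on operations, as a representation. -/
def GradedOperad.rep (T : GradedOperad k) (n : ℕ) (a : ℤ) :
    Representation k (Equiv.Perm (Fin n)) (T.obj n a) where
  toFun := T.act
  map_one' := LinearMap.ext T.act_one
  map_mul' σ τ := LinearMap.ext (T.act_mul σ τ)

namespace DGOperad.Hom

variable {P Q : DGOperad k} (f : DGOperad.Hom P Q)

/-- The differential `(x, y) ↦ (dx, fx - dy)` of the mapping cone. -/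
def coneD {n : ℕ} {a b c : ℤ} (h : a + 1 = b) (h' : b + 1 = c) :
    (P.obj n b × Q.obj n a) →ₗ[k] (P.obj n c × Q.obj n b) :=
  (P.dFam.map h' ∘ₗ LinearMap.fst k _ _).prod
    (f.map ∘ₗ LinearMap.fst k _ _ - Q.dFam.map h ∘ₗ LinearMap.snd k _ _)

theorem coneD_apply {n : ℕ} {a b c : ℤ} (h : a + 1 = b) (h' : b + 1 = c) (x : P.obj n b)
    (y : Q.obj n a) : f.coneD h h' (x, y) = (P.dFam.map h' x, f.map x - Q.dFam.map h y) := rfl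

theorem coneD_coneD {n : ℕ} {a b c e : ℤ} (h : a + 1 = b) (h' : b + 1 = c) (h'' : c + 1 = e)
    (v : P.obj n b × Q.obj n a) : f.coneD h' h'' (f.coneD h h' v) = 0 := by
  obtain ⟨x, y⟩ := v
  rw [coneD_apply, coneD_apply, map_sub, Q.dFam_dFam, f.map_dFam, sub_zero, sub_self,
    P.dFam_dFam]
  rfl

/-- A homotopy inverse of the morphism `f`, equivariant and `k`-linear (but in general not
compatible with the compositions). -/
structure HomotopyInverse where
  inv : EquivFam Q.toGradedOperad P.toGradedOperad 0
  left : EquivFam P.toGradedOperad P.toGradedOperad (-1)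
  right : EquivFam Q.toGradedOperad Q.toGradedOperad (-1)
  inv_d {n : ℕ} {a b : ℤ} (h : a + 1 = b) (y : Q.obj n a) :
    inv.map (add_zero b) (Q.dFam.map h y) = P.dFam.map h (inv.map (add_zero a) y)
  inv_map {n : ℕ} {a b c : ℤ} (h : a + 1 = b) (h' : b + 1 = c) (x : P.obj n b) :
    inv.map (add_zero b) (f.map x) =
      x + P.dFam.map h (left.map (by lia) x) + left.map (by lia) (P.dFam.map h' x)
  map_inv {n : ℕ} {a b c : ℤ} (h : a + 1 = b) (h' : b + 1 = c) (y : Q.obj n b) :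
    f.map (inv.map (add_zero b) y) =
      y + Q.dFam.map h (right.map (by lia) y) + right.map (by lia) (Q.dFam.map h' y)

variable {f}

/-- In characteristic `0`, a morphism with acyclic cone has an equivariant homotopy inverse: an
equivariant contraction of the cone. -/
theorem ConeAcyclic.nonempty_homotopyInverse [CharZero k] (hf : f.ConeAcyclic) :
    Nonempty f.HomotopyInverse := by
  have hs : ∀ (n : ℕ) (a b c : ℤ) (h : a + 1 = b) (h' : b + 1 = c),
      ∃ s : (P.obj n c × Q.obj n b) →ₗ[k] (P.obj n b × Q.obj n a),
        (∀ v, f.coneD h h' (s (f.coneD h h' v)) = f.coneD h h' v) ∧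
        ∀ σ x y, s (P.act σ x, Q.act σ y) =
          (P.act σ (s (x, y)).1, Q.act σ (s (x, y)).2) := by
    intro n a b c h h'
    obtain ⟨s, hs, hs'⟩ := exists_equivariant_generalizedInverse
      ((P.rep n b).prod (Q.rep n a)) ((P.rep n c).prod (Q.rep n b)) (f.coneD h h') (by
        rintro σ ⟨x, y⟩
        change f.coneD h h' (P.act σ x, Q.act σ y) = (P.act σ _, Q.act σ _)
        rw [coneD_apply, P.dFam.map_act, Q.dFam.map_act, f.map_act, ← map_sub]
        rfl)
    exact ⟨s, hs, fun σ x y => hs' σ (x, y)⟩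
  choose s hs₁ hs₂ using hs
  obtain ⟨H, H_act, H_d⟩ : ∃ H : ∀ (n : ℕ) (a b c : ℤ) (_ : a + 1 = b) (_ : b + 1 = c),
      (P.obj n c × Q.obj n b) →ₗ[k] (P.obj n b × Q.obj n a),
      (∀ (n : ℕ) (a b c : ℤ) (h : a + 1 = b) (h' : b + 1 = c) (σ : Equiv.Perm (Fin n))
        (x : P.obj n c) (y : Q.obj n b), H n a b c h h' (P.act σ x, Q.act σ y) =
          (P.act σ (H n a b c h h' (x, y)).1, Q.act σ (H n a b c h h' (x, y)).2)) ∧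
      (∀ (n : ℕ) (a b c e : ℤ) (h : a + 1 = b) (h' : b + 1 = c) (h'' : c + 1 = e)
        (v : P.obj n c × Q.obj n b),
        f.coneD h h' (H n a b c h h' v) + H n b c e h' h'' (f.coneD h' h'' v) = v) := by
    -- The generalized inverse `s` of the differential `D` gives the contraction `s (1 - s D)`, since
    -- cycles of the cone are boundaries.
    refine ⟨fun n a b c h h' => s n a b c h h' ∘ₗ
      (LinearMap.id - s n b c (c + 1) h' rfl ∘ₗ f.coneD h' rfl), ?_, ?_⟩
    · intro n a b c h h' σ x y
      have h1 : f.coneD h' rfl (P.act σ x, Q.act σ y) =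
          (P.act σ (f.coneD h' rfl (x, y)).1, Q.act σ (f.coneD h' rfl (x, y)).2) := by
        rw [coneD_apply, P.dFam.map_act, Q.dFam.map_act, f.map_act, ← map_sub]
        rfl
      change s n a b c h h' ((P.act σ x, Q.act σ y) - s n b c _ h' rfl (f.coneD h' rfl _)) = _
      rw [h1, hs₂, Prod.mk_sub_mk, ← map_sub, ← map_sub, hs₂]
      rfl
    · intro n a b c e h h' h'' v
      subst h''
      change f.coneD h h' (s n a b c h h' (v - s n b c _ h' rfl (f.coneD h' rfl v))) +
        s n b c _ h' rfl (f.coneD h' rfl v - s n c _ _ rfl rfl (f.coneD rfl rfl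
          (f.coneD h' rfl v))) = _
      rw [coneD_coneD, map_zero, sub_zero]
      have h1 : f.coneD h' rfl (v - s n b c _ h' rfl (f.coneD h' rfl v)) = 0 := by
        rw [map_sub, hs₁, sub_self]
      obtain ⟨w, hw⟩ : ∃ w, f.coneD h h' w = v - s n b c _ h' rfl (f.coneD h' rfl v) := by
        generalize v - s n b c _ h' rfl (f.coneD h' rfl v) = v at h1
        obtain ⟨x, y⟩ := v
        rw [coneD_apply] at h1
        obtain ⟨x', y', h2, h3⟩ := hf n a b c h h' x y (congrArg Prod.fst h1)
          (sub_eq_zero.mp (congrArg Prod.snd h1)).symm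
        exact ⟨(x', y'), by rw [coneD_apply, h2, h3, add_sub_cancel_right]⟩
      rw [← hw, hs₁, hw, sub_add_cancel]
  clear hs₁ hs₂ s
  have H_fst : ∀ (n : ℕ) (a b c : ℤ) (h : a + 1 = b) (h' : b + 1 = c) (v : P.obj n c × Q.obj n b),
      (H n a b c h h' v).1 = (H n (b - 1) b c (by lia) h' v).1 := by
    intro n a b c h h' v
    obtain rfl : a = b - 1 := by lia
    rfl
  -- The components of the contraction `H` of the cone are the inverse and the two homotopies.
  refine ⟨⟨EquivFam.ofMap (fun {n a} => LinearMap.fst k _ _ ∘ₗ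
      H n (a - 1) a (a + 1) (by lia) rfl ∘ₗ LinearMap.inr k _ _) (fun σ x => ?_),
    ⟨fun {n a a'} h => -(LinearMap.fst k _ _ ∘ₗ
      H n (a' - 1) a' a (by lia) (by lia) ∘ₗ LinearMap.inl k _ _), fun {n a a'} h σ x => ?_⟩,
    ⟨fun {n a a'} h => LinearMap.snd k _ _ ∘ₗ
      H n a' a (a + 1) (by lia) rfl ∘ₗ LinearMap.inr k _ _, fun {n a a'} h σ x => ?_⟩,
    fun {n a b} h y => ?_, fun {n a b c} h h' x => ?_, fun {n a b c} h h' y => ?_⟩⟩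
  · have h1 := H_act _ _ _ _ (sub_add_cancel _ 1) rfl σ 0 x
    rw [map_zero] at h1
    exact congrArg Prod.fst h1
  · have h1 := H_act _ _ _ _ (sub_add_cancel a' 1) (by lia) σ x 0
    rw [map_zero] at h1
    exact (congrArg (fun v => -Prod.fst v) h1).trans (map_neg _ _).symm
  · have h1 := H_act n a' a _ (by lia) rfl σ 0 x
    rw [map_zero] at h1
    exact congrArg Prod.snd h1
  · subst h
    have h1 := congrArg Prod.fst (H_d n (a - 1) a _ _ (by lia) rfl rfl (0, y))
    have h2 : f.coneD rfl rfl ((0 : P.obj n _), y) = -((0 : P.obj n _), Q.dFam.map rfl y) := by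
      rw [coneD_apply, map_zero, map_zero, zero_sub, Prod.neg_mk, neg_zero]
    rw [h2, map_neg] at h1
    exact (H_fst n a _ _ rfl rfl _).symm.trans (add_neg_eq_zero.mp h1).symm
  · have h1 := congrArg Prod.fst (H_d n (a - 1) a b c (by lia) h h' (x, 0))
    have h2 : f.coneD h h' (x, (0 : Q.obj n a)) = (P.dFam.map h' x, 0) + (0, f.map x) := by
      rw [coneD_apply, map_zero, sub_zero, Prod.mk_add_mk, add_zero, zero_add]
    rw [h2, map_add] at h1
    have h3 : P.dFam.map h (H n (a - 1) a b (by lia) h (x, 0)).1 +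
      ((H n a b c h h' (P.dFam.map h' x, 0)).1 + (H n a b c h h' (0, f.map x)).1) = x := h1
    change (H n (b - 1) b (b + 1) _ _ (0, f.map x)).1 = x +
      P.dFam.map h (-(H n (a - 1) a b _ _ (x, 0)).1) + -(H n (b - 1) b c _ _ (P.dFam.map h' x, 0)).1
    subst h'
    rw [← H_fst n a b _ h rfl, ← H_fst n a b _ h rfl, map_neg]
    rw [← sub_eq_zero] at h3 ⊢
    rw [← h3]
    abel
  · subst h'
    have h1 := congrArg Prod.snd (H_d n a b _ _ h rfl rfl (0, y))
    have h2 : f.coneD rfl rfl ((0 : P.obj n _), y) = -((0 : P.obj n _), Q.dFam.map rfl y) := by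
      rw [coneD_apply, map_zero, map_zero, zero_sub, Prod.neg_mk, neg_zero]
    rw [h2, map_neg] at h1
    have h3 : f.map (H n a b _ h rfl (0, y)).1 - Q.dFam.map h (H n a b _ h rfl (0, y)).2 +
      -(H n b _ _ rfl rfl (0, Q.dFam.map rfl y)).2 = y := h1
    change f.map (H n (b - 1) b (b + 1) _ _ (0, y)).1 = y +
      Q.dFam.map h (H n a b _ _ _ (0, y)).2 + (H n b _ _ _ _ (0, Q.dFam.map rfl y)).2
    rw [← H_fst n a b _ h rfl]
    rw [← sub_eq_zero] at h3 ⊢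
    rw [← h3]
    abel

end DGOperad.Hom

end

/-! ### Derivations, morphisms and contractions of the free infinitesimal bimodule -/

variable {k : Type u} [Field k]

theorem koszulSign_mul_even (k : Type u) [Field k] {a b : ℤ} (h : Even b) :
    koszulSign k (a * b) = 1 := koszulSign_even k (h.mul_left a)

/-- An equivariant family of degree `p` is a (graded) derivation of `T`. -/
def EquivFam.IsDer {T : GradedOperad k} {p : ℤ} (f : EquivFam T T p) : Prop :=
  ∀ {m n l : ℕ} {a b c a' b' c' : ℤ} (i : Fin m) (e : Graft m n l i) (h : a + b = c)
    (ha : a + p = a') (hb : b + p = b') (hc : c + p = c') (x : T.obj m a) (y : T.obj n b),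
    f.map hc (T.comp i e h x y) = T.comp i e (by lia) (f.map ha x) y +
      koszulSign k (p * a) • T.comp i e (by lia) x (f.map hb y)

theorem DGOperad.isDer_dFam (P : DGOperad k) : P.dFam.IsDer := by
  intro m n l a b c a' b' c' i e h ha hb hc x y
  subst ha hb hc
  rw [one_mul]
  exact P.d_comp i e h _ _ x y

namespace FreeInf

section Der

variable {T : GradedOperad k} {p : ℤ}

/-- The derivation `x ∘ᵢ [r] ∘ y ↦ f x ∘ᵢ [r] ∘ y ± x ∘ᵢ [r] ∘ f y` induced by a derivation of
degree `p`. -/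
noncomputable def der (f : EquivFam T T p) {n : ℕ} {a a' : ℤ} (h : a + p = a') :
    FreeInf T n a →ₗ[k] FreeInf T n a' :=
  map₂ 0 f (EquivFam.refl T) (by push_cast; lia) + map₂ 0 (EquivFam.refl T) f (by push_cast; lia)

theorem der_mk (f : EquivFam T T p) {m l n : ℕ} {a a' b c b' c' : ℤ} (ha : a + p = a') (r : ℕ)
    (i : Fin m) (e : Graft m l n i) (h : b + c = a + 2 * (r : ℤ)) (x : T.obj m b) (y : T.obj l c)
    (hb : b + p = b') (hc : c + p = c') (h' : b' + c = a' + 2 * (r : ℤ))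
    (h'' : b + c' = a' + 2 * (r : ℤ)) :
    der f ha (mk r i e h x y) = mk r i e h' (f.map hb x) y +
      koszulSign k (p * b) • mk r i e h'' x (f.map hc y) := by
  rw [der, LinearMap.add_apply, map₂_mk 0 f _ _ r i e h x y hb (add_zero c) h',
    map₂_mk 0 _ f _ r i e h x y (add_zero b) hc h'', zero_mul, koszulSign_even k (by decide),
    one_smul]
  rfl

theorem der_act (f : EquivFam T T p) {n : ℕ} {a a' : ℤ} (h : a + p = a')
    (σ : Equiv.Perm (Fin n)) (w : FreeInf T n a) : der f h (act σ w) = act σ (der f h w) := by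
  rw [der, LinearMap.add_apply, LinearMap.add_apply, map₂_act, map₂_act, map_add]

theorem der_lcomp {f : EquivFam T T p} (hf : f.IsDer) {m n l : ℕ} {a b c a' b' c' : ℤ} (i : Fin m)
    (e : Graft m n l i) (h : a + b = c) (ha : a + p = a') (hb : b + p = b') (hc : c + p = c')
    (x : T.obj m a) (w : FreeInf T n b) :
    der f hc (lcomp i e h x w) = lcomp i e (by lia) (f.map ha x) w +
      koszulSign k (p * a) • lcomp i e (by lia) x (der f hb w) := by
  induction w using induction with
  | zero => simp
  | add w w' hw hw' => simp only [map_add, hw, hw', smul_add]; abel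
  | @mk m₁ l₁ b₁ c₁ r j g hr y z =>
    obtain ⟨q, i₁, E₁, E₂, K⟩ := Graft.exists_left g e
    rw [lcomp_mk K h r hr rfl (by lia), der_mk f hc r i₁ E₂ _ _ z rfl rfl (by lia) (by lia),
      der_mk f hb r j g hr y z rfl rfl (by lia) (by lia), hf i E₁ rfl ha rfl rfl,
      lcomp_mk (b' := a + b₁ + p) K _ r hr (by lia) (by lia) (f.map ha x)]
    simp only [map_add, map_smul, LinearMap.add_apply, LinearMap.smul_apply, smul_add, smul_smul]
    rw [lcomp_mk (a := b') (t := c') (b' := a + b₁ + p) K (by lia) r (by lia) (by lia) (by lia) x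
        (f.map rfl y) z,
      lcomp_mk (a := b') (t := c') (b' := a + b₁) K (by lia) r (by lia) (by lia) (by lia) x y
        (f.map rfl z), mul_add, koszulSign_add]
    abel

theorem der_rcomp {f : EquivFam T T p} (hf : f.IsDer) {m n l : ℕ} {a b c a' b' c' : ℤ} (i : Fin m)
    (e : Graft m n l i) (h : a + b = c) (ha : a + p = a') (hb : b + p = b') (hc : c + p = c')
    (w : FreeInf T m a) (z : T.obj n b) :
    der f hc (rcomp i e h w z) = rcomp i e (by lia) (der f ha w) z +
      koszulSign k (p * a) • rcomp i e (by lia) w (f.map hb z) := by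
  induction w using induction with
  | zero => simp
  | add w w' hw hw' => simp only [map_add, LinearMap.add_apply, hw, hw', smul_add]; abel
  | @mk m₁ l₁ b₁ c₁ r j g hr x y =>
    have hs : koszulSign k (p * b₁) * koszulSign k (p * c₁) = koszulSign k (p * a) := by
      rw [← koszulSign_add, ← mul_add, hr, mul_add, koszulSign_add,
        koszulSign_mul_even k (b := 2 * (r : ℤ)) (by simp), mul_one]
    rw [der_mk f ha r j g hr x y rfl rfl (by lia) (by lia), map_add, map_smul,
      LinearMap.add_apply, LinearMap.smul_apply]
    rcases g.cases i with ⟨s, hs', h0⟩ | ⟨s, h0⟩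
    · obtain ⟨q, i₁, E₁, E₂, K⟩ := Graft.exists_right_par hs' g e h0
      rw [rcomp_mk_par (b' := b₁ + b) K h r hr (by lia) (by lia),
        rcomp_mk_par (b' := b₁ + b + p) (a := a') (t := c') K (by lia) r (by lia) (by lia) (by lia)
          (f.map rfl x) y z,
        rcomp_mk_par (b' := b₁ + b) (a := a') (t := c') K (by lia) r (by lia) (by lia) (by lia)
          x (f.map rfl y) z,
        rcomp_mk_par (b' := b₁ + b + p) (a₀ := b') (t := c') K (by lia) r hr (by lia) (by lia) x y
          (f.map hb z),
        map_smul,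
        der_mk f hc r i₁ E₂ _ _ y rfl rfl (by lia) (by lia), hf s E₁ rfl rfl hb rfl]
      simp only [map_add, map_smul, LinearMap.add_apply, LinearMap.smul_apply, smul_add, smul_smul]
      have h2 : koszulSign k (p * c₁) * koszulSign k (c₁ * p) = 1 := by
        rw [mul_comm c₁, koszulSign_mul_self]
      subst hb
      rw [← hs, mul_add c₁, mul_add p, add_mul, koszulSign_add, koszulSign_add, koszulSign_add,
        mul_comm p b]
      match_scalars <;> first | ring1 | linear_combination (-koszulSign k (p * b₁) * koszulSign k (c₁ * b)) * h2
    · obtain ⟨q, E₁, E₂, K⟩ := Graft.exists_right g e h0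
      rw [rcomp_mk_seq (c' := c₁ + b) K h r hr (by lia) (by lia),
        rcomp_mk_seq (c' := c₁ + b) (a := a') (t := c') K (by lia) r (by lia) (by lia) (by lia)
          (f.map rfl x) y z,
        rcomp_mk_seq (c' := c₁ + b + p) (a := a') (t := c') K (by lia) r (by lia) (by lia) (by lia)
          x (f.map rfl y) z,
        rcomp_mk_seq (c' := c₁ + b + p) (a₀ := b') (t := c') K (by lia) r hr (by lia) (by lia) x y
          (f.map hb z),
        der_mk f hc r j E₂ _ x _ rfl rfl (by lia) (by lia), hf s E₁ rfl rfl hb rfl, ← hs]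
      simp only [map_add, map_smul, LinearMap.add_apply, LinearMap.smul_apply, smul_add, smul_smul]
      abel

end Der

section Hom

variable {T S : GradedOperad k} (F : GradedOperad.Hom T S)

/-- The map `x ∘ᵢ [r] ∘ y ↦ F x ∘ᵢ [r] ∘ F y` induced by a morphism. -/
noncomputable def mapHom {n : ℕ} {a : ℤ} : FreeInf T n a →ₗ[k] FreeInf S n a :=
  map₂ 0 (EquivFam.ofMap F.map F.map_act) (EquivFam.ofMap F.map F.map_act) (by push_cast; lia)

theorem mapHom_mk {m l n : ℕ} {a b c : ℤ} (r : ℕ) (i : Fin m) (e : Graft m l n i)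
    (h : b + c = a + 2 * (r : ℤ)) (x : T.obj m b) (y : T.obj l c) :
    mapHom F (mk r i e h x y) = mk r i e h (F.map x) (F.map y) := by
  rw [mapHom, map₂_mk 0 _ _ _ r i e h x y (add_zero b) (add_zero c) h, zero_mul,
    koszulSign_even k (by decide), one_smul]
  rfl

theorem mapHom_act {n : ℕ} {a : ℤ} (σ : Equiv.Perm (Fin n)) (w : FreeInf T n a) :
    mapHom F (act σ w) = act σ (mapHom F w) := map₂_act _ _ _ _ _ _

theorem mapHom_lcomp {m n l : ℕ} {a b c : ℤ} (i : Fin m) (e : Graft m n l i) (h : a + b = c)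
    (x : T.obj m a) (w : FreeInf T n b) :
    mapHom F (lcomp i e h x w) = lcomp i e h (F.map x) (mapHom F w) := by
  induction w using induction with
  | zero => simp
  | add w w' hw hw' => simp only [map_add, hw, hw']
  | @mk m₁ l₁ b₁ c₁ r j g hr y z =>
    obtain ⟨q, i₁, E₁, E₂, K⟩ := Graft.exists_left g e
    rw [mapHom_mk, lcomp_mk K h r hr rfl (by lia), lcomp_mk K h r hr rfl (by lia), mapHom_mk,
      F.map_comp]

theorem mapHom_rcomp {m n l : ℕ} {a b c : ℤ} (i : Fin m) (e : Graft m n l i) (h : a + b = c)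
    (w : FreeInf T m a) (z : T.obj n b) :
    mapHom F (rcomp i e h w z) = rcomp i e h (mapHom F w) (F.map z) := by
  induction w using induction with
  | zero => simp
  | add w w' hw hw' => simp only [map_add, LinearMap.add_apply, hw, hw']
  | @mk m₁ l₁ b₁ c₁ r j g hr x y =>
    rcases g.cases i with ⟨s, hs', h0⟩ | ⟨s, h0⟩
    · obtain ⟨q, i₁, E₁, E₂, K⟩ := Graft.exists_right_par hs' g e h0
      rw [mapHom_mk, rcomp_mk_par K h r hr rfl (by lia), rcomp_mk_par K h r hr rfl (by lia),
        map_smul, mapHom_mk, F.map_comp]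
    · obtain ⟨q, E₁, E₂, K⟩ := Graft.exists_right g e h0
      rw [mapHom_mk, rcomp_mk_seq K h r hr rfl (by lia), rcomp_mk_seq K h r hr rfl (by lia),
        mapHom_mk, F.map_comp]

end Hom

section Contract

variable {T : GradedOperad k}

theorem _root_.GradedOperad.unit_act (T : GradedOperad k) {l : ℕ} {a b c : ℤ} (h : a + b = c)
    (τ : Equiv.Perm (Fin l)) (u : T.obj 1 a) (y : T.obj l b) :
    T.comp 0 (Graft.unit' l) h u (T.act τ y) = T.act τ (T.comp 0 (Graft.unit' l) h u y) := by
  have H : ActCompat 0 0 1 τ τ (Graft.unit' l) (Graft.unit' l) :=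
    ⟨rfl, fun j hj => absurd (Subsingleton.elim j 0) hj, fun _ => rfl⟩
  have h1 := T.comp_perm H h u y
  rwa [T.act_one] at h1

theorem _root_.GradedOperad.unit_comp (T : GradedOperad k) {l m q : ℕ} {a b c ab bc t : ℤ}
    (s : Fin l) (e : Graft l m q s) (hab : a + b = ab) (habc : ab + c = t) (hbc : b + c = bc)
    (habc' : a + bc = t) (u : T.obj 1 a) (y : T.obj l b) (z : T.obj m c) :
    T.comp s e habc (T.comp 0 (Graft.unit' l) hab u y) z =
      T.comp 0 (Graft.unit' q) habc' u (T.comp s e hbc y z) := by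
  have H : SeqCompat 0 s s (Graft.unit' l) e e (Graft.unit' q) :=
    ⟨rfl, fun j hj => absurd (Subsingleton.elim j 0) hj, fun _ _ _ => rfl, fun _ => rfl⟩
  exact T.comp_seq H hab habc hbc habc' u y z

/-- The morphism of bimodules `x ∘ᵢ [r] ∘ y ↦ x ∘ᵢ uᵣ ∘ y` that replaces the generators by unary
operations. -/
noncomputable def contract (u : ∀ r : ℕ, T.obj 1 (-2 * (r : ℤ))) {n : ℕ} {a : ℤ} :
    FreeInf T n a →ₗ[k] T.obj n a :=
  lift (fun {m l b c} r i e h => (T.comp i e (show b + (-2 * (r : ℤ) + c) = a by lia)).compl₂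
      (T.comp 0 (Graft.unit' l) rfl (u r))) (by
    intro m l b c r i i' e e' σ τ H h x y
    simp only [LinearMap.compl₂_apply]
    rw [T.unit_act, T.comp_perm H, T.act_one])

variable (u : ∀ r : ℕ, T.obj 1 (-2 * (r : ℤ)))

theorem contract_mk {m l n : ℕ} {a b c c' : ℤ} (r : ℕ) (i : Fin m) (e : Graft m l n i)
    (h : b + c = a + 2 * (r : ℤ)) (hc : -2 * (r : ℤ) + c = c') (ha : b + c' = a) (x : T.obj m b)
    (y : T.obj l c) : contract u (mk r i e h x y) =
      T.comp i e ha x (T.comp 0 (Graft.unit' l) hc (u r) y) := by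
  subst hc
  rw [contract, lift_mk]
  rfl

theorem contract_act {n : ℕ} {a : ℤ} (σ : Equiv.Perm (Fin n)) (w : FreeInf T n a) :
    contract u (act σ w) = T.act σ (contract u w) := by
  induction w using induction with
  | zero => simp
  | add w w' hw hw' => simp only [map_add, hw, hw']
  | @mk m₁ l₁ b₁ c₁ r j g hr y z =>
    have h1 := T.comp_perm (ActCompat.of_trans g σ)
      (show b₁ + (-2 * (r : ℤ) + c₁) = a by lia) y (T.comp 0 (Graft.unit' l₁) rfl (u r) z)
    rw [T.act_one, T.act_one] at h1
    rw [act_mk, contract_mk u r j _ hr rfl (by lia), contract_mk u r j _ hr rfl (by lia), h1]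

theorem contract_lcomp {m n l : ℕ} {a b c : ℤ} (i : Fin m) (e : Graft m n l i) (h : a + b = c)
    (x : T.obj m a) (w : FreeInf T n b) :
    contract u (lcomp i e h x w) = T.comp i e h x (contract u w) := by
  induction w using induction with
  | zero => simp
  | add w w' hw hw' => simp only [map_add, hw, hw']
  | @mk m₁ l₁ b₁ c₁ r j g hr y z =>
    obtain ⟨q, i₁, E₁, E₂, K⟩ := Graft.exists_left g e
    rw [lcomp_mk K h r hr rfl (by lia), contract_mk u r j g hr rfl (by lia),
      contract_mk u r i₁ E₂ _ rfl (by lia), T.comp_seq K]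

theorem contract_rcomp {m n l : ℕ} {a b c : ℤ} (i : Fin m) (e : Graft m n l i) (h : a + b = c)
    (w : FreeInf T m a) (z : T.obj n b) :
    contract u (rcomp i e h w z) = T.comp i e h (contract u w) z := by
  induction w using induction with
  | zero => simp
  | add w w' hw hw' => simp only [map_add, LinearMap.add_apply, hw, hw']
  | @mk m₁ l₁ b₁ c₁ r j g hr x y =>
    rw [contract_mk u r j g hr rfl (by lia)]
    rcases g.cases i with ⟨s, hs', h0⟩ | ⟨s, h0⟩
    · obtain ⟨q, i₁, E₁, E₂, K⟩ := Graft.exists_right_par hs' g e h0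
      rw [rcomp_mk_par K h r hr rfl (by lia), map_smul, contract_mk u r i₁ E₂ _ rfl (by lia),
        T.comp_par K (hac := rfl) (hacb := by lia), add_mul, koszulSign_add,
        koszulSign_even k (a := -2 * (r : ℤ) * b) ⟨-r * b, by ring⟩, one_mul]
    · obtain ⟨q, E₁, E₂, K⟩ := Graft.exists_right g e h0
      rw [rcomp_mk_seq K h r hr rfl (by lia), contract_mk u r j E₂ _ rfl (by lia),
        T.comp_seq K (by lia) h (show -2 * (r : ℤ) + c₁ + b = -2 * r + (c₁ + b) by lia) (by lia) x
          (T.comp 0 (Graft.unit' l₁) (rfl : -2 * (r : ℤ) + c₁ = _) (u r) y) z]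
      exact congrArg _ (T.unit_comp s E₁ rfl _ rfl _ _ _ _).symm

theorem contract_der {p : ℤ} {f : EquivFam T T p} (hf : f.IsDer)
    (hu : ∀ (r : ℕ) {b : ℤ} (h : -2 * (r : ℤ) + p = b), f.map h (u r) = 0) {n : ℕ} {a a' : ℤ}
    (h : a + p = a') (w : FreeInf T n a) :
    contract u (der f h w) = f.map h (contract u w) := by
  induction w using induction with
  | zero => simp
  | add w w' hw hw' => simp only [map_add, hw, hw']
  | @mk m₁ l₁ b₁ c₁ r j g hr x y =>
    rw [contract_mk u r j g hr rfl (by lia), der_mk f h r j g hr x y rfl rfl (by lia) (by lia),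
      map_add, map_smul, contract_mk u r j g _ rfl (by lia),
      contract_mk (c' := -2 * (r : ℤ) + c₁ + p) u r j g _ (by lia) (by lia),
      hf j g _ rfl rfl h, hf 0 _ _ rfl rfl rfl, hu, map_zero, LinearMap.zero_apply, zero_add,
      koszulSign_even k (a := p * (-2 * (r : ℤ))) ⟨p * (-r), by ring⟩, one_smul]

theorem map_contract {S : GradedOperad k} (F : GradedOperad.Hom T S) {n : ℕ} {a : ℤ}
    (w : FreeInf T n a) :
    F.map (contract u w) = contract (fun r => F.map (u r)) (mapHom F w) := by
  induction w using induction with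
  | zero => simp
  | add w w' hw hw' => simp only [map_add, hw, hw']
  | @mk m₁ l₁ b₁ c₁ r j g hr x y =>
    rw [contract_mk u r j g hr rfl (by lia), mapHom_mk, contract_mk _ r j g hr rfl (by lia),
      F.map_comp, F.map_comp]

end Contract

end FreeInf

/-! ### Weight gradings defined by Euler derivations -/

/-- Projections onto the eigenspaces of an endomorphism that is diagonalizable with eigenvalues
in `ℕ`. -/
theorem exists_eigenspace_proj {k V : Type*} [Field k] [CharZero k] [AddCommGroup V] [Module k V]
    (E : V →ₗ[k] V)
    (hE : ∀ x, x ∈ Submodule.span k {x : V | ∃ w : ℕ, E x = (w : k) • x}) :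
    ∃ p : ℕ → V →ₗ[k] V, ∀ (v w : ℕ) (x : V), E x = (v : k) • x →
      p w x = if v = w then x else 0 := by
  let W : ℕ → Submodule k V := fun v => Module.End.eigenspace E (v : k)
  have hW : ∀ {v : ℕ} {x : V}, x ∈ W v ↔ E x = (v : k) • x := Module.End.mem_eigenspace_iff
  have h1 : iSupIndep W := (Module.End.eigenspaces_iSupIndep E).comp Nat.cast_injective
  have h2 : iSup W = ⊤ := by
    rw [eq_top_iff]
    refine fun x _ => Submodule.span_le.mpr ?_ (hE x)
    rintro x ⟨w, hw⟩
    exact Submodule.mem_iSup_of_mem w (hW.mpr hw)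
  have h3 : DirectSum.IsInternal W :=
    DirectSum.isInternal_submodule_of_iSupIndep_of_iSup_eq_top h1 h2
  let e := LinearEquiv.ofBijective (DirectSum.coeLinearMap W) h3
  refine ⟨fun w => (W w).subtype ∘ₗ DirectSum.component k ℕ (fun v => W v) w ∘ₗ e.symm.toLinearMap,
    fun v w x hx => ?_⟩
  have h4 : e.symm x = DirectSum.lof k ℕ (fun v => W v) v ⟨x, hW.mpr hx⟩ := by
    rw [LinearEquiv.symm_apply_eq]
    exact (DirectSum.coeLinearMap_lof W v ⟨x, hW.mpr hx⟩).symm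
  simp only [LinearMap.comp_apply, LinearEquiv.coe_coe, h4]
  split_ifs with h
  · subst h
    rw [DirectSum.component.lof_self]
    rfl
  · rw [DirectSum.component.of, dif_neg (fun h' => h h')]
    rfl

/-- A grading of `T` by weights in `ℕ`, compatible with the compositions, given by its Euler
derivation `E`: the operations of weight `w` are those with `E x = w x`. -/
structure Weight {k : Type u} [Field k] (T : GradedOperad k) where
  E {n : ℕ} {a : ℤ} : T.obj n a →ₗ[k] T.obj n a
  E_act {n : ℕ} {a : ℤ} (σ : Equiv.Perm (Fin n)) (x : T.obj n a) : E (T.act σ x) = T.act σ (E x)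
  E_comp {m n p : ℕ} {a b c : ℤ} (i : Fin m) (e : Graft m n p i) (h : a + b = c)
    (x : T.obj m a) (y : T.obj n b) :
    E (T.comp i e h x y) = T.comp i e h (E x) y + T.comp i e h x (E y)
  mem_span {n : ℕ} {a : ℤ} (x : T.obj n a) :
    x ∈ Submodule.span k {x : T.obj n a | ∃ w : ℕ, E x = (w : k) • x}

namespace Weight

variable {k : Type u} [Field k] {T S : GradedOperad k} (W : Weight T) (W' : Weight S)

theorem E_comp_of {m n p : ℕ} {a b c : ℤ} (i : Fin m) (e : Graft m n p i) (h : a + b = c)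
    {x : T.obj m a} {y : T.obj n b} {v w : ℕ} (hx : W.E x = (v : k) • x)
    (hy : W.E y = (w : k) • y) :
    W.E (T.comp i e h x y) = ((v + w : ℕ) : k) • T.comp i e h x y := by
  rw [W.E_comp, hx, hy, map_smul, map_smul, LinearMap.smul_apply, ← add_smul, Nat.cast_add]

theorem induction {n : ℕ} {a : ℤ} {P : T.obj n a → Prop} (zero : P 0)
    (add : ∀ x y, P x → P y → P (x + y)) (of : ∀ (w : ℕ) (x : T.obj n a), W.E x = (w : k) • x → P x)
    (x : T.obj n a) : P x := by
  have h1 : ∀ c : k, P (c • x) := by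
    refine Submodule.span_induction (p := fun x _ => ∀ c : k, P (c • x)) ?_ ?_ ?_ ?_ (W.mem_span x)
    · rintro x ⟨w, hw⟩ c
      exact of w _ (by rw [map_smul, hw, smul_comm])
    · intro c
      rw [smul_zero]
      exact zero
    · intro x y _ _ hx hy c
      rw [smul_add]
      exact add _ _ (hx c) (hy c)
    · intro s x _ hx c
      rw [smul_smul]
      exact hx _
  simpa using h1 1

theorem hom_ext {n : ℕ} {a : ℤ} {V : Type*} [AddCommGroup V] [Module k V]
    {f g : T.obj n a →ₗ[k] V}
    (H : ∀ (w : ℕ) (x : T.obj n a), W.E x = (w : k) • x → f x = g x) (x : T.obj n a) :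
    f x = g x :=
  W.induction (P := fun x => f x = g x) (by simp) (fun x y hx hy => by rw [map_add, map_add, hx, hy])
    H x

variable [CharZero k]

/-- The component of weight `w`. -/
noncomputable def proj (w : ℕ) {n : ℕ} {a : ℤ} : T.obj n a →ₗ[k] T.obj n a :=
  Classical.choose (exists_eigenspace_proj W.E W.mem_span) w

theorem proj_of {n : ℕ} {a : ℤ} {v : ℕ} {x : T.obj n a} (hx : W.E x = (v : k) • x) (w : ℕ) :
    W.proj w x = if v = w then x else 0 :=
  Classical.choose_spec (exists_eigenspace_proj W.E W.mem_span) v w x hx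

theorem proj_of_self {n : ℕ} {a : ℤ} {v : ℕ} {x : T.obj n a} (hx : W.E x = (v : k) • x) :
    W.proj v x = x := by rw [W.proj_of hx, if_pos rfl]

theorem proj_of_ne {n : ℕ} {a : ℤ} {v w : ℕ} {x : T.obj n a} (hx : W.E x = (v : k) • x)
    (h : v ≠ w) : W.proj w x = 0 := by rw [W.proj_of hx, if_neg h]

theorem E_proj (w : ℕ) {n : ℕ} {a : ℤ} (x : T.obj n a) :
    W.E (W.proj w x) = (w : k) • W.proj w x := by
  refine W.hom_ext (f := W.E ∘ₗ W.proj w) (g := (w : k) • W.proj w) (fun v x hx => ?_) x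
  simp only [LinearMap.comp_apply, LinearMap.smul_apply, W.proj_of hx]
  split_ifs with h
  · rw [hx, h]
  · simp

theorem proj_E (w : ℕ) {n : ℕ} {a : ℤ} (x : T.obj n a) :
    W.proj w (W.E x) = (w : k) • W.proj w x := by
  refine W.hom_ext (f := W.proj w ∘ₗ W.E) (g := (w : k) • W.proj w) (fun v x hx => ?_) x
  simp only [LinearMap.comp_apply, LinearMap.smul_apply, hx, map_smul, W.proj_of hx]
  split_ifs with h
  · rw [h]
  · simp

theorem proj_proj (w : ℕ) {n : ℕ} {a : ℤ} (x : T.obj n a) :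
    W.proj w (W.proj w x) = W.proj w x := W.proj_of_self (W.E_proj w x)

variable {W W'}

/-- A linear map that commutes with the Euler derivations up to a shift commutes with the
projections up to this shift. -/
theorem map_proj_shift {n m : ℕ} {a b : ℤ} {A : T.obj n a →ₗ[k] S.obj m b} {s : ℕ}
    (hA : ∀ x, W'.E (A x) + (s : k) • A x = A (W.E x)) (w : ℕ) (x : T.obj n a) :
    W'.proj w (A x) = A (W.proj (w + s) x) := by
  refine W.hom_ext (f := W'.proj w ∘ₗ A) (g := A ∘ₗ W.proj (w + s)) (fun v x hx => ?_) x
  simp only [LinearMap.comp_apply, W.proj_of hx]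
  have h1 : W'.E (A x) = ((v : k) - s) • A x := by
    rw [sub_smul, ← map_smul, ← hx, ← hA, add_sub_cancel_right]
  rcases Nat.lt_or_ge v s with h | h
  · have h2 : (w : k) • W'.proj w (A x) = ((v : k) - s) • W'.proj w (A x) := by
      rw [← W'.proj_E, h1, map_smul]
    have h3 : ((w : k) + s - v) • W'.proj w (A x) = 0 := by
      rw [show (w : k) + s - v = w - (v - s) by ring, sub_smul, h2, sub_self]
    rw [if_neg (by lia), map_zero]
    refine (smul_eq_zero.mp h3).resolve_left ?_
    rw [sub_eq_zero]
    exact_mod_cast (show w + s ≠ v by lia)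
  · obtain ⟨t, rfl⟩ := Nat.exists_eq_add_of_le' h
    have h2 : W'.E (A x) = (t : k) • A x := by rw [h1]; push_cast; congr 1; ring
    rw [W'.proj_of h2]
    by_cases h3 : t = w
    · rw [if_pos h3, if_pos (by lia)]
    · rw [if_neg h3, if_neg (by lia), map_zero]

theorem map_proj {n m : ℕ} {a b : ℤ} {A : T.obj n a →ₗ[k] S.obj m b}
    (hA : ∀ x, W'.E (A x) = A (W.E x)) (w : ℕ) (x : T.obj n a) :
    W'.proj w (A x) = A (W.proj w x) :=
  map_proj_shift (s := 0) (fun x => by rw [hA, Nat.cast_zero, zero_smul, add_zero]) w x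

variable (W)

theorem proj_act (w : ℕ) {n : ℕ} {a : ℤ} (σ : Equiv.Perm (Fin n)) (x : T.obj n a) :
    W.proj w (T.act σ x) = T.act σ (W.proj w x) := map_proj (W.E_act σ) w x

/-- The sum of the components of weight less than `w`. -/
noncomputable def below (w : ℕ) {n : ℕ} {a : ℤ} : T.obj n a →ₗ[k] T.obj n a :=
  ∑ v ∈ Finset.range w, W.proj v

theorem below_zero {n : ℕ} {a : ℤ} (x : T.obj n a) : W.below 0 x = 0 := by simp [below]

theorem below_succ (w : ℕ) {n : ℕ} {a : ℤ} (x : T.obj n a) :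
    W.below (w + 1) x = W.below w x + W.proj w x := by
  simp [below, Finset.sum_range_succ]

theorem below_of {n : ℕ} {a : ℤ} {v : ℕ} {x : T.obj n a} (hx : W.E x = (v : k) • x) (w : ℕ) :
    W.below w x = if v < w then x else 0 := by
  rw [below, LinearMap.sum_apply, Finset.sum_congr rfl fun w' _ => W.proj_of hx w']
  simp

theorem below_act (w : ℕ) {n : ℕ} {a : ℤ} (σ : Equiv.Perm (Fin n)) (x : T.obj n a) :
    W.below w (T.act σ x) = T.act σ (W.below w x) := by
  simp only [below, LinearMap.sum_apply, map_sum, W.proj_act]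

theorem below_of_le {v w : ℕ} (h : v ≤ w) {n : ℕ} {a : ℤ} {x : T.obj n a}
    (hx : W.below v x = x) : W.below w x = x := by
  rw [← hx]
  refine W.hom_ext (f := W.below w ∘ₗ W.below v) (g := W.below v) (fun s x hs => ?_) x
  rw [LinearMap.comp_apply, W.below_of hs]
  split_ifs with h'
  · rw [W.below_of hs, if_pos (by lia)]
  · rw [map_zero]

theorem exists_below {n : ℕ} {a : ℤ} (x : T.obj n a) : ∃ w, W.below w x = x := by
  refine W.induction (P := fun x => ∃ w, W.below w x = x) ⟨0, map_zero _⟩ ?_ ?_ x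
  · rintro x y ⟨v, hv⟩ ⟨w, hw⟩
    exact ⟨max v w, by rw [map_add, W.below_of_le (le_max_left v w) hv,
      W.below_of_le (le_max_right v w) hw]⟩
  · exact fun w x hx => ⟨w + 1, by rw [W.below_of hx, if_pos (by lia)]⟩

theorem below_proj {v w : ℕ} (h : v < w) {n : ℕ} {a : ℤ} (x : T.obj n a) :
    W.below w (W.proj v x) = W.proj v x := by rw [W.below_of (W.E_proj v x), if_pos h]

theorem proj_below {v w : ℕ} (h : v < w) {n : ℕ} {a : ℤ} (x : T.obj n a) :
    W.proj v (W.below w x) = W.proj v x := by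
  refine W.hom_ext (f := W.proj v ∘ₗ W.below w) (g := W.proj v) (fun s x hs => ?_) x
  rw [LinearMap.comp_apply, W.below_of hs, W.proj_of hs]
  split_ifs with h1 h2 h2
  · rw [W.proj_of hs, if_pos h2]
  · rw [W.proj_of hs, if_neg h2]
  · lia
  · rw [map_zero]

variable {W}

theorem map_below {n m : ℕ} {a b : ℤ} {A : T.obj n a →ₗ[k] S.obj m b}
    (hA : ∀ x, W'.E (A x) = A (W.E x)) (w : ℕ) (x : T.obj n a) :
    W'.below w (A x) = A (W.below w x) := by
  simp only [below, LinearMap.sum_apply, map_sum, map_proj hA]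

end Weight

/-- Composition of morphisms of graded operads. -/
def GradedOperad.Hom.comp {k : Type u} [Field k] {P R S : GradedOperad k}
    (g : GradedOperad.Hom R S) (f : GradedOperad.Hom P R) : GradedOperad.Hom P S where
  map := g.map ∘ₗ f.map
  map_id := by simp [f.map_id, g.map_id]
  map_act σ x := by simp [f.map_act, g.map_act]
  map_comp i e h x y := by simp [f.map_comp, g.map_comp]

/-- The inclusion of an operad in a square-zero extension. -/
def InfBimodule.inl {k : Type u} [Field k] {T : GradedOperad k} (M : InfBimodule T) :
    GradedOperad.Hom T M.sqZero where
  map {n a} := LinearMap.inl k (T.obj n a) (M.obj n a)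
  map_id := rfl
  map_act σ x := Prod.ext rfl (map_zero (M.act σ)).symm
  map_comp i e h x y := Prod.ext rfl (by
    have h1 := M.sqZero_comp_snd i e h (LinearMap.inl k _ (M.obj _ _) x)
      (LinearMap.inl k _ (M.obj _ _) y)
    refine Eq.trans ?_ h1.symm
    simp only [LinearMap.inl_apply, map_zero, LinearMap.zero_apply, add_zero]
    rfl)

/-- The projection of a square-zero extension. -/
def InfBimodule.fst {k : Type u} [Field k] {T : GradedOperad k} (M : InfBimodule T) :
    GradedOperad.Hom M.sqZero T where
  map {n a} := LinearMap.fst k (T.obj n a) (M.obj n a)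
  map_id := rfl
  map_act _ _ := rfl
  map_comp _ _ _ _ _ := rfl

/-- The identity morphism. -/
def GradedOperad.Hom.id {k : Type u} [Field k] (P : GradedOperad k) : GradedOperad.Hom P P where
  map := LinearMap.id
  map_id := rfl
  map_act _ _ := rfl
  map_comp _ _ _ _ _ := rfl

/-! ### The universal property of `Q ⋆ k⟨φ₁, φ₂, …⟩` -/

section

variable {k : Type u} [Field k] {Q S : GradedOperad k}

theorem phi_induction {P : ∀ {n : ℕ} {a : ℤ}, (phiOperad Q).obj n a → Prop}
    (of : ∀ {n : ℕ} {a : ℤ} (q : Q.obj n a), P (phiOf Q q)) (gen : ∀ n, 0 < n → P (phiGen Q n))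
    (add : ∀ {n : ℕ} {a : ℤ} (x y : (phiOperad Q).obj n a), P x → P y → P (x + y))
    (smul : ∀ {n : ℕ} {a : ℤ} (s : k) (x : (phiOperad Q).obj n a), P x → P (s • x))
    (act : ∀ {n : ℕ} {a : ℤ} (σ : Equiv.Perm (Fin n)) (x : (phiOperad Q).obj n a), P x →
      P ((phiOperad Q).act σ x))
    (comp : ∀ {m n p : ℕ} {a b c : ℤ} (i : Fin m) (e : Graft m n p i) (h : a + b = c)
      (x : (phiOperad Q).obj m a) (y : (phiOperad Q).obj n b), P x → P y →
      P ((phiOperad Q).comp i e h x y)) {n : ℕ} {a : ℤ} (x : (phiOperad Q).obj n a) : P x := by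
  revert x
  refine phiMk_ind fun x => ?_
  induction x with
  | of q => exact of q
  | phi i =>
    have h := gen i i.pos
    rwa [phiGen, dif_pos i.pos] at h
  | add x y hx hy => exact add _ _ hx hy
  | smul s x hx => exact smul s _ hx
  | act σ x hx => exact act σ _ hx
  | comp i e h x y hx hy => exact comp i e h _ _ hx hy

/-- The operations of `Q` as operations of `Q ⋆ k⟨φ₁, φ₂, …⟩`. -/
def phiOfHom (Q : GradedOperad k) : GradedOperad.Hom Q (phiOperad Q) where
  map {_ _} :=
    { toFun := phiOf Q
      map_add' := fun q q' => phiMk_sound (.of_add q q')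
      map_smul' := fun s q => phiMk_sound (.of_smul s q) }
  map_id := rfl
  map_act σ q := phiMk_sound (.of_act σ q)
  map_comp i e h q q' := phiMk_sound (.of_comp i e h q q')

theorem phiOfHom_map {n : ℕ} {a : ℤ} (q : Q.obj n a) : (phiOfHom Q).map q = phiOf Q q := rfl

variable (f : GradedOperad.Hom Q S) (φ : ∀ n : ℕ, S.obj 1 (-2 * (n : ℤ)))

/-- The evaluation of expressions in `Q` and `φ₁, φ₂, …` in an operad. -/
def PhiTerm.eval : ∀ {n : ℕ} {a : ℤ}, PhiTerm Q n a → S.obj n a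
  | _, _, .of q => f.map q
  | _, _, .phi i => φ i
  | _, _, .add x y => eval x + eval y
  | _, _, .smul s x => s • eval x
  | _, _, .act σ x => S.act σ (eval x)
  | _, _, .comp i e h x y => S.comp i e h (eval x) (eval y)

theorem PhiRel.eval_eq {n : ℕ} {a : ℤ} {x y : PhiTerm Q n a} (h : PhiRel Q x y) :
    x.eval f φ = y.eval f φ := by
  induction h with
  | refl => rfl
  | symm _ ih => exact ih.symm
  | trans _ _ ih ih' => exact ih.trans ih'
  | add_congr _ _ ih ih' => simp only [PhiTerm.eval, ih, ih']
  | smul_congr _ _ ih => simp only [PhiTerm.eval, ih]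
  | act_congr _ _ ih => simp only [PhiTerm.eval, ih]
  | comp_congr _ _ _ _ _ ih ih' => simp only [PhiTerm.eval, ih, ih']
  | add_assoc => exact _root_.add_assoc _ _ _
  | add_comm => exact _root_.add_comm _ _
  | zero_add => simp only [PhiTerm.eval, map_zero, _root_.zero_add]
  | neg_add => simp [PhiTerm.eval]
  | smul_add => exact _root_.smul_add _ _ _
  | add_smul => exact _root_.add_smul _ _ _
  | mul_smul => exact _root_.SemigroupAction.mul_smul _ _ _
  | one_smul => exact _root_.one_smul _ _
  | of_add => exact map_add _ _ _
  | of_smul => exact map_smul _ _ _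
  | of_act => exact f.map_act _ _
  | of_comp => exact f.map_comp _ _ _ _ _
  | act_add => exact map_add _ _ _
  | act_smul => exact map_smul _ _ _
  | comp_add_left => simp only [PhiTerm.eval, map_add, LinearMap.add_apply]
  | comp_smul_left => simp only [PhiTerm.eval, map_smul, LinearMap.smul_apply]
  | comp_add_right => exact map_add _ _ _
  | comp_smul_right => exact map_smul _ _ _
  | act_one => exact S.act_one _
  | act_mul => exact S.act_mul _ _ _
  | comp_act i h σ τ ρ e e' he he' => exact S.comp_act i h σ τ ρ e e' he he' _ _
  | id_comp i e h he =>
    simp only [PhiTerm.eval, f.map_id]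
    exact S.id_comp i e h he _
  | comp_id i e h he he' =>
    simp only [PhiTerm.eval, f.map_id]
    exact S.comp_id i e h he he' _
  | assoc_seq i j e f e' f' hab habc hbc habc' h₁ h₂ h₃ =>
    exact S.assoc_seq i j e f e' f' hab habc hbc habc' h₁ h₂ h₃ _ _ _
  | assoc_par i j hij hji e f e' f' hab habc hac hacb h₁ h₂ h₃ =>
    exact S.assoc_par i j hij hji e f e' f' hab habc hac hacb h₁ h₂ h₃ _ _ _

/-- The morphism out of `Q ⋆ k⟨φ₁, φ₂, …⟩` determined by its values on `Q` and on the `φₙ`. -/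
def phiLift : GradedOperad.Hom (phiOperad Q) S where
  map {_ _} :=
    { toFun := Quot.lift (PhiTerm.eval f φ) (fun _ _ h => PhiRel.eval_eq f φ h)
      map_add' := phiMk_ind fun _ => phiMk_ind fun _ => rfl
      map_smul' := fun _ => phiMk_ind fun _ => rfl }
  map_id := f.map_id
  map_act _ := phiMk_ind fun _ => rfl
  map_comp _ _ _ := phiMk_ind fun _ => phiMk_ind fun _ => rfl

theorem phiLift_gen {n : ℕ} (h : 0 < n) : (phiLift f φ).map (phiGen Q n) = φ n := by
  rw [phiGen, dif_pos h]
  rfl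

theorem phiLift_gen' (hφ : φ 0 = 0) (n : ℕ) : (phiLift f φ).map (phiGen Q n) = φ n := by
  cases n with
  | zero => rw [phiGen_zero, map_zero, hφ]
  | succ n => exact phiLift_gen f φ n.succ_pos

theorem phiHom_ext {f g : GradedOperad.Hom (phiOperad Q) S}
    (h : ∀ {n : ℕ} {a : ℤ} (q : Q.obj n a), f.map (phiOf Q q) = g.map (phiOf Q q))
    (h' : ∀ n, 0 < n → f.map (phiGen Q n) = g.map (phiGen Q n)) {n : ℕ} {a : ℤ}
    (x : (phiOperad Q).obj n a) : f.map x = g.map x := by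
  refine phi_induction (P := fun x => f.map x = g.map x) h h' ?_ ?_ ?_ ?_ x
  · intro _ _ x y hx hy
    rw [map_add, map_add, hx, hy]
  · intro _ _ s x hx
    rw [map_smul, map_smul, hx]
  · intro _ _ σ x hx
    rw [f.map_act, g.map_act, hx]
  · intro _ _ _ _ _ _ i e h x y hx hy
    rw [f.map_comp, g.map_comp, hx, hy]

/-- The morphism to a square-zero extension that corresponds to `phiDerivation`. -/
def phiDerivationHom (M : InfBimodule (phiOperad Q)) (μ : ∀ n : ℕ, M.obj 1 (-2 * (n : ℤ))) :
    GradedOperad.Hom (phiOperad Q) M.sqZero :=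
  phiLift (M.inl.comp (phiOfHom Q)) fun n =>
    (show M.sqZero.obj 1 (-2 * (n : ℤ)) from (phiGen Q n, μ n))

/-- The derivation of `Q ⋆ k⟨φ₁, φ₂, …⟩` that vanishes on `Q` and has given values on the `φₙ`. -/
def phiDerivation (M : InfBimodule (phiOperad Q)) (μ : ∀ n : ℕ, M.obj 1 (-2 * (n : ℤ))) :
    OperadDerivation M :=
  InfBimodule.derivationOfHom M (phiDerivationHom M μ) (fun {n a} x => by
    refine phiHom_ext (f := M.fst.comp (phiDerivationHom M μ)) (g := .id _) (fun q => rfl)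
      (fun n hn => ?_) x
    exact congrArg M.fst.map (phiLift_gen _ _ hn))

theorem phiDerivation_gen (M : InfBimodule (phiOperad Q)) (μ : ∀ n : ℕ, M.obj 1 (-2 * (n : ℤ)))
    {n : ℕ} (h : 0 < n) : (phiDerivation M μ).map (phiGen Q n) = μ n :=
  congrArg Prod.snd (phiLift_gen (M.inl.comp (phiOfHom Q)) (fun n =>
    (show M.sqZero.obj 1 (-2 * (n : ℤ)) from (phiGen Q n, μ n))) h)

end

/-! ### The weight grading of `Q ⋆ k⟨φ₁, φ₂, …⟩` -/

section

variable {k : Type u} [Field k]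

/-- The generator `[r]` of the free infinitesimal bimodule. -/
noncomputable def FreeInf.gen (T : GradedOperad k) (r : ℕ) : FreeInf T 1 (-2 * (r : ℤ)) :=
  FreeInf.mk r 0 Graft.unary (by lia) T.id T.id

theorem FreeInf.contract_gen {T : GradedOperad k} (u : ∀ r : ℕ, T.obj 1 (-2 * (r : ℤ))) (r : ℕ) :
    contract u (gen T r) = u r := by
  rw [gen, contract_mk u r 0 _ _ (add_zero _) (zero_add _),
    T.comp_id 0 _ _ (fun s hs => absurd (Subsingleton.elim s 0) hs) (Subsingleton.elim _ _),
    T.id_comp 0 _ _ (fun _ => Subsingleton.elim _ _)]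

/-- If `E` is a derivation, the span of its eigenvectors with eigenvalues in `ℕ` is closed under
compositions. -/
theorem span_eigenvectors_comp {T : GradedOperad k}
    (E : ∀ {n : ℕ} {a : ℤ}, T.obj n a →ₗ[k] T.obj n a)
    (hE : ∀ {m n p : ℕ} {a b c : ℤ} (i : Fin m) (e : Graft m n p i) (h : a + b = c)
      (x : T.obj m a) (y : T.obj n b),
      E (T.comp i e h x y) = T.comp i e h (E x) y + T.comp i e h x (E y))
    {m n p : ℕ} {a b c : ℤ} (i : Fin m) (e : Graft m n p i) (h : a + b = c) {x : T.obj m a}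
    {y : T.obj n b} (hx : x ∈ Submodule.span k {x : T.obj m a | ∃ w : ℕ, E x = (w : k) • x})
    (hy : y ∈ Submodule.span k {x : T.obj n b | ∃ w : ℕ, E x = (w : k) • x}) :
    T.comp i e h x y ∈ Submodule.span k {x : T.obj p c | ∃ w : ℕ, E x = (w : k) • x} := by
  refine (Submodule.span_le (p := (Submodule.span k _).comap ((T.comp i e h).flip y))).mpr ?_ hx
  rintro x ⟨v, hv⟩
  refine (Submodule.span_le (p := (Submodule.span k _).comap (T.comp i e h x))).mpr ?_ hy
  rintro y ⟨w, hw⟩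
  refine Submodule.subset_span ⟨v + w, ?_⟩
  rw [hE, hv, hw, map_smul, map_smul, LinearMap.smul_apply, ← add_smul, Nat.cast_add]

variable (Q : GradedOperad k)

/-- The derivation that sends `φₙ` to the generator `[n]`. -/
noncomputable def phiUniversalDer : OperadDerivation (freeInf (phiOperad Q)) :=
  phiDerivation (freeInf (phiOperad Q)) (FreeInf.gen (phiOperad Q))

/-- The universal derivation of `Q ⋆ k⟨φ₁, φ₂, …⟩` relative to `Q`. -/
noncomputable abbrev phiUD {n : ℕ} {a : ℤ} :
    (phiOperad Q).obj n a →ₗ[k] FreeInf (phiOperad Q) n a := (phiUniversalDer Q).map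

theorem phiUD_of {n : ℕ} {a : ℤ} (q : Q.obj n a) : phiUD Q (phiOf Q q) = 0 := rfl

theorem phiUD_gen {n : ℕ} (h : 0 < n) : phiUD Q (phiGen Q n) = FreeInf.gen (phiOperad Q) n :=
  phiDerivation_gen _ _ h

theorem phiUD_act {n : ℕ} {a : ℤ} (σ : Equiv.Perm (Fin n)) (x : (phiOperad Q).obj n a) :
    phiUD Q ((phiOperad Q).act σ x) = FreeInf.act σ (phiUD Q x) := (phiUniversalDer Q).map_act σ x

theorem phiUD_comp {m n p : ℕ} {a b c : ℤ} (i : Fin m) (e : Graft m n p i) (h : a + b = c)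
    (x : (phiOperad Q).obj m a) (y : (phiOperad Q).obj n b) :
    phiUD Q ((phiOperad Q).comp i e h x y) =
      FreeInf.rcomp i e h (phiUD Q x) y + FreeInf.lcomp i e h x (phiUD Q y) :=
  (phiUniversalDer Q).map_comp i e h x y

/-- The morphism of bimodules `[n] ↦ n φₙ`. -/
noncomputable def phiContract {n : ℕ} {a : ℤ} :
    FreeInf (phiOperad Q) n a →ₗ[k] (phiOperad Q).obj n a :=
  FreeInf.contract fun r => (r : k) • phiGen Q r

/-- The weight grading in which `φₙ` has weight `n` and the operations of `Q` have weight `0`. -/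
noncomputable def phiWeight : Weight (phiOperad Q) where
  E := phiContract Q ∘ₗ phiUD Q
  E_act σ x := by
    rw [LinearMap.comp_apply, phiUD_act, phiContract, FreeInf.contract_act]
    rfl
  E_comp i e h x y := by
    rw [LinearMap.comp_apply, phiUD_comp, phiContract, map_add, FreeInf.contract_rcomp,
      FreeInf.contract_lcomp]
    rfl
  mem_span x := by
    refine phi_induction (P := fun {n a} x => x ∈ Submodule.span k
      {x : (phiOperad Q).obj n a | ∃ w : ℕ, (phiContract Q ∘ₗ phiUD Q) x = (w : k) • x})
      ?_ ?_ ?_ ?_ ?_ ?_ x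
    · intro n a q
      exact Submodule.subset_span ⟨0, by
        rw [LinearMap.comp_apply, phiUD_of, map_zero, Nat.cast_zero, zero_smul]⟩
    · intro n hn
      exact Submodule.subset_span ⟨n, by
        rw [LinearMap.comp_apply, phiUD_gen Q hn, phiContract, FreeInf.contract_gen]⟩
    · exact fun x y hx hy => add_mem hx hy
    · exact fun s x hx => Submodule.smul_mem _ s hx
    · intro n a σ x hx
      refine (Submodule.span_le (p := (Submodule.span k _).comap ((phiOperad Q).act σ))).mpr ?_ hx
      rintro x ⟨w, hw⟩
      refine Submodule.subset_span ⟨w, ?_⟩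
      rw [LinearMap.comp_apply] at hw
      rw [LinearMap.comp_apply, phiUD_act, phiContract, FreeInf.contract_act, ← phiContract, hw,
        map_smul]
    · intro m n p a b c i e h x y hx hy
      refine span_eigenvectors_comp (fun {_ _} => phiContract Q ∘ₗ phiUD Q) ?_ i e h hx hy
      intro _ _ _ _ _ _ i e h x y
      rw [LinearMap.comp_apply, phiUD_comp, phiContract, map_add, FreeInf.contract_rcomp,
        FreeInf.contract_lcomp]
      rfl

theorem phiWeight_E {n : ℕ} {a : ℤ} (x : (phiOperad Q).obj n a) :
    (phiWeight Q).E x = phiContract Q (phiUD Q x) := rfl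

theorem phiWeight_of {n : ℕ} {a : ℤ} (q : Q.obj n a) : (phiWeight Q).E (phiOf Q q) = 0 := by
  rw [phiWeight_E, phiUD_of, map_zero]

theorem phiWeight_gen (n : ℕ) : (phiWeight Q).E (phiGen Q n) = (n : k) • phiGen Q n := by
  cases n with
  | zero => rw [phiGen_zero, map_zero, smul_zero]
  | succ n => rw [phiWeight_E, phiUD_gen Q n.succ_pos, phiContract, FreeInf.contract_gen]

theorem Weight.E_mul {T : GradedOperad k} (W : Weight T) {a b c : ℤ} (h : a + b = c)
    (x : T.obj 1 a) (y : T.obj 1 b) : W.E (T.mul h x y) = T.mul h (W.E x) y + T.mul h x (W.E y) :=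
  W.E_comp _ _ _ _ _

theorem Weight.E_id {T : GradedOperad k} (W : Weight T) : W.E T.id = 0 := by
  have h := W.E_mul (add_zero 0) T.id T.id
  have h1 : ∀ x : T.obj 1 0, T.mul (zero_add 0) T.id x = x := fun x =>
    T.id_comp 0 Graft.unary _ (fun _ => Subsingleton.elim _ _) x
  rw [h1, h1, T.mul_id] at h
  exact left_eq_add.mp h

section Exp

variable {T : GradedOperad k} (W : Weight T) {φ : ∀ n : ℕ, T.obj 1 (-2 * (n : ℤ))}

theorem GradedOperad.smul_mul (T : GradedOperad k) {a b c : ℤ} (h : a + b = c) (s : k)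
    (x : T.obj 1 a) (y : T.obj 1 b) : T.mul h (s • x) y = s • T.mul h x y := by
  simp [GradedOperad.mul]

theorem GradedOperad.mul_smul (T : GradedOperad k) {a b c : ℤ} (h : a + b = c) (s : k)
    (x : T.obj 1 a) (y : T.obj 1 b) : T.mul h x (s • y) = s • T.mul h x y := by
  simp [GradedOperad.mul]

theorem Weight.E_phiPow (hφ : ∀ n, W.E (φ n) = (n : k) • φ n) (j n : ℕ) :
    W.E (phiPow T φ j n) = (n : k) • phiPow T φ j n := by
  induction j generalizing n with
  | zero =>
    cases n with
    | zero =>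
      exact W.E_id.trans
        ((congrArg (fun s : k => s • phiPow T φ 0 0) Nat.cast_zero).trans (zero_smul k _)).symm
    | succ n => rw [phiPow, map_zero, smul_zero]
  | succ j ih =>
    rw [phiPow, map_sum, Finset.smul_sum]
    refine Finset.sum_congr rfl fun i _ => ?_
    rw [W.E_mul, hφ, ih, T.smul_mul, T.mul_smul, ← add_smul, ← Nat.cast_add,
      Nat.add_sub_cancel' (by have := i.isLt; lia)]

theorem Weight.E_phiExp (hφ : ∀ n, W.E (φ n) = (n : k) • φ n) (n : ℕ) :
    W.E (phiExp T φ n) = (n : k) • phiExp T φ n := by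
  rw [phiExp, map_sum, Finset.smul_sum]
  exact Finset.sum_congr rfl fun j _ => by rw [map_smul, W.E_phiPow hφ, smul_comm]

theorem Weight.E_phiPowD (hφ : ∀ n, W.E (φ n) = (n : k) • φ n)
    {ψ : ∀ n : ℕ, T.obj 1 (-2 * (n : ℤ) + 1)} (hψ : ∀ n, W.E (ψ n) = ((n : k) - 1) • ψ n)
    (j n : ℕ) : W.E (phiPowD T φ ψ j n) = ((n : k) - 1) • phiPowD T φ ψ j n := by
  induction j generalizing n with
  | zero => rw [phiPowD, map_zero, smul_zero]
  | succ j ih =>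
    rw [phiPowD, map_sum, Finset.smul_sum]
    refine Finset.sum_congr rfl fun i _ => ?_
    have h : ((n - (i : ℕ) : ℕ) : k) = n - (i : ℕ) := Nat.cast_sub (by have := i.isLt; lia)
    rw [map_add, W.E_mul, W.E_mul, hφ, hψ, ih, W.E_phiPow hφ, T.smul_mul, T.mul_smul, T.smul_mul,
      T.mul_smul, smul_add, h]
    module

theorem Weight.E_phiDiff (hφ : ∀ n, W.E (φ n) = (n : k) • φ n) {Δ : T.obj 1 (-1)}
    (hΔ : W.E Δ = 0) (n : ℕ) :
    W.E (phiDiff T φ Δ n) = ((n : k) - 1) • phiDiff T φ Δ n := by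
  induction n using Nat.strong_induction_on with
  | _ n ih =>
    rw [phiDiff, map_sub, map_sum, smul_sub, Finset.smul_sum]
    congr 1
    · cases n with
      | zero => rw [phiExpDelta, map_zero, smul_zero]
      | succ n =>
        rw [phiExpDelta, W.E_mul, W.E_phiExp hφ, hΔ, T.mul_zero, add_zero, T.smul_mul]
        push_cast
        rw [add_sub_cancel_right]
    · refine Finset.sum_congr rfl fun j _ => ?_
      rw [map_smul, W.E_phiPowD hφ, smul_comm]
      intro i
      split_ifs with hi
      · exact ih i hi
      · rw [map_zero, smul_zero]

theorem phiDiff_zero_delta (T : GradedOperad k) (φ : ∀ n : ℕ, T.obj 1 (-2 * (n : ℤ))) (n : ℕ) :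
    phiDiff T φ 0 n = 0 := by
  have h1 : ∀ (j n : ℕ), phiPowD T φ (fun _ => 0) j n = 0 := by
    intro j
    induction j with
    | zero => exact fun _ => rfl
    | succ j ih =>
      refine fun n => Finset.sum_eq_zero fun i _ => ?_
      rw [ih, T.mul_zero, add_zero]
      exact T.zero_mul _ _
  induction n using Nat.strong_induction_on with
  | _ n ih =>
    rw [phiDiff]
    have h2 : (fun i => if i < n then phiDiff T φ 0 i else 0) = fun _ => 0 := by
      funext i
      split_ifs with h
      · exact ih i h
      · rfl
    rw [h2, Finset.sum_eq_zero fun j _ => by rw [h1, smul_zero], sub_zero]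
    cases n with
    | zero => rfl
    | succ n => exact T.mul_zero _ _

end Exp

end

/-! ### The differential of `Q ⋆ k⟨φ₁, φ₂, …⟩` for `Δ = 0` -/

section

variable {k : Type u} [Field k]

/-- The differential of `Q/Δ`, as an equivariant family. -/
noncomputable def phiDFam (Q : DeltaDGOperad k) :
    EquivFam (phiOperad Q.toGradedOperad) (phiOperad Q.toGradedOperad) 1 :=
  EquivFam.ofMap₁ (phiD Q) (phiD_act Q)

theorem isDer_phiDFam (Q : DeltaDGOperad k) : (phiDFam Q).IsDer := by
  intro m n l a b c a' b' c' i e h ha hb hc x y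
  subst ha hb hc
  rw [one_mul]
  exact phiD_comp Q i e h _ _ x y

variable (P : DGOperad k)

/-- The derivation of `P ⋆ k⟨φ₁, φ₂, …⟩` that extends the differential of `P` and sends the `φₙ`
to `0`. -/
noncomputable def phiD₀ : EquivFam (phiOperad P.toGradedOperad) (phiOperad P.toGradedOperad) 1 :=
  phiDFam ((trivDelta k).obj P)

theorem isDer_phiD₀ : (phiD₀ P).IsDer := isDer_phiDFam ((trivDelta k).obj P)

theorem phiD₀_of {n : ℕ} {a b : ℤ} (h : a + 1 = b) (q : P.obj n a) :
    (phiD₀ P).map h (phiOf P.toGradedOperad q) = phiOf _ (P.dFam.map h q) := by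
  subst h; rfl

theorem phiD₀_gen {b : ℤ} (n : ℕ) (h : -2 * (n : ℤ) + 1 = b) :
    (phiD₀ P).map h (phiGen P.toGradedOperad n) = 0 := by
  subst h
  exact (phiD_gen ((trivDelta k).obj P) n).trans (phiDiff_zero_delta _ _ n)

theorem phiOperad_id (Q : GradedOperad k) : (phiOperad Q).id = phiOf Q Q.id := rfl

theorem phiD₀_id {b : ℤ} (h : 0 + 1 = b) :
    (phiD₀ P).map h (phiOperad P.toGradedOperad).id = 0 := by
  subst h
  rw [phiOperad_id, phiD₀_of]
  exact congrArg _ P.d_id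

theorem phiUD_phiD₀ {n : ℕ} {a b : ℤ} (h : a + 1 = b)
    (x : (phiOperad P.toGradedOperad).obj n a) :
    phiUD P.toGradedOperad ((phiD₀ P).map h x) =
      FreeInf.der (phiD₀ P) h (phiUD P.toGradedOperad x) := by
  refine phi_induction (P := fun {n a} x => ∀ (b : ℤ) (h : a + 1 = b),
    phiUD P.toGradedOperad ((phiD₀ P).map h x) =
      FreeInf.der (phiD₀ P) h (phiUD P.toGradedOperad x)) ?_ ?_ ?_ ?_ ?_ ?_ x b h
  · intro n a q b h
    rw [phiD₀_of, phiUD_of, phiUD_of]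
    exact (map_zero (FreeInf.der _ _)).symm
  · intro n hn b h
    rw [phiD₀_gen, map_zero, phiUD_gen _ hn, FreeInf.gen,
      FreeInf.der_mk _ h n 0 _ _ _ _ rfl rfl (by lia) (by lia), phiD₀_id]
    simp
  · intro n a x y hx hy b h
    simp only [map_add, hx, hy]
  · intro n a s x hx b h
    simp only [map_smul, hx]
  · intro n a σ x hx b h
    rw [EquivFam.map_act, phiUD_act, phiUD_act, hx, FreeInf.der_act]
  · intro m n p a b c i e h x y hx hy c' hc
    rw [isDer_phiD₀ P i e h rfl rfl hc, map_add, map_smul, phiUD_comp, phiUD_comp, phiUD_comp,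
      map_add, FreeInf.der_rcomp (isDer_phiD₀ P) i e h rfl rfl hc,
      FreeInf.der_lcomp (isDer_phiD₀ P) i e h rfl rfl hc, hx, hy, smul_add]
    abel

theorem phiContract_phiD₀ {n : ℕ} {a b : ℤ} (h : a + 1 = b)
    (w : FreeInf (phiOperad P.toGradedOperad) n a) :
    phiContract P.toGradedOperad (FreeInf.der (phiD₀ P) h w) =
      (phiD₀ P).map h (phiContract P.toGradedOperad w) :=
  FreeInf.contract_der _ (isDer_phiD₀ P) (fun r b h => by
    rw [map_smul, phiD₀_gen, smul_zero]) h w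

theorem phiWeight_phiD₀ {n : ℕ} {a b : ℤ} (h : a + 1 = b)
    (x : (phiOperad P.toGradedOperad).obj n a) :
    (phiWeight P.toGradedOperad).E ((phiD₀ P).map h x) =
      (phiD₀ P).map h ((phiWeight P.toGradedOperad).E x) := by
  rw [phiWeight_E, phiUD_phiD₀, phiContract_phiD₀, ← phiWeight_E]

section Map

variable {P} {Q : DGOperad k} (f : DGOperad.Hom P Q)

/-- The morphism `P ⋆ k⟨φ₁, φ₂, …⟩ → Q ⋆ k⟨φ₁, φ₂, …⟩` induced by `f`. -/
def phiMapHom : GradedOperad.Hom (phiOperad P.toGradedOperad) (phiOperad Q.toGradedOperad) where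
  map := phiMap f
  map_id := congrArg (phiOf _) f.map_id
  map_act _ := phiMk_ind fun _ => rfl
  map_comp _ _ _ := phiMk_ind fun _ => phiMk_ind fun _ => rfl

theorem phiMapHom_of {n : ℕ} {a : ℤ} (q : P.obj n a) :
    (phiMapHom f).map (phiOf P.toGradedOperad q) = phiOf _ (f.map q) := rfl

theorem phiMapHom_gen (n : ℕ) :
    (phiMapHom f).map (phiGen P.toGradedOperad n) = phiGen Q.toGradedOperad n := phiMap_gen f n

theorem phiMapHom_phiD₀ {n : ℕ} {a b : ℤ} (h : a + 1 = b)
    (x : (phiOperad P.toGradedOperad).obj n a) :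
    (phiMapHom f).map ((phiD₀ P).map h x) = (phiD₀ Q).map h ((phiMapHom f).map x) := by
  subst h
  exact phiMap_d ((trivDelta k).map (X := P) (Y := Q) f) x

theorem mapHom_phiUD {n : ℕ} {a : ℤ} (x : (phiOperad P.toGradedOperad).obj n a) :
    FreeInf.mapHom (phiMapHom f) (phiUD P.toGradedOperad x) =
      phiUD Q.toGradedOperad ((phiMapHom f).map x) := by
  refine phi_induction (P := fun {n a} x => 
    FreeInf.mapHom (phiMapHom f) (phiUD P.toGradedOperad x) =
      phiUD Q.toGradedOperad ((phiMapHom f).map x)) ?_ ?_ ?_ ?_ ?_ ?_ x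
  · intro n a q
    rw [phiMapHom_of, phiUD_of, phiUD_of]
    exact map_zero (FreeInf.mapHom _)
  · intro n hn
    rw [phiMapHom_gen, phiUD_gen _ hn, phiUD_gen _ hn, FreeInf.gen, FreeInf.mapHom_mk,
      (phiMapHom f).map_id]
    rfl
  · intro n a x y hx hy
    simp only [map_add, hx, hy]
  · intro n a s x hx
    simp only [map_smul, hx]
  · intro n a σ x hx
    rw [(phiMapHom f).map_act, phiUD_act, phiUD_act, FreeInf.mapHom_act, hx]
  · intro m n p a b c i e h x y hx hy
    rw [(phiMapHom f).map_comp, phiUD_comp, phiUD_comp, map_add, FreeInf.mapHom_rcomp,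
      FreeInf.mapHom_lcomp, hx, hy]

theorem phiMapHom_phiContract {n : ℕ} {a : ℤ} (w : FreeInf (phiOperad P.toGradedOperad) n a) :
    (phiMapHom f).map (phiContract P.toGradedOperad w) =
      phiContract Q.toGradedOperad (FreeInf.mapHom (phiMapHom f) w) := by
  rw [phiContract, FreeInf.map_contract, phiContract]
  congr 2
  funext r
  rw [map_smul, phiMapHom_gen]

theorem phiWeight_phiMapHom {n : ℕ} {a : ℤ} (x : (phiOperad P.toGradedOperad).obj n a) :
    (phiWeight Q.toGradedOperad).E ((phiMapHom f).map x) =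
      (phiMapHom f).map ((phiWeight P.toGradedOperad).E x) := by
  rw [phiWeight_E, ← mapHom_phiUD, ← phiMapHom_phiContract, ← phiWeight_E]

end Map

end

/-! ### Approximate homotopy inverses in bounded weight -/

namespace FreeInf

variable {k : Type u} [Field k] {T S R : GradedOperad k}

/-- The map `x ∘ᵢ [r] ∘ y ↦ f x ∘ᵢ [r] ∘ f y` induced by a family of degree `0`. -/
noncomputable def map₀ (f : EquivFam T S 0) {n : ℕ} {a : ℤ} : FreeInf T n a →ₗ[k] FreeInf S n a :=
  map₂ 0 f f (by push_cast; lia)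

theorem map₀_mk (f : EquivFam T S 0) {m l n : ℕ} {a b c : ℤ} (r : ℕ) (i : Fin m)
    (e : Graft m l n i) (h : b + c = a + 2 * (r : ℤ)) (x : T.obj m b) (y : T.obj l c) :
    map₀ f (mk r i e h x y) = mk r i e h (f.map (add_zero b) x) (f.map (add_zero c) y) := by
  rw [map₀, map₂_mk 0 _ _ _ r i e h x y (add_zero b) (add_zero c) h, zero_mul,
    koszulSign_even k (by decide), one_smul]
  rfl

theorem map₀_map₀ (g : EquivFam S R 0) (f : EquivFam T S 0) {n : ℕ} {a : ℤ}
    (w : FreeInf T n a) : map₀ g (map₀ f w) = map₀ (g.comp f (add_zero 0)) w :=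
  hom_ext (f := map₀ g ∘ₗ map₀ f) (g := map₀ (g.comp f (add_zero 0))) (fun r i e h x y => by
    rw [LinearMap.comp_apply, map₀_mk, map₀_mk, map₀_mk,
      EquivFam.comp_map g f _ (add_zero _) (add_zero _),
      EquivFam.comp_map g f _ (add_zero _) (add_zero _)]) w

/-- The homotopy `A ⊗ U ± V ⊗ A` between `U ⊗ U` and `V ⊗ V`. -/
noncomputable def htpy (U V : EquivFam T T 0) (A : EquivFam T T (-1)) {n : ℕ} {a b : ℤ}
    (h : a + -1 = b) : FreeInf T n a →ₗ[k] FreeInf T n b :=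
  map₂ 0 A U (by push_cast; lia) + map₂ 0 V A (by push_cast; lia)

theorem htpy_mk (U V : EquivFam T T 0) (A : EquivFam T T (-1)) {m l n : ℕ} {a a' b c b' c' : ℤ}
    (ha : a + -1 = a') (r : ℕ) (i : Fin m) (e : Graft m l n i) (h : b + c = a + 2 * (r : ℤ))
    (hb : b + -1 = b') (hc : c + -1 = c') (h' : b' + c = a' + 2 * (r : ℤ))
    (h'' : b + c' = a' + 2 * (r : ℤ)) (x : T.obj m b) (y : T.obj l c) :
    htpy U V A ha (mk r i e h x y) =
      mk r i e h' (A.map hb x) (U.map (add_zero c) y) +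
        koszulSign k b • mk r i e h'' (V.map (add_zero b) x) (A.map hc y) := by
  rw [htpy, LinearMap.add_apply, map₂_mk 0 _ _ _ r i e h x y hb (add_zero c) h',
    map₂_mk 0 _ _ _ r i e h x y (add_zero b) hc h'', zero_mul,
    koszulSign_even k (a := 0) (by decide), one_smul]
  congr 2
  rw [koszulSign, koszulSign, neg_one_mul, Int.negOnePow_neg]

theorem htpy_act (U V : EquivFam T T 0) (A : EquivFam T T (-1)) {n : ℕ} {a b : ℤ}
    (h : a + -1 = b) (σ : Equiv.Perm (Fin n)) (w : FreeInf T n a) :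
    htpy U V A h (act σ w) = act σ (htpy U V A h w) := by
  simp only [htpy, LinearMap.add_apply, map₂_act, map_add]

end FreeInf

namespace EquivFam

variable {k : Type u} [Field k] {T S : GradedOperad k}

/-- `A` is a homotopy between `U` and `V`: `U = V + [D, A]`. -/
def IsHtpy (D : EquivFam T T 1) (U V : EquivFam T T 0) (A : EquivFam T T (-1)) : Prop :=
  ∀ {n : ℕ} {a b c : ℤ} (h : a + 1 = b) (h' : b + 1 = c) (x : T.obj n b),
    U.map (add_zero b) x = V.map (add_zero b) x + D.map h (A.map (by lia) x) +
      A.map (by lia) (D.map h' x)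

/-- The family commutes with the differentials. -/
def IsChain (D : EquivFam T T 1) (D' : EquivFam S S 1) (U : EquivFam T S 0) : Prop :=
  ∀ {n : ℕ} {a b : ℤ} (h : a + 1 = b) (x : T.obj n a),
    U.map (add_zero b) (D.map h x) = D'.map h (U.map (add_zero a) x)

end EquivFam

namespace FreeInf

variable {k : Type u} [Field k] {T S : GradedOperad k}

theorem map₀_der {D : EquivFam T T 1} {D' : EquivFam S S 1} {U : EquivFam T S 0}
    (hU : EquivFam.IsChain D D' U) {n : ℕ} {a b : ℤ} (h : a + 1 = b) (w : FreeInf T n a) :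
    map₀ U (der D h w) = der D' h (map₀ U w) := by
  refine hom_ext (f := map₀ U ∘ₗ der D h) (g := der D' h ∘ₗ map₀ U) (fun r i e hh x y => ?_) w
  rw [LinearMap.comp_apply, LinearMap.comp_apply, map₀_mk,
    der_mk D h r i e hh x y rfl rfl (by lia) (by lia),
    der_mk D' h r i e hh _ _ rfl rfl (by lia) (by lia), map_add, map_smul, map₀_mk, map₀_mk,
    hU, hU]

/-- Homotopic families induce homotopic maps of free infinitesimal bimodules. -/
theorem map₀_eq_of_isHtpy {D : EquivFam T T 1} {U V : EquivFam T T 0} {A : EquivFam T T (-1)}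
    (hU : EquivFam.IsChain D D U) (hV : EquivFam.IsChain D D V) (H : EquivFam.IsHtpy D U V A)
    {n : ℕ} {a b c : ℤ} (h : a + 1 = b) (h' : b + 1 = c) (w : FreeInf T n b) :
    map₀ U w = map₀ V w + der D h (htpy U V A (by lia) w) + htpy U V A (by lia) (der D h' w) := by
  induction w using induction with
  | zero => simp
  | add w w' hw hw' => simp only [map_add, hw, hw']; abel
  | @mk m l b₁ c₁ r i e hr x y =>
    have s1 : koszulSign k (b₁ - 1) = -koszulSign k b₁ := by
      rw [koszulSign, koszulSign, Int.negOnePow_sub]; simp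
    have s2 : koszulSign k (b₁ + 1) = -koszulSign k b₁ := by
      rw [koszulSign_add, koszulSign_one, mul_neg, mul_one]
    have s3 := koszulSign_mul_self k b₁
    rw [map₀_mk, map₀_mk,
      htpy_mk U V A _ r i e hr (b' := b₁ - 1) (c' := c₁ - 1) (by lia) (by lia) (by lia) (by lia),
      der_mk D h' r i e hr x y rfl rfl (by lia) (by lia), map_add, map_add, map_smul, map_smul,
      der_mk D h r i e _ _ _ (b' := b₁) (c' := c₁ + 1) (by lia) (by lia) (by lia) (by lia),
      der_mk D h r i e _ _ _ (b' := b₁ + 1) (c' := c₁) (by lia) (by lia) (by lia) (by lia),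
      htpy_mk U V A _ r i e _ (b' := b₁) (c' := c₁ - 1) (by lia) (by lia) (by lia) (by lia),
      htpy_mk U V A _ r i e _ (b' := b₁ - 1) (c' := c₁) (by lia) (by lia) (by lia) (by lia),
      hU, hV, one_mul, one_mul, s1, s2]
    have e1 := H (n := m) (show b₁ - 1 + 1 = b₁ by lia) rfl x
    have e2 := H (n := l) (show c₁ - 1 + 1 = c₁ by lia) rfl y
    simp only [smul_add, smul_smul, s3, one_smul]
    have e3 := congrArg (mk r i e hr (V.map (add_zero b₁) x)) e2
    rw [map_add, map_add] at e3
    rw [e1, map_add, map_add, LinearMap.add_apply, LinearMap.add_apply, e3]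
    module

end FreeInf

section

variable {k : Type u} [Field k] [CharZero k]

/-- The projection to the operations of weight less than `w`. -/
noncomputable def Weight.belowFam {T : GradedOperad k} (W : Weight T) (w : ℕ) : EquivFam T T 0 :=
  EquivFam.ofMap (W.below w) (W.below_act w)

theorem Weight.belowFam_map {T : GradedOperad k} (W : Weight T) (w : ℕ) {n : ℕ} {a : ℤ}
    (h : a + 0 = a) (x : T.obj n a) : (W.belowFam w).map h x = W.below w x := rfl

theorem phiWeight_proj_phiD₀ (P : DGOperad k) (w : ℕ) {n : ℕ} {a b : ℤ} (h : a + 1 = b)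
    (x : (phiOperad P.toGradedOperad).obj n a) :
    (phiWeight P.toGradedOperad).proj w ((phiD₀ P).map h x) =
      (phiD₀ P).map h ((phiWeight P.toGradedOperad).proj w x) :=
  Weight.map_proj (fun x => phiWeight_phiD₀ P h x) w x

theorem isChain_belowFam (P : DGOperad k) (w : ℕ) :
    EquivFam.IsChain (phiD₀ P) (phiD₀ P) ((phiWeight P.toGradedOperad).belowFam w) :=
  fun h x => Weight.map_below (fun x => phiWeight_phiD₀ P h x) w x

/-- The contraction `[n] ↦ n φₙ` raises weights, so in weight `w` it only depends on the components
of weight less than `w` of the two factors of `x ∘ᵢ [n] ∘ y`. -/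
theorem proj_phiContract_map₀ (Q : GradedOperad k) (w : ℕ) {n : ℕ} {a : ℤ}
    (μ : FreeInf (phiOperad Q) n a) :
    (phiWeight Q).proj w (phiContract Q (FreeInf.map₀ ((phiWeight Q).belowFam w) μ)) =
      (phiWeight Q).proj w (phiContract Q μ) := by
  induction μ using FreeInf.induction with
  | zero => simp
  | add μ μ' h h' => simp only [map_add, h, h']
  | @mk m l b c r i e h x y =>
    rw [FreeInf.map₀_mk, Weight.belowFam_map, Weight.belowFam_map]
    have key : ∀ x y, phiContract Q (FreeInf.mk r i e h x y) = (r : k) •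
        (phiOperad Q).comp i e (by lia) x
          ((phiOperad Q).comp 0 (Graft.unit' l) rfl (phiGen Q r) y) := by
      intro x y
      rw [phiContract, FreeInf.contract_mk _ r i e h rfl (by lia), map_smul, LinearMap.smul_apply,
        map_smul]
    rw [key, key, map_smul, map_smul]
    rcases Nat.eq_zero_or_pos r with rfl | hr
    · rw [Nat.cast_zero, zero_smul, zero_smul]
    congr 1
    induction x using (phiWeight Q).induction with
    | zero => simp
    | add x x' hx hx' => simp only [map_add, LinearMap.add_apply, hx, hx']
    | of v x hx =>
      induction y using (phiWeight Q).induction with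
      | zero => simp
      | add y y' hy hy' => simp only [map_add, hy, hy']
      | of v' y hy =>
        have h1 := (phiWeight Q).E_comp_of i e (show b + (-2 * (r : ℤ) + c) = a by lia) hx
          ((phiWeight Q).E_comp_of 0 (Graft.unit' l) rfl (phiWeight_gen Q r) hy)
        rw [Weight.below_of _ hx, Weight.below_of _ hy]
        split_ifs with h2 h3 h3
        · rfl
        · rw [map_zero, map_zero, map_zero, (phiWeight Q).proj_of_ne h1 (by lia)]
        · rw [map_zero, LinearMap.zero_apply, map_zero, (phiWeight Q).proj_of_ne h1 (by lia)]
        · rw [map_zero, LinearMap.zero_apply, map_zero, (phiWeight Q).proj_of_ne h1 (by lia)]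

/-- The component of weight `w` of the contraction, divided by `w`. -/
noncomputable def phiRetract (Q : GradedOperad k) (w : ℕ) {n : ℕ} {a : ℤ} :
    FreeInf (phiOperad Q) n a →ₗ[k] (phiOperad Q).obj n a :=
  (w : k)⁻¹ • (phiWeight Q).proj w ∘ₗ phiContract Q

theorem phiRetract_apply (Q : GradedOperad k) (w : ℕ) {n : ℕ} {a : ℤ}
    (μ : FreeInf (phiOperad Q) n a) :
    phiRetract Q w μ = (w : k)⁻¹ • (phiWeight Q).proj w (phiContract Q μ) := rfl

theorem phiRetract_act (Q : GradedOperad k) (w : ℕ) {n : ℕ} {a : ℤ} (σ : Equiv.Perm (Fin n))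
    (μ : FreeInf (phiOperad Q) n a) :
    phiRetract Q w (FreeInf.act σ μ) = (phiOperad Q).act σ (phiRetract Q w μ) := by
  rw [phiRetract_apply, phiRetract_apply, phiContract, FreeInf.contract_act, Weight.proj_act,
    map_smul]

theorem phiRetract_der (P : DGOperad k) (w : ℕ) {n : ℕ} {a b : ℤ} (h : a + 1 = b)
    (μ : FreeInf (phiOperad P.toGradedOperad) n a) :
    phiRetract P.toGradedOperad w (FreeInf.der (phiD₀ P) h μ) =
      (phiD₀ P).map h (phiRetract P.toGradedOperad w μ) := by
  rw [phiRetract_apply, phiRetract_apply, phiContract_phiD₀, phiWeight_proj_phiD₀, map_smul]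

theorem phiRetract_map₀ (Q : GradedOperad k) {w : ℕ} (hw : 0 < w) {n : ℕ} {a : ℤ}
    (x : (phiOperad Q).obj n a) :
    phiRetract Q w (FreeInf.map₀ ((phiWeight Q).belowFam w) (phiUD Q ((phiWeight Q).proj w x))) =
      (phiWeight Q).proj w x := by
  rw [phiRetract_apply, proj_phiContract_map₀, ← phiWeight_E, Weight.E_proj, map_smul,
    Weight.proj_proj, smul_smul, inv_mul_cancel₀, one_smul]
  exact_mod_cast hw.ne'

/-- The correction of a homotopy in weight `w`. -/
noncomputable def phiHtpyCorrection (Q : GradedOperad k) (U V : EquivFam (phiOperad Q) (phiOperad Q) 0)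
    (A : EquivFam (phiOperad Q) (phiOperad Q) (-1)) (w : ℕ) :
    EquivFam (phiOperad Q) (phiOperad Q) (-1) where
  map h := phiRetract Q w ∘ₗ FreeInf.htpy U V A h ∘ₗ phiUD Q ∘ₗ (phiWeight Q).proj w
  map_act h σ x := by
    simp only [LinearMap.comp_apply]
    rw [Weight.proj_act, phiUD_act, FreeInf.htpy_act, phiRetract_act]

theorem phiHtpyCorrection_spec (P : DGOperad k)
    {U : EquivFam (phiOperad P.toGradedOperad) (phiOperad P.toGradedOperad) 0}
    {A : EquivFam (phiOperad P.toGradedOperad) (phiOperad P.toGradedOperad) (-1)} {w : ℕ}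
    (hw : 0 < w) (hU : EquivFam.IsChain (phiD₀ P) (phiD₀ P) U)
    (H : EquivFam.IsHtpy (phiD₀ P) U ((phiWeight P.toGradedOperad).belowFam w) A)
    {n : ℕ} {a b c : ℤ} (h : a + 1 = b) (h' : b + 1 = c)
    (x : (phiOperad P.toGradedOperad).obj n b) :
    phiRetract P.toGradedOperad w (FreeInf.map₀ U (phiUD P.toGradedOperad
        ((phiWeight P.toGradedOperad).proj w x))) =
      (phiWeight P.toGradedOperad).proj w x +
        (phiD₀ P).map h ((phiHtpyCorrection P.toGradedOperad U
          ((phiWeight P.toGradedOperad).belowFam w) A w).map (by lia) x) +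
        (phiHtpyCorrection P.toGradedOperad U
          ((phiWeight P.toGradedOperad).belowFam w) A w).map (by lia) ((phiD₀ P).map h' x) := by
  rw [FreeInf.map₀_eq_of_isHtpy hU (isChain_belowFam P w) H h h', map_add, map_add,
    phiRetract_map₀ _ hw, phiRetract_der, ← phiUD_phiD₀, ← phiWeight_proj_phiD₀]
  rfl

end

/-! ### The homotopy quotient preserves quasi-isomorphisms -/

section

variable {k : Type u} [Field k] [CharZero k]

theorem Weight.proj_zero_comp {T : GradedOperad k} (W : Weight T) {m n p : ℕ} {a b c : ℤ}
    (i : Fin m) (e : Graft m n p i) (h : a + b = c) (x : T.obj m a) (y : T.obj n b) :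
    W.proj 0 (T.comp i e h x y) = T.comp i e h (W.proj 0 x) (W.proj 0 y) := by
  induction x using W.induction with
  | zero => simp
  | add x x' hx hx' => simp only [map_add, LinearMap.add_apply, hx, hx']
  | of v x hx =>
    induction y using W.induction with
    | zero => simp
    | add y y' hy hy' => simp only [map_add, hy, hy']
    | of w y hy =>
      rw [W.proj_of (W.E_comp_of i e h hx hy), W.proj_of hx, W.proj_of hy]
      split_ifs with h1 h2 h3 h2 h3
      · rfl
      all_goals first | lia | simp

theorem Weight.below_below {T : GradedOperad k} (W : Weight T) (w : ℕ) {n : ℕ} {a : ℤ}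
    (x : T.obj n a) : W.below w (W.below w x) = W.below w x := by
  refine W.hom_ext (f := W.below w ∘ₗ W.below w) (g := W.below w) (fun s x hs => ?_) x
  rw [LinearMap.comp_apply, W.below_of hs]
  split_ifs with h
  · rw [W.below_of hs, if_pos h]
  · rw [map_zero]

theorem Weight.below_one {T : GradedOperad k} (W : Weight T) {n : ℕ} {a : ℤ} (x : T.obj n a) :
    W.below 1 x = W.proj 0 x := by
  rw [W.below_succ, W.below_zero, zero_add]

/-- The projection `P ⋆ k⟨φ₁, φ₂, …⟩ → P` with `φₙ ↦ 0`. -/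
def phiAug (P : GradedOperad k) : GradedOperad.Hom (phiOperad P) P :=
  phiLift (GradedOperad.Hom.id P) fun _ => 0

theorem phiAug_of (P : GradedOperad k) {n : ℕ} {a : ℤ} (x : P.obj n a) :
    (phiAug P).map (phiOf P x) = x := rfl

theorem phiAug_gen (P : GradedOperad k) (n : ℕ) : (phiAug P).map (phiGen P n) = 0 :=
  phiLift_gen' _ _ rfl n

theorem phiAug_phiD₀ (P : DGOperad k) {n : ℕ} {a b : ℤ} (h : a + 1 = b)
    (x : (phiOperad P.toGradedOperad).obj n a) :
    (phiAug P.toGradedOperad).map ((phiD₀ P).map h x) =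
      P.dFam.map h ((phiAug P.toGradedOperad).map x) := by
  refine phi_induction (P := fun {n a} x => ∀ (b : ℤ) (h : a + 1 = b),
    (phiAug P.toGradedOperad).map ((phiD₀ P).map h x) =
      P.dFam.map h ((phiAug P.toGradedOperad).map x)) ?_ ?_ ?_ ?_ ?_ ?_ x b h
  · intro n a q b h
    rw [phiD₀_of, phiAug_of, phiAug_of]
  · intro n hn b h
    rw [phiD₀_gen, phiAug_gen, map_zero, map_zero]
  · intro n a x y hx hy b h
    simp only [map_add, hx, hy]
  · intro n a s x hx b h
    simp only [map_smul, hx]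
  · intro n a σ x hx b h
    rw [EquivFam.map_act, (phiAug _).map_act, (phiAug _).map_act, hx, EquivFam.map_act]
  · intro m n p a b c i e h x y hx hy c' hc
    rw [isDer_phiD₀ P i e h rfl rfl hc, map_add, map_smul, (phiAug _).map_comp,
      (phiAug _).map_comp, (phiAug _).map_comp, hx, hy, P.isDer_dFam i e h rfl rfl hc]

theorem phiWeight_proj_zero (P : GradedOperad k) {n : ℕ} {a : ℤ} (x : (phiOperad P).obj n a) :
    (phiWeight P).proj 0 x = phiOf P ((phiAug P).map x) := by
  refine phi_induction (P := fun {n a} x => 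
    (phiWeight P).proj 0 x = (phiOfHom P).map ((phiAug P).map x)) ?_ ?_ ?_ ?_ ?_ ?_ x
  · intro n a q
    rw [phiAug_of, phiOfHom_map, Weight.proj_of_self]
    rw [phiWeight_of, Nat.cast_zero, zero_smul]
  · intro n hn
    rw [phiAug_gen, map_zero, (phiWeight P).proj_of_ne (phiWeight_gen P n) hn.ne']
  · intro n a x y hx hy
    simp only [map_add, hx, hy]
  · intro n a s x hx
    simp only [map_smul, hx]
  · intro n a σ x hx
    rw [Weight.proj_act, hx, (phiAug P).map_act, (phiOfHom P).map_act]
  · intro m n p a b c i e h x y hx hy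
    rw [Weight.proj_zero_comp, hx, hy, (phiAug P).map_comp, (phiOfHom P).map_comp]

/-- The family of maps `x ↦ of (A (aug x))`. -/
def EquivFam.phiConj {P Q : GradedOperad k} {p : ℤ} (A : EquivFam P Q p) :
    EquivFam (phiOperad P) (phiOperad Q) p where
  map h := (phiOfHom Q).map ∘ₗ A.map h ∘ₗ (phiAug P).map
  map_act h σ x := by
    simp only [LinearMap.comp_apply]
    rw [(phiAug P).map_act, A.map_act, (phiOfHom Q).map_act]

theorem EquivFam.phiConj_map {P Q : GradedOperad k} {p : ℤ} (A : EquivFam P Q p) {n : ℕ} {a b : ℤ}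
    (h : a + p = b) (x : (phiOperad P).obj n a) :
    A.phiConj.map h x = phiOf Q (A.map h ((phiAug P).map x)) := rfl

variable {P Q : DGOperad k} (f : DGOperad.Hom P Q)

/-- `phiMapHom` as an equivariant family. -/
def phiMapFam : EquivFam (phiOperad P.toGradedOperad) (phiOperad Q.toGradedOperad) 0 :=
  EquivFam.ofMap (phiMapHom f).map (phiMapHom f).map_act

theorem phiMapFam_map {n : ℕ} {a : ℤ} (h : a + 0 = a) (x : (phiOperad P.toGradedOperad).obj n a) :
    (phiMapFam f).map h x = (phiMapHom f).map x := rfl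

theorem phiAug_phiMapHom {n : ℕ} {a : ℤ} (x : (phiOperad P.toGradedOperad).obj n a) :
    (phiAug Q.toGradedOperad).map ((phiMapHom f).map x) = f.map ((phiAug P.toGradedOperad).map x) := by
  refine phiHom_ext (f := (phiAug Q.toGradedOperad).comp (phiMapHom f))
    (g := f.toGraded.comp (phiAug P.toGradedOperad)) (fun {_ _} q => rfl) (fun n _ => ?_) x
  change (phiAug _).map ((phiMapHom f).map _) = f.map ((phiAug _).map _)
  rw [phiMapHom_gen, phiAug_gen, phiAug_gen, map_zero]

/-- An inverse of the morphism induced by `f` with respect to the differentials `phiD₀`, up to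
homotopies and up to operations of weight at least `w`. -/
structure PhiInverse (w : ℕ) where
  inv : EquivFam (phiOperad Q.toGradedOperad) (phiOperad P.toGradedOperad) 0
  left : EquivFam (phiOperad P.toGradedOperad) (phiOperad P.toGradedOperad) (-1)
  right : EquivFam (phiOperad Q.toGradedOperad) (phiOperad Q.toGradedOperad) (-1)
  isChain : EquivFam.IsChain (phiD₀ Q) (phiD₀ P) inv
  isHtpy_left : EquivFam.IsHtpy (phiD₀ P) (inv.comp (phiMapFam f) (add_zero 0))
    ((phiWeight P.toGradedOperad).belowFam w) left
  isHtpy_right : EquivFam.IsHtpy (phiD₀ Q) ((phiMapFam f).comp inv (add_zero 0))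
    ((phiWeight Q.toGradedOperad).belowFam w) right

variable {f}

/-- In weight `0`, the inverse is given by a homotopy inverse of `f`. -/
def DGOperad.Hom.HomotopyInverse.phiInverseOne (I : f.HomotopyInverse) : PhiInverse f 1 where
  inv := I.inv.phiConj
  left := I.left.phiConj
  right := I.right.phiConj
  isChain h x := by
    rw [EquivFam.phiConj_map, EquivFam.phiConj_map, phiAug_phiD₀, I.inv_d, phiD₀_of]
  isHtpy_left h h' x := by
    rw [EquivFam.comp_map _ _ _ (add_zero _) (add_zero _), phiMapFam_map, Weight.belowFam_map,
      Weight.below_one, phiWeight_proj_zero, EquivFam.phiConj_map, EquivFam.phiConj_map,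
      EquivFam.phiConj_map, phiAug_phiD₀, phiAug_phiMapHom, I.inv_map h h', phiD₀_of,
      ← phiOfHom_map, map_add, map_add]
    rfl
  isHtpy_right h h' x := by
    rw [EquivFam.comp_map _ _ _ (add_zero _) (add_zero _), phiMapFam_map, Weight.belowFam_map,
      Weight.below_one, phiWeight_proj_zero, EquivFam.phiConj_map, EquivFam.phiConj_map,
      EquivFam.phiConj_map, phiAug_phiD₀, phiMapHom_of, I.map_inv h h', phiD₀_of,
      ← phiOfHom_map, map_add, map_add]
    rfl

theorem phiMapFam_isChain : EquivFam.IsChain (phiD₀ P) (phiD₀ Q) (phiMapFam f) :=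
  fun h x => phiMapHom_phiD₀ f h x

theorem EquivFam.IsChain.comp {T S R : GradedOperad k} {D : EquivFam T T 1} {D' : EquivFam S S 1}
    {D'' : EquivFam R R 1} {V : EquivFam S R 0} {U : EquivFam T S 0}
    (hV : EquivFam.IsChain D' D'' V) (hU : EquivFam.IsChain D D' U) :
    EquivFam.IsChain D D'' (V.comp U (add_zero 0)) := fun h x => by
  rw [EquivFam.comp_map _ _ _ (add_zero _) (add_zero _),
    EquivFam.comp_map _ _ _ (add_zero _) (add_zero _), hU, hV]

theorem phiMapHom_proj (w : ℕ) {n : ℕ} {a : ℤ} (x : (phiOperad P.toGradedOperad).obj n a) :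
    (phiWeight Q.toGradedOperad).proj w ((phiMapHom f).map x) =
      (phiMapHom f).map ((phiWeight P.toGradedOperad).proj w x) :=
  Weight.map_proj (fun x => phiWeight_phiMapHom f x) w x

theorem phiMapHom_phiRetract (w : ℕ) {n : ℕ} {a : ℤ}
    (μ : FreeInf (phiOperad P.toGradedOperad) n a) :
    (phiMapHom f).map (phiRetract P.toGradedOperad w μ) =
      phiRetract Q.toGradedOperad w (FreeInf.map₀ (phiMapFam f) μ) := by
  rw [phiRetract_apply, phiRetract_apply, map_smul, ← phiMapHom_proj, phiMapHom_phiContract]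
  rfl

/-- In weight `w`, the inverse is `R (G ⊗ G) ∂`, for the universal derivation `∂`, the retraction
`R` of `∂`, and an inverse `G` in smaller weights. -/
noncomputable def PhiInverse.succ {w : ℕ} (hw : 0 < w) (I : PhiInverse f w) :
    PhiInverse f (w + 1) where
  inv := I.inv.add
    { map := fun {_ a a'} h => (show a = a' by lia) ▸ (phiRetract P.toGradedOperad w ∘ₗ
        FreeInf.map₀ I.inv ∘ₗ phiUD Q.toGradedOperad ∘ₗ (phiWeight Q.toGradedOperad).proj w)
      map_act := fun {n a a'} h σ x => by
        obtain rfl : a = a' := by lia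
        simp only [LinearMap.comp_apply]
        rw [Weight.proj_act, phiUD_act, FreeInf.map₀, FreeInf.map₂_act, phiRetract_act] }
  left := I.left.add (phiHtpyCorrection P.toGradedOperad (I.inv.comp (phiMapFam f) (add_zero 0))
    ((phiWeight P.toGradedOperad).belowFam w) I.left w)
  right := I.right.add (phiHtpyCorrection Q.toGradedOperad ((phiMapFam f).comp I.inv (add_zero 0))
    ((phiWeight Q.toGradedOperad).belowFam w) I.right w)
  isChain h x := by
    rw [EquivFam.add_map, EquivFam.add_map, map_add, I.isChain h x]
    congr 1
    change phiRetract _ w (FreeInf.map₀ I.inv (phiUD _ (Weight.proj _ w _))) =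
      (phiD₀ P).map h (phiRetract _ w (FreeInf.map₀ I.inv (phiUD _ (Weight.proj _ w _))))
    rw [phiWeight_proj_phiD₀, phiUD_phiD₀, FreeInf.map₀_der I.isChain, phiRetract_der]
  isHtpy_left h h' x := by
    have h1 := I.isHtpy_left h h' x
    have h2 := phiHtpyCorrection_spec P hw (EquivFam.IsChain.comp I.isChain phiMapFam_isChain) I.isHtpy_left h h' x
    rw [← FreeInf.map₀_map₀] at h2
    change phiRetract _ w (FreeInf.map₀ _ (FreeInf.mapHom (phiMapHom f) _)) = _ at h2
    rw [mapHom_phiUD, ← phiMapHom_proj] at h2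
    rw [EquivFam.comp_map _ _ _ (add_zero _) (add_zero _), phiMapFam_map] at h1
    rw [EquivFam.comp_map _ _ _ (add_zero _) (add_zero _), phiMapFam_map, EquivFam.add_map,
      EquivFam.add_map, EquivFam.add_map, h1]
    refine (congrArg _ h2).trans ?_
    rw [Weight.belowFam_map, Weight.belowFam_map, Weight.below_succ, map_add]
    abel
  isHtpy_right h h' x := by
    have h1 := I.isHtpy_right h h' x
    have h2 := phiHtpyCorrection_spec Q hw (EquivFam.IsChain.comp phiMapFam_isChain I.isChain) I.isHtpy_right h h' x
    rw [← FreeInf.map₀_map₀, ← phiMapHom_phiRetract] at h2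
    rw [EquivFam.comp_map _ _ _ (add_zero _) (add_zero _), phiMapFam_map] at h1
    rw [EquivFam.comp_map _ _ _ (add_zero _) (add_zero _), phiMapFam_map, EquivFam.add_map,
      EquivFam.add_map, EquivFam.add_map, map_add, h1]
    refine (congrArg _ h2).trans ?_
    rw [Weight.belowFam_map, Weight.belowFam_map, Weight.below_succ, map_add]
    abel

theorem DGOperad.Hom.HomotopyInverse.nonempty_phiInverse (I : f.HomotopyInverse) (w : ℕ) :
    Nonempty (PhiInverse f (w + 1)) := by
  induction w with
  | zero => exact ⟨I.phiInverseOne⟩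
  | succ w ih => exact ih.elim fun J => ⟨J.succ w.succ_pos⟩

/-- In each weight, the cone of the morphism induced by `f` is acyclic for `phiD₀`. -/
theorem DGOperad.Hom.HomotopyInverse.phiD₀_coneAcyclic (I : f.HomotopyInverse) (w : ℕ) {n : ℕ}
    {a₁ a a₂ : ℤ} (h : a₁ + 1 = a) (h' : a + 1 = a₂) {x : (phiOperad P.toGradedOperad).obj n a₂}
    {y : (phiOperad Q.toGradedOperad).obj n a} (hx : (phiWeight P.toGradedOperad).proj w x = x)
    (hy : (phiWeight Q.toGradedOperad).proj w y = y) (hdx : (phiD₀ P).map rfl x = 0)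
    (hdy : (phiD₀ Q).map h' y = (phiMapHom f).map x) :
    ∃ (x' : (phiOperad P.toGradedOperad).obj n a) (y' : (phiOperad Q.toGradedOperad).obj n a₁),
      (phiWeight P.toGradedOperad).proj w x' = x' ∧ (phiWeight Q.toGradedOperad).proj w y' = y' ∧
      (phiD₀ P).map h' x' = x ∧ (phiMapHom f).map x' = y + (phiD₀ Q).map h y' := by
  obtain ⟨J⟩ := I.nonempty_phiInverse w
  have hb : ∀ {P : DGOperad k} {b : ℤ} {x : (phiOperad P.toGradedOperad).obj n b},
      (phiWeight P.toGradedOperad).proj w x = x →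
      (phiWeight P.toGradedOperad).below (w + 1) x = x := fun {_ _ x} hx => by
    rw [← hx, Weight.below_proj _ w.lt_succ_self]
  have h1 := J.isHtpy_left h' rfl x
  have h2 := J.isHtpy_right h h' y
  have h3 := J.isHtpy_right h' rfl ((phiMapHom f).map x)
  rw [EquivFam.comp_map _ _ _ (add_zero _) (add_zero _), Weight.belowFam_map, phiMapFam_map] at h1 h2 h3
  rw [hdx, map_zero, add_zero, hb hx] at h1
  rw [hdy, hb hy] at h2
  rw [← phiMapHom_phiD₀, hdx, map_zero, map_zero, add_zero, h1, hb (by rw [phiMapHom_proj, hx])] at h3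
  have h4 := J.isHtpy_right h h' (J.right.map (by lia) ((phiMapHom f).map x) -
    (phiMapHom f).map (J.left.map (show a₂ + -1 = a by lia) x))
  -- The homotopies need not be compatible with `f`. The failure `z` is a cycle and is subtracted.
  set z := J.right.map (show a₂ + -1 = a by lia) ((phiMapHom f).map x) -
    (phiMapHom f).map (J.left.map (show a₂ + -1 = a by lia) x) with hz
  have hdz : (phiD₀ Q).map h' z = 0 := by
    rw [map_add] at h3
    rw [hz, map_sub, ← phiMapHom_phiD₀, sub_eq_zero]
    exact (add_left_cancel h3).symm
  rw [EquivFam.comp_map _ _ _ (add_zero _) (add_zero _), Weight.belowFam_map, phiMapFam_map, hdz,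
    map_zero, add_zero] at h4
  refine ⟨(phiWeight P.toGradedOperad).proj w (J.inv.map (add_zero a) y -
      J.left.map (by lia) x - J.inv.map (add_zero a) z),
    (phiWeight Q.toGradedOperad).proj w (J.right.map (by lia) y - J.right.map (by lia) z),
    Weight.proj_proj _ _ _, Weight.proj_proj _ _ _, ?_, ?_⟩
  · rw [← phiWeight_proj_phiD₀]
    simp only [map_sub]
    rw [← J.isChain, ← J.isChain, hdz, hdy, h1]
    simp only [map_add, map_zero, hx]
    abel
  · rw [← phiWeight_proj_phiD₀, ← phiMapHom_proj]
    simp only [map_sub]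
    rw [h2, h4]
    simp only [map_add, Weight.proj_below _ w.lt_succ_self, hy]
    have h5 : (phiWeight Q.toGradedOperad).proj w z = (phiWeight Q.toGradedOperad).proj w
        (J.right.map (by lia) ((phiMapHom f).map x)) - (phiWeight Q.toGradedOperad).proj w
        ((phiMapHom f).map (J.left.map (by lia) x)) := by rw [hz, map_sub]
    rw [h5]
    abel

variable (Q' : DeltaDGOperad k)

/-- The difference of the differential of `Q/Δ` and `phiD₀`. -/
noncomputable def phiD₁ : EquivFam (phiOperad Q'.toGradedOperad) (phiOperad Q'.toGradedOperad) 1 :=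
  (phiDFam Q').add (EquivFam.smul (-1) (phiD₀ Q'.toDGOperad))

theorem phiD₁_map {n : ℕ} {a b : ℤ} (h : a + 1 = b) (x : (phiOperad Q'.toGradedOperad).obj n a) :
    (phiD₁ Q').map h x = (phiDFam Q').map h x - (phiD₀ Q'.toDGOperad).map h x := by
  rw [phiD₁, EquivFam.add_map, EquivFam.smul_map, neg_one_smul, sub_eq_add_neg]

theorem phiDFam_eq_add {n : ℕ} {a b : ℤ} (h : a + 1 = b)
    (x : (phiOperad Q'.toGradedOperad).obj n a) :
    (phiDFam Q').map h x = (phiD₀ Q'.toDGOperad).map h x + (phiD₁ Q').map h x := by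
  rw [phiD₁_map, add_sub_cancel]

theorem phiDFam_of {n : ℕ} {a b : ℤ} (h : a + 1 = b) (q : Q'.obj n a) :
    (phiDFam Q').map h (phiOf Q'.toGradedOperad q) = phiOf _ (Q'.dFam.map h q) := by
  subst h; rfl

theorem phiDFam_gen {n : ℕ} :
    (phiDFam Q').map rfl (phiGen Q'.toGradedOperad n) =
      phiDiff _ (phiGen Q'.toGradedOperad) (phiOf _ Q'.Δ) n := phiD_gen Q' n

/-- The component `phiD₁` lowers the weight by one. -/
theorem phiWeight_phiD₁ {n : ℕ} {a b : ℤ} (h : a + 1 = b)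
    (x : (phiOperad Q'.toGradedOperad).obj n a) :
    (phiWeight Q'.toGradedOperad).E ((phiD₁ Q').map h x) + ((1 : ℕ) : k) • (phiD₁ Q').map h x =
      (phiD₁ Q').map h ((phiWeight Q'.toGradedOperad).E x) := by
  rw [Nat.cast_one, one_smul]
  refine phi_induction (P := fun {n a} x => ∀ (b : ℤ) (h : a + 1 = b),
    (phiWeight Q'.toGradedOperad).E ((phiD₁ Q').map h x) + (phiD₁ Q').map h x =
      (phiD₁ Q').map h ((phiWeight Q'.toGradedOperad).E x)) ?_ ?_ ?_ ?_ ?_ ?_ x b h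
  · intro n a q b h
    rw [phiD₁_map, phiDFam_of, phiD₀_of, sub_self, phiWeight_of, map_zero, map_zero, add_zero]
  · intro n hn b h
    subst h
    rw [phiWeight_gen, map_smul, phiD₁_map, phiDFam_gen, phiD₀_gen, sub_zero,
      Weight.E_phiDiff _ (phiWeight_gen _) (phiWeight_of _ _), sub_smul, one_smul,
      sub_add_cancel]
  · intro n a x y hx hy b h
    simp only [map_add, ← hx, ← hy]
    abel
  · intro n a s x hx b h
    simp only [map_smul, ← hx, smul_add]
  · intro n a σ x hx b h
    rw [EquivFam.map_act, Weight.E_act, Weight.E_act, EquivFam.map_act, ← hx, map_add]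
  · intro m n p a b c i e h x y hx hy c' hc
    have key : ∀ (x : (phiOperad Q'.toGradedOperad).obj m a)
        (y : (phiOperad Q'.toGradedOperad).obj n b), (phiD₁ Q').map hc
          ((phiOperad Q'.toGradedOperad).comp i e h x y) =
        (phiOperad Q'.toGradedOperad).comp i e (by lia) ((phiD₁ Q').map rfl x) y +
          koszulSign k (1 * a) • (phiOperad Q'.toGradedOperad).comp i e (by lia) x
            ((phiD₁ Q').map rfl y) := by
      intro x y
      rw [phiD₁_map, phiD₁_map, phiD₁_map, isDer_phiDFam Q' i e h rfl rfl hc,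
        isDer_phiD₀ Q'.toDGOperad i e h rfl rfl hc]
      simp only [map_sub, LinearMap.sub_apply, smul_sub]
      abel
    rw [Weight.E_comp, map_add, key, key, key, ← hx, ← hy]
    simp only [map_add, map_smul, Weight.E_comp, LinearMap.add_apply, smul_add]
    abel

theorem phiWeight_proj_phiD₁ (w : ℕ) {n : ℕ} {a b : ℤ} (h : a + 1 = b)
    (x : (phiOperad Q'.toGradedOperad).obj n a) :
    (phiWeight Q'.toGradedOperad).proj w ((phiD₁ Q').map h x) =
      (phiD₁ Q').map h ((phiWeight Q'.toGradedOperad).proj (w + 1) x) :=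
  Weight.map_proj_shift (phiWeight_phiD₁ Q' h) w x

theorem phiWeight_below_phiD₁ {w : ℕ} {n : ℕ} {a b : ℤ} (h : a + 1 = b)
    {x : (phiOperad Q'.toGradedOperad).obj n a} (hx : (phiWeight Q'.toGradedOperad).proj w x = x) :
    (phiWeight Q'.toGradedOperad).below w ((phiD₁ Q').map h x) = (phiD₁ Q').map h x := by
  obtain ⟨N, hN⟩ := (phiWeight Q'.toGradedOperad).exists_below ((phiD₁ Q').map h x)
  have h1 : ∀ v, (phiWeight Q'.toGradedOperad).proj v ((phiD₁ Q').map h x) =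
      if v + 1 = w then (phiD₁ Q').map h x else 0 := by
    intro v
    have hE := (phiWeight Q'.toGradedOperad).E_proj w x
    rw [hx] at hE
    rw [phiWeight_proj_phiD₁, Weight.proj_of _ hE]
    split_ifs <;> first | lia | simp
  have h2 : ∀ v, (phiWeight Q'.toGradedOperad).below v ((phiD₁ Q').map h x) =
      ∑ v' ∈ Finset.range v, if v' + 1 = w then (phiD₁ Q').map h x else 0 := by
    intro v
    rw [Weight.below, LinearMap.sum_apply]
    exact Finset.sum_congr rfl fun v' _ => h1 v'
  rw [h2] at hN ⊢
  cases w with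
  | zero => simpa using hN
  | succ w => simp

variable {Q'}

/-- Acyclicity of the cone in weights less than `w`: the component of top weight is a boundary for
`phiD₀`, and the error, in `phiD₁`, has smaller weight. -/
theorem DeltaDGOperad.Hom.coneAcyclic_of_below {P' : DeltaDGOperad k} (f : DeltaDGOperad.Hom P' Q')
    (hf : f.hom.ConeAcyclic) (w : ℕ) {n : ℕ} {a₁ a a₂ : ℤ} (h : a₁ + 1 = a) (h' : a + 1 = a₂)
    {x : (phiOperad P'.toGradedOperad).obj n a₂} {y : (phiOperad Q'.toGradedOperad).obj n a}
    (hx : (phiWeight P'.toGradedOperad).below w x = x)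
    (hy : (phiWeight Q'.toGradedOperad).below w y = y) (hdx : (phiDFam P').map rfl x = 0)
    (hdy : (phiDFam Q').map h' y = (phiMapHom f.hom).map x) :
    ∃ (x' : (phiOperad P'.toGradedOperad).obj n a) (y' : (phiOperad Q'.toGradedOperad).obj n a₁),
      (phiDFam P').map h' x' = x ∧ (phiMapHom f.hom).map x' = y + (phiDFam Q').map h y' := by
  have hF : ∀ {n : ℕ} {a b : ℤ} (h : a + 1 = b) (x : (phiOperad P'.toGradedOperad).obj n a),
      (phiMapHom f.hom).map ((phiDFam P').map h x) =
        (phiDFam Q').map h ((phiMapHom f.hom).map x) := by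
    intro n a b h x
    subst h
    exact phiMap_d f x
  have hdd : ∀ {Q' : DeltaDGOperad k} {n : ℕ} {a b c : ℤ} (h : a + 1 = b) (h' : b + 1 = c)
      (x : (phiOperad Q'.toGradedOperad).obj n a), (phiDFam Q').map h' ((phiDFam Q').map h x) = 0 := by
    intro Q' n a b c h h' x
    subst h h'
    exact phiD_phiD Q' x
  induction w generalizing x y with
  | zero =>
    rw [Weight.below_zero] at hx hy
    subst hx hy
    exact ⟨0, 0, by simp, by simp⟩
  | succ w ih =>
    obtain ⟨I⟩ := hf.nonempty_homotopyInverse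
    have htop : ∀ {Q' : DeltaDGOperad k} {b c : ℤ} (h : b + 1 = c)
        {x : (phiOperad Q'.toGradedOperad).obj n b},
        (phiWeight Q'.toGradedOperad).below (w + 1) x = x →
        (phiWeight Q'.toGradedOperad).proj w ((phiDFam Q').map h x) =
          (phiD₀ Q'.toDGOperad).map h ((phiWeight Q'.toGradedOperad).proj w x) := by
      intro Q' b c h x hx
      have h0 : (phiWeight Q'.toGradedOperad).proj (w + 1) x = 0 := by
        rw [← hx, Weight.below, LinearMap.sum_apply, map_sum]
        exact Finset.sum_eq_zero fun v hv => Weight.proj_of_ne _ (Weight.E_proj _ v x)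
          (Finset.mem_range.mp hv).ne
      rw [phiDFam_eq_add, map_add, phiWeight_proj_phiD₀, phiWeight_proj_phiD₁, h0, map_zero,
        add_zero]
    obtain ⟨x', y', hx', hy', hdx', hdy'⟩ := I.phiD₀_coneAcyclic w h h'
      (x := (phiWeight P'.toGradedOperad).proj w x) (y := (phiWeight Q'.toGradedOperad).proj w y)
      (Weight.proj_proj _ _ _) (Weight.proj_proj _ _ _)
      (by rw [← htop _ hx, hdx, map_zero]) (by rw [← htop _ hy, hdy, phiMapHom_proj])
    rw [Weight.below_succ] at hx hy
    have hx2 : x - (phiDFam P').map h' x' = (phiWeight P'.toGradedOperad).below w x -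
        (phiD₁ P').map h' x' := by
      conv_lhs => rw [← hx]
      rw [phiDFam_eq_add, hdx']
      abel
    have hy2 : y + (phiDFam Q').map h y' - (phiMapHom f.hom).map x' =
        (phiWeight Q'.toGradedOperad).below w y + (phiD₁ Q').map h y' := by
      conv_lhs => rw [← hy]
      rw [phiDFam_eq_add, hdy']
      abel
    obtain ⟨x'', y'', h1, h2⟩ := ih (x := x - (phiDFam P').map h' x')
      (y := y + (phiDFam Q').map h y' - (phiMapHom f.hom).map x')
      (by rw [hx2, map_sub, phiWeight_below_phiD₁ _ _ hx', Weight.below_below])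
      (by rw [hy2, map_add, phiWeight_below_phiD₁ _ _ hy', Weight.below_below])
      (by rw [map_sub, hdx, hdd, sub_zero])
      (by rw [map_sub, map_sub, map_add, hdy, hdd, add_zero, hF])
    refine ⟨x'' + x', y' + y'', by rw [map_add, h1, sub_add_cancel], ?_⟩
    rw [map_add, h2, map_add]
    abel

theorem homotopyQuotient_map_quasiIso {P' Q' : DeltaDGOperad k} (f : P' ⟶ Q')
    (hf : DeltaDGOperad.quasiIso k f) : DGOperad.quasiIso k ((homotopyQuotient k).map f) := by
  refine (DGOperad.Hom.quasiIso_iff_coneAcyclic _).mpr fun n a₁ a a₂ h h' x y hx hy => ?_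
  obtain ⟨v, hv⟩ := (phiWeight P'.toGradedOperad).exists_below x
  obtain ⟨w, hw⟩ := (phiWeight Q'.toGradedOperad).exists_below y
  exact DeltaDGOperad.Hom.coneAcyclic_of_below f
    ((DGOperad.Hom.quasiIso_iff_coneAcyclic _).mp hf) (max v w) h h'
    (Weight.below_of_le _ (le_max_left v w) hv) (Weight.below_of_le _ (le_max_right v w) hw) hx hy

end

/-! ### Logarithms -/

section

variable {k : Type u} [Field k] {P : GradedOperad k}

theorem phiPow_congr {φ φ' : ∀ n : ℕ, P.obj 1 (-2 * (n : ℤ))} (n : ℕ) (h : ∀ i ≤ n, φ i = φ' i)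
    (j : ℕ) : phiPow P φ j n = phiPow P φ' j n := by
  induction j generalizing n with
  | zero => cases n <;> rfl
  | succ j ih =>
    rw [phiPow, phiPow]
    refine Finset.sum_congr rfl fun i _ => ?_
    have hi := i.isLt
    rw [h i (by lia), ih (n - i) fun i' hi' => h i' (by lia)]

theorem phiPow_congr' {φ φ' : ∀ n : ℕ, P.obj 1 (-2 * (n : ℤ))} (hφ : φ 0 = 0) (hφ' : φ' 0 = 0)
    (n : ℕ) (h : ∀ i < n, φ i = φ' i) (j : ℕ) :
    phiPow P φ (j + 2) n = phiPow P φ' (j + 2) n := by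
  rw [phiPow, phiPow]
  refine Finset.sum_congr rfl fun i _ => ?_
  have hi := i.isLt
  rcases Nat.lt_or_ge (i : ℕ) n with h1 | h1
  · rw [h i h1]
    rcases Nat.eq_zero_or_pos (i : ℕ) with h2 | h2
    · have h3 : φ' i = 0 := by rw [h2]; exact hφ'
      rw [h3, P.zero_mul, P.zero_mul]
    · rw [phiPow_congr (φ' := φ') _ fun i' hi' => h i' (by lia)]
  · have h3 : ∀ {φ : ∀ n : ℕ, P.obj 1 (-2 * (n : ℤ))} (_ : φ 0 = 0) {s : ℕ} (_ : s = 0),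
        phiPow P φ (j + 1) s = 0 := by
      rintro φ hφ s rfl
      exact phiPow_zero_coeff hφ j
    rw [h3 hφ (by lia), h3 hφ' (by lia), P.mul_zero, P.mul_zero]

theorem phiExp_eq {φ : ∀ n : ℕ, P.obj 1 (-2 * (n : ℤ))} {n : ℕ} (hn : 0 < n) :
    phiExp P φ n = φ n + ∑ j ∈ Finset.Icc 2 n, ((j.factorial : k)⁻¹) • phiPow P φ j n := by
  obtain ⟨n, rfl⟩ := Nat.exists_eq_add_of_lt hn
  rw [zero_add]
  have hr : Finset.range (n + 1 + 1) = insert 0 (insert 1 (Finset.Icc 2 (n + 1))) := by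
    ext j
    simp only [Finset.mem_range, Finset.mem_insert, Finset.mem_Icc]
    lia
  rw [phiExp, hr, Finset.sum_insert (by simp), Finset.sum_insert (by simp), phiPow_one]
  simp [phiPow]

theorem phiExp_zero (φ : ∀ n : ℕ, P.obj 1 (-2 * (n : ℤ))) : phiExp P φ 0 = P.id := by
  simp only [phiExp, zero_add, Finset.sum_range_one, Nat.factorial_zero, Nat.cast_one, inv_one,
    one_smul]
  rfl

/-- The coefficients of the logarithm of a power series `u(z) = 1 + ∑ uₙ zⁿ`, determined one after
another. -/
noncomputable def phiLog (u : ∀ n : ℕ, P.obj 1 (-2 * (n : ℤ))) (n : ℕ) : P.obj 1 (-2 * (n : ℤ)) :=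
  if n = 0 then 0 else u n - ∑ j ∈ Finset.Icc 2 n, ((j.factorial : k)⁻¹) •
    phiPow P (fun i => if i < n then phiLog u i else 0) j n
termination_by n

theorem phiLog_zero (u : ∀ n : ℕ, P.obj 1 (-2 * (n : ℤ))) : phiLog u 0 = 0 := by
  rw [phiLog, if_pos rfl]

theorem phiExp_phiLog {u : ∀ n : ℕ, P.obj 1 (-2 * (n : ℤ))} (hu : u 0 = (by exact P.id)) (n : ℕ) :
    phiExp P (phiLog u) n = u n := by
  rcases Nat.eq_zero_or_pos n with rfl | hn
  · rw [phiExp_zero, hu]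
  · rw [phiExp_eq hn, phiLog, if_neg hn.ne', sub_add_eq_add_sub, sub_eq_iff_eq_add]
    refine congrArg _ (Finset.sum_congr rfl fun j hj => ?_)
    obtain ⟨j, rfl⟩ := Nat.exists_eq_add_of_le' (Finset.mem_Icc.mp hj).1
    rw [phiPow_congr' (phiLog_zero u) (by simp [hn, phiLog_zero]) n (fun i hi => (if_pos hi).symm)]

theorem GradedOperad.Hom.map_phiPow {S : GradedOperad k} (F : GradedOperad.Hom P S)
    (φ : ∀ n : ℕ, P.obj 1 (-2 * (n : ℤ))) (j n : ℕ) :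
    F.map (phiPow P φ j n) = phiPow S (fun n => F.map (φ n)) j n := by
  induction j generalizing n with
  | zero =>
    cases n with
    | zero => exact F.map_id
    | succ n => exact map_zero _
  | succ j ih =>
    rw [phiPow, phiPow, map_sum]
    exact Finset.sum_congr rfl fun i _ => by rw [F.map_mul, ih]

theorem GradedOperad.Hom.map_phiExp {S : GradedOperad k} (F : GradedOperad.Hom P S)
    (φ : ∀ n : ℕ, P.obj 1 (-2 * (n : ℤ))) (n : ℕ) :
    F.map (phiExp P φ n) = phiExp S (fun n => F.map (φ n)) n := by
  rw [phiExp, phiExp, map_sum]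
  exact Finset.sum_congr rfl fun j _ => by rw [map_smul, F.map_phiPow]

/-- The coefficients of `u(z) = exp(φ(z))` generate the same operad as the `φₙ`. -/
theorem phiExp_induction {Q : GradedOperad k}
    {P : ∀ {n : ℕ} {a : ℤ}, (phiOperad Q).obj n a → Prop}
    (of : ∀ {n : ℕ} {a : ℤ} (q : Q.obj n a), P (phiOf Q q))
    (exp : ∀ n, P (phiExp (phiOperad Q) (phiGen Q) n))
    (add : ∀ {n : ℕ} {a : ℤ} (x y : (phiOperad Q).obj n a), P x → P y → P (x + y))
    (smul : ∀ {n : ℕ} {a : ℤ} (s : k) (x : (phiOperad Q).obj n a), P x → P (s • x))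
    (act : ∀ {n : ℕ} {a : ℤ} (σ : Equiv.Perm (Fin n)) (x : (phiOperad Q).obj n a), P x →
      P ((phiOperad Q).act σ x))
    (comp : ∀ {m n p : ℕ} {a b c : ℤ} (i : Fin m) (e : Graft m n p i) (h : a + b = c)
      (x : (phiOperad Q).obj m a) (y : (phiOperad Q).obj n b), P x → P y →
      P ((phiOperad Q).comp i e h x y)) {n : ℕ} {a : ℤ} (x : (phiOperad Q).obj n a) : P x := by
  have zero : ∀ {n : ℕ} {a : ℤ}, P (0 : (phiOperad Q).obj n a) := fun {n a} => by
    have := of (0 : Q.obj n a)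
    rwa [phiOf_zero] at this
  have sum : ∀ {ι : Type} (s : Finset ι) (n : ℕ) (a : ℤ) (f : ι → (phiOperad Q).obj n a),
      (∀ i ∈ s, P (f i)) → P (∑ i ∈ s, f i) := fun s n a f hf =>
    Finset.sum_induction f (fun x => P x) (fun x y hx hy => add x y hx hy) zero hf
  have pow : ∀ (φ : ∀ n : ℕ, (phiOperad Q).obj 1 (-2 * (n : ℤ))) (_ : ∀ n, P (φ n)) (j n : ℕ),
      P (phiPow (phiOperad Q) φ j n) := by
    intro φ hφ j
    induction j with
    | zero =>
      intro n
      cases n with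
      | zero => exact of Q.id
      | succ n => exact zero
    | succ j ih => exact fun n => sum _ _ _ _ fun i _ => comp _ _ _ _ _ (hφ _) (ih _)
  refine phi_induction of (fun n _ => ?_) add smul act comp x
  induction n using Nat.strong_induction_on with
  | _ n ih =>
    rcases Nat.eq_zero_or_pos n with rfl | hn
    · rw [phiGen_zero]
      exact zero
    · have h1 := exp n
      rw [phiExp_eq hn] at h1
      have h2 : P (∑ j ∈ Finset.Icc 2 n, ((j.factorial : k)⁻¹) •
          phiPow (phiOperad Q) (phiGen Q) j n) := by
        refine sum _ _ _ _ fun j hj => smul _ _ ?_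
        obtain ⟨j, rfl⟩ := Nat.exists_eq_add_of_le' (Finset.mem_Icc.mp hj).1
        rw [phiPow_congr' (φ' := fun i => if i < n then phiGen Q i else 0) (phiGen_zero Q)
          (by simp [hn, phiGen_zero]) n (fun i hi => (if_pos hi).symm)]
        refine pow _ (fun i => ?_) _ _
        split_ifs with hi
        · rcases Nat.eq_zero_or_pos i with rfl | hi'
          · rw [phiGen_zero]
            exact zero
          · exact ih i hi hi'
        · exact zero
      have h3 := add _ _ h1 (smul (-1) _ h2)
      rwa [neg_one_smul, add_neg_cancel_right] at h3

/-- The morphism out of `Q ⋆ k⟨φ₁, φ₂, …⟩` determined by its values on `Q` and on the coefficients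
of `exp(φ(z))`. -/
noncomputable def phiLiftExp {Q S : GradedOperad k} (f : GradedOperad.Hom Q S)
    (u : ∀ n : ℕ, S.obj 1 (-2 * (n : ℤ))) : GradedOperad.Hom (phiOperad Q) S :=
  phiLift f (phiLog u)

theorem phiLiftExp_exp {Q S : GradedOperad k} (f : GradedOperad.Hom Q S)
    {u : ∀ n : ℕ, S.obj 1 (-2 * (n : ℤ))} (hu : u 0 = (by exact S.id)) (n : ℕ) :
    (phiLiftExp f u).map (phiExp (phiOperad Q) (phiGen Q) n) = u n := by
  rw [GradedOperad.Hom.map_phiExp]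
  refine Eq.trans ?_ (phiExp_phiLog hu n)
  congr 1
  funext i
  exact phiLift_gen' f _ (phiLog_zero u) i

end

/-! ### Maps out of the free infinitesimal bimodule -/

theorem Graft.seqCompat_unit' (l : ℕ) :
    SeqCompat 0 0 0 Graft.unary (Graft.unit' l) (Graft.unit' l) (Graft.unit' l) :=
  ⟨rfl, fun j hj => absurd (Subsingleton.elim j 0) hj,
    fun j hj => absurd (Subsingleton.elim j 0) hj, fun _ => rfl⟩

theorem Graft.seqCompat_unit {m l n : ℕ} (i : Fin m) (e : Graft m l n i) :
    SeqCompat i 0 i (Graft.unit i) e (Graft.unit' l) e :=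
  ⟨rfl, fun _ _ _ => rfl, fun j hj => absurd (Subsingleton.elim j 0) hj, fun _ => rfl⟩

/-- A graded operad as an infinitesimal bimodule over itself. -/
def GradedOperad.self {k : Type u} [Field k] (T : GradedOperad k) : InfBimodule T where
  obj := T.obj
  act := T.act
  lcomp := T.comp
  rcomp := T.comp
  act_one := T.act_one
  act_mul := T.act_mul
  lcomp_perm := T.comp_perm
  rcomp_perm := T.comp_perm
  id_lcomp i e h he μ := T.id_comp i e h he μ
  rcomp_id i e h he he' μ := T.comp_id i e h he he' μ
  seq_llr := T.comp_seq
  seq_lr := T.comp_seq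
  seq_rr := T.comp_seq
  par_rr := T.comp_par
  par_lr := T.comp_par

namespace InfBimodule

variable {k : Type u} [Field k] {T : GradedOperad k} (M : InfBimodule T)

/-- The operation `x ∘ᵢ v ∘ y`, for a unary operation `v` of an infinitesimal bimodule. -/
def ins {m l n : ℕ} {a b c p : ℤ} (v : M.obj 1 p) (i : Fin m) (e : Graft m l n i)
    (h : b + (p + c) = a) : T.obj m b →ₗ[k] T.obj l c →ₗ[k] M.obj n a :=
  (M.lcomp i e h).compl₂ (M.rcomp 0 (Graft.unit' l) rfl v)

theorem ins_apply {m l n : ℕ} {a b c c' p : ℤ} (v : M.obj 1 p) (i : Fin m) (e : Graft m l n i)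
    (h : b + (p + c) = a) (hc : p + c = c') (h' : b + c' = a) (x : T.obj m b) (y : T.obj l c) :
    M.ins v i e h x y = M.lcomp i e h' x (M.rcomp 0 (Graft.unit' l) hc v y) := by
  subst hc; rfl

section

variable {m l n : ℕ} {a b c p : ℤ} (i : Fin m) (e : Graft m l n i) (h : b + (p + c) = a)
  (x : T.obj m b) (y : T.obj l c)

theorem ins_zero : M.ins (0 : M.obj 1 p) i e h x y = 0 := by simp [M.ins_apply _ i e h rfl h]

theorem ins_add (v v' : M.obj 1 p) :
    M.ins (v + v') i e h x y = M.ins v i e h x y + M.ins v' i e h x y := by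
  simp [M.ins_apply _ i e h rfl h]

theorem ins_sub (v v' : M.obj 1 p) :
    M.ins (v - v') i e h x y = M.ins v i e h x y - M.ins v' i e h x y := by
  simp [M.ins_apply _ i e h rfl h]

end

theorem ins_perm {m l n : ℕ} {a b c p : ℤ} (v : M.obj 1 p) {i i' : Fin m} {e : Graft m l n i}
    {e' : Graft m l n i'} {σ : Equiv.Perm (Fin m)} {τ : Equiv.Perm (Fin l)}
    {ρ : Equiv.Perm (Fin n)} (H : ActCompat i i' σ τ ρ e e') (h : b + (p + c) = a)
    (x : T.obj m b) (y : T.obj l c) :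
    M.ins v i' e' h (T.act σ x) (T.act τ y) = M.act ρ (M.ins v i e h x y) := by
  have H' : ActCompat 0 0 1 τ τ (Graft.unit' l) (Graft.unit' l) :=
    ⟨rfl, fun j hj => absurd (Subsingleton.elim j 0) hj, fun _ => rfl⟩
  have h1 := M.rcomp_perm H' rfl v y
  rw [M.act_one] at h1
  rw [M.ins_apply v i' e' h rfl h, M.ins_apply v i e h rfl h, h1, M.lcomp_perm H]

theorem act_ins {m l n : ℕ} {a b c p : ℤ} (v : M.obj 1 p) (i : Fin m) (e : Graft m l n i)
    (h : b + (p + c) = a) (ρ : Equiv.Perm (Fin n)) (x : T.obj m b) (y : T.obj l c) :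
    M.act ρ (M.ins v i e h x y) = M.ins v i (e.trans ρ) h x y := by
  have h1 := M.ins_perm v (ActCompat.of_trans e ρ) h x y
  rw [T.act_one, T.act_one] at h1
  exact h1.symm

theorem lcomp_ins {m₀ m l n p q : ℕ} {a₀ a b c t b' d : ℤ} (v : M.obj 1 d) {j : Fin m₀}
    {g : Graft m₀ n p j} {i : Fin m} {e : Graft m l n i} {i₁ : Fin q} {e₁ : Graft m₀ m q j}
    {e₂ : Graft q l p i₁} (K : SeqCompat j i i₁ e₁ e₂ e g) (h : a₀ + a = t)
    (hr : b + (d + c) = a) (hb : a₀ + b = b') (hr' : b' + (d + c) = t) (w : T.obj m₀ a₀)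
    (x : T.obj m b) (y : T.obj l c) :
    M.lcomp j g h w (M.ins v i e hr x y) = M.ins v i₁ e₂ hr' (T.comp j e₁ hb w x) y := by
  rw [M.ins_apply v i e hr rfl hr, M.ins_apply v i₁ e₂ hr' rfl hr', M.seq_llr K hb hr' hr h]

theorem rcomp_ins_seq {m l n m₀ p q : ℕ} {a₀ a b c t c' d : ℤ} (v : M.obj 1 d) {j : Fin n}
    {f : Graft n m₀ p j} {i : Fin m} {s : Fin l} {e : Graft m l n i} {e' : Graft l m₀ q s}
    {f' : Graft m q p i} (K : SeqCompat i s j e f e' f') (h : a + a₀ = t)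
    (hr : b + (d + c) = a) (hc : c + a₀ = c') (hr' : b + (d + c') = t) (x : T.obj m b)
    (y : T.obj l c) (z : T.obj m₀ a₀) :
    M.rcomp j f h (M.ins v i e hr x y) z = M.ins v i f' hr' x (T.comp s e' hc y z) := by
  have H : SeqCompat 0 s s (Graft.unit' l) e' e' (Graft.unit' q) :=
    ⟨rfl, fun j hj => absurd (Subsingleton.elim j 0) hj, fun _ _ _ => rfl, fun _ => rfl⟩
  rw [M.ins_apply v i e hr rfl hr, M.ins_apply v i f' hr' rfl hr',
    M.seq_lr K hr h (show d + c + a₀ = d + c' by lia) hr',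
    M.seq_rr H rfl (show d + c + a₀ = d + c' by lia) hc rfl]

theorem rcomp_ins_par {m l n m₀ p q : ℕ} {a₀ a b c t b' d : ℤ} (v : M.obj 1 d) {j : Fin n}
    {f : Graft n m₀ p j} {i s : Fin m} {i₁ : Fin q} {e : Graft m l n i} {e' : Graft m m₀ q s}
    {f' : Graft q l p i₁} (K : ParCompat i s i₁ j e f e' f') (h : a + a₀ = t)
    (hr : b + (d + c) = a) (hb : b + a₀ = b') (hr' : b' + (d + c) = t) (x : T.obj m b)
    (y : T.obj l c) (z : T.obj m₀ a₀) :
    M.rcomp j f h (M.ins v i e hr x y) z =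
      koszulSign k ((d + c) * a₀) • M.ins v i₁ f' hr' (T.comp s e' hb x z) y := by
  rw [M.ins_apply v i e hr rfl hr, M.ins_apply v i₁ f' hr' rfl hr', M.par_lr K hr h hb hr']

end InfBimodule

namespace FreeInf

variable {k : Type u} [Field k] {T : GradedOperad k}

theorem mk_eq_ins {m l n : ℕ} {a b c : ℤ} (r : ℕ) (i : Fin m) (e : Graft m l n i)
    (h : b + c = a + 2 * (r : ℤ)) (h' : b + (-2 * (r : ℤ) + c) = a) (x : T.obj m b)
    (y : T.obj l c) : mk r i e h x y = (freeInf T).ins (gen T r) i e h' x y := by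
  have h1 : rcomp 0 (Graft.unit' l) rfl (gen T r) y =
      mk r 0 (Graft.unit' l) (show 0 + c = -2 * (r : ℤ) + c + 2 * (r : ℤ) by lia) T.id y := by
    rw [gen, rcomp_mk_seq (Graft.seqCompat_unit' l) rfl r _ (zero_add c) (by lia),
      T.id_comp 0 (Graft.unit' l) _ (fun _ => rfl)]
  have h2 := lcomp_mk (Graft.seqCompat_unit i e) h' r (show 0 + c = -2 * (r : ℤ) + c + 2 * (r : ℤ) by lia) (add_zero b) h
    x T.id y
  rw [T.comp_id i (Graft.unit i) _ (fun _ _ => rfl) rfl] at h2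
  exact h2.symm.trans (congrArg _ h1.symm)

section Twist

variable (M : InfBimodule T) (v : ∀ r : ℕ, M.obj 1 (-2 * (r : ℤ))) (v₀ : M.obj 1 (-1))
  (s : EquivFam T T 1)

/-- The map `x ∘ᵢ [r] ∘ y ↦ x ∘ᵢ vᵣ ∘ y` for `r ≥ 1` and `x ∘ᵢ [0] ∘ y ↦ x ∘ᵢ v₀ ∘ s y`. -/
noncomputable def twist {n : ℕ} {a : ℤ} : FreeInf T n a →ₗ[k] M.obj n a :=
  lift (fun {m l b c} r i e h => match r with
    | 0 => (M.ins v₀ i e (show b + (-1 + (c + 1)) = a by push_cast at h; lia)).compl₂ (s.map rfl)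
    | r + 1 => M.ins (v (r + 1)) i e (by lia)) (by
    intro m l b c r i i' e e' σ τ H h x y
    cases r with
    | zero =>
      simp only [LinearMap.compl₂_apply]
      rw [s.map_act, M.ins_perm _ H, M.act_one]
    | succ r =>
      simp only
      rw [M.ins_perm _ H, M.act_one])

variable {m l n : ℕ} {a b c : ℤ}

theorem twist_mk {r : ℕ} (hr : 0 < r) (i : Fin m) (e : Graft m l n i)
    (h : b + c = a + 2 * (r : ℤ)) (h' : b + (-2 * (r : ℤ) + c) = a) (x : T.obj m b)
    (y : T.obj l c) : twist M v v₀ s (mk r i e h x y) = M.ins (v r) i e h' x y := by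
  obtain ⟨r, rfl⟩ := Nat.exists_eq_add_of_lt hr
  rw [twist, lift_mk]

theorem twist_mk_zero {c' : ℤ} (i : Fin m) (e : Graft m l n i)
    (h : b + c = a + 2 * ((0 : ℕ) : ℤ)) (hc : c + 1 = c') (h' : b + (-1 + c') = a) (x : T.obj m b)
    (y : T.obj l c) : twist M v v₀ s (mk 0 i e h x y) = M.ins v₀ i e h' x (s.map hc y) := by
  subst hc
  rw [twist, lift_mk]
  rfl

theorem twist_act (σ : Equiv.Perm (Fin n)) (w : FreeInf T n a) :
    twist M v v₀ s (act σ w) = M.act σ (twist M v v₀ s w) := by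
  induction w using induction with
  | zero => simp
  | add w w' hw hw' => simp only [map_add, hw, hw']
  | @mk m₁ l₁ b₁ c₁ r j g hr y z =>
    rw [act_mk]
    rcases Nat.eq_zero_or_pos r with rfl | h0
    · rw [twist_mk_zero M v v₀ s j _ hr rfl (by push_cast at hr; lia),
        twist_mk_zero M v v₀ s j _ hr rfl (by push_cast at hr; lia), M.act_ins]
    · rw [twist_mk M v v₀ s h0 j _ hr (by lia), twist_mk M v v₀ s h0 j _ hr (by lia), M.act_ins]

theorem twist_lcomp {i : Fin m} (e : Graft m n l i) (h : a + b = c) (x : T.obj m a)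
    (w : FreeInf T n b) :
    twist M v v₀ s (lcomp i e h x w) = M.lcomp i e h x (twist M v v₀ s w) := by
  induction w using induction with
  | zero => simp
  | add w w' hw hw' => simp only [map_add, hw, hw']
  | @mk m₁ l₁ b₁ c₁ r j g hr y z =>
    obtain ⟨q, i₁, E₁, E₂, K⟩ := Graft.exists_left g e
    rw [lcomp_mk K h r hr rfl (by lia)]
    rcases Nat.eq_zero_or_pos r with rfl | h0
    · rw [twist_mk_zero M v v₀ s _ _ _ rfl (by push_cast at hr; lia),
        twist_mk_zero M v v₀ s _ _ _ rfl (by push_cast at hr; lia),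
        M.lcomp_ins v₀ K h _ rfl (by push_cast at hr; lia)]
    · rw [twist_mk M v v₀ s h0 _ _ _ (by lia), twist_mk M v v₀ s h0 _ _ _ (by lia),
        M.lcomp_ins _ K h _ rfl (by lia)]

theorem twist_rcomp_mk {r m₀ p : ℕ} {a₀ t : ℤ} (h0 : 0 < r) (i : Fin m) (e : Graft m l n i)
    (hr : b + c = a + 2 * (r : ℤ)) (x : T.obj m b) (y : T.obj l c) (j : Fin n)
    (f : Graft n m₀ p j) (h : a + a₀ = t) (z : T.obj m₀ a₀) :
    twist M v v₀ s (rcomp j f h (mk r i e hr x y) z) =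
      M.rcomp j f h (twist M v v₀ s (mk r i e hr x y)) z := by
  rw [twist_mk M v v₀ s h0 i e hr (by lia)]
  rcases e.cases j with ⟨s', hs', h1⟩ | ⟨s', h1⟩
  · obtain ⟨q, i₁, E₁, E₂, K⟩ := Graft.exists_right_par hs' e f h1
    rw [rcomp_mk_par K h r hr rfl (by lia), map_smul, twist_mk M v v₀ s h0 _ _ _ (by lia),
      M.rcomp_ins_par _ K h _ rfl (by lia), add_mul, koszulSign_add,
      koszulSign_even k (a := -2 * (r : ℤ) * a₀) ⟨-r * a₀, by ring⟩, one_mul]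
  · obtain ⟨q, E₁, E₂, K⟩ := Graft.exists_right e f h1
    rw [rcomp_mk_seq K h r hr rfl (by lia), twist_mk M v v₀ s h0 _ _ _ (by lia),
      M.rcomp_ins_seq _ K h _ rfl (by lia)]

end Twist

end FreeInf

/-! ### The complex of differentials relative to the base -/

namespace GradedOperad

variable {k : Type u} [Field k] (T : GradedOperad k)

/-- The operation `u ∘ y`, for a unary operation `u`, with the inputs of `y`. -/
def lmul {l : ℕ} {a b c : ℤ} (h : a + b = c) : T.obj 1 a →ₗ[k] T.obj l b →ₗ[k] T.obj l c :=
  T.comp 0 (Graft.unit' l) h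

/-- The operation `x ∘ᵢ u`, for a unary operation `u`, with the inputs of `x`. -/
def rmul {m : ℕ} {a b c : ℤ} (i : Fin m) (h : a + b = c) :
    T.obj m a →ₗ[k] T.obj 1 b →ₗ[k] T.obj m c :=
  T.comp i (Graft.unit i) h

theorem lmul_lmul {l : ℕ} {a b c ab bc t : ℤ} (hab : a + b = ab) (habc : ab + c = t)
    (hbc : b + c = bc) (habc' : a + bc = t) (u : T.obj 1 a) (v : T.obj 1 b) (y : T.obj l c) :
    T.lmul habc' u (T.lmul hbc v y) = T.lmul habc (T.mul hab u v) y :=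
  (T.comp_seq (Graft.seqCompat_unit' l) hab habc hbc habc' u v y).symm

theorem rmul_rmul {m : ℕ} {a b c ab bc t : ℤ} (i : Fin m) (hab : a + b = ab) (habc : ab + c = t)
    (hbc : b + c = bc) (habc' : a + bc = t) (x : T.obj m a) (u : T.obj 1 b) (v : T.obj 1 c) :
    T.rmul i habc (T.rmul i hab x u) v = T.rmul i habc' x (T.mul hbc u v) :=
  have H : SeqCompat i 0 i (Graft.unit i) (Graft.unit i) Graft.unary (Graft.unit i) :=
    ⟨rfl, fun _ _ _ => rfl, fun j hj => absurd (Subsingleton.elim j 0) hj, fun _ => rfl⟩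
  T.comp_seq H hab habc hbc habc' x u v

end GradedOperad

namespace InfBimodule

variable {k : Type u} [Field k] {T : GradedOperad k} (M : InfBimodule T)

/-- The commutator of a unary operation of a bimodule with a unary operation of the operad. -/
def comm {a b c : ℤ} (h : a + b = c) (h' : b + a = c) (v : M.obj 1 a) (u : T.obj 1 b) :
    M.obj 1 c := M.rcomp 0 Graft.unary h v u - M.lcomp 0 Graft.unary h' u v

theorem ins_rcomp {m l n : ℕ} {a b c p q r cq : ℤ} (i : Fin m) (e : Graft m l n i)
    (hpq : p + q = r) (h : b + (r + c) = a) (hc : q + c = cq) (h' : b + (p + cq) = a)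
    (v : M.obj 1 p) (u : T.obj 1 q) (x : T.obj m b) (y : T.obj l c) :
    M.ins (M.rcomp 0 Graft.unary hpq v u) i e h x y = M.ins v i e h' x (T.lmul hc u y) := by
  rw [M.ins_apply _ i e h rfl h, M.ins_apply v i e h' (show p + cq = r + c by lia) h,
    M.seq_rr (Graft.seqCompat_unit' l) hpq rfl hc (show p + cq = r + c by lia)]
  rfl

theorem ins_lcomp {m l n : ℕ} {a b c p q r bq : ℤ} (i : Fin m) (e : Graft m l n i)
    (hpq : q + p = r) (h : b + (r + c) = a) (hb : b + q = bq) (h' : bq + (p + c) = a)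
    (v : M.obj 1 p) (u : T.obj 1 q) (x : T.obj m b) (y : T.obj l c) :
    M.ins (M.lcomp 0 Graft.unary hpq u v) i e h x y = M.ins v i e h' (T.rmul i hb x u) y := by
  rw [M.ins_apply _ i e h rfl h, M.ins_apply v i e h' rfl h',
    M.seq_lr (Graft.seqCompat_unit' l) hpq rfl rfl (show q + (p + c) = r + c by lia), GradedOperad.rmul,
    M.seq_llr (Graft.seqCompat_unit i e) hb h' (show q + (p + c) = r + c by lia) h]

theorem ins_comm {m l n : ℕ} {a b c p q r bq cq : ℤ} (i : Fin m) (e : Graft m l n i)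
    (hpq : p + q = r) (hpq' : q + p = r) (h : b + (r + c) = a) (hc : q + c = cq)
    (h' : b + (p + cq) = a) (hb : b + q = bq) (h'' : bq + (p + c) = a)
    (v : M.obj 1 p) (u : T.obj 1 q) (x : T.obj m b) (y : T.obj l c) :
    M.ins (M.comm hpq hpq' v u) i e h x y =
      M.ins v i e h' x (T.lmul hc u y) - M.ins v i e h'' (T.rmul i hb x u) y := by
  rw [comm, ins_sub, M.ins_rcomp i e hpq h hc h', M.ins_lcomp i e hpq' h hb h'']

end InfBimodule

namespace FreeInf

variable {k : Type u} [Field k] {T : GradedOperad k}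

/-- The commutator `[r] Δ - Δ [r]`. -/
noncomputable def genComm (Δ : T.obj 1 (-1)) (r : ℕ) {a : ℤ} (h : a + 2 * (r : ℤ) = -1) :
    FreeInf T 1 a := (freeInf T).comm (by lia) (by lia) (gen T r) Δ

theorem ins_genComm (Δ : T.obj 1 (-1)) (r : ℕ) {m l n : ℕ} {a b b' c c' d : ℤ} (i : Fin m)
    (e : Graft m l n i) (hd : d + 2 * (r : ℤ) = -1) (h : b + (d + c) = a) (hc : -1 + c = c')
    (hb : b + -1 = b') (h' : b + c' = a + 2 * (r : ℤ)) (h'' : b' + c = a + 2 * (r : ℤ))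
    (x : T.obj m b) (y : T.obj l c) :
    (freeInf T).ins (genComm Δ r hd) i e h x y =
      mk r i e h' x (T.lmul hc Δ y) - mk r i e h'' (T.rmul i hb x Δ) y := by
  rw [mk_eq_ins r i e h' (by lia), mk_eq_ins r i e h'' (by lia)]
  exact (freeInf T).ins_comm i e _ _ h hc (by lia) hb (by lia) _ _ x y

/-- The span of the operations `x ∘ᵢ [r] ∘ y`, `r ≥ 1`, and `x ∘ᵢ ω ∘ y`. -/
inductive Adm (ω : FreeInf T 1 (-1)) : ∀ {n : ℕ} {a : ℤ}, FreeInf T n a → Prop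
  | zero {n : ℕ} {a : ℤ} : Adm ω (0 : FreeInf T n a)
  | add {n : ℕ} {a : ℤ} {w w' : FreeInf T n a} : Adm ω w → Adm ω w' → Adm ω (w + w')
  | smul {n : ℕ} {a : ℤ} (s : k) {w : FreeInf T n a} : Adm ω w → Adm ω (s • w)
  | mk {m l n : ℕ} {a b c : ℤ} {r : ℕ} (hr : 0 < r) (i : Fin m) (e : Graft m l n i)
      (h : b + c = a + 2 * (r : ℤ)) (x : T.obj m b) (y : T.obj l c) : Adm ω (mk r i e h x y)
  | ins {m l n : ℕ} {a b c : ℤ} (i : Fin m) (e : Graft m l n i) (h : b + (-1 + c) = a)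
      (x : T.obj m b) (y : T.obj l c) : Adm ω ((freeInf T).ins ω i e h x y)

variable {ω : FreeInf T 1 (-1)}

theorem Adm.act {n : ℕ} {a : ℤ} {w : FreeInf T n a} (hw : Adm ω w) (σ : Equiv.Perm (Fin n)) :
    Adm ω (act σ w) := by
  induction hw with
  | zero => rw [map_zero]; exact .zero
  | add _ _ h h' => rw [map_add]; exact .add (h σ) (h' σ)
  | smul s _ h => rw [map_smul]; exact .smul s (h σ)
  | mk hr i e h x y => rw [act_mk]; exact .mk hr i _ h x y
  | ins i e h x y =>
    have h1 : FreeInf.act σ ((freeInf T).ins ω i e h x y) = (freeInf T).ins ω i (e.trans σ) h x y :=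
      (freeInf T).act_ins ω i e h σ x y
    rw [h1]
    exact .ins i _ h x y

theorem Adm.lcomp {n : ℕ} {b : ℤ} {w : FreeInf T n b} (hw : Adm ω w) {m l : ℕ} {a c : ℤ}
    {i : Fin m} (e : Graft m n l i) (h : a + b = c) (x : T.obj m a) :
    Adm ω (lcomp i e h x w) := by
  induction hw generalizing m l a c with
  | zero => rw [map_zero]; exact .zero
  | add _ _ h1 h2 => rw [map_add]; exact .add (h1 e h x) (h2 e h x)
  | smul s _ h1 => rw [map_smul]; exact .smul s (h1 e h x)
  | mk hr j g h0 y z =>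
    obtain ⟨q, i₁, E₁, E₂, K⟩ := Graft.exists_left g e
    rw [lcomp_mk K h _ h0 rfl (by lia)]
    exact .mk hr _ _ _ _ _
  | ins j g h0 y z =>
    obtain ⟨q, i₁, E₁, E₂, K⟩ := Graft.exists_left g e
    have h1 : FreeInf.lcomp i e h x ((freeInf T).ins ω j g h0 y z) = _ :=
      (freeInf T).lcomp_ins ω K h h0 rfl (by lia) x y z
    rw [h1]
    exact .ins _ _ _ _ _

theorem Adm.rcomp {m : ℕ} {a : ℤ} {w : FreeInf T m a} (hw : Adm ω w) {n l : ℕ} {b c : ℤ}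
    {i : Fin m} (e : Graft m n l i) (h : a + b = c) (y : T.obj n b) :
    Adm ω (rcomp i e h w y) := by
  induction hw generalizing n l b c with
  | zero => rw [map_zero, LinearMap.zero_apply]; exact .zero
  | add _ _ h1 h2 => rw [map_add, LinearMap.add_apply]; exact .add (h1 e h y) (h2 e h y)
  | smul s _ h1 => rw [map_smul, LinearMap.smul_apply]; exact .smul s (h1 e h y)
  | mk hr j g h0 x z =>
    rcases g.cases i with ⟨s, hs, h1⟩ | ⟨s, h1⟩
    · obtain ⟨q, i₁, E₁, E₂, K⟩ := Graft.exists_right_par hs g e h1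
      rw [rcomp_mk_par K h _ h0 rfl (by lia)]
      exact .smul _ (.mk hr _ _ _ _ _)
    · obtain ⟨q, E₁, E₂, K⟩ := Graft.exists_right g e h1
      rw [rcomp_mk_seq K h _ h0 rfl (by lia)]
      exact .mk hr _ _ _ _ _
  | ins j g h0 x z =>
    rcases g.cases i with ⟨s, hs, h1⟩ | ⟨s, h1⟩
    · obtain ⟨q, i₁, E₁, E₂, K⟩ := Graft.exists_right_par hs g e h1
      have h2 : FreeInf.rcomp i e h ((freeInf T).ins ω j g h0 x z) y = _ :=
        (freeInf T).rcomp_ins_par ω K h h0 rfl (by lia) x z y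
      rw [h2]
      exact .smul _ (.ins _ _ _ _ _)
    · obtain ⟨q, E₁, E₂, K⟩ := Graft.exists_right g e h1
      have h2 : FreeInf.rcomp i e h ((freeInf T).ins ω j g h0 x z) y = _ :=
        (freeInf T).rcomp_ins_seq ω K h h0 rfl (by lia) x z y
      rw [h2]
      exact .ins _ _ _ _ _

section Twist

variable (M : InfBimodule T) (v : ∀ r : ℕ, M.obj 1 (-2 * (r : ℤ))) (v₀ : M.obj 1 (-1))
  (s : EquivFam T T 1)

theorem twist_ins_genComm {Δ : T.obj 1 (-1)}
    (hs : ∀ {l : ℕ} {a b c : ℤ} (h : -1 + a = b) (h' : b + 1 = a) (h'' : a + 1 = c) (h₃ : -1 + c = a)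
      (y : T.obj l a), s.map h' (T.lmul h Δ y) = y - T.lmul h₃ Δ (s.map h'' y))
    (hv₀ : M.rcomp 0 Graft.unary (show -1 + -1 = -2 by norm_num) v₀ Δ +
      M.lcomp 0 Graft.unary (by norm_num) Δ v₀ = 0)
    {m l n : ℕ} {a b c : ℤ} (i : Fin m) (e : Graft m l n i) (h : b + (-1 + c) = a)
    (x : T.obj m b) (y : T.obj l c) :
    twist M v v₀ s ((freeInf T).ins (genComm Δ 0 (by norm_num)) i e h x y) =
      M.ins v₀ i e h x y := by
  rw [ins_genComm Δ 0 i e _ h rfl rfl (by push_cast; omega) (by push_cast; omega), map_sub,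
    twist_mk_zero M v v₀ s i e _ (show -1 + c + 1 = c by omega) h,
    twist_mk_zero M v v₀ s i e _ rfl (by omega), hs _ _ rfl (by omega), map_sub,
    ← M.ins_rcomp i e (show -1 + -1 = -2 by norm_num) (by omega),
    ← M.ins_lcomp i e (show -1 + -1 = -2 by norm_num) (by omega), sub_sub, ← M.ins_add, hv₀,
    M.ins_zero, sub_zero]

/-- The map `twist` is not compatible with right composition in general, since `s` is a derivation;
it is on the span `Adm`, where the terms with `s` cancel. -/
theorem twist_rcomp_of_adm (hω : ∀ {m l n : ℕ} {a b c : ℤ} (i : Fin m) (e : Graft m l n i)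
      (h : b + (-1 + c) = a) (x : T.obj m b) (y : T.obj l c),
      twist M v v₀ s ((freeInf T).ins ω i e h x y) = M.ins v₀ i e h x y)
    {n : ℕ} {a : ℤ} {w : FreeInf T n a} (hw : Adm ω w) {m₀ p : ℕ} {a₀ t : ℤ} (j : Fin n)
    (f : Graft n m₀ p j) (h : a + a₀ = t) (z : T.obj m₀ a₀) :
    twist M v v₀ s (FreeInf.rcomp j f h w z) = M.rcomp j f h (twist M v v₀ s w) z := by
  induction hw generalizing m₀ p a₀ t with
  | zero => simp
  | add _ _ h1 h2 => simp only [map_add, LinearMap.add_apply, h1, h2]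
  | smul s _ h1 => simp only [map_smul, LinearMap.smul_apply, h1]
  | mk hr i e h0 x y => exact twist_rcomp_mk M v v₀ s hr i e h0 x y j f h z
  | ins i e h0 x y =>
    rw [hω]
    rcases e.cases j with ⟨s', hs, h1⟩ | ⟨s', h1⟩
    · obtain ⟨q, i₁, E₁, E₂, K⟩ := Graft.exists_right_par hs e f h1
      have h2 : FreeInf.rcomp j f h ((freeInf T).ins ω i e h0 x y) z = _ :=
        (freeInf T).rcomp_ins_par ω K h h0 rfl (by omega) x y z
      rw [h2, M.rcomp_ins_par v₀ K h h0 rfl (by omega)]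
      exact (map_smul _ _ _).trans (congrArg _ (hω _ _ _ _ _))
    · obtain ⟨q, E₁, E₂, K⟩ := Graft.exists_right e f h1
      have h2 : FreeInf.rcomp j f h ((freeInf T).ins ω i e h0 x y) z = _ :=
        (freeInf T).rcomp_ins_seq ω K h h0 rfl (by omega) x y z
      rw [h2, M.rcomp_ins_seq v₀ K h h0 rfl (by omega)]
      exact hω _ _ _ _ _

end Twist

end FreeInf

theorem koszulSign_neg_one (k : Type u) [Field k] : koszulSign k (-1) = -1 := by
  simp [koszulSign]

namespace FreeInf

variable {k : Type u} [Field k] {T : GradedOperad k}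

section OddContract

variable (M : InfBimodule T) (v : ∀ r : ℕ, M.obj 1 (-2 * (r : ℤ) + 1))

/-- The morphism of bimodules of degree `1` that replaces `[r]` by `vᵣ`. -/
noncomputable def oddContract {n : ℕ} {a a' : ℤ} (ha : a + 1 = a') :
    FreeInf T n a →ₗ[k] M.obj n a' :=
  lift (fun {m l b c} r i e h => koszulSign k b •
    M.ins (v r) i e (show b + (-2 * (r : ℤ) + 1 + c) = a' by lia)) (by
    intro m l b c r i i' e e' σ τ H h x y
    simp only [LinearMap.smul_apply]
    rw [M.ins_perm _ H, M.act_one])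

variable {m l n : ℕ} {a b c a' : ℤ}

theorem oddContract_mk (ha : a + 1 = a') (r : ℕ) (i : Fin m) (e : Graft m l n i)
    (h : b + c = a + 2 * (r : ℤ)) (h' : b + (-2 * (r : ℤ) + 1 + c) = a') (x : T.obj m b)
    (y : T.obj l c) :
    oddContract M v ha (mk r i e h x y) = koszulSign k b • M.ins (v r) i e h' x y := by
  rw [oddContract, lift_mk]
  rfl

theorem oddContract_lcomp {i : Fin m} (e : Graft m n l i) (h : a + b = c) {b' c' : ℤ}
    (hb : b + 1 = b') (hc : c + 1 = c') (h' : a + b' = c') (x : T.obj m a) (w : FreeInf T n b) :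
    oddContract M v hc (lcomp i e h x w) =
      koszulSign k a • M.lcomp i e h' x (oddContract M v hb w) := by
  induction w using induction with
  | zero => simp
  | add w w' hw hw' => simp only [map_add, hw, hw', smul_add]
  | @mk m₁ l₁ b₁ c₁ r j g hr y z =>
    obtain ⟨q, i₁, E₁, E₂, K⟩ := Graft.exists_left g e
    rw [lcomp_mk K h r hr rfl (by lia), oddContract_mk M v hb r j g hr (by lia),
      oddContract_mk M v hc r _ _ _ (by lia), map_smul, M.lcomp_ins _ K h' _ rfl (by lia),
      koszulSign_add, smul_smul]

theorem oddContract_rcomp {i : Fin m} (e : Graft m n l i) (h : a + b = c) {c' : ℤ}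
    (ha : a + 1 = a') (hc : c + 1 = c') (h' : a' + b = c') (w : FreeInf T m a) (z : T.obj n b) :
    oddContract M v hc (rcomp i e h w z) = M.rcomp i e h' (oddContract M v ha w) z := by
  induction w using induction with
  | zero => simp
  | add w w' hw hw' => simp only [map_add, LinearMap.add_apply, hw, hw']
  | @mk m₁ l₁ b₁ c₁ r j g hr x y =>
    rw [oddContract_mk M v ha r j g hr (by lia), map_smul, LinearMap.smul_apply]
    rcases g.cases i with ⟨s, hs', h0⟩ | ⟨s, h0⟩
    · obtain ⟨q, i₁, E₁, E₂, K⟩ := Graft.exists_right_par hs' g e h0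
      rw [rcomp_mk_par K h r hr rfl (by lia), map_smul, oddContract_mk M v hc r _ _ _ (by lia),
        M.rcomp_ins_par _ K h' _ rfl (by lia), smul_smul, smul_smul]
      congr 1
      rw [show (-2 * (r : ℤ) + 1 + c₁) * b = -2 * (r * b) + b + c₁ * b by ring, koszulSign_add,
        koszulSign_add, koszulSign_add, koszulSign_even k (a := -2 * ((r : ℤ) * b))
          ⟨-(r * b), by ring⟩]
      ring
    · obtain ⟨q, E₁, E₂, K⟩ := Graft.exists_right g e h0
      rw [rcomp_mk_seq K h r hr rfl (by lia), oddContract_mk M v hc r _ _ _ (by lia),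
        M.rcomp_ins_seq _ K h' _ rfl (by lia)]

end OddContract

/-- The values of the differential on the generators: `[r] ↦ [r - 1] Δ - Δ [r - 1]`. -/
noncomputable def genD (Δ : T.obj 1 (-1)) : ∀ r : ℕ, FreeInf T 1 (-2 * (r : ℤ) + 1)
  | 0 => 0
  | r + 1 => genComm Δ r (by push_cast; lia)

section Differential

variable (d : EquivFam T T 1) (Δ : T.obj 1 (-1))

/-- The differential `d + [z Δ, -]` on the free infinitesimal bimodule. -/
noncomputable def twDer {n : ℕ} {a b : ℤ} (h : a + 1 = b) : FreeInf T n a →ₗ[k] FreeInf T n b :=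
  der d h + oddContract (freeInf T) (genD Δ) h

variable {d Δ} {m l n : ℕ} {a b c a' b' c' : ℤ}

theorem oddContract_genD_zero (ha : a + 1 = a') (i : Fin m) (e : Graft m l n i)
    (h : b + c = a + 2 * ((0 : ℕ) : ℤ)) (x : T.obj m b) (y : T.obj l c) :
    oddContract (freeInf T) (genD Δ) ha (mk 0 i e h x y) = 0 := by
  rw [oddContract_mk _ _ ha 0 i e h (by push_cast at h ⊢; lia)]
  exact (congrArg _ ((freeInf T).ins_zero i e _ x y)).trans (smul_zero _)

theorem oddContract_genD_succ (ha : a + 1 = a') (r : ℕ) (i : Fin m) (e : Graft m l n i)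
    (h : b + c = a + 2 * ((r + 1 : ℕ) : ℤ)) (hb : b + -1 = b') (hc : -1 + c = c')
    (h₃ : b + c' = a' + 2 * (r : ℤ)) (h₄ : b' + c = a' + 2 * (r : ℤ)) (x : T.obj m b)
    (y : T.obj l c) :
    oddContract (freeInf T) (genD Δ) ha (mk (r + 1) i e h x y) = koszulSign k b •
      (mk r i e h₃ x (T.lmul hc Δ y) - mk r i e h₄ (T.rmul i hb x Δ) y) := by
  rw [oddContract_mk _ _ ha (r + 1) i e h (by push_cast at h ⊢; lia)]
  exact congrArg _ (ins_genComm Δ r i e (by push_cast; lia) _ hc hb h₃ h₄ x y)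

theorem twDer_apply (ha : a + 1 = a') (w : FreeInf T n a) :
    twDer d Δ ha w = der d ha w + oddContract (freeInf T) (genD Δ) ha w := rfl

theorem twDer_lcomp (hd : d.IsDer) {i : Fin m} (e : Graft m n l i) (h : a + b = c)
    (ha : a + 1 = a') (hb : b + 1 = b') (hc : c + 1 = c') (h₁ : a' + b = c') (h₂ : a + b' = c')
    (x : T.obj m a) (w : FreeInf T n b) :
    twDer d Δ hc (lcomp i e h x w) = lcomp i e h₁ (d.map ha x) w +
      koszulSign k a • lcomp i e h₂ x (twDer d Δ hb w) := by
  have h1 := der_lcomp hd i e h ha hb hc x w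
  have h2 : oddContract (freeInf T) (genD Δ) hc (lcomp i e h x w) =
    koszulSign k a • lcomp i e h₂ x (oddContract (freeInf T) (genD Δ) hb w) :=
    oddContract_lcomp (freeInf T) (genD Δ) e h hb hc h₂ x w
  refine (congrArg₂ (· + ·) h1 h2).trans ?_
  rw [one_mul, add_assoc, ← smul_add, ← map_add]
  rfl

theorem twDer_rcomp (hd : d.IsDer) {i : Fin m} (e : Graft m n l i) (h : a + b = c)
    (ha : a + 1 = a') (hb : b + 1 = b') (hc : c + 1 = c') (h₁ : a' + b = c') (h₂ : a + b' = c')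
    (w : FreeInf T m a) (y : T.obj n b) :
    twDer d Δ hc (rcomp i e h w y) = rcomp i e h₁ (twDer d Δ ha w) y +
      koszulSign k a • rcomp i e h₂ w (d.map hb y) := by
  have h1 := der_rcomp hd i e h ha hb hc w y
  have h2 : oddContract (freeInf T) (genD Δ) hc (rcomp i e h w y) =
    rcomp i e h₁ (oddContract (freeInf T) (genD Δ) ha w) y :=
    oddContract_rcomp (freeInf T) (genD Δ) e h ha hc h₁ w y
  refine (congrArg₂ (· + ·) h1 h2).trans ?_
  rw [one_mul, add_right_comm, ← LinearMap.add_apply, ← map_add]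
  rfl

variable (hd : d.IsDer)
  (hdd : ∀ {n : ℕ} {a b c : ℤ} (h : a + 1 = b) (h' : b + 1 = c) (x : T.obj n a),
    d.map h' (d.map h x) = 0)
  (hdΔ : ∀ {b : ℤ} (h : -1 + 1 = b), d.map h Δ = 0)
  (hΔ : T.mul (show -1 + -1 = -2 by norm_num) Δ Δ = 0)

theorem koszulSign_add_one (k : Type u) [Field k] (a : ℤ) :
    koszulSign k (a + 1) = -koszulSign k a := by
  rw [koszulSign_add, koszulSign_one, mul_neg, mul_one]

theorem koszulSign_sub_one (k : Type u) [Field k] (a : ℤ) :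
    koszulSign k (a + -1) = -koszulSign k a := by
  rw [koszulSign_add, koszulSign_neg_one, mul_neg, mul_one]

include hd hdΔ in
theorem der_lmul_delta (h : -1 + a = b) (ha : a + 1 = a') (hb : b + 1 = b') (h' : -1 + a' = b')
    (y : T.obj n a) : d.map hb (T.lmul h Δ y) = -T.lmul h' Δ (d.map ha y) := by
  rw [GradedOperad.lmul, hd 0 _ h rfl ha hb, hdΔ, map_zero, LinearMap.zero_apply, zero_add,
    one_mul, koszulSign_neg_one, neg_one_smul]
  rfl

include hd hdΔ in
theorem der_rmul_delta (i : Fin n) (h : a + -1 = b) (ha : a + 1 = a') (hb : b + 1 = b')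
    (h' : a' + -1 = b') (x : T.obj n a) :
    d.map hb (T.rmul i h x Δ) = T.rmul i h' (d.map ha x) Δ := by
  rw [GradedOperad.rmul, hd i _ h ha rfl hb, hdΔ, map_zero, smul_zero, add_zero]
  rfl

include hΔ in
theorem lmul_delta_delta (h : -1 + a = b) (h' : -1 + b = c) (y : T.obj n a) :
    T.lmul h' Δ (T.lmul h Δ y) = 0 := by
  rw [T.lmul_lmul (ab := -2) (by norm_num) (by lia) h h', hΔ, map_zero, LinearMap.zero_apply]

include hΔ in
theorem rmul_delta_delta (i : Fin n) (h : a + -1 = b) (h' : b + -1 = c) (x : T.obj n a) :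
    T.rmul i h' (T.rmul i h x Δ) Δ = 0 := by
  rw [T.rmul_rmul i h h' (bc := -2) (by norm_num) (by lia), hΔ, map_zero]

include hdd in
theorem der_der (h : a + 1 = b) (h' : b + 1 = c) (w : FreeInf T n a) :
    der d h' (der d h w) = 0 := by
  induction w using induction with
  | zero => simp
  | add w w' hw hw' => simp only [map_add, hw, hw', add_zero]
  | @mk m₁ l₁ b₁ c₁ r i e hr x y =>
    rw [der_mk d h r i e hr x y rfl rfl (by omega) (by omega), map_add, map_smul,
      der_mk d h' r i e _ _ y rfl rfl (by omega) (by omega),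
      der_mk d h' r i e _ x _ rfl rfl (by omega) (by omega), hdd, hdd]
    simp only [one_mul, koszulSign_add_one, map_zero, LinearMap.zero_apply]
    module

include hΔ in
theorem oddContract_genD_genD (h : a + 1 = b) (h' : b + 1 = c) (w : FreeInf T n a) :
    oddContract (freeInf T) (genD Δ) h' (oddContract (freeInf T) (genD Δ) h w) = 0 := by
  induction w using induction with
  | zero => simp
  | add w w' hw hw' => simp only [map_add, hw, hw', add_zero]
  | @mk m₁ l₁ b₁ c₁ r i e hr x y =>
    rcases r with _ | _ | r
    · rw [oddContract_genD_zero, map_zero]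
    · rw [oddContract_genD_succ h 0 i e hr rfl rfl (by push_cast at hr ⊢; omega)
        (by push_cast at hr ⊢; omega), map_smul, map_sub, oddContract_genD_zero,
        oddContract_genD_zero, sub_zero, smul_zero]
    · rw [oddContract_genD_succ h (r + 1) i e hr rfl rfl (by push_cast at hr ⊢; omega)
        (by push_cast at hr ⊢; omega), map_smul, map_sub,
        oddContract_genD_succ h' r i e _ rfl rfl (by push_cast at hr ⊢; omega)
        (by push_cast at hr ⊢; omega),
        oddContract_genD_succ h' r i e _ rfl rfl (by push_cast at hr ⊢; omega)
        (by push_cast at hr ⊢; omega), lmul_delta_delta hΔ, rmul_delta_delta hΔ,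
        koszulSign_sub_one]
      simp only [map_zero, LinearMap.zero_apply]
      module

include hd hdΔ in
theorem der_oddContract_genD (h : a + 1 = b) (h' : b + 1 = c) (w : FreeInf T n a) :
    der d h' (oddContract (freeInf T) (genD Δ) h w) +
      oddContract (freeInf T) (genD Δ) h' (der d h w) = 0 := by
  induction w using induction with
  | zero => simp
  | add w w' hw hw' =>
    simp only [map_add]
    rw [add_add_add_comm, hw, hw', add_zero]
  | @mk m₁ l₁ b₁ c₁ r i e hr x y =>
    rw [der_mk d h r i e hr x y rfl rfl (by omega) (by omega), map_add, map_smul]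
    rcases r with _ | r
    · rw [oddContract_genD_zero, oddContract_genD_zero, oddContract_genD_zero, map_zero, smul_zero,
        add_zero, add_zero]
    · rw [oddContract_genD_succ h r i e hr rfl rfl (by push_cast at hr ⊢; omega)
          (by push_cast at hr ⊢; omega),
        oddContract_genD_succ h' r i e _ (show b₁ + 1 + -1 = b₁ by omega) rfl
          (by push_cast at hr ⊢; omega) (by push_cast at hr ⊢; omega),
        oddContract_genD_succ h' r i e _ rfl (show -1 + (c₁ + 1) = c₁ by omega)
          (by push_cast at hr ⊢; omega) (by push_cast at hr ⊢; omega),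
        map_smul, map_sub,
        der_mk d h' r i e _ x _ rfl (show -1 + c₁ + 1 = c₁ by omega) (by push_cast at hr ⊢; omega)
          (by push_cast at hr ⊢; omega),
        der_mk d h' r i e _ _ y (show b₁ + -1 + 1 = b₁ by omega) rfl (by push_cast at hr ⊢; omega)
          (by push_cast at hr ⊢; omega),
        der_lmul_delta hd hdΔ _ rfl _ (by omega), der_rmul_delta hd hdΔ i _ rfl _ (by omega)]
      simp only [one_mul, koszulSign_add_one, koszulSign_sub_one, map_neg]
      module

include hd hdd hdΔ hΔ in
/-- The twisted differential has square zero, since `Δ` is a cycle of square zero. -/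
theorem twDer_twDer (h : a + 1 = b) (h' : b + 1 = c) (w : FreeInf T n a) :
    twDer d Δ h' (twDer d Δ h w) = 0 := by
  have h1 := der_oddContract_genD hd hdΔ h h' w
  rw [twDer_apply h, map_add, twDer_apply, twDer_apply, der_der hdd,
    oddContract_genD_genD hΔ, zero_add, add_zero, add_comm]
  exact h1

end Differential

section Homotopy

variable (s : EquivFam T T 1)

/-- The homotopy `x ∘ᵢ [r] ∘ y ↦ ± x ∘ᵢ [r + 1] ∘ s y`. -/
noncomputable def raise {n : ℕ} {a b : ℤ} (h : a + -1 = b) : FreeInf T n a →ₗ[k] FreeInf T n b :=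
  map₂ 1 (EquivFam.refl T) s (by push_cast; omega)

variable {m l n : ℕ} {a b c a' b' c' : ℤ}

theorem raise_mk (ha : a + -1 = a') (r : ℕ) (i : Fin m) (e : Graft m l n i)
    (h : b + c = a + 2 * (r : ℤ)) (hc : c + 1 = c') (h' : b + c' = a' + 2 * ((r + 1 : ℕ) : ℤ))
    (x : T.obj m b) (y : T.obj l c) :
    raise s ha (mk r i e h x y) = koszulSign k b • mk (r + 1) i e h' x (s.map hc y) := by
  rw [raise, map₂_mk 1 _ _ _ r i e h x y (add_zero b) hc h', one_mul]
  rfl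

/-- The map `x ∘ᵢ [r] ∘ y ↦ x ∘ᵢ [r + 1] ∘ δ y` for a family `δ` of degree `2`. -/
noncomputable def raise₂ (δ : EquivFam T T 2) {n : ℕ} {a : ℤ} : FreeInf T n a →ₗ[k] FreeInf T n a :=
  map₂ 1 (EquivFam.refl T) δ (by push_cast; omega)

theorem raise₂_mk (δ : EquivFam T T 2) (r : ℕ) (i : Fin m) (e : Graft m l n i)
    (h : b + c = a + 2 * (r : ℤ)) (hc : c + 2 = c') (h' : b + c' = a + 2 * ((r + 1 : ℕ) : ℤ))
    (x : T.obj m b) (y : T.obj l c) :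
    raise₂ δ (mk r i e h x y) = mk (r + 1) i e h' x (δ.map hc y) := by
  rw [raise₂, map₂_mk 1 _ _ _ r i e h x y (add_zero b) hc h',
    koszulSign_even k (a := 2 * b) ⟨b, by ring⟩, one_smul]
  rfl

variable {s} {d : EquivFam T T 1} {Δ : T.obj 1 (-1)} {δ : EquivFam T T 2}

/-- The homotopy `raise s` connects the identity, on the span of the operations `x ∘ᵢ [r] ∘ y` with
`r ≥ 1` and `x ∘ᵢ ([0] Δ - Δ [0]) ∘ y`, with a locally nilpotent map. -/
theorem twDer_raise
    (hs : ∀ {l : ℕ} {a b c : ℤ} (h : -1 + a = b) (h' : b + 1 = a) (h'' : a + 1 = c) (h₃ : -1 + c = a)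
      (y : T.obj l a), s.map h' (T.lmul h Δ y) = y - T.lmul h₃ Δ (s.map h'' y))
    (hδ : ∀ {l : ℕ} {a b c : ℤ} (h : a + 1 = b) (h' : b + 1 = c) (h'' : a + 2 = c) (y : T.obj l a),
      δ.map h'' y = d.map h' (s.map h y) + s.map h' (d.map h y))
    {n : ℕ} {a b c : ℤ} (h : a + -1 = b) (h' : a + 1 = c) (w : FreeInf T n a) :
    twDer d Δ (by omega) (raise s h w) + raise s (by omega) (twDer d Δ h' w) =
      twist (freeInf T) (gen T) (genComm Δ 0 (by norm_num)) s w + raise₂ δ w := by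
  induction w using induction with
  | zero => simp
  | add w w' hw hw' =>
    simp only [map_add]
    rw [add_add_add_comm, hw, hw', add_add_add_comm]
  | @mk m₁ l₁ b₁ c₁ r i e hr x y =>
    have e1 := koszulSign_mul_self k b₁
    have e2 : b₁ + (c₁ + 1) = b + 2 * ((r + 1 : ℕ) : ℤ) := by push_cast; omega
    rw [raise_mk s h r i e hr rfl e2, map_smul, twDer_apply, twDer_apply,
      der_mk d _ (r + 1) i e e2 x _ rfl rfl (by push_cast; omega) (by push_cast; omega),
      oddContract_genD_succ _ r i e e2 rfl (show -1 + (c₁ + 1) = c₁ by omega) (by omega) (by omega),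
      der_mk d h' r i e hr x y rfl rfl (by omega) (by omega), map_add, map_add, map_smul,
      raise_mk s _ r i e _ rfl (by push_cast; omega), raise_mk s _ r i e _ rfl (by push_cast; omega),
      raise₂_mk δ r i e hr (show c₁ + 2 = c₁ + 1 + 1 by omega) (by push_cast; omega), hδ rfl rfl]
    rcases r with _ | r
    · rw [oddContract_genD_zero, map_zero, twist_mk_zero _ _ _ s i e hr rfl
        (by push_cast at hr; omega), ins_genComm Δ 0 i e _ _ (show -1 + (c₁ + 1) = c₁ by omega) rfl (by push_cast at hr ⊢; omega)
          (by push_cast at hr ⊢; omega)]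
      simp only [one_mul, koszulSign_add_one, smul_add, smul_sub, smul_smul, map_add, map_zero, e1, neg_mul, mul_neg, neg_smul, one_smul, smul_neg]
      abel
    · rw [oddContract_genD_succ h' r i e hr (show b₁ + -1 = b₁ - 1 by omega) (show -1 + c₁ = c₁ - 1 by omega) (by push_cast at hr ⊢; omega)
          (by push_cast at hr ⊢; omega), map_smul, map_sub,
        raise_mk s _ r i e _ (show c₁ - 1 + 1 = c₁ by omega) (by push_cast at hr ⊢; omega),
        raise_mk s _ r i e _ rfl (by push_cast at hr ⊢; omega),
        hs _ _ rfl (by omega), twist_mk _ _ _ s (Nat.succ_pos r) i e hr (by omega), ← mk_eq_ins (r + 1) i e hr]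
      have e3 : koszulSign k (b₁ - 1) = -koszulSign k b₁ := koszulSign_sub_one k b₁
      simp only [one_mul, koszulSign_add_one, e3, smul_add, smul_sub, smul_smul, map_add, map_sub, e1, neg_mul, mul_neg, neg_smul, one_smul, smul_neg]
      abel

end Homotopy

end FreeInf

/-! ### The free product `P ⋆ k[Δ]` -/

section

variable {k : Type u} [Field k]

/-- Formal operadic expressions in the operations of `P` and a unary symbol `Δ` of degree `-1`. -/
inductive DeltaTerm (P : GradedOperad k) : ℕ → ℤ → Type u
  | of {n : ℕ} {a : ℤ} (q : P.obj n a) : DeltaTerm P n a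
  | delta : DeltaTerm P 1 (-1)
  | add {n : ℕ} {a : ℤ} (x y : DeltaTerm P n a) : DeltaTerm P n a
  | smul {n : ℕ} {a : ℤ} (c : k) (x : DeltaTerm P n a) : DeltaTerm P n a
  | act {n : ℕ} {a : ℤ} (σ : Equiv.Perm (Fin n)) (x : DeltaTerm P n a) : DeltaTerm P n a
  | comp {m n p : ℕ} {a b c : ℤ} (i : Fin m) (e : Graft m n p i) (h : a + b = c)
      (x : DeltaTerm P m a) (y : DeltaTerm P n b) : DeltaTerm P p c

/-- The evaluation of expressions in `P` and `Δ` in an operad. -/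
def DeltaTerm.eval {P S : GradedOperad k} (f : GradedOperad.Hom P S) (v : S.obj 1 (-1)) :
    ∀ {n : ℕ} {a : ℤ}, DeltaTerm P n a → S.obj n a
  | _, _, .of q => f.map q
  | _, _, .delta => v
  | _, _, .add x y => eval f v x + eval f v y
  | _, _, .smul s x => s • eval f v x
  | _, _, .act σ x => S.act σ (eval f v x)
  | _, _, .comp i e h x y => S.comp i e h (eval f v x) (eval f v y)

/-- Two expressions are identified when they have the same value in every operad with a morphism
from `P` and an operation `Δ` of square zero. -/
def deltaSetoid (P : GradedOperad k) (n : ℕ) (a : ℤ) : Setoid (DeltaTerm P n a) where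
  r x y := ∀ (S : GradedOperad.{u} k) (f : GradedOperad.Hom P S) (v : S.obj 1 (-1)),
    S.mul (c := -2) (by norm_num) v v = 0 → x.eval f v = y.eval f v
  iseqv :=
    { refl := fun _ _ _ _ _ => rfl
      symm := fun h S f v hv => (h S f v hv).symm
      trans := fun h h' S f v hv => (h S f v hv).trans (h' S f v hv) }

/-- The space of `n`-ary operations of degree `a` of `P ⋆ k[Δ]`. -/
def DeltaObj (P : GradedOperad k) (n : ℕ) (a : ℤ) : Type u := Quotient (deltaSetoid P n a)

namespace DeltaObj

variable {P : GradedOperad k} {n : ℕ} {a : ℤ}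

/-- The class of an expression. -/
def mk (x : DeltaTerm P n a) : DeltaObj P n a := Quotient.mk _ x

theorem sound {x y : DeltaTerm P n a} (h : ∀ (S : GradedOperad.{u} k) (f : GradedOperad.Hom P S)
    (v : S.obj 1 (-1)), S.mul (c := -2) (by norm_num) v v = 0 → x.eval f v = y.eval f v) :
    mk x = mk y := Quotient.sound h

theorem ind {p : DeltaObj P n a → Prop} (h : ∀ x, p (mk x)) (x : DeltaObj P n a) : p x :=
  Quotient.ind h x

instance : Add (DeltaObj P n a) := ⟨Quotient.map₂ DeltaTerm.add fun _ _ h _ _ h' S f v hv =>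
  congrArg₂ (· + ·) (h S f v hv) (h' S f v hv)⟩

instance : Zero (DeltaObj P n a) := ⟨mk (.of 0)⟩

instance : SMul k (DeltaObj P n a) := ⟨fun c => Quotient.map (DeltaTerm.smul c) fun _ _ h S f v hv =>
  congrArg (c • ·) (h S f v hv)⟩

instance : Neg (DeltaObj P n a) := ⟨fun x => (-1 : k) • x⟩

instance : AddCommGroup (DeltaObj P n a) where
  nsmul := nsmulRec
  zsmul := zsmulRec
  add_assoc := ind fun _ => ind fun _ => ind fun _ => sound fun _ _ _ _ => add_assoc _ _ _
  add_comm := ind fun _ => ind fun _ => sound fun _ _ _ _ => add_comm _ _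
  zero_add := ind fun _ => sound fun _ f _ _ => by simp only [DeltaTerm.eval, map_zero, zero_add]
  add_zero := ind fun _ => sound fun _ f _ _ => by simp only [DeltaTerm.eval, map_zero, add_zero]
  neg_add_cancel := ind fun _ => sound fun _ f _ _ => by simp [DeltaTerm.eval]

instance : Module k (DeltaObj P n a) :=
  Module.ofMinimalAxioms (R := k) (M := DeltaObj P n a)
    (fun c => ind fun _ => ind fun _ => sound fun _ _ _ _ => smul_add c _ _)
    (fun c c' => ind fun _ => sound fun _ _ _ _ => add_smul c c' _)
    (fun c c' => ind fun _ => sound fun _ _ _ _ => mul_smul c c' _)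
    (ind fun _ => sound fun _ _ _ _ => one_smul k _)

/-- The action of permutations on operations. -/
def act (σ : Equiv.Perm (Fin n)) : DeltaObj P n a →ₗ[k] DeltaObj P n a where
  toFun := Quotient.map (DeltaTerm.act σ) fun _ _ h S f v hv => congrArg (S.act σ) (h S f v hv)
  map_add' := ind fun _ => ind fun _ => sound fun S _ _ _ => map_add (S.act σ) _ _
  map_smul' c := ind fun _ => sound fun S _ _ _ => map_smul (S.act σ) c _

/-- Partial composition of operations. -/
def comp {m n p : ℕ} {a b c : ℤ} (i : Fin m) (e : Graft m n p i) (h : a + b = c) :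
    DeltaObj P m a →ₗ[k] DeltaObj P n b →ₗ[k] DeltaObj P p c :=
  LinearMap.mk₂ k
    (Quotient.map₂ (DeltaTerm.comp i e h) fun _ _ h₁ _ _ h₂ S f v hv =>
      congrArg₂ (fun x y => S.comp i e h x y) (h₁ S f v hv) (h₂ S f v hv))
    (ind fun _ => ind fun _ => ind fun _ => sound fun S _ _ _ =>
      LinearMap.map_add₂ (S.comp i e h) _ _ _)
    (fun s => ind fun _ => ind fun _ => sound fun S _ _ _ =>
      LinearMap.map_smul₂ (S.comp i e h) s _ _)
    (ind fun _ => ind fun _ => ind fun _ => sound fun S _ _ _ => map_add (S.comp i e h _) _ _)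
    (fun s => ind fun _ => ind fun _ => sound fun S _ _ _ => map_smul (S.comp i e h _) s _)

end DeltaObj

/-- The graded operad `P ⋆ k[Δ]`. -/
def deltaOperad (P : GradedOperad k) : GradedOperad k where
  obj := DeltaObj P
  id := DeltaObj.mk (.of P.id)
  act := DeltaObj.act
  comp := DeltaObj.comp
  act_one := DeltaObj.ind fun x => DeltaObj.sound fun S _ _ _ => S.act_one _
  act_mul σ τ := DeltaObj.ind fun x => DeltaObj.sound fun S _ _ _ => S.act_mul σ τ _
  comp_act i h σ τ ρ e e' he he' := DeltaObj.ind fun x => DeltaObj.ind fun y =>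
    DeltaObj.sound fun S _ _ _ => S.comp_act i h σ τ ρ e e' he he' _ _
  id_comp i e h he := DeltaObj.ind fun y => DeltaObj.sound fun S f v _ => by
    refine Eq.trans ?_ (S.id_comp i e h he (y.eval f v))
    simp only [DeltaTerm.eval, f.map_id]
  comp_id i e h he he' := DeltaObj.ind fun x => DeltaObj.sound fun S f v _ => by
    refine Eq.trans ?_ (S.comp_id i e h he he' (x.eval f v))
    simp only [DeltaTerm.eval, f.map_id]
  assoc_seq i j e f e' f' hab habc hbc habc' h₁ h₂ h₃ :=
    DeltaObj.ind fun x => DeltaObj.ind fun y => DeltaObj.ind fun z => DeltaObj.sound fun S _ _ _ =>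
      S.assoc_seq i j e f e' f' hab habc hbc habc' h₁ h₂ h₃ _ _ _
  assoc_par i j hij hji e f e' f' hab habc hac hacb h₁ h₂ h₃ :=
    DeltaObj.ind fun x => DeltaObj.ind fun y => DeltaObj.ind fun z => DeltaObj.sound fun S _ _ _ =>
      S.assoc_par i j hij hji e f e' f' hab habc hac hacb h₁ h₂ h₃ _ _ _

/-- The operations of `P` as operations of `P ⋆ k[Δ]`. -/
def deltaOf (P : GradedOperad k) : GradedOperad.Hom P (deltaOperad P) where
  map {_ _} :=
    { toFun := fun q => DeltaObj.mk (.of q)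
      map_add' := fun _ _ => DeltaObj.sound fun _ f _ _ => map_add f.map _ _
      map_smul' := fun _ _ => DeltaObj.sound fun _ f _ _ => map_smul f.map _ _ }
  map_id := rfl
  map_act _ _ := DeltaObj.sound fun _ f _ _ => f.map_act _ _
  map_comp _ _ _ _ _ := DeltaObj.sound fun _ f _ _ => f.map_comp _ _ _ _ _

/-- The operation `Δ` of `P ⋆ k[Δ]`. -/
def deltaGen (P : GradedOperad k) : (deltaOperad P).obj 1 (-1) := DeltaObj.mk .delta

theorem deltaGen_mul_self (P : GradedOperad k) :
    (deltaOperad P).mul (c := -2) (by norm_num) (deltaGen P) (deltaGen P) = 0 :=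
  DeltaObj.sound fun _ f _ hv => hv.trans (map_zero f.map).symm

theorem delta_induction {Q : GradedOperad k} {P : ∀ {n : ℕ} {a : ℤ}, (deltaOperad Q).obj n a → Prop}
    (of : ∀ {n : ℕ} {a : ℤ} (q : Q.obj n a), P ((deltaOf Q).map q)) (gen : P (deltaGen Q))
    (add : ∀ {n : ℕ} {a : ℤ} (x y : (deltaOperad Q).obj n a), P x → P y → P (x + y))
    (smul : ∀ {n : ℕ} {a : ℤ} (s : k) (x : (deltaOperad Q).obj n a), P x → P (s • x))
    (act : ∀ {n : ℕ} {a : ℤ} (σ : Equiv.Perm (Fin n)) (x : (deltaOperad Q).obj n a), P x →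
      P ((deltaOperad Q).act σ x))
    (comp : ∀ {m n p : ℕ} {a b c : ℤ} (i : Fin m) (e : Graft m n p i) (h : a + b = c)
      (x : (deltaOperad Q).obj m a) (y : (deltaOperad Q).obj n b), P x → P y →
      P ((deltaOperad Q).comp i e h x y)) {n : ℕ} {a : ℤ} (x : (deltaOperad Q).obj n a) : P x := by
  revert x
  refine DeltaObj.ind fun x => ?_
  induction x with
  | of q => exact of q
  | delta => exact gen
  | add x y hx hy => exact add _ _ hx hy
  | smul s x hx => exact smul s _ hx
  | act σ x hx => exact act σ _ hx
  | comp i e h x y hx hy => exact comp i e h _ _ hx hy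

/-- The morphism out of `P ⋆ k[Δ]` determined by its values on `P` and on `Δ`. -/
def deltaLift {P S : GradedOperad k} (f : GradedOperad.Hom P S) (v : S.obj 1 (-1))
    (hv : S.mul (c := -2) (by norm_num) v v = 0) : GradedOperad.Hom (deltaOperad P) S where
  map {_ _} :=
    { toFun := Quotient.lift (DeltaTerm.eval f v) (fun _ _ h => h S f v hv)
      map_add' := DeltaObj.ind fun _ => DeltaObj.ind fun _ => rfl
      map_smul' := fun _ => DeltaObj.ind fun _ => rfl }
  map_id := f.map_id
  map_act _ := DeltaObj.ind fun _ => rfl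
  map_comp _ _ _ := DeltaObj.ind fun _ => DeltaObj.ind fun _ => rfl

theorem deltaHom_ext {P S : GradedOperad k} {f g : GradedOperad.Hom (deltaOperad P) S}
    (h : ∀ {n : ℕ} {a : ℤ} (q : P.obj n a), f.map ((deltaOf P).map q) = g.map ((deltaOf P).map q))
    (h' : f.map (deltaGen P) = g.map (deltaGen P)) {n : ℕ} {a : ℤ}
    (x : (deltaOperad P).obj n a) : f.map x = g.map x := by
  refine delta_induction (P := fun x => f.map x = g.map x) h h' ?_ ?_ ?_ ?_ x
  · intro _ _ x y hx hy
    rw [map_add, map_add, hx, hy]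
  · intro _ _ s x hx
    rw [map_smul, map_smul, hx]
  · intro _ _ σ x hx
    rw [f.map_act, g.map_act, hx]
  · intro _ _ _ _ _ _ i e h x y hx hy
    rw [f.map_comp, g.map_comp, hx, hy]

/-- The differential of `P ⋆ k[Δ]`, as a section of a square-zero extension. -/
def deltaDHom (P : DGOperad k) : GradedOperad.Hom (deltaOperad P.toGradedOperad)
    (deltaOperad P.toGradedOperad).shift.sqZero :=
  deltaLift
    { map := fun {n a} => (deltaOf P.toGradedOperad).map.prod ((deltaOf P.toGradedOperad).map ∘ₗ P.d)
      map_id := Prod.ext rfl ((congrArg (deltaOf P.toGradedOperad).map P.d_id).trans (map_zero _))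
      map_act := fun σ x => Prod.ext ((deltaOf _).map_act σ x)
        ((congrArg (deltaOf P.toGradedOperad).map (P.d_act σ x)).trans ((deltaOf _).map_act σ (P.d x)))
      map_comp := fun i e h x y => Prod.ext ((deltaOf _).map_comp i e h x y) (by
        refine (congrArg (deltaOf P.toGradedOperad).map (P.d_comp i e h (by lia) (by lia) x y)).trans ?_
        rw [map_add, map_smul, (deltaOf _).map_comp, (deltaOf _).map_comp]
        rfl) }
    (deltaGen _, 0)
    (Prod.ext (deltaGen_mul_self _) (by
      refine (InfBimodule.sqZero_comp_snd _ _ _ _ _ _).trans ?_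
      simp only [map_zero, LinearMap.zero_apply, add_zero]
      rfl))

/-- The differential of `P ⋆ k[Δ]`: it extends that of `P` and vanishes on `Δ`. -/
def deltaD (P : DGOperad k) {n : ℕ} {a : ℤ} : (deltaOperad P.toGradedOperad).obj n a →ₗ[k]
    (deltaOperad P.toGradedOperad).obj n (a + 1) :=
  (InfBimodule.derivationOfHom _ (deltaDHom P) fun {n a} x =>
    deltaHom_ext (f := (InfBimodule.fst _).comp (deltaDHom P)) (g := .id _) (fun q => rfl) rfl x).map

theorem deltaD_of (P : DGOperad k) {n : ℕ} {a : ℤ} (q : P.obj n a) :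
    deltaD P ((deltaOf P.toGradedOperad).map q) = (deltaOf P.toGradedOperad).map (P.d q) := rfl

theorem deltaD_gen (P : DGOperad k) : deltaD P (deltaGen P.toGradedOperad) = 0 := rfl

theorem deltaD_act (P : DGOperad k) {n : ℕ} {a : ℤ} (σ : Equiv.Perm (Fin n))
    (x : (deltaOperad P.toGradedOperad).obj n a) :
    deltaD P ((deltaOperad P.toGradedOperad).act σ x) =
      (deltaOperad P.toGradedOperad).act σ (deltaD P x) :=
  OperadDerivation.map_act _ σ x

theorem deltaD_comp (P : DGOperad k) {m n p : ℕ} {a b c : ℤ} (i : Fin m) (e : Graft m n p i)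
    (h : a + b = c) (h₁ : a + 1 + b = c + 1) (h₂ : a + (b + 1) = c + 1)
    (x : (deltaOperad P.toGradedOperad).obj m a) (y : (deltaOperad P.toGradedOperad).obj n b) :
    deltaD P ((deltaOperad P.toGradedOperad).comp i e h x y) =
      (deltaOperad P.toGradedOperad).comp i e h₁ (deltaD P x) y +
        koszulSign k a • (deltaOperad P.toGradedOperad).comp i e h₂ x (deltaD P y) :=
  OperadDerivation.map_comp _ i e h x y

theorem deltaD_deltaD (P : DGOperad k) {n : ℕ} {a : ℤ} (x : (deltaOperad P.toGradedOperad).obj n a) :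
    deltaD P (deltaD P x) = 0 := by
  refine delta_induction (P := fun x => deltaD P (deltaD P x) = 0) ?_ ?_ ?_ ?_ ?_ ?_ x
  · intro n a q
    rw [deltaD_of, deltaD_of, P.d_d, map_zero]
  · rw [deltaD_gen, map_zero]
  · intro n a x y hx hy
    rw [map_add, map_add, hx, hy, add_zero]
  · intro n a s x hx
    rw [map_smul, map_smul, hx, smul_zero]
  · intro n a σ x hx
    rw [deltaD_act, deltaD_act, hx, map_zero]
  · intro m n l a b c i e h x y hx hy
    rw [deltaD_comp P i e h (by lia) (by lia), map_add, map_smul,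
      deltaD_comp P i e _ (by lia) (by lia), deltaD_comp P i e _ (by lia) (by lia), hx, hy, map_zero,
      map_zero, LinearMap.zero_apply, koszulSign_add, koszulSign_one]
    module

/-- The dg-operad `P ⋆ k[Δ]`. -/
def freeDelta (P : DGOperad k) : DeltaDGOperad k where
  toGradedOperad := deltaOperad P.toGradedOperad
  d := deltaD P
  d_d := deltaD_deltaD P
  d_act := deltaD_act P
  d_comp := deltaD_comp P
  Δ := deltaGen _
  Δ_Δ := deltaGen_mul_self _
  d_Δ := rfl

end

/-! ### The homotopy quotient of `P ⋆ k[Δ]` -/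

section

variable {k : Type u} [Field k]

namespace InfBimodule

variable {T : GradedOperad k} (M : InfBimodule T)

theorem unary_lcomp_id {a : ℤ} (h : 0 + a = a) (v : M.obj 1 a) :
    M.lcomp 0 Graft.unary h T.id v = v := M.id_lcomp 0 _ h (fun _ => Subsingleton.elim _ _) v

theorem ins_unary_id {a : ℤ} (h : 0 + (a + 0) = a) (e : Graft 1 1 1 0) (v : M.obj 1 a) :
    M.ins v 0 e h T.id T.id = v := by
  rw [M.ins_apply v 0 e h (add_zero a) (zero_add a),
    M.rcomp_id 0 _ _ (fun j hj => absurd (Subsingleton.elim j 0) hj) rfl,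
    M.id_lcomp 0 _ _ (fun _ => Subsingleton.elim _ _)]

/-- The commutator with an operation of square zero anticommutes with it. -/
theorem comm_anticomm {a b c : ℤ} (h : a + -1 = b) (h' : -1 + a = b) (h₁ : b + -1 = c)
    (h₂ : -1 + b = c) (v : M.obj 1 a) {Δ : T.obj 1 (-1)}
    (hΔ : T.mul (show -1 + -1 = -2 by norm_num) Δ Δ = 0) :
    M.rcomp 0 Graft.unary h₁ (M.comm h h' v Δ) Δ +
      M.lcomp 0 Graft.unary h₂ Δ (M.comm h h' v Δ) = 0 := by
  have H : SeqCompat 0 0 0 Graft.unary Graft.unary Graft.unary Graft.unary :=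
    ⟨rfl, fun j hj => absurd (Subsingleton.elim j 0) hj,
      fun j hj => absurd (Subsingleton.elim j 0) hj, fun _ => rfl⟩
  have e1 := M.seq_rr H h h₁ (show -1 + -1 = -2 by norm_num) (by omega) v Δ Δ
  have e2 := M.seq_lr H h' h₁ h h₂ Δ v Δ
  have e3 := M.seq_llr H (show -1 + -1 = -2 by norm_num) (by omega) h' h₂ Δ Δ v
  rw [show T.comp 0 Graft.unary (show -1 + -1 = -2 by norm_num) Δ Δ = 0 from hΔ, map_zero] at e1
  rw [show T.comp 0 Graft.unary (show -1 + -1 = -2 by norm_num) Δ Δ = 0 from hΔ, map_zero,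
    LinearMap.zero_apply] at e3
  rw [comm, map_sub, LinearMap.sub_apply, map_sub, e1, e2, ← e3]
  abel

end InfBimodule

variable [CharZero k] (P : DGOperad k)

/-- The graded operad `P ⋆ k[Δ] ⋆ k⟨φ₁, φ₂, …⟩`. -/
abbrev freeQuot : GradedOperad k := phiOperad (freeDelta P).toGradedOperad

namespace FreeQuot

/-- The operations of `P` as operations of `freeQuot P`. -/
def of : GradedOperad.Hom P.toGradedOperad (freeQuot P) :=
  (phiOfHom (freeDelta P).toGradedOperad).comp (deltaOf P.toGradedOperad)

/-- The operation `Δ` of `freeQuot P`. -/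
def delta : (freeQuot P).obj 1 (-1) := phiOf _ (freeDelta P).Δ

/-- The coefficients of `exp(φ(z))`. -/
noncomputable def exp (n : ℕ) : (freeQuot P).obj 1 (-2 * (n : ℤ)) :=
  phiExp (freeQuot P) (phiGen (freeDelta P).toGradedOperad) n

theorem exp_zero : exp P 0 = (freeQuot P).id := phiExp_zero _

variable {P}

theorem induction {p : ∀ {n : ℕ} {a : ℤ}, (freeQuot P).obj n a → Prop}
    (of : ∀ {n : ℕ} {a : ℤ} (q : P.obj n a), p ((of P).map q)) (delta : p (delta P))
    (exp : ∀ n, p (exp P n))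
    (add : ∀ {n : ℕ} {a : ℤ} (x y : (freeQuot P).obj n a), p x → p y → p (x + y))
    (smul : ∀ {n : ℕ} {a : ℤ} (s : k) (x : (freeQuot P).obj n a), p x → p (s • x))
    (act : ∀ {n : ℕ} {a : ℤ} (σ : Equiv.Perm (Fin n)) (x : (freeQuot P).obj n a), p x →
      p ((freeQuot P).act σ x))
    (comp : ∀ {m n l : ℕ} {a b c : ℤ} (i : Fin m) (e : Graft m n l i) (h : a + b = c)
      (x : (freeQuot P).obj m a) (y : (freeQuot P).obj n b), p x → p y →
      p ((freeQuot P).comp i e h x y)) {n : ℕ} {a : ℤ} (x : (freeQuot P).obj n a) : p x := by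
  refine phiExp_induction (P := p) (fun q => ?_) exp add smul act comp x
  let f := phiOfHom (freeDelta P).toGradedOperad
  refine delta_induction (P := fun q => p (f.map q)) of delta ?_ ?_ ?_ ?_ q
  · intro n a x y hx hy
    exact (map_add f.map x y).symm ▸ add _ _ hx hy
  · intro n a s x hx
    exact (map_smul f.map s x).symm ▸ smul s _ hx
  · intro n a σ x hx
    exact (f.map_act σ x).symm ▸ act σ _ hx
  · intro m n l a b c i e h x y hx hy
    exact (f.map_comp i e h x y).symm ▸ comp i e h _ _ hx hy

theorem hom_ext {S : GradedOperad k} {f g : GradedOperad.Hom (freeQuot P) S}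
    (h₁ : ∀ {n : ℕ} {a : ℤ} (q : P.obj n a), f.map ((of P).map q) = g.map ((of P).map q))
    (h₂ : f.map (delta P) = g.map (delta P)) (h₃ : ∀ n, f.map (exp P n) = g.map (exp P n))
    {n : ℕ} {a : ℤ} (x : (freeQuot P).obj n a) : f.map x = g.map x := by
  refine induction (p := fun x => f.map x = g.map x) h₁ h₂ h₃ ?_ ?_ ?_ ?_ x
  · intro _ _ x y hx hy
    rw [map_add, map_add, hx, hy]
  · intro _ _ s x hx
    rw [map_smul, map_smul, hx]
  · intro _ _ σ x hx
    rw [f.map_act, g.map_act, hx]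
  · intro _ _ _ _ _ _ i e h x y hx hy
    rw [f.map_comp, g.map_comp, hx, hy]

theorem der_ext {M : InfBimodule (freeQuot P)} {D D' : OperadDerivation M}
    (h₁ : ∀ {n : ℕ} {a : ℤ} (q : P.obj n a), D.map ((of P).map q) = D'.map ((of P).map q))
    (h₂ : D.map (delta P) = D'.map (delta P)) (h₃ : ∀ n, D.map (exp P n) = D'.map (exp P n))
    {n : ℕ} {a : ℤ} (x : (freeQuot P).obj n a) : D.map x = D'.map x := by
  refine induction (p := fun x => D.map x = D'.map x) h₁ h₂ h₃ ?_ ?_ ?_ ?_ x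
  · intro _ _ x y hx hy
    rw [map_add, map_add, hx, hy]
  · intro _ _ s x hx
    rw [map_smul, map_smul, hx]
  · intro _ _ σ x hx
    rw [D.map_act, D'.map_act, hx]
  · intro _ _ _ _ _ _ i e h x y hx hy
    rw [D.map_comp, D'.map_comp, hx, hy]

theorem delta_mul_self :
    (freeQuot P).mul (show -1 + -1 = -2 by norm_num) (delta P) (delta P) = 0 :=
  ((phiOfHom (freeDelta P).toGradedOperad).map_mul _ _ _).symm.trans
    ((congrArg _ (freeDelta P).Δ_Δ).trans (map_zero _))

section Derivation

variable (M : InfBimodule (freeQuot P)) (v : M.obj 1 (-1))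
  (hv : M.rcomp 0 Graft.unary (show -1 + -1 = -2 by norm_num) v (delta P) +
      M.lcomp 0 Graft.unary (by norm_num) (delta P) v = 0)
  (μ : ∀ n : ℕ, M.obj 1 (-2 * (n : ℤ))) (hμ : μ 0 = 0)

/-- The section of a square-zero extension that corresponds to `derivation`. -/
noncomputable def derivationHom : GradedOperad.Hom (freeQuot P) M.sqZero :=
  phiLiftExp (deltaLift (M.inl.comp (of P)) (delta P, v) (Prod.ext delta_mul_self hv))
    (fun n => (exp P n, μ n))

include hμ in
theorem derivationHom_exp (n : ℕ) : (derivationHom M v hv μ).map (exp P n) = (exp P n, μ n) :=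
  phiLiftExp_exp _ (Prod.ext (exp_zero P) hμ) n

/-- The derivation that vanishes on `P` and has given values on `Δ` and on the coefficients of
`exp(φ(z))`. -/
noncomputable def derivation : OperadDerivation M :=
  InfBimodule.derivationOfHom M (derivationHom M v hv μ) fun {n a} x =>
    hom_ext (f := M.fst.comp (derivationHom M v hv μ)) (g := .id _) (fun q => rfl) rfl
      (fun n => congrArg M.fst.map (derivationHom_exp M v hv μ hμ n)) x

theorem derivation_of {n : ℕ} {a : ℤ} (q : P.obj n a) :
    (derivation M v hv μ hμ).map ((of P).map q) = 0 := rfl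

theorem derivation_delta : (derivation M v hv μ hμ).map (delta P) = v := rfl

theorem derivation_exp (n : ℕ) : (derivation M v hv μ hμ).map (exp P n) = μ n :=
  congrArg Prod.snd (derivationHom_exp M v hv μ hμ n)

end Derivation

end FreeQuot

end

/-! ### The universal derivation relative to `P` -/

section

variable {k : Type u} [Field k]

variable [CharZero k] (P : DGOperad k)

theorem FreeInf.twDer_act {T : GradedOperad k} {d : EquivFam T T 1} {Δ : T.obj 1 (-1)} {n : ℕ}
    {a b : ℤ} (h : a + 1 = b) (σ : Equiv.Perm (Fin n)) (w : FreeInf T n a) :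
    twDer d Δ h (act σ w) = act σ (twDer d Δ h w) := by
  rw [twDer_apply, twDer_apply, map_add, der_act]
  congr 1
  induction w using FreeInf.induction with
  | zero => simp
  | add w w' hw hw' => simp only [map_add, hw, hw']
  | @mk m₁ l₁ b₁ c₁ r j g hr y z =>
    rw [act_mk, oddContract_mk _ _ _ r j _ hr (by omega), oddContract_mk _ _ _ r j _ hr (by omega)]
    exact (congrArg _ ((freeInf T).act_ins _ j g _ σ y z).symm).trans (map_smul _ _ _).symm

namespace FreeQuot

/-- The derivation of degree `1` that vanishes on `P` and on the `φₙ`, with `Δ ↦ 1`. -/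
noncomputable def sDer : OperadDerivation (freeQuot P).shift :=
  derivation (freeQuot P).shift (show (freeQuot P).obj 1 (-1 + 1) from (freeQuot P).id) (by
    change (freeQuot P).comp 0 Graft.unary (show 0 + -1 = -1 by norm_num) (freeQuot P).id (delta P) +
      koszulSign k (-1) • (freeQuot P).comp 0 Graft.unary (show -1 + 0 = -1 by norm_num) (delta P)
        (freeQuot P).id = 0
    rw [koszulSign_neg_one, neg_one_smul, (freeQuot P).id_comp 0 _ _ (fun _ => Subsingleton.elim _ _)]
    exact add_neg_eq_zero.mpr ((freeQuot P).mul_id _ _).symm) (fun _ => 0) rfl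

/-- The derivation `sDer` as a family of maps. -/
noncomputable def s : EquivFam (freeQuot P) (freeQuot P) 1 :=
  EquivFam.ofMap₁ (sDer P).map (sDer P).map_act

theorem isDer_s : (s P).IsDer := by
  intro m n l a b c a' b' c' i e h ha hb hc x y
  subst ha hb hc
  rw [one_mul]
  exact (sDer P).map_comp i e h x y

/-- The differential of `freeQuot P`. -/
noncomputable abbrev d : EquivFam (freeQuot P) (freeQuot P) 1 := phiDFam (freeDelta P)

variable {P} {n : ℕ} {a b : ℤ}

theorem s_of (h : a + 1 = b) (q : P.obj n a) : (s P).map h ((of P).map q) = 0 := by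
  subst h; rfl

theorem s_delta (h : -1 + 1 = (0 : ℤ)) : (s P).map h (delta P) = (freeQuot P).id := rfl

theorem s_exp (n : ℕ) (h : -2 * (n : ℤ) + 1 = b) : (s P).map h (exp P n) = 0 := by
  subst h; exact derivation_exp _ _ _ _ rfl n

theorem d_of (h : a + 1 = b) (q : P.obj n a) :
    (d P).map h ((of P).map q) = (of P).map (P.dFam.map h q) := by
  subst h; rfl

theorem d_delta (h : -1 + 1 = b) : (d P).map h (delta P) = 0 := by
  subst h
  exact phiOf_zero _

theorem d_exp_zero (h : -2 * ((0 : ℕ) : ℤ) + 1 = b) : (d P).map h (exp P 0) = 0 := by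
  subst h
  exact phiD_exp (freeDelta P) 0

theorem d_exp_succ (n : ℕ) (h : -2 * ((n + 1 : ℕ) : ℤ) + 1 = b) (h' : -2 * (n : ℤ) + -1 = b) :
    (d P).map h (exp P (n + 1)) = (freeQuot P).mul h' (exp P n) (delta P) := by
  subst h
  exact phiD_exp (freeDelta P) (n + 1)

theorem d_d {c : ℤ} (h : a + 1 = b) (h' : b + 1 = c) (x : (freeQuot P).obj n a) :
    (d P).map h' ((d P).map h x) = 0 := by
  subst h h'
  exact phiD_phiD (freeDelta P) x

theorem s_lmul {l : ℕ} {a b c : ℤ} (h : -1 + a = b) (h' : b + 1 = a) (h'' : a + 1 = c)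
    (h₃ : -1 + c = a) (y : (freeQuot P).obj l a) :
    (s P).map h' ((freeQuot P).lmul h (delta P) y) =
      y - (freeQuot P).lmul h₃ (delta P) ((s P).map h'' y) := by
  rw [GradedOperad.lmul, isDer_s P 0 _ h (show -1 + 1 = (0 : ℤ) by norm_num) h'' h', s_delta,
    one_mul, koszulSign_neg_one, neg_one_smul, (freeQuot P).id_comp 0 _ _ (fun _ => rfl), sub_eq_add_neg]
  rfl

variable (P)

/-- The value `[0] Δ - Δ [0]` of the universal derivation on `Δ`. -/
noncomputable abbrev dDelta : FreeInf (freeQuot P) 1 (-1) :=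
  FreeInf.genComm (delta P) 0 (by norm_num)

/-- The derivation with values in the free infinitesimal bimodule that vanishes on `P`, with
`Δ ↦ [0] Δ - Δ [0]` and `uₙ ↦ ∑ uᵢ [n - i]`, for `u(z) = exp(φ(z))`. -/
noncomputable def D : OperadDerivation (freeInf (freeQuot P)) :=
  derivation (freeInf (freeQuot P)) (dDelta P)
    ((freeInf (freeQuot P)).comm_anticomm _ _ _ _ _ delta_mul_self)
    (fun n => ∑ i : Fin n, FreeInf.lcomp 0 Graft.unary (by have := i.isLt; omega) (exp P i)
      (FreeInf.gen (freeQuot P) (n - i))) rfl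

variable {P}

theorem D_of (q : P.obj n a) : (D P).map ((of P).map q) = 0 := derivation_of _ _ _ _ _ q

theorem D_delta : (D P).map (delta P) = dDelta P := derivation_delta _ _ _ _ _

theorem D_exp (n : ℕ) : (D P).map (exp P n) =
    ∑ i : Fin n, FreeInf.lcomp 0 Graft.unary (by have := i.isLt; omega) (exp P i)
      (FreeInf.gen (freeQuot P) (n - i)) := derivation_exp _ _ _ _ _ n

theorem Adm.sum {T : GradedOperad k} {ω : FreeInf T 1 (-1)} {ι : Type} (t : Finset ι) {n : ℕ}
    {a : ℤ} (f : ι → FreeInf T n a) (hf : ∀ i ∈ t, FreeInf.Adm ω (f i)) :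
    FreeInf.Adm ω (∑ i ∈ t, f i) :=
  Finset.sum_induction f (FreeInf.Adm ω) (fun _ _ => .add) .zero hf

theorem adm_dDelta : FreeInf.Adm (dDelta P) (dDelta P) := by
  have h := FreeInf.Adm.ins (ω := dDelta P) 0 Graft.unary (show (0 : ℤ) + (-1 + 0) = -1 by norm_num)
    (freeQuot P).id (freeQuot P).id
  rwa [(freeInf (freeQuot P)).ins_unary_id] at h

theorem adm_D (x : (freeQuot P).obj n a) : FreeInf.Adm (dDelta P) ((D P).map x) := by
  refine induction (p := fun x => FreeInf.Adm (dDelta P) ((D P).map x)) ?_ ?_ ?_ ?_ ?_ ?_ ?_ x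
  · intro n a q
    rw [D_of]
    exact .zero
  · rw [D_delta]
    exact adm_dDelta
  · intro n
    rw [D_exp]
    refine Adm.sum _ _ fun i _ => FreeInf.Adm.lcomp ?_ _ _ _
    exact .mk (by have := i.isLt; omega) _ _ _ _ _
  · intro n a x y hx hy
    rw [map_add]
    exact .add hx hy
  · intro n a s x hx
    rw [map_smul]
    exact .smul s hx
  · intro n a σ x hx
    rw [(D P).map_act]
    exact hx.act σ
  · intro m n l a b c i e h x y hx hy
    rw [(D P).map_comp]
    exact .add (hx.rcomp e h y) (hy.lcomp e h x)

theorem _root_.FreeInf.lcomp_gen_congr {T : GradedOperad k} {a b : ℤ} {r r' : ℕ} (hr : r = r')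
    (h : a + -2 * (r : ℤ) = b) (h' : a + -2 * (r' : ℤ) = b) (x : T.obj 1 a) :
    FreeInf.lcomp 0 Graft.unary h x (FreeInf.gen T r) =
      FreeInf.lcomp 0 Graft.unary h' x (FreeInf.gen T r') := by
  subst hr; rfl

/-- The differential on the free infinitesimal bimodule. -/
noncomputable abbrev tw {n : ℕ} {a b : ℤ} (h : a + 1 = b) :
    FreeInf (freeQuot P) n a →ₗ[k] FreeInf (freeQuot P) n b := FreeInf.twDer (d P) (delta P) h

theorem _root_.EquivFam.IsDer.map_id {T : GradedOperad k} {f : EquivFam T T 1} (hf : f.IsDer)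
    (h : 0 + 1 = b) : f.map h T.id = 0 := by
  subst h
  have h1 := hf 0 Graft.unary (add_zero 0) rfl rfl rfl T.id T.id
  rw [T.id_comp 0 _ _ (fun _ => Subsingleton.elim _ _),
    T.id_comp 0 _ _ (fun _ => Subsingleton.elim _ _), mul_zero, koszulSign_even k (by decide),
    one_smul, T.comp_id 0 _ (add_zero _) (fun j hj => absurd (Subsingleton.elim j 0) hj) rfl] at h1
  exact left_eq_add.mp h1

theorem tw_gen_zero (h : -2 * ((0 : ℕ) : ℤ) + 1 = b) :
    tw h (FreeInf.gen (freeQuot P) 0) = 0 := by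
  rw [FreeInf.gen, FreeInf.twDer_apply, FreeInf.oddContract_genD_zero,
    FreeInf.der_mk _ h 0 0 _ _ _ _ (zero_add 1) (zero_add 1) (by push_cast at h ⊢; omega)
      (by push_cast at h ⊢; omega), EquivFam.IsDer.map_id (isDer_phiDFam (freeDelta P))]
  simp

theorem tw_gen_succ (r : ℕ) (h : -2 * ((r + 1 : ℕ) : ℤ) + 1 = b) (h' : b + 2 * (r : ℤ) = -1) :
    tw h (FreeInf.gen (freeQuot P) (r + 1)) = FreeInf.genComm (delta P) r h' := by
  have h1 := FreeInf.oddContract_mk (freeInf (freeQuot P)) (FreeInf.genD (delta P)) h (r + 1) 0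
    Graft.unary (show (0 : ℤ) + 0 = -2 * ((r + 1 : ℕ) : ℤ) + 2 * ((r + 1 : ℕ) : ℤ) by push_cast; omega)
    (by omega) (freeQuot P).id (freeQuot P).id
  rw [FreeInf.gen, FreeInf.twDer_apply,
    FreeInf.der_mk _ h (r + 1) 0 _ _ _ _ (zero_add 1) (zero_add 1) (by push_cast at h ⊢; omega)
      (by push_cast at h ⊢; omega), EquivFam.IsDer.map_id (isDer_phiDFam (freeDelta P))]
  subst h
  simp only [map_zero, LinearMap.zero_apply, smul_zero, zero_add]
  refine h1.trans ?_
  rw [koszulSign_even k (by decide), one_smul]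
  exact (freeInf (freeQuot P)).ins_unary_id _ _ _

theorem tw_dDelta (h : -1 + 1 = b) : tw h (dDelta P) = 0 := by
  have hd : (d P).IsDer := isDer_phiDFam (freeDelta P)
  have h1 := FreeInf.twDer_rcomp (Δ := delta P) hd Graft.unary (show -2 * ((0 : ℕ) : ℤ) + -1 = -1 by simp)
    rfl rfl h (by push_cast; omega) (by push_cast; omega) (FreeInf.gen (freeQuot P) 0) (delta P)
  have h2 := FreeInf.twDer_lcomp (Δ := delta P) hd Graft.unary (show -1 + -2 * ((0 : ℕ) : ℤ) = -1 by simp)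
    rfl rfl h (by push_cast; omega) (by push_cast; omega) (delta P) (FreeInf.gen (freeQuot P) 0)
  rw [tw_gen_zero, d_delta] at h1 h2
  simp only [map_zero, LinearMap.zero_apply, smul_zero, add_zero] at h1 h2
  exact (map_sub _ _ _).trans ((congrArg₂ (· - ·) h1 h2).trans (sub_zero 0))

theorem _root_.FreeInf.lcomp_genComm {T : GradedOperad k} (Δ : T.obj 1 (-1)) (r : ℕ)
    {a b c e f : ℤ} (h : c + 2 * (r : ℤ) = -1) (h₀ : a + c = b) (h₁ : a + -2 * (r : ℤ) = e)
    (h₂ : e + -1 = b) (h₃ : a + -1 = f) (h₄ : f + -2 * (r : ℤ) = b) (x : T.obj 1 a) :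
    FreeInf.lcomp 0 Graft.unary h₀ x (FreeInf.genComm Δ r h) =
      FreeInf.rcomp 0 Graft.unary h₂ (FreeInf.lcomp 0 Graft.unary h₁ x (FreeInf.gen T r)) Δ -
        FreeInf.lcomp 0 Graft.unary h₄ (T.mul h₃ x Δ) (FreeInf.gen T r) := by
  have H : SeqCompat 0 0 0 Graft.unary Graft.unary Graft.unary Graft.unary :=
    ⟨rfl, fun j hj => absurd (Subsingleton.elim j 0) hj,
      fun j hj => absurd (Subsingleton.elim j 0) hj, fun _ => rfl⟩
  have e1 := (freeInf T).seq_lr H h₁ h₂ (show -2 * (r : ℤ) + -1 = c by omega) h₀ x (FreeInf.gen T r) Δ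
  have e2 := (freeInf T).seq_llr H h₃ h₄ (show -1 + -2 * (r : ℤ) = c by omega) h₀ x Δ (FreeInf.gen T r)
  exact (map_sub _ _ _).trans (congrArg₂ (· - ·) e1.symm e2.symm)

/-- On `uₙ₊₁`, with differential `uₙ Δ`, the terms `uᵢ Δ [n - i]` of the two sides cancel in pairs. -/
theorem D_d_exp (n : ℕ) (h : -2 * (n : ℤ) + 1 = b) :
    (D P).map ((d P).map h (exp P n)) = tw h ((D P).map (exp P n)) := by
  have hd : (d P).IsDer := isDer_phiDFam (freeDelta P)
  cases n with
  | zero => rw [d_exp_zero, map_zero, D_exp, Fin.sum_univ_zero, map_zero]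
  | succ n =>
    have h0 : -2 * (n : ℤ) + -1 = b := by push_cast at h; omega
    -- the terms `uᵢ [r] Δ` and `uᵢ Δ [r]`
    let R : ∀ i r : ℕ, i + r = n → FreeInf (freeQuot P) 1 b := fun i r hr =>
      FreeInf.rcomp 0 Graft.unary (show -2 * (n : ℤ) + -1 = b from h0)
        (FreeInf.lcomp 0 Graft.unary (by omega) (exp P i) (FreeInf.gen _ r)) (delta P)
    let C : ∀ i r : ℕ, i + r = n → FreeInf (freeQuot P) 1 b := fun i r hr =>
      FreeInf.lcomp 0 Graft.unary (by omega) ((freeQuot P).mul rfl (exp P i) (delta P))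
        (FreeInf.gen _ r)
    have hC : ∀ i i' r r' (hr : i + r = n) (hr' : i' + r' = n), i = i' → C i r hr = C i' r' hr' := by
      intro i i' r r' hr hr' hi
      obtain rfl : r = r' := by omega
      subst hi
      rfl
    have hR₀ : ∀ i i' r r' (hr : i + r = n) (hr' : i' + r' = n), i = i' → R i r hr = R i' r' hr' := by
      intro i i' r r' hr hr' hi
      obtain rfl : r = r' := by omega
      subst hi
      rfl
    have key : ∀ i : Fin (n + 1), tw h (FreeInf.lcomp 0 Graft.unary (by have := i.isLt; omega)
        (exp P i) (FreeInf.gen (freeQuot P) (n + 1 - i))) =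
        FreeInf.lcomp 0 Graft.unary (by have := i.isLt; omega) ((d P).map rfl (exp P i))
          (FreeInf.gen (freeQuot P) (n + 1 - i)) +
        (R i (n - i) (by have := i.isLt; omega) - C i (n - i) (by have := i.isLt; omega)) := by
      intro i
      have hi := i.isLt
      have h1 := FreeInf.lcomp_gen_congr (T := freeQuot P) (show n + 1 - (i : ℕ) = (n - i) + 1 by omega)
        (by omega) (show -2 * ((i : ℕ) : ℤ) + _ = -2 * ((n + 1 : ℕ) : ℤ) by omega) (exp P i)
      have h2 := FreeInf.lcomp_gen_congr (T := freeQuot P) (show n + 1 - (i : ℕ) = (n - i) + 1 by omega)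
        (show -2 * ((i : ℕ) : ℤ) + 1 + _ = b by omega) (by omega) ((d P).map rfl (exp P i))
      rw [h1, h2, FreeInf.twDer_lcomp hd Graft.unary _ rfl rfl h _ (by omega), tw_gen_succ (n - i) rfl
          (by push_cast; omega), koszulSign_even k ⟨-(i : ℤ), by ring⟩, one_smul,
        FreeInf.lcomp_genComm (delta P) (n - i) _ _ (show _ = -2 * (n : ℤ) by omega) h0 rfl
          (by omega)]
    have hL := FreeInf.lcomp_genComm (delta P) 0 (c := -1) (by norm_num) h0
      (show _ = -2 * (n : ℤ) by simp) h0 rfl (by push_cast; omega) (exp P n)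
    have hA : ∀ j : Fin n, FreeInf.lcomp 0 Graft.unary (by have := j.succ.isLt; omega)
        ((d P).map rfl (exp P j.succ)) (FreeInf.gen (freeQuot P) (n + 1 - j.succ)) =
        C j (n - j) (by have := j.isLt; omega) := by
      intro j
      have hj := j.isLt
      have hj' : ((j.succ : ℕ) : ℤ) = j + 1 := by simp
      rw [FreeInf.lcomp_gen_congr (T := freeQuot P) (show n + 1 - (j.succ : ℕ) = n - j by simp)
          (by omega) (show -2 * ((j.succ : ℕ) : ℤ) + 1 + _ = b by omega)
          ((d P).map rfl (exp P j.succ))]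
      have h1 : (d P).map rfl (exp P j.succ) = _ :=
        d_exp_succ (P := P) (j : ℕ) rfl (by omega)
      have h2 : ∀ {f : ℤ} (hf : -2 * ((j : ℕ) : ℤ) + -1 = f) (hf' : f + -2 * ((n - j : ℕ) : ℤ) = b),
          FreeInf.lcomp 0 Graft.unary hf' ((freeQuot P).mul hf (exp P j) (delta P))
            (FreeInf.gen _ (n - j)) = C j (n - j) (by omega) := by
        rintro _ rfl _
        rfl
      rw [h1, h2]
    have hA₀ : FreeInf.lcomp 0 Graft.unary (by omega)
        ((d P).map rfl (exp P (0 : Fin (n + 1)))) (FreeInf.gen (freeQuot P) (n + 1 - (0 : Fin (n + 1)))) =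
        (0 : FreeInf (freeQuot P) 1 b) := by
      have h1 : (d P).map rfl (exp P (0 : Fin (n + 1))) = 0 := d_exp_zero rfl
      rw [h1, map_zero, LinearMap.zero_apply]
    have hR : (D P).map ((d P).map h (exp P (n + 1))) =
        ∑ j : Fin n, R j (n - j) (by have := j.isLt; omega) + (R n 0 rfl - C n 0 rfl) := by
      rw [d_exp_succ n h h0, GradedOperad.mul, (D P).map_comp, D_exp, D_delta]
      rw [map_sum, LinearMap.sum_apply]
      exact congrArg _ hL
    rw [hR, D_exp, map_sum]
    refine Eq.trans ?_ (Finset.sum_congr rfl fun i _ => key i).symm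
    rw [Finset.sum_add_distrib, Finset.sum_sub_distrib, Fin.sum_univ_succ,
      Finset.sum_congr rfl fun j _ => hA j, hA₀]
    have eR := Fin.sum_univ_castSucc fun i : Fin (n + 1) => R i (n - i) (by have := i.isLt; omega)
    have eC := Fin.sum_univ_castSucc fun i : Fin (n + 1) => C i (n - i) (by have := i.isLt; omega)
    rw [eR, eC, hC (Fin.last n) n _ 0 (by simp) rfl rfl, hR₀ (Fin.last n) n _ 0 (by simp) rfl rfl]
    simp only [Fin.val_castSucc]
    abel

/-- The universal derivation commutes with the differentials. -/
theorem D_d {n : ℕ} {a b : ℤ} (h : a + 1 = b) (x : (freeQuot P).obj n a) :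
    (D P).map ((d P).map h x) = tw h ((D P).map x) := by
  have hd : (d P).IsDer := isDer_phiDFam (freeDelta P)
  refine induction (p := fun {n a} x => ∀ (b : ℤ) (h : a + 1 = b),
    (D P).map ((d P).map h x) = tw h ((D P).map x)) ?_ ?_ ?_ ?_ ?_ ?_ ?_ x b h
  · intro n a q b h
    rw [d_of, D_of, D_of, map_zero]
  · intro b h
    rw [d_delta, D_delta, tw_dDelta, map_zero]
  · exact fun n b h => D_d_exp n h
  · intro n a x y hx hy b h
    simp only [map_add, hx b h, hy b h]
  · intro n a s x hx b h
    simp only [map_smul, hx b h]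
  · intro n a σ x hx b h
    rw [(d P).map_act, (D P).map_act, (D P).map_act, hx b h]
    exact (FreeInf.twDer_act h σ _).symm
  · intro m n l a b c i e h x y hx hy c' hc
    rw [hd i e h rfl rfl hc, map_add, map_smul, (D P).map_comp, (D P).map_comp, (D P).map_comp,
      map_add, hx _ rfl, hy _ rfl, FreeInf.twDer_rcomp hd e h rfl rfl hc (by omega) (by omega),
      FreeInf.twDer_lcomp hd e h rfl rfl hc (by omega) (by omega), one_mul, smul_add]
    abel

end FreeQuot

end

/-! ### Contractions of the universal derivation, and the weight grading -/

section

variable {k : Type u} [Field k] [CharZero k] {P : DGOperad k}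

namespace FreeQuot

section Twist

variable (M : InfBimodule (freeQuot P)) (v : ∀ r : ℕ, M.obj 1 (-2 * (r : ℤ))) (v₀ : M.obj 1 (-1))
  (hv₀ : M.rcomp 0 Graft.unary (show -1 + -1 = -2 by norm_num) v₀ (delta P) +
      M.lcomp 0 Graft.unary (by norm_num) (delta P) v₀ = 0)

include hv₀ in
theorem twist_ins_dDelta {m l n : ℕ} {a b c : ℤ} (i : Fin m) (e : Graft m l n i)
    (h : b + (-1 + c) = a) (x : (freeQuot P).obj m b) (y : (freeQuot P).obj l c) :
    FreeInf.twist M v v₀ (s P) ((freeInf (freeQuot P)).ins (dDelta P) i e h x y) =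
      M.ins v₀ i e h x y :=
  FreeInf.twist_ins_genComm M v v₀ (s P) (fun h h' h'' h₃ y => s_lmul h h' h'' h₃ y) hv₀ i e h x y

include hv₀ in
theorem twist_rcomp {n : ℕ} {a : ℤ} {w : FreeInf (freeQuot P) n a} (hw : FreeInf.Adm (dDelta P) w)
    {m p : ℕ} {b c : ℤ} (j : Fin n) (f : Graft n m p j) (h : a + b = c) (z : (freeQuot P).obj m b) :
    FreeInf.twist M v v₀ (s P) (FreeInf.rcomp j f h w z) =
      M.rcomp j f h (FreeInf.twist M v v₀ (s P) w) z :=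
  FreeInf.twist_rcomp_of_adm M v v₀ (s P)
    (fun i e h x y => twist_ins_dDelta M v v₀ hv₀ i e h x y) hw j f h z

theorem twist_gen {r : ℕ} (hr : 0 < r) :
    FreeInf.twist M v v₀ (s P) (FreeInf.gen (freeQuot P) r) = v r := by
  rw [FreeInf.gen, FreeInf.twist_mk _ _ _ _ hr _ _ _ (by omega)]
  exact M.ins_unary_id _ _ _

include hv₀ in
theorem twist_dDelta : FreeInf.twist M v v₀ (s P) (dDelta P) = v₀ := by
  have h := twist_ins_dDelta M v v₀ hv₀ 0 Graft.unary (show (0 : ℤ) + (-1 + 0) = -1 by norm_num)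
    (freeQuot P).id (freeQuot P).id
  rwa [M.ins_unary_id, (freeInf (freeQuot P)).ins_unary_id] at h

/-- The derivation with `Δ ↦ v₀` and `uₙ ↦ ∑ uᵢ vₙ₋ᵢ`, for `u(z) = exp(φ(z))`. -/
noncomputable def twistDer : OperadDerivation M where
  map := FreeInf.twist M v v₀ (s P) ∘ₗ (D P).map
  map_act σ x := by
    rw [LinearMap.comp_apply, (D P).map_act]
    exact FreeInf.twist_act M v v₀ (s P) σ _
  map_comp i e h x y := by
    rw [LinearMap.comp_apply, (D P).map_comp, map_add]
    exact congrArg₂ (· + ·) (twist_rcomp M v v₀ hv₀ (adm_D x) i e h y)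
      (FreeInf.twist_lcomp M v v₀ (s P) e h x _)

theorem twistDer_of {n : ℕ} {a : ℤ} (q : P.obj n a) :
    (twistDer M v v₀ hv₀).map ((of P).map q) = 0 := by
  rw [twistDer, LinearMap.comp_apply, D_of, map_zero]

theorem twistDer_delta : (twistDer M v v₀ hv₀).map (delta P) = v₀ := by
  rw [twistDer, LinearMap.comp_apply, D_delta]
  exact twist_dDelta M v v₀ hv₀

theorem twistDer_exp (n : ℕ) : (twistDer M v v₀ hv₀).map (exp P n) =
    ∑ i : Fin n, M.lcomp 0 Graft.unary (by have := i.isLt; omega) (exp P i) (v (n - i)) := by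
  rw [twistDer, LinearMap.comp_apply, D_exp, map_sum]
  refine Finset.sum_congr rfl fun i _ => ?_
  rw [FreeInf.twist_lcomp, twist_gen M v v₀ (by have := i.isLt; omega)]

end Twist

/-- The universal derivation is fixed by the replacement of `x [0] y` by `x ([0] Δ - Δ [0]) s y`. -/
theorem twist_D {n : ℕ} {a : ℤ} (x : (freeQuot P).obj n a) :
    FreeInf.twist (freeInf (freeQuot P)) (FreeInf.gen (freeQuot P)) (dDelta P) (s P) ((D P).map x) =
      (D P).map x := by
  have h0 := (freeInf (freeQuot P)).comm_anticomm (show -2 * ((0 : ℕ) : ℤ) + -1 = -1 by simp)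
    (by simp) (show -1 + -1 = -2 by norm_num) (by norm_num) (FreeInf.gen (freeQuot P) 0)
    (delta_mul_self (P := P))
  refine der_ext (D := twistDer _ _ _ h0) (D' := D P) (fun q => ?_) ?_ (fun n => ?_) x
  · rw [twistDer_of, D_of]
  · rw [twistDer_delta, D_delta]
    rfl
  · rw [twistDer_exp, D_exp]

/-- The coefficients of `u(z)⁻¹ z u'(z)`, for `u(z) = exp(φ(z))`. -/
noncomputable def cLog (P : DGOperad k) (n : ℕ) : (freeQuot P).obj 1 (-2 * (n : ℤ)) :=
  (n : k) • exp P n - ∑ i : Fin n, if h : (i : ℕ) = 0 then 0 else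
    (freeQuot P).mul (by have := i.isLt; omega) (exp P i) (cLog P (n - i))
termination_by n
decreasing_by have := i.isLt; omega

theorem sum_exp_cLog (n : ℕ) :
    ∑ i : Fin n, (freeQuot P).mul (by have := i.isLt; omega) (exp P i) (cLog P (n - i)) =
      (n : k) • exp P n := by
  cases n with
  | zero => simp
  | succ n =>
    rw [Fin.sum_univ_succ]
    have h1 : cLog P (n + 1) = ((n + 1 : ℕ) : k) • exp P (n + 1) - ∑ i : Fin n,
        (freeQuot P).mul (by have := i.isLt; push_cast; omega) (exp P i.succ) (cLog P (n + 1 - i.succ)) := by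
      rw [cLog, Fin.sum_univ_succ]
      simp
    have h2 : (freeQuot P).mul (by simp) (exp P (0 : Fin (n + 1))) (cLog P (n + 1 - (0 : Fin (n + 1)))) =
        cLog P (n + 1) :=
      (congrArg (fun u : (freeQuot P).obj 1 0 => (freeQuot P).mul (zero_add _) u (cLog P (n + 1)))
        (exp_zero P)).trans
        ((freeQuot P).id_comp 0 Graft.unary _ (fun _ => Subsingleton.elim _ _) _)
    rw [h2, h1, sub_add_cancel]

theorem self_delta : (freeQuot P).self.rcomp 0 Graft.unary (show -1 + -1 = -2 by norm_num) (delta P)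
    (delta P) + (freeQuot P).self.lcomp 0 Graft.unary (by norm_num) (delta P) (delta P) = 0 := by
  have h := delta_mul_self (P := P)
  exact (congrArg₂ (· + ·) h h).trans (add_zero 0)

/-- The Euler derivation, with `Δ ↦ Δ` and `uₙ ↦ n uₙ`. -/
noncomputable def euler (P : DGOperad k) : OperadDerivation (freeQuot P).self :=
  twistDer (freeQuot P).self (cLog P) (delta P) self_delta

theorem euler_of {n : ℕ} {a : ℤ} (q : P.obj n a) : (euler P).map ((of P).map q) = 0 :=
  twistDer_of _ _ _ _ q

theorem euler_delta : (euler P).map (delta P) = delta P := twistDer_delta _ _ _ _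

theorem euler_exp (n : ℕ) : (euler P).map (exp P n) = (n : k) • exp P n :=
  (twistDer_exp _ _ _ _ n).trans (sum_exp_cLog n)

/-- The grading of `freeQuot P` in which `Δ` has weight `1` and `φₙ` has weight `n`. -/
noncomputable def weight (P : DGOperad k) : Weight (freeQuot P) where
  E := (euler P).map
  E_act := (euler P).map_act
  E_comp := (euler P).map_comp
  mem_span x := by
    refine induction (p := fun {n a} x => x ∈ Submodule.span k
      {x : (freeQuot P).obj n a | ∃ w : ℕ, (euler P).map x = (w : k) • x}) ?_ ?_ ?_ ?_ ?_ ?_ ?_ x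
    · exact fun q => Submodule.subset_span ⟨0, by
        rw [euler_of, Nat.cast_zero, zero_smul]
        rfl⟩
    · exact Submodule.subset_span ⟨1, by rw [euler_delta, Nat.cast_one, one_smul]⟩
    · exact fun n => Submodule.subset_span ⟨n, euler_exp n⟩
    · exact fun x y hx hy => add_mem hx hy
    · exact fun s x hx => Submodule.smul_mem _ s hx
    · intro n a σ x hx
      refine (Submodule.span_le (p := (Submodule.span k _).comap ((freeQuot P).act σ))).mpr ?_ hx
      rintro x ⟨w, hw⟩
      exact Submodule.subset_span ⟨w, by
        rw [(euler P).map_act, hw]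
        exact map_smul ((freeQuot P).act σ) _ x⟩
    · intro m n p a b c i e h x y hx hy
      exact span_eigenvectors_comp (T := freeQuot P) (euler P).map (euler P).map_comp i e h hx hy

theorem weight_d {n : ℕ} {a b : ℤ} (h : a + 1 = b) (x : (freeQuot P).obj n a) :
    (weight P).E ((d P).map h x) = (d P).map h ((weight P).E x) := by
  have hd : (d P).IsDer := isDer_phiDFam (freeDelta P)
  refine induction (p := fun {n a} x => ∀ (b : ℤ) (h : a + 1 = b),
    (weight P).E ((d P).map h x) = (d P).map h ((weight P).E x)) ?_ ?_ ?_ ?_ ?_ ?_ ?_ x b h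
  · intro n a q b h
    rw [d_of, show (weight P).E _ = _ from euler_of _, show (weight P).E _ = _ from euler_of _]
    exact (map_zero _).symm
  · intro b h
    rw [d_delta, show (weight P).E (delta P) = _ from euler_delta, d_delta, map_zero]
  · intro n b h
    rw [show (weight P).E (exp P n) = _ from euler_exp n, map_smul]
    cases n with
    | zero => rw [d_exp_zero, map_zero, smul_zero]
    | succ n =>
      rw [d_exp_succ n h (by push_cast at h; omega), (weight P).E_mul,
        show (weight P).E (exp P n) = _ from euler_exp n,
        show (weight P).E (delta P) = _ from euler_delta, GradedOperad.smul_mul]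
      push_cast
      module
  · intro n a x y hx hy b h
    simp only [map_add, hx b h, hy b h]
  · intro n a s x hx b h
    simp only [map_smul, hx b h]
  · intro n a σ x hx b h
    rw [(d P).map_act, (weight P).E_act, hx b h, (weight P).E_act, (d P).map_act]
  · intro m n l a b c i e h x y hx hy c' hc
    rw [hd i e h rfl rfl hc, map_add, map_smul, (weight P).E_comp, (weight P).E_comp,
      (weight P).E_comp, map_add, hd i e h rfl rfl hc, hd i e h rfl rfl hc, hx _ rfl, hy _ rfl]
    module

theorem weight_s {n : ℕ} {a b : ℤ} (h : a + 1 = b) (x : (freeQuot P).obj n a) :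
    (weight P).E ((s P).map h x) + (s P).map h x = (s P).map h ((weight P).E x) := by
  refine induction (p := fun {n a} x => ∀ (b : ℤ) (h : a + 1 = b),
    (weight P).E ((s P).map h x) + (s P).map h x = (s P).map h ((weight P).E x))
    ?_ ?_ ?_ ?_ ?_ ?_ ?_ x b h
  · intro n a q b h
    rw [s_of, show (weight P).E _ = _ from euler_of _, map_zero, zero_add]
    exact (map_zero _).symm
  · intro b h
    obtain rfl : b = 0 := by omega
    rw [s_delta, show (weight P).E (delta P) = _ from euler_delta, s_delta, (weight P).E_id, zero_add]
  · intro n b h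
    rw [show (weight P).E (exp P n) = _ from euler_exp n, map_smul, s_exp, map_zero, smul_zero,
      zero_add]
  · intro n a x y hx hy b h
    simp only [map_add]
    rw [← hx b h, ← hy b h]
    abel
  · intro n a s x hx b h
    simp only [map_smul]
    rw [← hx b h, smul_add]
  · intro n a σ x hx b h
    rw [(s P).map_act, (weight P).E_act, (weight P).E_act, (s P).map_act, ← hx b h, map_add]
  · intro m n l a b c i e h x y hx hy c' hc
    rw [isDer_s P i e h rfl rfl hc, map_add, map_smul, (weight P).E_comp, (weight P).E_comp,
      (weight P).E_comp, map_add, isDer_s P i e h rfl rfl hc, isDer_s P i e h rfl rfl hc,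
      ← hx _ rfl, ← hy _ rfl]
    simp only [map_add, LinearMap.add_apply]
    module

end FreeQuot

end

/-! ### The homotopy quotient of `P ⋆ k[Δ]` is quasi-isomorphic to `P` -/

section

variable {k : Type u} [Field k] [CharZero k] {P : DGOperad k}

/-- A vector with eigenvalue `-1` vanishes. -/
theorem Weight.eq_zero_of_E_eq_neg {T : GradedOperad k} (W : Weight T) {n : ℕ} {a : ℤ}
    {x : T.obj n a} (hx : W.E x = -x) : x = 0 := by
  obtain ⟨w, hw⟩ := W.exists_below x
  rw [← hw, below, LinearMap.sum_apply]
  refine Finset.sum_eq_zero fun v _ => ?_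
  have h1 := W.proj_E v x
  rw [hx, map_neg, neg_eq_iff_add_eq_zero] at h1
  have h2 : ((v + 1 : ℕ) : k) • W.proj v x = 0 := by
    rw [Nat.cast_succ, add_smul, one_smul, add_comm, h1]
  exact (smul_eq_zero.mp h2).resolve_left (Nat.cast_ne_zero.mpr v.succ_ne_zero)

namespace FreeInf

variable {T : GradedOperad k}

/-- If `δ` lowers weights by one, the map `x ∘ᵢ [r] ∘ y ↦ x ∘ᵢ [r + 1] ∘ δ y` is locally
nilpotent. -/
theorem raise₂_nilpotent (W : Weight T) (δ : EquivFam T T 2)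
    (hδ : ∀ {n : ℕ} {a b : ℤ} (h : a + 2 = b) (x : T.obj n a),
      W.E (δ.map h x) + δ.map h x = δ.map h (W.E x)) {n : ℕ} {a : ℤ} (w : FreeInf T n a) :
    ∃ N : ℕ, ((raise₂ δ)^[N]) w = 0 := by
  have hN : ∀ {w : FreeInf T n a} {N M : ℕ} (_ : N ≤ M), ((raise₂ δ)^[N]) w = 0 →
      ((raise₂ δ)^[M]) w = 0 := by
    intro w N M h hw
    obtain ⟨M, rfl⟩ := Nat.exists_eq_add_of_le' h
    rw [Function.iterate_add_apply, hw]
    exact iterate_map_zero (raise₂ δ) M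
  have hadd : ∀ w w' : FreeInf T n a, (∃ N : ℕ, ((raise₂ δ)^[N]) w = 0) →
      (∃ N : ℕ, ((raise₂ δ)^[N]) w' = 0) → ∃ N : ℕ, ((raise₂ δ)^[N]) (w + w') = 0 := by
    rintro w w' ⟨N, h⟩ ⟨N', h'⟩
    refine ⟨max N N', ?_⟩
    rw [iterate_map_add (raise₂ δ), hN (le_max_left _ _) h, hN (le_max_right _ _) h', add_zero]
  induction w using induction with
  | zero => exact ⟨0, rfl⟩
  | add w w' hw hw' => exact hadd _ _ hw hw'
  | @mk m₁ l₁ b₁ c₁ r i e h x y =>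
    induction y using W.induction with
    | zero => exact ⟨0, map_zero _⟩
    | add y y' hy hy' =>
      rw [map_add]
      exact hadd _ _ hy hy'
    | of v y hy =>
      induction v generalizing r c₁ with
      | zero =>
        refine ⟨1, ?_⟩
        have h1 := hδ (show c₁ + 2 = c₁ + 2 from rfl) y
        rw [hy, Nat.cast_zero, zero_smul, map_zero] at h1
        rw [Function.iterate_one, raise₂_mk δ r i e h rfl (by push_cast; omega),
          W.eq_zero_of_E_eq_neg (eq_neg_of_add_eq_zero_left h1), map_zero]
      | succ v ih =>
        have h1 := hδ (show c₁ + 2 = c₁ + 2 from rfl) y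
        rw [hy, map_smul, Nat.cast_succ, add_smul, one_smul] at h1
        obtain ⟨N, hN⟩ := ih (r + 1) (by push_cast; omega) (δ.map rfl y) (add_right_cancel h1)
        exact ⟨N + 1, by
          rw [Function.iterate_succ_apply, raise₂_mk δ r i e h rfl (by push_cast; omega), hN]⟩

end FreeInf

namespace FreeQuot

variable (P) in
/-- The family `d s + s d` of degree `2`. -/
noncomputable def ds : EquivFam (freeQuot P) (freeQuot P) 2 :=
  ((d P).comp (s P) (by norm_num)).add ((s P).comp (d P) (by norm_num))

theorem ds_apply {n : ℕ} {a b c : ℤ} (h : a + 1 = b) (h' : b + 1 = c) (h'' : a + 2 = c)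
    (x : (freeQuot P).obj n a) :
    (ds P).map h'' x = (d P).map h' ((s P).map h x) + (s P).map h' ((d P).map h x) := by
  rw [ds, EquivFam.add_map, EquivFam.comp_map _ _ _ h h', EquivFam.comp_map _ _ _ h h']

theorem weight_ds {n : ℕ} {a b : ℤ} (h : a + 2 = b) (x : (freeQuot P).obj n a) :
    (weight P).E ((ds P).map h x) + (ds P).map h x = (ds P).map h ((weight P).E x) := by
  rw [ds_apply rfl (by omega) h, ds_apply rfl (by omega) h, map_add, weight_d, ← weight_s, map_add,
    ← weight_d, ← weight_d, ← weight_s]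
  abel

variable (P) in
/-- The contraction `[r] ↦ cᵣ`, with `[0] ↦ Δ s`, that takes the universal derivation to the Euler
derivation. -/
noncomputable def ctr {n : ℕ} {a : ℤ} : FreeInf (freeQuot P) n a →ₗ[k] (freeQuot P).obj n a :=
  FreeInf.twist (freeQuot P).self (cLog P) (delta P) (s P)

theorem ctr_D {n : ℕ} {a : ℤ} (x : (freeQuot P).obj n a) : ctr P ((D P).map x) = (weight P).E x := rfl

/-- Elements of the free infinitesimal bimodule on which the contraction commutes with the
differentials. -/
structure Good {n : ℕ} {a : ℤ} (w : FreeInf (freeQuot P) n a) : Prop where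
  adm : FreeInf.Adm (dDelta P) w
  adm_tw {b : ℤ} (h : a + 1 = b) : FreeInf.Adm (dDelta P) (tw h w)
  ctr_tw {b : ℤ} (h : a + 1 = b) : ctr P (tw h w) = (d P).map h (ctr P w)

namespace Good

variable {n : ℕ} {a : ℤ} {w w' : FreeInf (freeQuot P) n a}

theorem zero : Good (0 : FreeInf (freeQuot P) n a) :=
  ⟨.zero, fun h => by rw [map_zero]; exact .zero, fun h => by simp only [map_zero]⟩

theorem add (hw : Good w) (hw' : Good w') : Good (w + w') :=
  ⟨hw.adm.add hw'.adm, fun h => by rw [map_add]; exact (hw.adm_tw h).add (hw'.adm_tw h),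
    fun h => by simp only [map_add, hw.ctr_tw h, hw'.ctr_tw h]⟩

theorem smul (c : k) (hw : Good w) : Good (c • w) :=
  ⟨hw.adm.smul c, fun h => by rw [map_smul]; exact (hw.adm_tw h).smul c,
    fun h => by simp only [map_smul, hw.ctr_tw h]⟩

theorem sub (hw : Good w) (hw' : Good w') : Good (w - w') := by
  rw [sub_eq_add_neg, ← neg_one_smul k w']
  exact hw.add (hw'.smul _)

theorem ctr_lcomp {m l : ℕ} {b c : ℤ} (i : Fin m) (e : Graft m n l i) (h : b + a = c)
    (x : (freeQuot P).obj m b) (w : FreeInf (freeQuot P) n a) :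
    ctr P (FreeInf.lcomp i e h x w) = (freeQuot P).comp i e h x (ctr P w) :=
  FreeInf.twist_lcomp (freeQuot P).self _ _ _ e h x w

theorem ctr_rcomp (hw : FreeInf.Adm (dDelta P) w) {m l : ℕ} {b c : ℤ} (i : Fin n)
    (e : Graft n m l i) (h : a + b = c) (y : (freeQuot P).obj m b) :
    ctr P (FreeInf.rcomp i e h w y) = (freeQuot P).comp i e h (ctr P w) y :=
  twist_rcomp (freeQuot P).self _ _ self_delta hw i e h y

theorem lcomp (hw : Good w) {m l : ℕ} {b c : ℤ} (i : Fin m) (e : Graft m n l i) (h : b + a = c)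
    (x : (freeQuot P).obj m b) : Good (FreeInf.lcomp i e h x w) := by
  have hd : (d P).IsDer := isDer_phiDFam (freeDelta P)
  refine ⟨hw.adm.lcomp e h x, fun {c'} hc => ?_, fun {c'} hc => ?_⟩
  · rw [FreeInf.twDer_lcomp hd e h rfl rfl hc (by omega) (by omega)]
    exact (hw.adm.lcomp _ _ _).add (.smul _ ((hw.adm_tw rfl).lcomp _ _ _))
  · rw [FreeInf.twDer_lcomp hd e h rfl rfl hc (by omega) (by omega), map_add, map_smul, ctr_lcomp,
      ctr_lcomp, ctr_lcomp, hd i e h rfl rfl hc, hw.ctr_tw, one_mul]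

theorem rcomp (hw : Good w) {m l : ℕ} {b c : ℤ} (i : Fin n) (e : Graft n m l i) (h : a + b = c)
    (y : (freeQuot P).obj m b) : Good (FreeInf.rcomp i e h w y) := by
  have hd : (d P).IsDer := isDer_phiDFam (freeDelta P)
  refine ⟨hw.adm.rcomp e h y, fun {c'} hc => ?_, fun {c'} hc => ?_⟩
  · rw [FreeInf.twDer_rcomp hd e h rfl rfl hc (by omega) (by omega)]
    exact ((hw.adm_tw rfl).rcomp _ _ _).add (.smul _ (hw.adm.rcomp _ _ _))
  · rw [FreeInf.twDer_rcomp hd e h rfl rfl hc (by omega) (by omega), map_add, map_smul,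
      ctr_rcomp (hw.adm_tw rfl), ctr_rcomp hw.adm, ctr_rcomp hw.adm, hd i e h rfl rfl hc, hw.ctr_tw,
      one_mul]

theorem of_D (x : (freeQuot P).obj n a) : Good ((D P).map x) :=
  ⟨adm_D x, fun h => by rw [← D_d]; exact adm_D _,
    fun h => by rw [← D_d, ctr_D, ctr_D, weight_d]⟩

theorem gen {r : ℕ} (hr : 0 < r) : Good (FreeInf.gen (freeQuot P) r) := by
  induction r using Nat.strong_induction_on with
  | _ r ih =>
    obtain ⟨r, rfl⟩ := Nat.exists_eq_add_of_lt hr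
    rw [zero_add] at ih ⊢
    have h1 := D_exp (P := P) (r + 1)
    rw [Fin.sum_univ_succ] at h1
    have h2 : FreeInf.lcomp 0 Graft.unary (by simp) (exp P (0 : Fin (r + 1)))
        (FreeInf.gen (freeQuot P) (r + 1 - (0 : Fin (r + 1)))) = FreeInf.gen (freeQuot P) (r + 1) :=
      (congrArg (fun u : (freeQuot P).obj 1 0 => FreeInf.lcomp 0 Graft.unary (zero_add _) u
        (FreeInf.gen (freeQuot P) (r + 1))) (exp_zero P)).trans
        ((freeInf (freeQuot P)).unary_lcomp_id (zero_add _) _)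
    rw [h2, ← sub_eq_iff_eq_add] at h1
    rw [← h1]
    refine (of_D _).sub ?_
    refine Finset.sum_induction _ Good (fun _ _ => .add) .zero fun i _ => ?_
    exact (ih _ (by simp) (by have := i.isLt; simp)).lcomp _ _ _ _

theorem of_mk {m l : ℕ} {b c : ℤ} {r : ℕ} (hr : 0 < r) (i : Fin m) (e : Graft m l n i)
    (h : b + c = a + 2 * (r : ℤ)) (x : (freeQuot P).obj m b) (y : (freeQuot P).obj l c) :
    Good (FreeInf.mk r i e h x y) := by
  rw [FreeInf.mk_eq_ins r i e h (by omega), InfBimodule.ins_apply _ _ _ _ (by omega) rfl (by omega)]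
  exact ((gen hr).rcomp 0 (Graft.unit' l) rfl y).lcomp i e (by omega) x

theorem raise {b : ℤ} (h : a + -1 = b) (w : FreeInf (freeQuot P) n a) :
    Good (FreeInf.raise (s P) h w) := by
  induction w using FreeInf.induction with
  | zero => rw [map_zero]; exact .zero
  | add w w' hw hw' => rw [map_add]; exact hw.add hw'
  | mk r i e h' x y =>
    rw [FreeInf.raise_mk (s P) h r i e h' rfl (by push_cast; omega)]
    exact .smul _ (.of_mk r.succ_pos i e _ _ _)

end Good

theorem twist_raise₂ {n : ℕ} {a : ℤ} (w : FreeInf (freeQuot P) n a) :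
    FreeInf.twist (freeInf (freeQuot P)) (FreeInf.gen (freeQuot P)) (dDelta P) (s P)
      (FreeInf.raise₂ (ds P) w) = FreeInf.raise₂ (ds P) w := by
  induction w using FreeInf.induction with
  | zero => simp only [map_zero]
  | add w w' hw hw' => rw [map_add, map_add, hw, hw']
  | mk r i e h' x y =>
    rw [FreeInf.raise₂_mk _ r i e h' rfl (by push_cast; omega),
      FreeInf.twist_mk _ _ _ _ r.succ_pos _ _ _ (by push_cast; omega),
      FreeInf.mk_eq_ins (r + 1) i e _ (by push_cast; omega)]

/-- A cycle of the free infinitesimal bimodule that is fixed by `twist` is the boundary of a good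
element. -/
theorem exists_good {n : ℕ} {a b c : ℤ} (h : a + 1 = b) (h' : c + 1 = a) (N : ℕ)
    (w : FreeInf (freeQuot P) n a) (hw : tw h w = 0)
    (he : FreeInf.twist (freeInf (freeQuot P)) (FreeInf.gen (freeQuot P)) (dDelta P) (s P) w = w)
    (hN : ((FreeInf.raise₂ (ds P))^[N]) w = 0) :
    ∃ η : FreeInf (freeQuot P) n c, Good η ∧ tw h' η = w := by
  have hd : (d P).IsDer := isDer_phiDFam (freeDelta P)
  induction N generalizing w with
  | zero => exact ⟨0, .zero, by rw [map_zero]; exact hN.symm⟩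
  | succ N ih =>
    have h1 := FreeInf.twDer_raise (s := s P) (d := d P) (Δ := delta P) (δ := ds P)
      (fun h h' h'' h₃ y => s_lmul h h' h'' h₃ y) (fun h h' h'' y => ds_apply h h' h'' y)
      (show a + -1 = c by omega) h w
    rw [hw, map_zero, add_zero, he] at h1
    obtain ⟨η, hη, hη'⟩ := ih (-FreeInf.raise₂ (ds P) w) (by
        have h2 := congrArg (tw h) h1
        rw [map_add, hw, zero_add, FreeInf.twDer_twDer hd (fun h h' x => d_d h h' x)
          (fun h => d_delta h) delta_mul_self] at h2
        rw [map_neg, ← h2, neg_zero])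
      (by rw [map_neg, twist_raise₂]) (by
        rw [iterate_map_neg (FreeInf.raise₂ (ds P)), ← Function.iterate_succ_apply, hN, neg_zero])
    exact ⟨FreeInf.raise (s P) (by omega) w + η, (Good.raise _ w).add hη, by
      rw [map_add, hη', h1, add_neg_cancel_right]⟩

/-- The cycles of positive weight are boundaries. -/
theorem exists_of_weight_pos {n : ℕ} {a b c : ℤ} (h : a + 1 = b) (h' : c + 1 = a) {v : ℕ} (hv : 0 < v)
    {x : (freeQuot P).obj n a} (hx : (d P).map h x = 0) (hE : (weight P).E x = (v : k) • x) :
    ∃ y : (freeQuot P).obj n c, (d P).map h' y = x := by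
  -- If `D x` is the boundary of `η`, then `v x`, the contraction of `D x`, is the boundary of `ctr η`.
  obtain ⟨N, hN⟩ := FreeInf.raise₂_nilpotent (weight P) (ds P) weight_ds ((D P).map x)
  obtain ⟨η, hη, hη'⟩ := exists_good h h' N ((D P).map x) (by rw [← D_d, hx, map_zero]) (twist_D x) hN
  refine ⟨(v : k)⁻¹ • ctr P η, ?_⟩
  rw [map_smul, ← hη.ctr_tw, hη', ctr_D, hE, smul_smul, inv_mul_cancel₀ (Nat.cast_ne_zero.mpr hv.ne'),
    one_smul]

variable (P) in
/-- The projection `freeQuot P → P` with `Δ ↦ 0` and `φₙ ↦ 0`. -/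
def proj : GradedOperad.Hom (freeQuot P) P.toGradedOperad :=
  phiLift (deltaLift (.id P.toGradedOperad) 0 (by simp [GradedOperad.mul])) fun _ => 0

theorem proj_of {n : ℕ} {a : ℤ} (q : P.obj n a) : (proj P).map ((of P).map q) = q := rfl

theorem proj_delta : (proj P).map (delta P) = 0 := rfl

theorem _root_.phiExp_zero_fun {T : GradedOperad k} {n : ℕ} (hn : 0 < n) :
    phiExp T (fun _ => 0) n = 0 := by
  rw [phiExp_eq hn, zero_add]
  refine Finset.sum_eq_zero fun j hj => ?_
  obtain ⟨j, rfl⟩ := Nat.exists_eq_add_of_le' (Finset.mem_Icc.mp hj).1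
  rw [phiPow]
  simp only [T.zero_mul, Finset.sum_const_zero, smul_zero]

theorem proj_exp {n : ℕ} (hn : 0 < n) : (proj P).map (exp P n) = 0 := by
  rw [exp, GradedOperad.Hom.map_phiExp]
  refine Eq.trans ?_ (phiExp_zero_fun (T := P.toGradedOperad) hn)
  congr 1
  funext i
  exact phiLift_gen' _ _ rfl i

theorem weight_proj_zero {n : ℕ} {a : ℤ} (x : (freeQuot P).obj n a) :
    (weight P).proj 0 x = (of P).map ((proj P).map x) := by
  refine induction (p := fun x => (weight P).proj 0 x = (of P).map ((proj P).map x))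
    ?_ ?_ ?_ ?_ ?_ ?_ ?_ x
  · intro n a q
    rw [proj_of, Weight.proj_of_self]
    rw [show (weight P).E _ = _ from euler_of _, Nat.cast_zero, zero_smul]
    rfl
  · rw [proj_delta, map_zero]
    refine (weight P).proj_of_ne (v := 1) ?_ one_ne_zero
    rw [show (weight P).E (delta P) = _ from euler_delta, Nat.cast_one, one_smul]
  · intro n
    have h1 : (weight P).E (exp P n) = (n : k) • exp P n := euler_exp n
    rcases Nat.eq_zero_or_pos n with rfl | hn
    · rw [(weight P).proj_of_self h1]
      refine (exp_zero P).trans ?_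
      refine ((of P).map_id.symm.trans (congrArg _ (proj P).map_id.symm)).trans ?_
      exact congrArg (fun z : (freeQuot P).obj 1 0 => (of P).map ((proj P).map z)) (exp_zero P).symm
    · rw [(weight P).proj_of_ne h1 hn.ne', proj_exp hn, map_zero]
  · intro n a x y hx hy
    simp only [map_add, hx, hy]
  · intro n a s x hx
    simp only [map_smul, hx]
  · intro n a σ x hx
    rw [(weight P).proj_act, hx, (proj P).map_act, (of P).map_act]
  · intro m n l a b c i e h x y hx hy
    rw [Weight.proj_zero_comp, hx, hy, (proj P).map_comp, (of P).map_comp]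

/-- Every cycle is homologous to its image under the projection to `P`. -/
theorem exists_sub_proj {n : ℕ} {a b c : ℤ} (h : a + 1 = b) (h' : c + 1 = a)
    {x : (freeQuot P).obj n a} (hx : (d P).map h x = 0) :
    ∃ y : (freeQuot P).obj n c, (d P).map h' y = x - (of P).map ((proj P).map x) := by
  have h1 : ∀ v, (d P).map h ((weight P).proj v x) = 0 := fun v => by
    rw [← Weight.map_proj (W := weight P) (W' := weight P) (fun x => weight_d h x), hx, map_zero]
  have h2 : ∀ w, ∃ y : (freeQuot P).obj n c,
      (d P).map h' y = (weight P).below (w + 1) x - (weight P).proj 0 x := by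
    intro w
    induction w with
    | zero => exact ⟨0, by rw [Weight.below_one, sub_self, map_zero]⟩
    | succ w ih =>
      obtain ⟨y, hy⟩ := ih
      obtain ⟨y', hy'⟩ := exists_of_weight_pos h h' w.succ_pos (h1 (w + 1)) ((weight P).E_proj _ x)
      exact ⟨y + y', by rw [map_add, hy, hy', (weight P).below_succ (w + 1), sub_add_eq_add_sub]⟩
  obtain ⟨w, hw⟩ := (weight P).exists_below x
  obtain ⟨y, hy⟩ := h2 w
  exact ⟨y, by rw [hy, (weight P).below_of_le w.le_succ hw, weight_proj_zero]⟩

end FreeQuot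

end

/-! ### Adjunctions between localizations from natural roofs -/

section

variable {C D C' D' : Type*} [Category C] [Category D] [Category C'] [Category D']

/-- A natural transformation `z : L₂ X ⟶ L₂ T F X` and a counit `T ⋙ F ⟶ 𝟭` that satisfy the triangle
identities in the localizations define an adjunction between the localized functors. -/
theorem Localization.nonempty_adjunction {F : C ⥤ D} {T : D ⥤ C} {L₁ : D ⥤ D'} {L₂ : C ⥤ C'}
    (W₁ : MorphismProperty D) (W₂ : MorphismProperty C) [L₁.IsLocalization W₁]
    [L₂.IsLocalization W₂] {F' : C' ⥤ D'} {T' : D' ⥤ C'} (a : L₂ ⋙ F' ≅ F ⋙ L₁)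
    (b : L₁ ⋙ T' ≅ T ⋙ L₂) (z : L₂ ⟶ F ⋙ T ⋙ L₂) (ε : T ⋙ F ⟶ 𝟭 D)
    (hl : ∀ X, F'.map (z.app X) ≫ a.hom.app (T.obj (F.obj X)) ≫ L₁.map (ε.app (F.obj X)) =
      a.hom.app X)
    (hr : ∀ Y, z.app (T.obj Y) ≫ L₂.map (T.map (ε.app Y)) = 𝟙 _) : Nonempty (F' ⊣ T') := by
  let : Localization.Lifting L₂ W₂ (L₂ ⋙ F' ⋙ T') (F' ⋙ T') := ⟨Iso.refl _⟩
  let : Localization.Lifting L₁ W₁ (L₁ ⋙ T' ⋙ F') (T' ⋙ F') := ⟨Iso.refl _⟩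
  let : Localization.Lifting L₂ W₂ L₂ (𝟭 C') := ⟨Functor.rightUnitor _⟩
  let : Localization.Lifting L₁ W₁ L₁ (𝟭 D') := ⟨Functor.rightUnitor _⟩
  let u' : L₂ ⟶ L₂ ⋙ F' ⋙ T' := z ≫ Functor.whiskerLeft F b.inv ≫ Functor.whiskerRight a.inv T'
  let c' : L₁ ⋙ T' ⋙ F' ⟶ L₁ :=
    Functor.whiskerRight b.hom F' ≫ Functor.whiskerLeft T a.hom ≫ Functor.whiskerRight ε L₁
  let u : 𝟭 C' ⟶ F' ⋙ T' := Localization.liftNatTrans L₂ W₂ L₂ (L₂ ⋙ F' ⋙ T') _ _ u'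
  let c : T' ⋙ F' ⟶ 𝟭 D' := Localization.liftNatTrans L₁ W₁ (L₁ ⋙ T' ⋙ F') L₁ _ _ c'
  have hu : ∀ X, u.app (L₂.obj X) =
      z.app X ≫ b.inv.app (F.obj X) ≫ T'.map (a.inv.app X) := fun X => by
    refine (Localization.liftNatTrans_app L₂ W₂ L₂ _ _ _ u' X).trans ?_
    exact (Category.id_comp _).trans (Category.comp_id _)
  have hc : ∀ Y, c.app (L₁.obj Y) =
      F'.map (b.hom.app Y) ≫ a.hom.app (T.obj Y) ≫ L₁.map (ε.app Y) := fun Y => by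
    refine (Localization.liftNatTrans_app L₁ W₁ _ L₁ _ _ c' Y).trans ?_
    exact (Category.id_comp _).trans (Category.comp_id _)
  have key : ∀ {X Y : D'} (f : X ⟶ Y), F'.map (T'.map f) ≫ c.app Y = c.app X ≫ f :=
    fun f => c.naturality f
  have key' : ∀ {X Y : C'} (f : X ⟶ Y), f ≫ u.app Y = u.app X ≫ T'.map (F'.map f) :=
    fun f => u.naturality f
  have h₁ : Functor.whiskerRight u F' ≫ (Functor.associator _ _ _).hom ≫
      Functor.whiskerLeft F' c = NatTrans.id (𝟭 C' ⋙ F') := by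
    refine Localization.natTrans_ext L₂ W₂ fun X => ?_
    change F'.map (u.app (L₂.obj X)) ≫ 𝟙 _ ≫ c.app (F'.obj (L₂.obj X)) = 𝟙 _
    have h3 : F'.map (T'.map (a.inv.app X)) ≫ c.app (F'.obj (L₂.obj X)) =
      c.app (L₁.obj (F.obj X)) ≫ a.inv.app X := key _
    have h4 : F'.map (b.inv.app (F.obj X)) ≫ F'.map (b.hom.app (F.obj X)) = 𝟙 _ := by
      rw [← F'.map_comp, b.inv_hom_id_app, F'.map_id]
    rw [hu, Category.id_comp, F'.map_comp, F'.map_comp, Category.assoc, Category.assoc, h3, hc]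
    simp only [Category.assoc]
    rw [reassoc_of% h4, reassoc_of% hl X]
    exact a.hom_inv_id_app X
  have h₂ : Functor.whiskerLeft T' u ≫ (Functor.associator _ _ _).inv ≫
      Functor.whiskerRight c T' = NatTrans.id (T' ⋙ 𝟭 C') := by
    refine Localization.natTrans_ext L₁ W₁ fun Y => ?_
    change u.app (T'.obj (L₁.obj Y)) ≫ 𝟙 _ ≫ T'.map (c.app (L₁.obj Y)) = 𝟙 _
    rw [Category.id_comp, hc, T'.map_comp, T'.map_comp, ← Category.assoc]
    have h3 : u.app (T'.obj (L₁.obj Y)) ≫ T'.map (F'.map (b.hom.app Y)) =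
      b.hom.app Y ≫ u.app (L₂.obj (T.obj Y)) := (key' _).symm
    have h4 : b.inv.app (F.obj (T.obj Y)) ≫ T'.map (L₁.map (ε.app Y)) =
      L₂.map (T.map (ε.app Y)) ≫ b.inv.app Y := (b.inv.naturality (ε.app Y)).symm
    have h5 : T'.map (a.inv.app (T.obj Y)) ≫ T'.map (a.hom.app (T.obj Y)) = 𝟙 _ := by
      rw [← T'.map_comp, a.inv_hom_id_app, T'.map_id]
    rw [h3, hu]
    simp only [Category.assoc]
    rw [reassoc_of% h5, h4, reassoc_of% hr Y]
    exact b.hom_inv_id_app Y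
  exact ⟨Adjunction.mkOfUnitCounit { unit := u, counit := c, left_triangle := h₁, right_triangle := h₂ }⟩

/-- An adjunction between localizations whose unit is the natural roof `X → G X ← H F X → T F X`. -/
theorem Localization.nonempty_adjunction_of_roof {F : C ⥤ D} {T : D ⥤ C} (L₁ : D ⥤ D')
    (L₂ : C ⥤ C') (W₁ : MorphismProperty D) (W₂ : MorphismProperty C) [L₁.IsLocalization W₁]
    [L₂.IsLocalization W₂] (hF : W₂.IsInvertedBy (F ⋙ L₁)) (hT : W₁.IsInvertedBy (T ⋙ L₂))
    {H : D ⥤ C} {G : C ⥤ C} (i : 𝟭 C ⟶ G) (q : F ⋙ H ⟶ G) (p : H ⟶ T) (ε : T ⋙ F ⟶ 𝟭 D)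
    (hq : ∀ X, W₂ (q.app X))
    (hl : ∀ (X) (_ : IsIso (L₁.map (F.map (q.app X)))), L₁.map (F.map (i.app X)) ≫
      inv (L₁.map (F.map (q.app X))) ≫ L₁.map (F.map (p.app (F.obj X))) ≫
        L₁.map (ε.app (F.obj X)) = 𝟙 _)
    (hr : ∀ (Y) (_ : IsIso (L₂.map (q.app (T.obj Y)))), L₂.map (i.app (T.obj Y)) ≫
      inv (L₂.map (q.app (T.obj Y))) ≫ L₂.map (p.app (F.obj (T.obj Y))) ≫ L₂.map (T.map (ε.app Y)) =
        𝟙 _) :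
    Nonempty (Localization.lift (F ⋙ L₁) hF L₂ ⊣ Localization.lift (T ⋙ L₂) hT L₁) := by
  have h₁ : ∀ X, IsIso (L₂.map (q.app X)) := fun X => Localization.inverts L₂ W₂ _ (hq X)
  have h₂ : ∀ X, IsIso (L₁.map (F.map (q.app X))) := fun X => hF _ (hq X)
  have : ∀ X, IsIso ((Functor.whiskerRight q L₂).app X) := h₁
  have : IsIso (Functor.whiskerRight q L₂) := NatIso.isIso_of_isIso_app _
  let a := Localization.fac (F ⋙ L₁) hF L₂
  let z : L₂ ⟶ F ⋙ T ⋙ L₂ := (Functor.whiskerRight i L₂ : L₂ ⟶ G ⋙ L₂) ≫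
    inv (Functor.whiskerRight q L₂) ≫ Functor.whiskerLeft F (Functor.whiskerRight p L₂)
  have hz : ∀ X, z.app X =
      L₂.map (i.app X) ≫ inv (L₂.map (q.app X)) ≫ L₂.map (p.app (F.obj X)) := fun X => by
    change L₂.map (i.app X) ≫ (inv (Functor.whiskerRight q L₂)).app X ≫ _ = _
    rw [NatIso.isIso_inv_app]
    rfl
  refine Localization.nonempty_adjunction W₁ W₂ a (Localization.fac (T ⋙ L₂) hT L₁) z ε
    (fun X => ?_) fun Y => ?_
  · let F' := Localization.lift (F ⋙ L₁) hF L₂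
    have ha : ∀ {X Y : C} (f : X ⟶ Y), F'.map (L₂.map f) ≫ a.hom.app Y =
      a.hom.app X ≫ L₁.map (F.map f) := fun f => a.hom.naturality f
    have ha' : F'.map (inv (L₂.map (q.app X))) ≫ a.hom.app (H.obj (F.obj X)) =
        a.hom.app (G.obj X) ≫ inv (L₁.map (F.map (q.app X))) := by
      have h3 : F'.map (L₂.map (q.app X)) ≫ a.hom.app (G.obj X) =
        a.hom.app (H.obj (F.obj X)) ≫ L₁.map (F.map (q.app X)) := ha _
      rw [Functor.map_inv, IsIso.inv_comp_eq, ← Category.assoc, h3, Category.assoc,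
        IsIso.hom_inv_id, Category.comp_id]
    change F'.map (z.app X) ≫ _ = _
    rw [hz, F'.map_comp, F'.map_comp, Category.assoc, Category.assoc]
    rw [reassoc_of% ha (p.app (F.obj X)), reassoc_of% ha', reassoc_of% ha (i.app X), hl X (h₂ X)]
    exact Category.comp_id _
  · rw [hz, Category.assoc, Category.assoc]
    exact hr Y (h₁ _)

end

/-! ### Morphisms of dg-operads out of `Q/Δ` and `P ⋆ k[Δ]` -/

section

variable {k : Type u} [Field k]

theorem DGOperad.comp_map_eq {P Q R : DGOperad k} {f : P ⟶ Q} {g : Q ⟶ R} {n : ℕ} {a : ℤ}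
    {x : P.obj n a} {y : Q.obj n a} {z : R.obj n a} (hf : DGOperad.Hom.map f x = y)
    (hg : DGOperad.Hom.map g y = z) : DGOperad.Hom.map (f ≫ g) x = z :=
  (congrArg (DGOperad.Hom.map g) hf).trans hg

theorem DGOperad.hom_ext {P Q : DGOperad k} {f g : P ⟶ Q}
    (h : ∀ {n : ℕ} {a : ℤ} (x : P.obj n a), DGOperad.Hom.map f x = DGOperad.Hom.map g x) : f = g :=
  DGOperad.Hom.ext (by funext n a; exact LinearMap.ext h)

/-- The morphism `P ⋆ k[Δ] → S` that extends a morphism from `P` to the dg-operad underlying `S`. -/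
def freeDeltaLift {P : DGOperad k} {S : DeltaDGOperad k} (f : P ⟶ S.toDGOperad) :
    freeDelta P ⟶ S where
  hom :=
    let g := deltaLift (DGOperad.Hom.toGraded f) S.Δ S.Δ_Δ
    { map := g.map
      map_id := g.map_id
      map_act := g.map_act
      map_comp := g.map_comp
      map_d := fun x => by
        refine delta_induction (P := fun x => g.map (deltaD P x) = S.d (g.map x))
          ?_ ?_ ?_ ?_ ?_ ?_ x
        · exact fun q => DGOperad.Hom.map_d f q
        · exact (map_zero g.map).trans S.d_Δ.symm
        · intro _ _ x y hx hy
          simp only [map_add, hx, hy]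
        · intro _ _ s x hx
          simp only [map_smul, hx]
        · intro _ _ σ x hx
          rw [deltaD_act, g.map_act, g.map_act, hx, S.d_act]
        · intro m n p a b c i e h x y hx hy
          rw [deltaD_comp P i e h (by omega) (by omega), map_add, map_smul, g.map_comp, g.map_comp,
            g.map_comp, hx, hy, S.d_comp i e h (by omega) (by omega)] }
  map_Δ := rfl

theorem freeDelta_hom_ext {P : DGOperad k} {S : DeltaDGOperad k} {f g : freeDelta P ⟶ S}
    (h : ∀ {n : ℕ} {a : ℤ} (q : P.obj n a),
      DGOperad.Hom.map (DeltaDGOperad.Hom.hom f) ((deltaOf P.toGradedOperad).map q) =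
        DGOperad.Hom.map (DeltaDGOperad.Hom.hom g) ((deltaOf P.toGradedOperad).map q)) : f = g :=
  DeltaDGOperad.Hom.ext (DGOperad.hom_ext (deltaHom_ext
    (f := DGOperad.Hom.toGraded (DeltaDGOperad.Hom.hom f))
    (g := DGOperad.Hom.toGraded (DeltaDGOperad.Hom.hom g)) h
    ((DeltaDGOperad.Hom.map_Δ f).trans (DeltaDGOperad.Hom.map_Δ g).symm)))

variable (k) in
/-- The functor `P ↦ (P ⋆ k[Δ], Δ)`. -/
def freeDeltaFunctor : DGOperad k ⥤ DeltaDGOperad k where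
  obj P := freeDelta P
  map {P P'} f := freeDeltaLift (f ≫ ⟨(deltaOf _).map, (deltaOf _).map_id, (deltaOf _).map_act,
    (deltaOf _).map_comp, fun _ => rfl⟩ : P ⟶ (freeDelta P').toDGOperad)
  map_id P := freeDelta_hom_ext fun _ => rfl
  map_comp f g := freeDelta_hom_ext fun _ => rfl

variable [CharZero k]

/-- The morphism `Q/Δ → P` given by a morphism `f : Q → P` and a solution `φ` in `P` of the equation
`[d, exp(φ(z))] = exp(φ(z)) z f(Δ)`. -/
def homotopyQuotientLift {Q : DeltaDGOperad k} {P : DGOperad k} (f : Q.toDGOperad ⟶ P)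
    (φ : ∀ n : ℕ, P.obj 1 (-2 * (n : ℤ))) (hφ : φ 0 = 0)
    (h : ∀ n, P.d (phiExp P.toGradedOperad φ n) =
      phiExpDelta P.toGradedOperad φ (DGOperad.Hom.map f Q.Δ) n) :
    (homotopyQuotient k).obj Q ⟶ P :=
  let g := phiLift (DGOperad.Hom.toGraded f) φ
  { map := g.map
    map_id := g.map_id
    map_act := g.map_act
    map_comp := g.map_comp
    map_d := fun x => by
      have hexp : ∀ n, g.map (phiExp _ (phiGen Q.toGradedOperad) n) =
          phiExp P.toGradedOperad φ n := fun n => by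
        rw [g.map_phiExp]
        congr 1
        funext n
        exact phiLift_gen' _ _ hφ n
      refine phiExp_induction (P := fun x => g.map (phiD Q x) = P.d (g.map x)) ?_ ?_ ?_ ?_ ?_ ?_ x
      · intro n a q
        rw [phiD_of]
        exact DGOperad.Hom.map_d f q
      · intro n
        rw [hexp, h, phiD_exp]
        cases n with
        | zero => exact map_zero _
        | succ n =>
          rw [phiExpDelta, phiExpDelta, g.map_mul, hexp]
          rfl
      · intro _ _ x y hx hy
        simp only [map_add, hx, hy]
      · intro _ _ s x hx
        simp only [map_smul, hx]
      · intro _ _ σ x hx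
        rw [phiD_act, g.map_act, g.map_act, hx, P.d_act]
      · intro m n p a b c i e h x y hx hy
        rw [phiD_comp Q i e h (by omega) (by omega), map_add, map_smul, g.map_comp, g.map_comp,
          g.map_comp, hx, hy, P.d_comp i e h (by omega) (by omega)] }

theorem phiExpDelta_zero_fun {T : GradedOperad k} (φ : ∀ n : ℕ, T.obj 1 (-2 * (n : ℤ))) (n : ℕ) :
    phiExpDelta T φ 0 n = 0 := by
  cases n with
  | zero => rfl
  | succ n => exact T.mul_zero _ _

theorem DGOperad.d_phiExp_zero_fun (P : DGOperad k) (n : ℕ) :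
    P.d (phiExp P.toGradedOperad (fun _ => 0) n) =
      phiExpDelta P.toGradedOperad (fun _ => 0) 0 n := by
  rw [phiExpDelta_zero_fun]
  rcases Nat.eq_zero_or_pos n with rfl | hn
  · exact (congrArg (fun u : P.obj 1 0 => P.d u) (phiExp_zero _)).trans P.d_id
  · rw [phiExp_zero_fun hn, map_zero]

theorem homotopyQuotient_hom_ext {Q : DeltaDGOperad k} {P : DGOperad k}
    {f g : (homotopyQuotient k).obj Q ⟶ P}
    (h : ∀ {n : ℕ} {a : ℤ} (q : Q.obj n a),
      DGOperad.Hom.map f (phiOf _ q) = DGOperad.Hom.map g (phiOf _ q))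
    (h' : ∀ n, 0 < n → DGOperad.Hom.map f (phiGen _ n) = DGOperad.Hom.map g (phiGen _ n)) : f = g :=
  DGOperad.hom_ext (phiHom_ext (f := DGOperad.Hom.toGraded f) (g := DGOperad.Hom.toGraded g) h h')

theorem freeQuot_hom_ext {P S : DGOperad k} {f g : (homotopyQuotient k).obj (freeDelta P) ⟶ S}
    (h : ∀ {n : ℕ} {a : ℤ} (q : P.obj n a), DGOperad.Hom.map f ((FreeQuot.of P).map q) =
      DGOperad.Hom.map g ((FreeQuot.of P).map q))
    (h' : DGOperad.Hom.map f (FreeQuot.delta P) = DGOperad.Hom.map g (FreeQuot.delta P))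
    (h'' : ∀ n, 0 < n → DGOperad.Hom.map f (phiGen _ n) = DGOperad.Hom.map g (phiGen _ n)) : f = g :=
  homotopyQuotient_hom_ext (deltaHom_ext
    (f := (DGOperad.Hom.toGraded f).comp (phiOfHom _)) (g := (DGOperad.Hom.toGraded g).comp (phiOfHom _))
    h h') h''

theorem homotopyQuotient_map_gen {Q R : DeltaDGOperad k} (f : Q ⟶ R) (n : ℕ) :
    DGOperad.Hom.map ((homotopyQuotient k).map f) (phiGen _ n) = phiGen _ n := phiMap_gen _ n

variable (k) in
/-- The functor `(Q, Δ) ↦ (Q/Δ, Δ)`. -/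
noncomputable def quotientDelta : DeltaDGOperad k ⥤ DeltaDGOperad k where
  obj Q :=
    { (homotopyQuotient k).obj Q with
      Δ := phiOf _ Q.Δ
      Δ_Δ := ((phiOfHom Q.toGradedOperad).map_mul _ _ _).symm.trans
        ((congrArg _ Q.Δ_Δ).trans (map_zero _))
      d_Δ := (phiD_of _ _).trans ((congrArg _ Q.d_Δ).trans (map_zero (phiOfHom _).map)) }
  map f := ⟨(homotopyQuotient k).map f, congrArg (phiOf _) (DeltaDGOperad.Hom.map_Δ f)⟩
  map_id Q := DeltaDGOperad.Hom.ext ((homotopyQuotient k).map_id Q)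
  map_comp f g := DeltaDGOperad.Hom.ext ((homotopyQuotient k).map_comp f g)

variable (k) in
/-- The natural morphism `Q → Q/Δ`. -/
noncomputable def toQuotient : 𝟭 (DeltaDGOperad k) ⟶ quotientDelta k where
  app Q := 
    ⟨⟨(phiOfHom _).map, (phiOfHom _).map_id, (phiOfHom _).map_act, (phiOfHom _).map_comp,
      fun _ => rfl⟩, rfl⟩

/-- The morphism `(Q/Δ)/Δ → Q/Δ` that identifies the two families `φₙ`. -/
noncomputable def quotientMul (Q : DeltaDGOperad k) :
    (homotopyQuotient k).obj ((quotientDelta k).obj Q) ⟶ (homotopyQuotient k).obj Q :=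
  homotopyQuotientLift (Q := (quotientDelta k).obj Q) (𝟙 ((homotopyQuotient k).obj Q))
    (phiGen _) (phiGen_zero _) (phiD_exp Q)

theorem quotientMul_gen {Q : DeltaDGOperad k} {n : ℕ} (hn : 0 < n) :
    DGOperad.Hom.map (quotientMul Q) (phiGen _ n) = phiGen _ n := phiLift_gen _ _ hn

variable (k) in
/-- The natural morphism `P/0 → P` with `φₙ ↦ 0`. -/
noncomputable def trivQuotient : trivDelta k ⋙ homotopyQuotient k ⟶ 𝟭 (DGOperad k) where
  app P := homotopyQuotientLift (Q := (trivDelta k).obj P) (𝟙 P) (fun _ => 0) rfl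
    P.d_phiExp_zero_fun
  naturality P P' f := homotopyQuotient_hom_ext (Q := (trivDelta k).obj P) (P := P')
    (fun _ => rfl) fun n hn =>
      (DGOperad.comp_map_eq (homotopyQuotient_map_gen ((trivDelta k).map f) n)
        (phiLift_gen _ _ hn)).trans
      (DGOperad.comp_map_eq (g := f) (phiLift_gen _ _ hn) (map_zero _)).symm

theorem trivQuotient_gen {P : DGOperad k} {n : ℕ} (hn : 0 < n) :
    DGOperad.Hom.map ((trivQuotient k).app P) (phiGen _ n) = 0 := phiLift_gen _ _ hn

/-- The morphism `(Q/Δ ⋆ k[Δ'])/Δ' → Q/Δ` with `Δ' ↦ Δ` that identifies the two families `φₙ`. -/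
noncomputable def freeQuotientHom (Q : DeltaDGOperad k) :
    (homotopyQuotient k).obj (freeDelta ((homotopyQuotient k).obj Q)) ⟶
      (homotopyQuotient k).obj Q :=
  (homotopyQuotient k).map (freeDeltaLift (S := (quotientDelta k).obj Q)
    (𝟙 ((homotopyQuotient k).obj Q))) ≫ quotientMul Q

theorem freeQuotient_gen (Q : DeltaDGOperad k) {n : ℕ} (hn : 0 < n) :
    DGOperad.Hom.map (freeQuotientHom Q) (phiGen _ n) = phiGen _ n :=
  DGOperad.comp_map_eq (homotopyQuotient_map_gen _ n) (quotientMul_gen hn)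

/-- The morphism `(P ⋆ k[Δ])/Δ → P` with `Δ, φₙ ↦ 0`. -/
noncomputable def freeTrivHom (P : DGOperad k) :
    (homotopyQuotient k).obj (freeDelta P) ⟶ P :=
  (homotopyQuotient k).map (freeDeltaLift (S := (trivDelta k).obj P) (𝟙 P)) ≫
    (trivQuotient k).app P

theorem freeTriv_gen (P : DGOperad k) {n : ℕ} (hn : 0 < n) :
    DGOperad.Hom.map (freeTrivHom P) (phiGen _ n) = 0 :=
  DGOperad.comp_map_eq (homotopyQuotient_map_gen _ n) (trivQuotient_gen hn)

variable (k) in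
/-- The natural morphism `(Q/Δ ⋆ k[Δ'])/Δ' → Q/Δ` with `Δ' ↦ Δ` that identifies the two families
`φₙ`. -/
noncomputable def freeQuotient :
    homotopyQuotient k ⋙ freeDeltaFunctor k ⋙ quotientDelta k ⟶ quotientDelta k where
  app Q := ⟨freeQuotientHom Q, rfl⟩
  naturality Q R f := DeltaDGOperad.Hom.ext (freeQuot_hom_ext
    (P := (homotopyQuotient k).obj Q) (S := (homotopyQuotient k).obj R) (fun _ => rfl)
    (congrArg (phiOf _) (DeltaDGOperad.Hom.map_Δ f).symm) fun n hn =>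
      (DGOperad.comp_map_eq (homotopyQuotient_map_gen _ n) (freeQuotient_gen R hn)).trans
      (DGOperad.comp_map_eq (freeQuotient_gen Q hn) (homotopyQuotient_map_gen f n)).symm)

variable (k) in
/-- The natural morphism `(P ⋆ k[Δ])/Δ → P` with `Δ, φₙ ↦ 0`. -/
noncomputable def freeTriv : freeDeltaFunctor k ⋙ quotientDelta k ⟶ trivDelta k where
  app P := ⟨freeTrivHom P, rfl⟩
  naturality P P' f := DeltaDGOperad.Hom.ext (freeQuot_hom_ext (P := P) (S := P')
    (fun _ => rfl) (map_zero (DGOperad.Hom.map f)).symm fun n hn =>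
      (DGOperad.comp_map_eq (homotopyQuotient_map_gen _ n) (freeTriv_gen P' hn)).trans
      (DGOperad.comp_map_eq (g := f) (freeTriv_gen P hn) (map_zero _)).symm)

end

/-! ### The derived adjunction -/

section

variable {k : Type u} [Field k] [CharZero k]

/-- Every retraction of `P → (P ⋆ k[Δ])/Δ` is a quasi-isomorphism. -/
theorem quasiIso_of_freeQuot_retraction {P : DGOperad k}
    (p : (homotopyQuotient k).obj (freeDelta P) ⟶ P)
    (hp : ∀ {n : ℕ} {a : ℤ} (q : P.obj n a), DGOperad.Hom.map p ((FreeQuot.of P).map q) = q) :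
    DGOperad.quasiIso k p := by
  refine (DGOperad.Hom.quasiIso_iff_coneAcyclic _).mpr fun n a₁ a a₂ h h' x y hx hy => ?_
  obtain ⟨η, hη⟩ := FreeQuot.exists_sub_proj (P := P) (x := x) rfl h' hx
  have hpd : P.dFam.map h' (DGOperad.Hom.map p η) = DGOperad.Hom.map p x -
      (FreeQuot.proj P).map x := by
    refine (DGOperad.Hom.map_dFam p h' η).symm.trans ((congrArg (DGOperad.Hom.map p) hη).trans ?_)
    exact (map_sub (DGOperad.Hom.map p) _ _).trans (congrArg _ (hp _))
  refine ⟨η + (FreeQuot.of P).map (y - DGOperad.Hom.map p η), 0, ?_, ?_⟩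
  · refine (map_add ((FreeQuot.d P).map h') _ _).trans ?_
    rw [hη, FreeQuot.d_of, map_sub, hy, hpd, sub_sub_cancel]
    exact sub_add_cancel (G := (freeQuot P).obj n a₂) _ _
  · refine (map_add (DGOperad.Hom.map p) _ _).trans ?_
    rw [hp, map_zero]
    abel

theorem quasiIso_freeQuotientHom (Q : DeltaDGOperad k) : DGOperad.quasiIso k (freeQuotientHom Q) :=
  quasiIso_of_freeQuot_retraction _ fun _ => rfl

/-- The morphism `P → (P ⋆ k[Δ])/Δ`. -/
noncomputable def toFreeQuot (P : DGOperad k) : P ⟶ (homotopyQuotient k).obj (freeDelta P) :=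
  ⟨(FreeQuot.of P).map, (FreeQuot.of P).map_id, (FreeQuot.of P).map_act, (FreeQuot.of P).map_comp,
    fun _ => rfl⟩

/-- Two retractions of `P → (P ⋆ k[Δ])/Δ` agree in the homotopy category. -/
theorem freeQuot_retraction_unique {P : DGOperad k}
    {p q : (homotopyQuotient k).obj (freeDelta P) ⟶ P} (hp : toFreeQuot P ≫ p = 𝟙 P)
    (hq : toFreeQuot P ≫ q = 𝟙 P) (hp' : DGOperad.quasiIso k p) :
    (DGOperad.quasiIso k).Q.map p = (DGOperad.quasiIso k).Q.map q := by
  let L := (DGOperad.quasiIso k).Q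
  have : IsIso (L.map p) := Localization.inverts L (DGOperad.quasiIso k) _ hp'
  have h1 : L.map (toFreeQuot P) = inv (L.map p) := by
    rw [← cancel_mono (L.map p), ← L.map_comp, hp, L.map_id, IsIso.inv_hom_id]
  rw [← cancel_epi (inv (L.map p)), IsIso.inv_hom_id, ← h1]
  exact (L.map_id P).symm.trans ((congrArg L.map hq).symm.trans (L.map_comp _ _))

theorem freeTriv_comp_trivQuotient (P : DGOperad k) :
    (homotopyQuotient k).map ((freeTriv k).app P) ≫ (trivQuotient k).app P =
      quotientMul (freeDelta P) ≫ freeTrivHom P :=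
  homotopyQuotient_hom_ext (Q := (quotientDelta k).obj (freeDelta P)) (fun _ => rfl) fun n hn =>
    (DGOperad.comp_map_eq (homotopyQuotient_map_gen _ n) (trivQuotient_gen hn)).trans
    (DGOperad.comp_map_eq (quotientMul_gen hn) (freeTriv_gen P hn)).symm

theorem freeQuotient_comp_quotientMul (Q : DeltaDGOperad k) :
    (homotopyQuotient k).map ((freeQuotient k).app Q) ≫ quotientMul Q =
      quotientMul (freeDelta ((homotopyQuotient k).obj Q)) ≫ freeQuotientHom Q :=
  homotopyQuotient_hom_ext
    (Q := (quotientDelta k).obj (freeDelta ((homotopyQuotient k).obj Q))) (fun _ => rfl) fun n hn =>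
    (DGOperad.comp_map_eq (homotopyQuotient_map_gen _ n) (quotientMul_gen hn)).trans
    (DGOperad.comp_map_eq (quotientMul_gen hn) (freeQuotient_gen Q hn)).symm

theorem toQuotient_comp_quotientMul (Q : DeltaDGOperad k) :
    (homotopyQuotient k).map ((toQuotient k).app Q) ≫ quotientMul Q = 𝟙 _ :=
  homotopyQuotient_hom_ext (fun _ => rfl) fun n hn =>
    DGOperad.comp_map_eq (homotopyQuotient_map_gen _ n) (quotientMul_gen hn)

/-- The morphism `(P/0, 0) → (P, 0)` with `φₙ ↦ 0`. -/
noncomputable def quotientTriv (P : DGOperad k) :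
    (quotientDelta k).obj ((trivDelta k).obj P) ⟶ (trivDelta k).obj P :=
  ⟨(trivQuotient k).app P, rfl⟩

theorem toQuotient_comp_quotientTriv (P : DGOperad k) :
    (toQuotient k).app ((trivDelta k).obj P) ≫ quotientTriv P = 𝟙 _ := rfl

theorem freeTriv_comp_triv (P : DGOperad k) :
    (freeTriv k).app ((homotopyQuotient k).obj ((trivDelta k).obj P)) ≫
        (trivDelta k).map ((trivQuotient k).app P) =
      (freeQuotient k).app ((trivDelta k).obj P) ≫ quotientTriv P :=
  DeltaDGOperad.Hom.ext (freeQuot_hom_ext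
    (P := (homotopyQuotient k).obj ((trivDelta k).obj P)) (S := P) (fun _ => rfl)
    (map_zero (DGOperad.Hom.map ((trivQuotient k).app P))) fun n hn =>
      (DGOperad.comp_map_eq (g := (trivQuotient k).app P) (freeTriv_gen _ hn) (map_zero _)).trans
      (DGOperad.comp_map_eq (freeQuotient_gen ((trivDelta k).obj P) hn) (trivQuotient_gen hn)).symm)

theorem isInvertedBy_homotopyQuotient : (DeltaDGOperad.quasiIso k).IsInvertedBy
    (homotopyQuotient k ⋙ (DGOperad.quasiIso k).Q) := fun _ _ f hf =>
  Localization.inverts (DGOperad.quasiIso k).Q (DGOperad.quasiIso k) _ (homotopyQuotient_map_quasiIso f hf)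

theorem isInvertedBy_trivDelta : (DGOperad.quasiIso k).IsInvertedBy
    (trivDelta k ⋙ (DeltaDGOperad.quasiIso k).Q) := fun _ _ f hf =>
  Localization.inverts (DeltaDGOperad.quasiIso k).Q (DeltaDGOperad.quasiIso k) ((trivDelta k).map f) hf

variable (k) in
/-- The homotopy quotient is left adjoint to the trivial action on the homotopy categories. -/
theorem nonempty_homotopyQuotient_adjunction : Nonempty
    (Localization.lift (homotopyQuotient k ⋙ (DGOperad.quasiIso k).Q) isInvertedBy_homotopyQuotient
        (DeltaDGOperad.quasiIso k).Q ⊣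
      Localization.lift (trivDelta k ⋙ (DeltaDGOperad.quasiIso k).Q) isInvertedBy_trivDelta
        (DGOperad.quasiIso k).Q) := by
  refine Localization.nonempty_adjunction_of_roof (DGOperad.quasiIso k).Q
    (DeltaDGOperad.quasiIso k).Q (DGOperad.quasiIso k) (DeltaDGOperad.quasiIso k) _ _
    (toQuotient k) (freeQuotient k) (freeTriv k) (trivQuotient k) quasiIso_freeQuotientHom
    (fun Q _ => ?_) fun P _ => ?_
  · -- The two projections of `(Q/Δ ⋆ k[Δ])/Δ` to `Q/Δ` become equal in the homotopy category.
    let L := (DGOperad.quasiIso k).Q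
    have h1 : L.map (freeQuotientHom Q) = L.map (freeTrivHom ((homotopyQuotient k).obj Q)) :=
      freeQuot_retraction_unique rfl rfl (quasiIso_freeQuotientHom Q)
    have h2 : L.map ((homotopyQuotient k).map ((freeTriv k).app ((homotopyQuotient k).obj Q))) ≫
        L.map ((trivQuotient k).app ((homotopyQuotient k).obj Q)) =
        L.map ((homotopyQuotient k).map ((freeQuotient k).app Q)) ≫ L.map (quotientMul Q) := by
      have h3 : L.map (quotientMul (freeDelta ((homotopyQuotient k).obj Q)) ≫
            freeTrivHom ((homotopyQuotient k).obj Q)) =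
          L.map (quotientMul (freeDelta ((homotopyQuotient k).obj Q)) ≫ freeQuotientHom Q) := by
        rw [L.map_comp, L.map_comp, h1]
      rw [← L.map_comp, freeTriv_comp_trivQuotient, ← L.map_comp, freeQuotient_comp_quotientMul]
      exact h3
    have h3 : L.map ((homotopyQuotient k).map ((toQuotient k).app Q)) ≫ L.map (quotientMul Q) =
        𝟙 _ := by
      rw [← L.map_comp, toQuotient_comp_quotientMul, L.map_id]
    refine (congrArg (L.map ((homotopyQuotient k).map ((toQuotient k).app Q)) ≫ ·) ?_).trans h3
    exact (IsIso.inv_comp_eq _).mpr h2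
  · let L := (DeltaDGOperad.quasiIso k).Q
    have h2 : L.map ((freeTriv k).app ((homotopyQuotient k).obj ((trivDelta k).obj P))) ≫
        L.map ((trivDelta k).map ((trivQuotient k).app P)) =
        L.map ((freeQuotient k).app ((trivDelta k).obj P)) ≫ L.map (quotientTriv P) := by
      rw [← L.map_comp, freeTriv_comp_triv, ← L.map_comp]
    have h3 : L.map ((toQuotient k).app ((trivDelta k).obj P)) ≫ L.map (quotientTriv P) = 𝟙 _ := by
      rw [← L.map_comp, toQuotient_comp_quotientTriv, L.map_id]
    refine (congrArg (L.map ((toQuotient k).app ((trivDelta k).obj P)) ≫ ·) ?_).trans h3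
    exact (IsIso.inv_comp_eq _).mpr h2

end

/-! ### The homotopy quotient of `k[Δ]` is acyclic -/

section

variable {k : Type u} [Field k]

theorem kDelta_induction {p : ∀ {n : ℕ} {a : ℤ}, (kDelta k).obj n a → Prop}
    (zero : ∀ {n : ℕ} {a : ℤ}, p (0 : (kDelta k).obj n a))
    (id : ∀ s : k, p (s • (kDelta k).id)) (delta : ∀ s : k, p (s • (kDelta k).Δ))
    {n : ℕ} {a : ℤ} (x : (kDelta k).obj n a) : p x := by
  by_cases h : x = 0
  · exact h ▸ zero
  obtain ⟨⟨s, t⟩, h1, h2⟩ := x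
  by_cases hs : s = 0
  · subst hs
    by_cases ht : t = 0
    · subst ht
      exact absurd rfl h
    · obtain ⟨rfl, rfl⟩ := h2 ht
      exact (show t • (kDelta k).Δ = ⟨(0, t), h1, h2⟩ from
        Subtype.ext (Prod.ext (mul_zero t) (mul_one t))) ▸ delta t
  · obtain ⟨rfl, rfl⟩ := h1 hs
    obtain rfl : t = 0 := by
      by_contra ht
      exact absurd (h2 ht).2 (by norm_num)
    exact (show s • (kDelta k).id = ⟨(s, 0), h1, h2⟩ from
      Subtype.ext (Prod.ext (mul_one s) (mul_zero s))) ▸ id s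

/-- The unit of `S` in arity `1` and degree `0`, and `0` elsewhere. -/
def GradedOperad.idAt (S : GradedOperad k) (n : ℕ) (a : ℤ) : S.obj n a :=
  if h : n = 1 ∧ a = 0 then cast (by rw [h.1, h.2]) S.id else 0

/-- The operation `Δ` of `S` in arity `1` and degree `-1`, and `0` elsewhere. -/
def DeltaDGOperad.deltaAt (S : DeltaDGOperad k) (n : ℕ) (a : ℤ) : S.obj n a :=
  if h : n = 1 ∧ a = -1 then cast (by rw [h.1, h.2]) S.Δ else 0

/-- The linear map `s + tΔ ↦ s + tΔ` from `k[Δ]` to a dg-operad with `Δ`. -/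
def kDeltaMap (S : DeltaDGOperad k) (n : ℕ) (a : ℤ) : (kDelta k).obj n a →ₗ[k] S.obj n a :=
  ((LinearMap.fst k k k ∘ₗ (kDeltaObj k n a).subtype).smulRight (S.idAt n a)) +
    ((LinearMap.snd k k k ∘ₗ (kDeltaObj k n a).subtype).smulRight (S.deltaAt n a))

theorem kDeltaMap_id (S : DeltaDGOperad k) : kDeltaMap S 1 0 (kDelta k).id = S.id := by
  change (1 : k) • S.idAt 1 0 + (0 : k) • S.deltaAt 1 0 = S.id
  rw [one_smul, zero_smul, add_zero, GradedOperad.idAt, dif_pos ⟨rfl, rfl⟩, cast_eq]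

theorem kDeltaMap_delta (S : DeltaDGOperad k) : kDeltaMap S 1 (-1) (kDelta k).Δ = S.Δ := by
  change (0 : k) • S.idAt 1 (-1) + (1 : k) • S.deltaAt 1 (-1) = S.Δ
  rw [one_smul, zero_smul, zero_add, DeltaDGOperad.deltaAt, dif_pos ⟨rfl, rfl⟩, cast_eq]

theorem kDeltaMap_comp (S : DeltaDGOperad k) {m n p : ℕ} {a b c : ℤ} (i : Fin m)
    (e : Graft m n p i) (h : a + b = c) (x : (kDelta k).obj m a) (y : (kDelta k).obj n b) :
    kDeltaMap S p c ((kDelta k).comp i e h x y) =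
      S.comp i e h (kDeltaMap S m a x) (kDeltaMap S n b y) := by
  have he : ∀ {p : ℕ} (i : Fin 1) (e : Graft 1 1 p i) (q : ∀ p i, Graft 1 1 p i → Prop),
      q 1 0 Graft.unary → q p i e := by
    intro p i e q hq
    obtain rfl := e.eq_one
    obtain rfl := Subsingleton.elim 0 i
    rwa [show e = Graft.unary from Equiv.ext fun _ => Subsingleton.elim _ _]
  induction x using kDelta_induction generalizing p with
  | zero => simp only [map_zero, LinearMap.zero_apply]
  | id s =>
    induction y using kDelta_induction generalizing p with
    | zero => simp only [map_zero]
    | id t =>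
      subst h
      simp only [map_smul, LinearMap.smul_apply]
      congr 2
      refine he i e (fun p i e => kDeltaMap S p (0 + 0) ((kDelta k).comp i e rfl (kDelta k).id
        (kDelta k).id) = S.comp i e rfl (kDeltaMap S 1 0 _) (kDeltaMap S 1 0 _)) ?_
      rw [kDeltaMap_id]
      exact ((congrArg (kDeltaMap S 1 0) ((kDelta k).mul_id rfl _)).trans (kDeltaMap_id S)).trans
        (S.mul_id rfl _).symm
    | delta t =>
      obtain rfl : -1 = c := by omega
      simp only [map_smul, LinearMap.smul_apply]
      congr 2
      refine he i e (fun p i e => kDeltaMap S p (-1) ((kDelta k).comp i e h (kDelta k).id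
        (kDelta k).Δ) = S.comp i e h (kDeltaMap S 1 0 _) (kDeltaMap S 1 (-1) _)) ?_
      rw [(kDelta k).id_comp _ _ _ (fun _ => Subsingleton.elim _ _), kDeltaMap_id,
        S.id_comp _ _ _ (fun _ => Subsingleton.elim _ _)]
  | delta s =>
    induction y using kDelta_induction generalizing p with
    | zero => simp only [map_zero]
    | id t =>
      obtain rfl : -1 = c := by omega
      simp only [map_smul, LinearMap.smul_apply]
      congr 2
      refine he i e (fun p i e => kDeltaMap S p (-1) ((kDelta k).comp i e h (kDelta k).Δ
        (kDelta k).id) = S.comp i e h (kDeltaMap S 1 (-1) _) (kDeltaMap S 1 0 _)) ?_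
      rw [kDeltaMap_id]
      exact (congrArg (kDeltaMap S 1 (-1)) ((kDelta k).mul_id h _)).trans (S.mul_id h _).symm
    | delta t =>
      obtain rfl : -2 = c := by omega
      simp only [map_smul, LinearMap.smul_apply]
      congr 2
      refine he i e (fun p i e => kDeltaMap S p (-2) ((kDelta k).comp i e h (kDelta k).Δ
        (kDelta k).Δ) = S.comp i e h (kDeltaMap S 1 (-1) _) (kDeltaMap S 1 (-1) _)) ?_
      rw [kDeltaMap_delta]
      exact (congrArg (kDeltaMap S 1 (-2)) (kDelta k).Δ_Δ).trans ((map_zero _).trans S.Δ_Δ.symm)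

/-- The dg-operad `(k[Δ], Δ)` is initial: the morphism to `S`. -/
def kDeltaLift (S : DeltaDGOperad k) : kDelta k ⟶ S where
  hom :=
    { map := fun {n a} => kDeltaMap S n a
      map_id := kDeltaMap_id S
      map_act := fun {n a} σ x => by
        change kDeltaMap S n a x = _
        induction x using kDelta_induction with
        | zero => simp only [map_zero]
        | id s => rw [Subsingleton.elim σ 1, S.act_one]
        | delta s => rw [Subsingleton.elim σ 1, S.act_one]
      map_comp := kDeltaMap_comp S
      map_d := fun {n a} x => by
        refine (map_zero (kDeltaMap S n (a + 1))).trans ?_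
        induction x using kDelta_induction with
        | zero => simp only [map_zero]
        | id s => rw [map_smul, map_smul, kDeltaMap_id, S.d_id, smul_zero]
        | delta s => rw [map_smul, map_smul, kDeltaMap_delta, S.d_Δ, smul_zero] }
  map_Δ := kDeltaMap_delta S

theorem kDelta_hom_ext {S : GradedOperad k} {f g : GradedOperad.Hom (kDelta k).toGradedOperad S}
    (h : f.map (kDelta k).Δ = g.map (kDelta k).Δ) {n : ℕ} {a : ℤ} (x : (kDelta k).obj n a) :
    f.map x = g.map x := by
  induction x using kDelta_induction with
  | zero => simp only [map_zero]
  | id s =>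
    rw [map_smul, map_smul]
    exact congrArg (s • ·) (f.map_id.trans g.map_id.symm)
  | delta s => rw [map_smul, map_smul, h]

variable (k) in
/-- The morphism `k[Δ] → k[Δ]` with `Δ ↦ 0`. -/
def kDeltaConst : (kDelta k).toDGOperad ⟶ (kDelta k).toDGOperad where
  map :=
    { toFun := fun x => ⟨(x.1.1, 0), x.2.1, fun h => absurd rfl h⟩
      map_add' := fun x y => Subtype.ext (Prod.ext rfl (add_zero _).symm)
      map_smul' := fun c x => Subtype.ext (Prod.ext rfl (mul_zero _).symm) }
  map_id := rfl
  map_act _ _ := rfl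
  map_comp _ _ _ _ _ := Subtype.ext (Prod.ext rfl
    (by change (0 : k) = _ * 0 + 0 * _; rw [mul_zero, zero_mul, add_zero]))
  map_d x := Subtype.ext rfl

variable [CharZero k]

variable (k) in
/-- The morphism `k[Δ]/Δ → k[Δ]` with `Δ, φₙ ↦ 0`. -/
noncomputable def kDeltaAug : (homotopyQuotient k).obj (kDelta k) ⟶ (kDelta k).toDGOperad :=
  (homotopyQuotient k).map (⟨kDeltaConst k, rfl⟩ : kDelta k ⟶ (trivDelta k).obj (kDelta k).toDGOperad) ≫
    (trivQuotient k).app (kDelta k).toDGOperad ≫ kDeltaConst k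

theorem kDeltaAug_snd {n : ℕ} {a : ℤ} (x : ((homotopyQuotient k).obj (kDelta k)).obj n a) :
    (DGOperad.Hom.map (kDeltaAug k) x).1.2 = 0 := rfl

variable (k) in
/-- The morphism `k[Δ] → k[Δ]/Δ`. -/
noncomputable def kDeltaOf : (kDelta k).toDGOperad ⟶ (homotopyQuotient k).obj (kDelta k) :=
  DeltaDGOperad.Hom.hom ((toQuotient k).app (kDelta k))

variable (k) in
/-- The morphism `k[Δ]/Δ → (k[Δ]/Δ ⋆ k[Δ'])/Δ'` with `Δ ↦ Δ'`. -/
noncomputable def kDeltaSection : (homotopyQuotient k).obj (kDelta k) ⟶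
    (homotopyQuotient k).obj (freeDelta ((homotopyQuotient k).obj (kDelta k))) :=
  (homotopyQuotient k).map (kDeltaLift _)

theorem kDeltaSection_freeQuotientHom : kDeltaSection k ≫ freeQuotientHom (kDelta k) = 𝟙 _ :=
  homotopyQuotient_hom_ext
    (kDelta_hom_ext
      (f := (DGOperad.Hom.toGraded (kDeltaSection k ≫ freeQuotientHom (kDelta k))).comp (phiOfHom _))
      (g := phiOfHom _)
      (congrArg (fun u => DGOperad.Hom.map (freeQuotientHom (kDelta k)) (phiOf _ u))
        (kDeltaMap_delta (freeDelta ((homotopyQuotient k).obj (kDelta k))))))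
    fun n hn => DGOperad.comp_map_eq (homotopyQuotient_map_gen _ n) (freeQuotient_gen _ hn)

theorem proj_kDeltaSection {n : ℕ} {a : ℤ} (x : ((homotopyQuotient k).obj (kDelta k)).obj n a) :
    (FreeQuot.proj _).map (DGOperad.Hom.map (kDeltaSection k) x) =
      DGOperad.Hom.map (kDeltaOf k) (DGOperad.Hom.map (kDeltaAug k) x) := by
  refine phiHom_ext (f := (FreeQuot.proj _).comp (DGOperad.Hom.toGraded (kDeltaSection k)))
    (g := (DGOperad.Hom.toGraded (kDeltaOf k)).comp (DGOperad.Hom.toGraded (kDeltaAug k))) (fun q => ?_) (fun n hn => ?_) x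
  · refine kDelta_hom_ext
      (f := ((FreeQuot.proj _).comp (DGOperad.Hom.toGraded (kDeltaSection k))).comp (phiOfHom _))
      (g := ((DGOperad.Hom.toGraded (kDeltaOf k)).comp
        (DGOperad.Hom.toGraded (kDeltaAug k))).comp (phiOfHom _)) ?_ q
    have h1 : DGOperad.Hom.map (kDeltaAug k) (phiOf _ (kDelta k).Δ) = 0 :=
      map_zero (DGOperad.Hom.map (kDeltaConst k))
    exact (congrArg (fun u => (FreeQuot.proj _).map (phiOf _ u)) (kDeltaMap_delta _)).trans
      (((congrArg (DGOperad.Hom.map (kDeltaOf k)) h1).trans (map_zero _)).symm)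
  · refine (congrArg (FreeQuot.proj _).map (homotopyQuotient_map_gen _ n)).trans ?_
    refine (phiLift_gen _ _ hn).trans ?_
    refine ((congrArg (kDeltaOf k).map ?_).trans (map_zero _)).symm
    exact DGOperad.comp_map_eq (homotopyQuotient_map_gen _ n)
      (DGOperad.comp_map_eq (trivQuotient_gen hn) (map_zero _))

/-- Every cycle of `k[Δ]/Δ` is homologous to a multiple of the unit. -/
theorem kDelta_exists_sub_aug {n : ℕ} {a b c : ℤ} (h : a + 1 = b) (h' : c + 1 = a)
    {x : ((homotopyQuotient k).obj (kDelta k)).obj n a}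
    (hx : ((homotopyQuotient k).obj (kDelta k)).dFam.map h x = 0) :
    ∃ y, ((homotopyQuotient k).obj (kDelta k)).dFam.map h' y =
      x - DGOperad.Hom.map (kDeltaOf k) (DGOperad.Hom.map (kDeltaAug k) x) := by
  obtain ⟨η, hη⟩ := FreeQuot.exists_sub_proj (P := (homotopyQuotient k).obj (kDelta k)) h h'
    (x := DGOperad.Hom.map (kDeltaSection k) x)
    ((DGOperad.Hom.map_dFam (kDeltaSection k) h x).symm.trans ((congrArg _ hx).trans (map_zero _)))
  refine ⟨DGOperad.Hom.map (freeQuotientHom (kDelta k)) η, ?_⟩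
  refine (DGOperad.Hom.map_dFam (freeQuotientHom (kDelta k)) h' η).symm.trans
    ((congrArg (DGOperad.Hom.map (freeQuotientHom (kDelta k))) hη).trans ?_)
  rw [proj_kDeltaSection]
  refine (map_sub (DGOperad.Hom.map (freeQuotientHom (kDelta k))) _ _).trans
    (congrArg₂ _ ?_ rfl)
  exact congrArg (fun f : (homotopyQuotient k).obj (kDelta k) ⟶ _ => DGOperad.Hom.map f x)
    kDeltaSection_freeQuotientHom

theorem kDelta_exactAt {n : ℕ} {a : ℤ} (hna : ¬(n = 1 ∧ a = 0)) :
    (((homotopyQuotient k).obj (kDelta k)).complex n).ExactAt a := by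
  rw [HomologicalComplex.exactAt_iff' _ (a - 1) a (a + 1) (by simp) (by simp),
    ShortComplex.moduleCat_exact_iff]
  intro x hx
  change (((homotopyQuotient k).obj (kDelta k)).complex n).d a (a + 1) x = 0 at hx
  change ∃ y, (((homotopyQuotient k).obj (kDelta k)).complex n).d (a - 1) a y = x
  rw [DGOperad.complex_d _ rfl] at hx
  rw [DGOperad.complex_d _ (sub_add_cancel a 1)]
  obtain ⟨y, hy⟩ := kDelta_exists_sub_aug (x := x) rfl (sub_add_cancel a 1) hx
  have h0 : DGOperad.Hom.map (kDeltaAug k) x = 0 :=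
    Subtype.ext (Prod.ext (by_contra fun h => hna ((DGOperad.Hom.map (kDeltaAug k) x).2.1 h))
      (kDeltaAug_snd x))
  exact ⟨y, hy.trans (by rw [h0, map_zero]; exact sub_zero _)⟩

/-- The scalar is unique because the augmentation maps boundaries to `0`. -/
theorem kDelta_existsUnique (x : ((homotopyQuotient k).obj (kDelta k)).obj 1 0)
    (hx : ((homotopyQuotient k).obj (kDelta k)).d x = 0) :
    ∃! c : k, ∃ y : ((homotopyQuotient k).obj (kDelta k)).obj 1 (-1),
      (((homotopyQuotient k).obj (kDelta k)).complex 1).d (-1) 0 y =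
        x - c • ((homotopyQuotient k).obj (kDelta k)).id := by
  rw [DGOperad.complex_d _ (show (-1 : ℤ) + 1 = 0 by norm_num)]
  have key : ∀ u : (kDelta k).obj 1 0, u.1.2 = 0 → u = u.1.1 • (kDelta k).id := fun u hu =>
    Subtype.ext (Prod.ext (mul_one _).symm (hu.trans (mul_zero _).symm))
  have h1 := key (DGOperad.Hom.map (kDeltaAug k) x) (kDeltaAug_snd x)
  refine ⟨(DGOperad.Hom.map (kDeltaAug k) x).1.1, ?_, fun c hc => ?_⟩
  · obtain ⟨y, hy⟩ := kDelta_exists_sub_aug (x := x) rfl (show (-1 : ℤ) + 1 = 0 by norm_num) hx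
    refine ⟨y, hy.trans (congrArg (x - ·) ?_)⟩
    exact (congrArg (DGOperad.Hom.map (kDeltaOf k)) h1).trans (map_smul (DGOperad.Hom.map (kDeltaOf k)) _ _)
  · obtain ⟨y, hy⟩ := hc
    have h2 : (kDelta k).dFam.map (show (-1 : ℤ) + 1 = 0 by norm_num)
        (DGOperad.Hom.map (kDeltaAug k) y) =
        DGOperad.Hom.map (kDeltaAug k) x - c • (kDelta k).id :=
      (DGOperad.Hom.map_dFam (kDeltaAug k) _ y).symm.trans ((congrArg _ hy).trans
        ((map_sub _ _ _).trans (congrArg _ ((map_smul _ _ _).trans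
          (congrArg (c • ·) (DGOperad.Hom.map_id (kDeltaAug k)))))))
    have h3 : (DGOperad.Hom.map (kDeltaAug k) x).1.1 - c * 1 = 0 :=
      (congrArg (fun u => u.1.1) h2).symm
    rw [sub_eq_zero.mp h3, mul_one]

end

theorem mainTheorem10 (k : Type u) [Field k] [CharZero k] :
    (∃ (hF : (DeltaDGOperad.quasiIso k).IsInvertedBy
          (homotopyQuotient k ⋙ (DGOperad.quasiIso k).Q))
        (hT : (DGOperad.quasiIso k).IsInvertedBy
          (trivDelta k ⋙ (DeltaDGOperad.quasiIso k).Q)),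
      Nonempty
        (Localization.lift (homotopyQuotient k ⋙ (DGOperad.quasiIso k).Q) hF
            (DeltaDGOperad.quasiIso k).Q ⊣
          Localization.lift (trivDelta k ⋙ (DeltaDGOperad.quasiIso k).Q) hT
            (DGOperad.quasiIso k).Q)) ∧
    (∀ (n : ℕ) (a : ℤ), ¬(n = 1 ∧ a = 0) →
      (((homotopyQuotient k).obj (kDelta k)).complex n).ExactAt a) ∧
    (∀ x : ((homotopyQuotient k).obj (kDelta k)).obj 1 0,
      ((homotopyQuotient k).obj (kDelta k)).d x = 0 →
        ∃! c : k, ∃ y : ((homotopyQuotient k).obj (kDelta k)).obj 1 (-1),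
          (((homotopyQuotient k).obj (kDelta k)).complex 1).d (-1) 0 y =
            x - c • ((homotopyQuotient k).obj (kDelta k)).id) :=
  ⟨⟨isInvertedBy_homotopyQuotient, isInvertedBy_trivDelta, nonempty_homotopyQuotient_adjunction k⟩,
    fun _ _ h => kDelta_exactAt h, kDelta_existsUnique⟩
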